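/- **Setting.** For an odd integer $N$ let $\mathbb Z_N=\mathbb Z/N$, and for $(\tau_0,\omega_0)\in\mathbb Z_N^2$ let $(H_{\tau_0,\omega_0}S)[\tau]=e^{2\pi i\omega_0\tau/N}S[\tau-\tau_0]$ on functions $S:\mathbb Z_N\to\mathbb C$. The ambiguity function is $\mathcal A(S,R)[p]=\sum_\tau (H_pS)[\tau]\overline{R[\tau]}$. The line of slope $a\in\mathbb Z_N$ is $L_a=\{(\tau,a\tau)\}$, with chirp $S_{L_a}[\tau]=N^{-1/2}e^{\frac{2\pi i}{N}2^{-1}a\tau^2}$; two lines are transversal if they meet only in $0$. The limit $N\to\infty$ is taken through integers whose smallest prime factor tends to infinity (for instance primes). **Channel.** $R=\sum_{j=1}^{m}\alpha_jH_{\tau_j,\omega_j}S+\nu$, where: (A1) $1\le m\le k$, with $k$ independent of $N$, and the targets $(\tau_j,\omega_j)\in\mathbb Z_N^2$ are distinct; (A2) for some $A>0$, $\epsilon\in(0,1)$ the vector $\alpha$ is drawn uniformly (surface measure) from $B_\epsilon=\{x\in\mathbb C^m:\|x\|^2=A,\ \min_{x_j\neq0}|x_j|\ge\epsilon\sqrt{A/k}\}$;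 (A3) the $\nu_\tau$ are i.i.d., complex, of mean zero and subgaussian with parameter $\sigma^2/N$ (that is, $\mathbb E e^{\lambda X}\le e^{\sigma^2\lambda^2/2N}$ for all real $\lambda$, for $X$ the real and the imaginary part of $\nu_\tau$), $\sigma>0$. Lines, coefficients, noise and the coins of the algorithm are independent. Put $\mathrm{SNR}=A/\sigma^2$. **$\mathrm{SCE}_\mu$.** Lines $K,L,M$ are chosen uniformly among the pairwise transversal triples, and $S=S_K+S_L+S_M$ is transmitted. By sampling $R$, the algorithm finds at most $k$ peaks $\kappa_i$ of $\mathcal A(S_K,R)$ on $L$, at most $k$ peaks $\ell_j$ of $\mathcal A(S_L,R)$ on $K$, and at most $k$ peaks $m_{j'}$ of $\mathcal A(S_M,R)$ on $L$, each reported with an estimate, of absolute value greater than $\mu$, of the value of the ambiguity function there. It returns exactly the points of triple incidence, i.e. those lying in $(\kappa_i+K)\cap(\ell_j+L)\cap(m_{j'}+M)$ for some $i,j,j'$. An implementation is a single program, the same for all $N$, for a word RAM with words of $8\lceil\log_2(N+1)\rceil$ bits; samples and cosines and sines of $2\pi x/y$ are delivered in fixed point in unit time, random integers are drawn in unit time,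 every executed instruction counts as an operation, and every memory cell and loop counter counts as memory. **Theorem.** Let $\kappa\in(0,1)$. There are constants $c_1,c_2,c_3>0$ (depending on nothing but possibly $\kappa$; in particular independent of $\epsilon$, $\mathrm{SNR}$, $k$ and $N$) such that for all $k\ge1$, $\epsilon\in(0,1)$, $A,\sigma>0$ and $\mu=\kappa\epsilon\sqrt{A/k}$ there is an implementation of $\mathrm{SCE}_\mu$ that, as soon as the smallest prime factor of $N$ is large enough, takes in every run at most 1. $c_1k(\log N)^3(\epsilon^2\mathrm{SNR})^{-1}$ samples, 2. $c_2k(\log N)^3(\epsilon^2\mathrm{SNR})^{-1}$ bits of memory, and 3. $c_3k(\log N)^3(\epsilon^2\mathrm{SNR})^{-1}+k^2$ arithmetic operations, and for which, as $N\to\infty$, uniformly over the number and positions of the targets, the law of the noise and the index $j$: the probability of detection (that the $j$-th target is returned) tends to $1$; the probability of false alarm (that a $j$-th shift is returned and is not a target) tends to $0$; and for every $\delta>0$ the probability that some reported estimate of an ambiguity value is off by more than $\delta$ tends to $0$. -/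

import Mathlib

open MeasureTheory ProbabilityTheory
open scoped ENNReal

noncomputable section

namespace SCE

/-! ## Signals, time-frequency shifts, lines and chirps -/

/-- The time-frequency shift `(H_{τ₀,ω₀} S)[τ] = e^{2πi ω₀ τ / N} S[τ - τ₀]`, `p = (τ₀, ω₀)`. -/
def tfShift {N : ℕ} [NeZero N] (p : ZMod N × ZMod N) (S : ZMod N → ℂ) : ZMod N → ℂ :=
  fun t => ZMod.stdAddChar (p.2 * t) * S (t - p.1)

/-- The ambiguity function `𝒜(S, R)[p] = ⟨H_p S, R⟩`. -/
def ambiguity {N : ℕ} [NeZero N] (S R : ZMod N → ℂ) (p : ZMod N × ZMod N) : ℂ :=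
  ∑ t, tfShift p S t * starRingEnd ℂ (R t)

/-- The line of slope `a` through the origin of the plane `ℤ_N × ℤ_N`. -/
def line {N : ℕ} (a : ZMod N) : Set (ZMod N × ZMod N) := {p | p.2 = a * p.1}

/-- Two lines are transversal if they meet only at the origin. -/
def Transversal {N : ℕ} (a b : ZMod N) : Prop := line a ∩ line b = {0}

/-- The chirp of unit norm attached to the line of slope `a` (for odd `N`):
`S_a[τ] = N^{-1/2} e^{(2πi/N) 2⁻¹ a τ²}`. -/
def chirp {N : ℕ} [NeZero N] (a : ZMod N) : ZMod N → ℂ :=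
  fun t => ((1 / Real.sqrt N : ℝ) : ℂ) * ZMod.stdAddChar ((2 : ZMod N)⁻¹ * a * t ^ 2)

open Classical in
/-- The triples `(a_K, a_L, a_M)` of slopes of pairwise transversal lines `K`, `L`, `M`. -/
def slopeTriples (N : ℕ) [NeZero N] : Finset (ZMod N × ZMod N × ZMod N) :=
  Finset.univ.filter fun a =>
    Transversal a.1 a.2.1 ∧ Transversal a.1 a.2.2 ∧ Transversal a.2.1 a.2.2

/-- The transmitted signal `S_K + S_L + S_M`. -/
def transmitted {N : ℕ} [NeZero N] (a : ZMod N × ZMod N × ZMod N) : ZMod N → ℂ :=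
  fun t => chirp a.1 t + chirp a.2.1 t + chirp a.2.2 t

/-! ## The channel -/

/-- The targets of a channel of sparsity at most `k`: between `1` and `k` distinct shifts. -/
structure Targets (N k : ℕ) where
  num : ℕ
  one_le_num : 1 ≤ num
  num_le : num ≤ k
  shift : Fin num → ZMod N × ZMod N
  shift_injective : Function.Injective shift

/-- The received signal `R = ∑ j, α_j H_{τ_j, ω_j} S + ν`. -/
def received {N k : ℕ} [NeZero N] (T : Targets N k) (S : ZMod N → ℂ)
    (α : EuclideanSpace ℂ (Fin T.num)) (ν : ZMod N → ℂ) : ZMod N → ℂ :=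
  fun t => ∑ j, α j * tfShift (T.shift j) S t + ν t

/-- The `ε`-target set `B_ε`, for `m` targets and sparsity bound `k`. -/
def targetSet (m k : ℕ) (A ε : ℝ) : Set (EuclideanSpace ℂ (Fin m)) :=
  {x | ‖x‖ ^ 2 = A ∧ ∀ j, x j ≠ 0 → ε * Real.sqrt (A / k) ≤ ‖x j‖}

/-- The uniform distribution on `B_ε`: the surface measure of the sphere of radius `√A`,
conditioned on `B_ε`. -/
def coeffLaw (m k : ℕ) (A ε : ℝ) : Measure (EuclideanSpace ℂ (Fin m)) :=
  ProbabilityTheory.cond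
    (Measure.map (fun x : Metric.sphere (0 : EuclideanSpace ℂ (Fin m)) 1 =>
        Real.sqrt A • (x : EuclideanSpace ℂ (Fin m)))
      (Measure.addHaar : Measure (EuclideanSpace ℂ (Fin m))).toSphere)
    (targetSet m k A ε)

/-- `Q` is the law of a complex random variable that has mean zero and is subgaussian with
parameter `v`, in the sense that its real and imaginary parts are. -/
def IsSubgaussianLaw (Q : Measure ℂ) (v : ℝ) : Prop :=
  IsProbabilityMeasure Q ∧ ∫ z, z ∂Q = 0 ∧
    HasSubgaussianMGF (fun z : ℂ => z.re) v.toNNReal Q ∧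
    HasSubgaussianMGF (fun z : ℂ => z.im) v.toNNReal Q

/-! ## The machine

A word RAM. A word is an integer of `8 * Nat.size N` bits in two's complement, where `Nat.size N`
is the number of binary digits of `N`; a real number is held in a word in fixed point, with
`2 * Nat.size N` fractional bits. A program is one finite text for all `N`. -/

/-- The length of a word in bits. -/
def wordLen (N : ℕ) : ℕ := 8 * Nat.size N

/-- Two's complement reduction to a word. -/
def wrap (N : ℕ) (z : ℤ) : ℤ := Int.bmod z (2 ^ wordLen N)

/-- Rounding (down) of a real number to fixed point. -/
def toFixed (N : ℕ) (x : ℝ) : ℤ := ⌊(2 : ℝ) ^ (2 * Nat.size N) * x⌋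

/-- The real number that a fixed-point word stands for. -/
def ofFixed (N : ℕ) (z : ℤ) : ℝ := (z : ℝ) / (2 : ℝ) ^ (2 * Nat.size N)

inductive BinOp
  | add | sub | mul | div | mod

def BinOp.eval : BinOp → ℤ → ℤ → ℤ
  | .add, x, y => x + y
  | .sub, x, y => x - y
  | .mul, x, y => x * y
  | .div, x, y => x / y
  | .mod, x, y => x % y

/-- Programs. Here `mem i` is the word in cell `i`. -/
inductive Prog
  /-- `mem d := z` -/
  | const (d : ℕ) (z : ℤ)
  /-- `mem d := mem a o mem b` -/
  | op (o : BinOp) (d a b : ℕ)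
  /-- `mem d := mem (mem a)` -/
  | load (d a : ℕ)
  /-- `mem (mem a) := mem b` -/
  | store (a b : ℕ)
  /-- `mem d := cos (2π mem a / mem b)`, in fixed point -/
  | cos (d a b : ℕ)
  /-- `mem d := sin (2π mem a / mem b)`, in fixed point -/
  | sin (d a b : ℕ)
  /-- take the sample `R[mem a]`; `mem d` and `mem e` become its real and imaginary part,
  in fixed point -/
  | sample (d e a : ℕ)
  /-- `mem d :=` an integer drawn uniformly from `0, …, mem a - 1` (and `0` if `mem a ≤ 0`) -/
  | rand (d a : ℕ)
  /-- first `p`, then `q` -/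
  | seq (p q : Prog)
  /-- if `mem a < mem b` then `p` else `q` -/
  | ite (a b : ℕ) (p q : Prog)
  /-- repeat `p` as often as the value of `mem a` at the start says -/
  | loop (a : ℕ) (p : Prog)

/-- Nesting depth of loops: so many words are needed for loop counters. -/
def Prog.depth : Prog → ℕ
  | .seq p q => max p.depth q.depth
  | .ite _ _ p q => max p.depth q.depth
  | .loop _ p => p.depth + 1
  | _ => 0

/-- A configuration: the memory, the number of samples taken and the number of operations
carried out so far. -/
structure Config where
  mem : ℕ → ℤ
  samples : ℕ
  ops : ℕ

/-- Write to a cell; there are only `c` cells, and writing anywhere else has no effect. -/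
def Config.write (N c : ℕ) (s : Config) (i : ℕ) (z : ℤ) : Config :=
  if i < c then { s with mem := Function.update s.mem i (wrap N z) } else s

/-- Count one operation. -/
def Config.tick (s : Config) : Config := { s with ops := s.ops + 1 }

/-- Running a program with `c` cells of memory on the received signal `R`: the distribution of
the final configuration. Every executed instruction, every test and every turn of a loop counts
as one operation, and every query to `R` as one sample. -/
def Prog.run (N c : ℕ) (R : ZMod N → ℂ) : Prog → Config → PMF Config
  | .const d z, s => PMF.pure (s.tick.write N c d z)
  | .op o d a b, s => PMF.pure (s.tick.write N c d (o.eval (s.mem a) (s.mem b)))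
  | .load d a, s => PMF.pure (s.tick.write N c d (s.mem (s.mem a).toNat))
  | .store a b, s => PMF.pure (s.tick.write N c (s.mem a).toNat (s.mem b))
  | .cos d a b, s => PMF.pure (s.tick.write N c d
      (toFixed N (Real.cos (2 * Real.pi * (s.mem a : ℝ) / (s.mem b : ℝ)))))
  | .sin d a b, s => PMF.pure (s.tick.write N c d
      (toFixed N (Real.sin (2 * Real.pi * (s.mem a : ℝ) / (s.mem b : ℝ)))))
  | .sample d e a, s =>
      let x : ℂ := R ((s.mem a : ℤ) : ZMod N)
      let s' : Config := { s.tick with samples := s.samples + 1 }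
      PMF.pure ((s'.write N c d (toFixed N x.re)).write N c e (toFixed N x.im))
  | .rand d a, s =>
      (PMF.uniformOfFintype (Fin ((s.mem a).toNat - 1 + 1))).bind fun i =>
        PMF.pure (s.tick.write N c d ((i : ℕ) : ℤ))
  | .seq p q, s => (p.run N c R s).bind (q.run N c R)
  | .ite a b p q, s =>
      if s.mem a < s.mem b then p.run N c R s.tick else q.run N c R s.tick
  | .loop a p, s =>
      (fun D : PMF Config => D.bind fun s' => p.run N c R s'.tick)^[(s.mem a).toNat]
        (PMF.pure s.tick)

/-- A program, together with the number of memory cells that it gets for each `N`. -/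
structure Algorithm where
  prog : Prog
  cells : ℕ → ℕ

/-- Bits of memory: all cells (input, output and work space) and all loop counters. -/
def Algorithm.memoryBits (P : Algorithm) (N : ℕ) : ℕ :=
  (P.cells N + P.prog.depth) * wordLen N

/-- The initial configuration: cells `0` to `6` hold `N`, the number of binary digits of `N`, `k`,
the threshold `μ` in fixed point, and the three slopes; all other cells hold `0`. -/
def initial (N k : ℕ) (μ : ℝ) (a : ZMod N × ZMod N × ZMod N) (c : ℕ) : Config where
  mem i := if i < c then
      wrap N (([(N : ℤ), (Nat.size N : ℤ), (k : ℤ), toFixed N μ,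
        (a.1.val : ℤ), (a.2.1.val : ℤ), (a.2.2.val : ℤ)] : List ℤ).getD i 0)
    else 0
  samples := 0
  ops := 0

/-- The distribution of the final configuration, given the lines and the received signal. -/
def Algorithm.run (P : Algorithm) (N k : ℕ) (μ : ℝ) (a : ZMod N × ZMod N × ZMod N)
    (R : ZMod N → ℂ) : PMF Config :=
  P.prog.run N (P.cells N) R (initial N k μ a (P.cells N))

/-! ## Reading the final memory

Cells `0`, `1`, `2`, `3` hold the addresses of four lists. A list starts with its length, and the
entries follow. Lists `0`, `1`, `2` are the peaks found for `𝒜(S_K, R)`, `𝒜(S_L, R)` and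
`𝒜(S_M, R)`, with four words per entry: the point `(τ, ω)` and the estimate (real and imaginary
part) of the ambiguity function there. List `3` is the list of returned shifts `(τ, ω)`. -/

structure Peak (N : ℕ) where
  pt : ZMod N × ZMod N
  est : ℂ

def Config.peaks (N : ℕ) (s : Config) (i : ℕ) : List (Peak N) :=
  let p := (s.mem i).toNat
  (List.range (s.mem p).toNat).map fun j =>
    { pt := (((s.mem (p + 1 + 4 * j) : ℤ) : ZMod N), ((s.mem (p + 2 + 4 * j) : ℤ) : ZMod N))
      est := ⟨ofFixed N (s.mem (p + 3 + 4 * j)), ofFixed N (s.mem (p + 4 + 4 * j))⟩ }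

def Config.shifts (N : ℕ) (s : Config) : List (ZMod N × ZMod N) :=
  let p := (s.mem 3).toNat
  (List.range (s.mem p).toNat).map fun j =>
    (((s.mem (p + 1 + 2 * j) : ℤ) : ZMod N), ((s.mem (p + 2 + 2 * j) : ℤ) : ZMod N))

/-- The final configuration is that of a run of `SCE_μ` with lines `a = (K, L, M)`: it holds at most
`k` peaks of `𝒜(S_K, R)` on `L`, of `𝒜(S_L, R)` on `K` and of `𝒜(S_M, R)` on `L`, each with an
estimate above the threshold `μ`, and the shifts returned are exactly the points of triple
incidence `(κ + K) ∩ (ℓ + L) ∩ (m + M)` for peaks `κ`, `ℓ`, `m` of the three kinds. -/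
def IsSCEOutput {N : ℕ} (k : ℕ) (μ : ℝ) (a : ZMod N × ZMod N × ZMod N) (s : Config) : Prop :=
  (∀ i < 3, (s.peaks N i).length ≤ k ∧ ∀ x ∈ s.peaks N i, μ < ‖x.est‖) ∧
  (∀ x ∈ s.peaks N 0, x.pt ∈ line a.2.1) ∧
  (∀ x ∈ s.peaks N 1, x.pt ∈ line a.1) ∧
  (∀ x ∈ s.peaks N 2, x.pt ∈ line a.2.1) ∧
  ∀ q, q ∈ s.shifts N ↔
    ∃ x ∈ s.peaks N 0, ∃ y ∈ s.peaks N 1, ∃ z ∈ s.peaks N 2,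
      q - x.pt ∈ line a.1 ∧ q - y.pt ∈ line a.2.1 ∧ q - z.pt ∈ line a.2.2

/-- Some reported estimate is off by more than `δ`. -/
def BadEstimate {N : ℕ} [NeZero N] (δ : ℝ) (a : ZMod N × ZMod N × ZMod N) (R : ZMod N → ℂ)
    (s : Config) : Prop :=
  (∃ x ∈ s.peaks N 0, δ < ‖x.est - ambiguity (chirp a.1) R x.pt‖) ∨
  (∃ x ∈ s.peaks N 1, δ < ‖x.est - ambiguity (chirp a.2.1) R x.pt‖) ∨
  (∃ x ∈ s.peaks N 2, δ < ‖x.est - ambiguity (chirp a.2.2) R x.pt‖)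

/-! ## Probabilities -/

/-- The probability of the event `E` (on lines, received signal and final configuration), when the
lines are uniform on the transversal triples, the coefficients uniform on `B_ε`, the noise i.i.d.
with law `Q`, and these and the coins of the algorithm are independent. -/
def prob {N k : ℕ} [NeZero N] (P : Algorithm) (μ A ε : ℝ) (T : Targets N k) (Q : Measure ℂ)
    (E : ZMod N × ZMod N × ZMod N → (ZMod N → ℂ) → Config → Prop) : ℝ≥0∞ :=
  (∑ a ∈ slopeTriples N,
    ∫⁻ z : EuclideanSpace ℂ (Fin T.num) × (ZMod N → ℂ),
      (P.run N k μ a (received T (transmitted a) z.1 z.2)).toOuterMeasure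
        {s | E a (received T (transmitted a) z.1 z.2) s}
      ∂((coeffLaw T.num k A ε).prod (Measure.pi fun _ : ZMod N => Q))) /
    ((slopeTriples N).card : ℝ≥0∞)

/-- Probability of detection: the `j`-th target is returned. -/
def PD {N k : ℕ} [NeZero N] (P : Algorithm) (μ A ε : ℝ) (T : Targets N k) (Q : Measure ℂ)
    (j : Fin T.num) : ℝ≥0∞ :=
  prob P μ A ε T Q fun _ _ s => T.shift j ∈ s.shifts N

/-- Probability of false alarm: the `j`-th shift returned is not that of a target. -/
def PFA {N k : ℕ} [NeZero N] (P : Algorithm) (μ A ε : ℝ) (T : Targets N k) (Q : Measure ℂ)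
    (j : ℕ) : ℝ≥0∞ :=
  prob P μ A ε T Q fun _ _ s => ∃ q, (s.shifts N)[j]? = some q ∧ q ∉ Set.range T.shift

/-- `P` implements `SCE_μ` for the modulus `N`: whatever the lines, the signal and the coins are,
every run ends in an output of `SCE_μ`. -/
def Implements (P : Algorithm) (N : ℕ) [NeZero N] (k : ℕ) (μ : ℝ) : Prop :=
  ∀ a ∈ slopeTriples N, ∀ R : ZMod N → ℂ, ∀ s ∈ (P.run N k μ a R).support,
    IsSCEOutput k μ a s

/-- For the modulus `N`, every run of `P` takes at most `n` samples and `t` operations. -/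
def RunsWithin (P : Algorithm) (N : ℕ) [NeZero N] (k : ℕ) (μ n t : ℝ) : Prop :=
  ∀ a ∈ slopeTriples N, ∀ R : ZMod N → ℂ, ∀ s ∈ (P.run N k μ a R).support,
    (s.samples : ℝ) ≤ n ∧ (s.ops : ℝ) ≤ t

end SCE

end

/-! The bounds are asymptotic in `N` with `k`, `ε` and the SNR fixed, so a program whose cost is
`o((log N)^3)` satisfies them with any constants, and the constants 1 are taken. Let `L` be the
binary length of `N`, `p` its smallest prime factor and `W` the least integer with `W^8 ≥ L`. The
program works with `W^2` grid points, `L + 2` binary digits, `M = L W` random draws and windows of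
`W` samples: about `L^2 W^4`, hence of order `L^(5/2)`, operations, and `O(L^2 W)` bits
(`opBound_le`, `mul_pow_le_of_ell`, `exists_resources`).

Reduction to spectra. On the line of slope `b` the ambiguity function with the chirp of slope `a`
is, up to a phase, the Fourier transform of the dechirped signal (`ambiguity_chirp`). Through the
chirp of the same slope a target `(τ, ω)` appears as one character, of frequency `a τ - ω`; through
a transversal chirp it has a flat spectrum of height `1/√N`, by a Gauss sum (`dft_dechirp_same`,
`dft_dechirp_other`). Subgaussian noise is small in all spectra at once
(`measure_goodNoise_compl_le`). Almost surely no coefficient vanishes, so target peaks have height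
about `ε √(A/k) = μ/κ` or more, and a gap separates them from the rest (`gap_received`).

Sparse Fourier transform. A window is an arithmetic progression of `W` times with random step `b`,
demodulated at a grid frequency next to `b x / N`. It keeps the frequency `x` and damps all others:
averaged over `b`, their energy shrinks by a factor of order `1/p + 1/W` (`expect_leak_le`). Most
windows therefore see almost only `β e(x t / N)`. Comparing the windows at `t` and `t + 2^i` reveals
the phase `2^i x / N`, and majority votes over the draws give the binary digits of `x / N`, from the
least significant on; the first digit may be wrong without harm (`digit_step`, `roundFreq_eq`). A
second, independent set of draws estimates the Fourier coefficient at all `W^2` candidates, by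
Chebyshev's inequality (`card_not_decoded_le`). Thresholding then leaves exactly the target
frequencies (`PeakOutput.spec`).

Incidence. A translate of `K` through a peak of the first kind is a translate of `K` through a
target. A given nonzero vector lies on a random line with probability at most `1/(p - 2)`
(`card_line_mul_le`); so usually no two targets share a frequency, and targets are the only triple
incidences (`card_not_goodLines_mul_le`, `Output.correct`).

Machine. The program is written in a small language with a verified compiler (`St.run_code`), and a
run is a uniform point of the space of draws pushed through a deterministic map (`exists_run_eq`).
Its output has to be legal for every signal, however wild. The simulation lemmas therefore describe
results exactly, overflow included; only for bounded signals (`Tame`) are these results compared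
with real numbers. `prob_bounds` puts the probabilities together. -/

noncomputable section

namespace SCE

open scoped BigOperators ComplexConjugate
open Function (update update_of_ne update_self iterate_succ_apply')
open Finset (range univ mul_sum sum_congr mem_univ mem_filter sum_const sum_le_sum sum_mul card_univ card_range sum_add_distrib card_le_card mem_range sum_comm card_union_le univ_product_univ expect_product sum_le_card_nsmul mul_expect sum_nonneg sum_sub_distrib coe_filter)
open Nat (size lt_size_self lt_two_pow_self lt_succ_iff_lt_or_eq)
open Int (emod_nonneg emod_lt_of_pos emod_eq_of_lt)
open Real (pi exp)
open Complex (I norm_real sq_norm)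
open ZMod (stdAddChar)
open ENNReal (ofReal ofReal_le_ofReal)
open Fintype (expect_eq_sum_div_card expect_const)
open Prod (fst_sub snd_sub)
open PMF (uniformOfFintype)
open Config (tick write)

/-! ## A small imperative language on top of the word RAM

Cells `0, …, 59` are registers, cells `60, …, 99` hold intermediate results, and the cells from
`100` on form the heap. -/

/-- Arithmetic expressions in the registers. -/
inductive Ex
  | var (i : ℕ)
  | lit (z : ℤ)
  | bin (o : BinOp) (e f : Ex)

namespace Ex

instance : Add Ex := ⟨.bin .add⟩
instance : Sub Ex := ⟨.bin .sub⟩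
instance : Mul Ex := ⟨.bin .mul⟩
instance : Div Ex := ⟨.bin .div⟩
instance : Mod Ex := ⟨.bin .mod⟩

/-- The value in machine arithmetic. -/
def eval (N : ℕ) (m : ℕ → ℤ) : Ex → ℤ
  | .var i => wrap N (m i)
  | .lit z => wrap N z
  | .bin o e f => wrap N (o.eval (e.eval N m) (f.eval N m))

/-- The value in exact arithmetic. -/
def val (m : ℕ → ℤ) : Ex → ℤ
  | .var i => m i
  | .lit z => z
  | .bin o e f => o.eval (e.val m) (f.val m)

/-- Instructions that put the value into cell `d`. -/
def code : Ex → ℕ → Prog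
  | .var i, d => .seq (.const d 0) (.op .add d d i)
  | .lit z, d => .const d z
  | .bin o e f, d => .seq (e.code d) (.seq (f.code (d + 1)) (.op o d d (d + 1)))

/-- Number of instructions. -/
def size : Ex → ℕ
  | .var _ => 2
  | .lit _ => 1
  | .bin _ e f => e.size + f.size + 1

/-- Only registers are read, and evaluation from cell `d` on stays below the heap. -/
def ok : Ex → ℕ → Bool
  | .var i, d => decide (i < 60) && decide (d < 100)
  | .lit _, d => decide (d < 100)
  | .bin _ e f, d => e.ok d && f.ok (d + 1)

/-- A bound on the binary length of the value, if all registers are of length `b`. -/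
def bits (b : ℕ) : Ex → ℕ
  | .var _ => b
  -- A crude length, from `|z| ≤ 2 ^ |z|`. Addresses enter programs as literals, which is why they
  -- are later required to be at most `size N`.
  | .lit z => z.natAbs
  | .bin .add e f => max (e.bits b) (f.bits b) + 1
  | .bin .sub e f => max (e.bits b) (f.bits b) + 1
  | .bin .mul e f => e.bits b + f.bits b
  | .bin .div e f => max (e.bits b) (f.bits b)
  | .bin .mod e f => max (e.bits b) (f.bits b)

/-- All registers that occur have absolute value at most `2 ^ b`. -/
def Bdd (b : ℕ) (m : ℕ → ℤ) : Ex → Prop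
  | .var i => |m i| ≤ 2 ^ b
  | .lit _ => True
  | .bin _ e f => e.Bdd b m ∧ f.Bdd b m

section simp
variable (m : ℕ → ℤ) (N b : ℕ) (e f : Ex)
@[simp] lemma val_var (i : ℕ) : (Ex.var i).val m = m i := rfl
@[simp] lemma val_lit (z : ℤ) : (Ex.lit z).val m = z := rfl
@[simp] lemma val_add : (e + f).val m = e.val m + f.val m := rfl
@[simp] lemma val_sub : (e - f).val m = e.val m - f.val m := rfl
@[simp] lemma val_mul : (e * f).val m = e.val m * f.val m := rfl
@[simp] lemma val_div : (e / f).val m = e.val m / f.val m := rfl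
@[simp] lemma val_mod : (e % f).val m = e.val m % f.val m := rfl
@[simp] lemma bits_var (i : ℕ) : (Ex.var i).bits b = b := rfl
@[simp] lemma bits_lit (z : ℤ) : (Ex.lit z).bits b = z.natAbs := rfl
@[simp] lemma bits_add : (e + f).bits b = max (e.bits b) (f.bits b) + 1 := rfl
@[simp] lemma bits_sub : (e - f).bits b = max (e.bits b) (f.bits b) + 1 := rfl
@[simp] lemma bits_mul : (e * f).bits b = e.bits b + f.bits b := rfl
@[simp] lemma bits_div : (e / f).bits b = max (e.bits b) (f.bits b) := rfl
@[simp] lemma bits_mod : (e % f).bits b = max (e.bits b) (f.bits b) := rfl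
@[simp] lemma bdd_var (i : ℕ) : (Ex.var i).Bdd b m ↔ |m i| ≤ 2 ^ b := Iff.rfl
@[simp] lemma bdd_lit (z : ℤ) : (Ex.lit z).Bdd b m ↔ True := Iff.rfl
@[simp] lemma bdd_add : (e + f).Bdd b m ↔ e.Bdd b m ∧ f.Bdd b m := Iff.rfl
@[simp] lemma bdd_sub : (e - f).Bdd b m ↔ e.Bdd b m ∧ f.Bdd b m := Iff.rfl
@[simp] lemma bdd_mul : (e * f).Bdd b m ↔ e.Bdd b m ∧ f.Bdd b m := Iff.rfl
@[simp] lemma bdd_div : (e / f).Bdd b m ↔ e.Bdd b m ∧ f.Bdd b m := Iff.rfl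
@[simp] lemma bdd_mod : (e % f).Bdd b m ↔ e.Bdd b m ∧ f.Bdd b m := Iff.rfl
lemma eval_var (i : ℕ) : (Ex.var i).eval N m = wrap N (m i) := rfl
lemma eval_lit (z : ℤ) : (Ex.lit z).eval N m = wrap N z := rfl
lemma eval_add : (e + f).eval N m = wrap N (e.eval N m + f.eval N m) := rfl
lemma eval_sub : (e - f).eval N m = wrap N (e.eval N m - f.eval N m) := rfl
lemma eval_mul : (e * f).eval N m = wrap N (e.eval N m * f.eval N m) := rfl
lemma eval_div : (e / f).eval N m = wrap N (e.eval N m / f.eval N m) := rfl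
lemma eval_mod : (e % f).eval N m = wrap N (e.eval N m % f.eval N m) := rfl
end simp

end Ex

/-! ### Arithmetic modulo the word size. -/

section wrap
variable (N : ℕ) (x y : ℤ)
@[simp] lemma wrap_zero : wrap N 0 = 0 := by simp [wrap]
@[simp] lemma wrap_wrap : wrap N (wrap N x) = wrap N x := by simp [wrap]
@[simp] lemma wrap_wrap_add : wrap N (wrap N x + y) = wrap N (x + y) := by
  simp [wrap, Int.bmod_add_bmod]
@[simp] lemma wrap_add_wrap : wrap N (x + wrap N y) = wrap N (x + y) := by
  rw [add_comm, wrap_wrap_add, add_comm]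
@[simp] lemma wrap_wrap_sub : wrap N (wrap N x - y) = wrap N (x - y) := by
  simp [wrap, Int.bmod_sub_bmod]
@[simp] lemma wrap_sub_wrap : wrap N (x - wrap N y) = wrap N (x - y) := by
  simp [wrap, Int.sub_bmod_bmod]
@[simp] lemma wrap_wrap_mul : wrap N (wrap N x * y) = wrap N (x * y) := by
  simp [wrap, Int.bmod_mul_bmod]
@[simp] lemma wrap_mul_wrap : wrap N (x * wrap N y) = wrap N (x * y) := by
  rw [mul_comm, wrap_wrap_mul, mul_comm]
end wrap

lemma wrap_of_lt {N : ℕ} {x : ℤ} (hN : 1 ≤ wordLen N) (h1 : -2 ^ (wordLen N - 1) ≤ x) (h2 : x < 2 ^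
  (wordLen N - 1)) : wrap N x = x := by
  obtain ⟨k, hk⟩ : ∃ k, wordLen N = k + 1 := ⟨wordLen N - 1, by omega⟩
  rw [hk] at h1 h2
  simp only [Nat.add_sub_cancel] at h1 h2
  rw [wrap, hk]
  apply Int.bmod_eq_of_le_mul_two
  · push_cast; rw [pow_succ]; linarith
  · push_cast; rw [pow_succ]; linarith

/-- Two spare bits: one for the sign, and one because the bound is not strict, while `2 ^ b` itself
is no signed word of `b + 1` bits. -/
lemma wrap_of_abs_le {N : ℕ} {x : ℤ} {b : ℕ} (hb : b + 2 ≤ wordLen N) (h : |x| ≤ 2 ^ b) : wrap N x =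
  x := by
  have : (2 : ℤ) ^ b < 2 ^ (wordLen N - 1) := pow_lt_pow_right₀ (by simp) (by omega)
  rw [abs_le] at h
  exact wrap_of_lt (by omega) (by linarith) (by linarith)

/-- Without overflow, machine arithmetic is exact. -/
lemma Ex.eval_eq {N b : ℕ} {m : ℕ → ℤ} : ∀ {e : Ex}, e.Bdd b m → e.bits b + 2 ≤ wordLen N → e.eval N
  m = e.val m ∧ |e.val m| ≤ 2 ^ e.bits b
  | .var i, h, hb => ⟨wrap_of_abs_le hb h, h⟩
  | .lit z, _, hb => by
      have : |z| ≤ 2 ^ z.natAbs := by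
        rw [← Int.natCast_natAbs]; exact_mod_cast lt_two_pow_self.le
      exact ⟨wrap_of_abs_le hb this, this⟩
  | .bin o e f, ⟨h1, h2⟩, hb => by
      have hle : e.bits b ≤ (Ex.bin o e f).bits b ∧ f.bits b ≤ (Ex.bin o e f).bits b := by
        cases o <;> simp only [Ex.bits] <;> omega
      obtain ⟨he, he'⟩ := Ex.eval_eq (N := N) h1 (by omega)
      obtain ⟨hf, hf'⟩ := Ex.eval_eq (N := N) h2 (by omega)
      have key : |(Ex.bin o e f).val m| ≤ 2 ^ (Ex.bin o e f).bits b := by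
        have hE : |e.val m| ≤ 2 ^ (max (e.bits b) (f.bits b)) :=
          he'.trans (pow_le_pow_right₀ (by simp) (le_max_left _ _))
        have hF : |f.val m| ≤ 2 ^ (max (e.bits b) (f.bits b)) :=
          hf'.trans (pow_le_pow_right₀ (by simp) (le_max_right _ _))
        cases o <;> simp only [Ex.bits, Ex.val, BinOp.eval]
        · rw [pow_succ]; exact (abs_add_le _ _).trans (by linarith)
        · rw [pow_succ]; exact (abs_sub _ _).trans (by linarith)
        · rw [abs_mul, pow_add]; gcongr
        · refine le_trans ?_ hE
          rw [← Int.natCast_natAbs, ← Int.natCast_natAbs]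
          exact_mod_cast Int.natAbs_ediv_le_natAbs _ _
        · rcases eq_or_ne (f.val m) 0 with h0 | h0
          · rw [h0, Int.emod_zero]; exact hE
          · rw [abs_of_nonneg (emod_nonneg _ h0)]
            exact (Int.emod_lt_abs _ h0).le.trans hF
      exact ⟨by rw [Ex.eval, he, hf]; exact wrap_of_abs_le hb key, key⟩

/-- Statements. -/
inductive St
  | skip
  | asg (d : ℕ) (e : Ex)
  | load (d : ℕ) (e : Ex)
  | store (e f : Ex)
  | cos (d : ℕ) (e f : Ex)
  | sin (d : ℕ) (e f : Ex)
  | sample (d d' : ℕ) (e : Ex)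
  | seq (p q : St)
  | ite (e f : Ex) (p q : St)
  | loop (r : ℕ) (p : St)

infixr:21 " ;; " => St.seq
infix:22 " ≔ " => St.asg

namespace St

/-- Compilation. -/
def code : St → Prog
  | .skip => .const 60 0
  | .asg d e => .seq (e.code 60) (.seq (.const d 0) (.op .add d d 60))
  | .load d e => .seq (e.code 60) (.seq (.const 61 100)
      (.ite 60 61 (.const d 0) (.load d 60)))
  | .store e f => .seq (e.code 60) (.seq (f.code 61) (.seq (.const 62 100)
      (.ite 60 62 (.const 60 0) (.store 60 61))))
  | .cos d e f => .seq (e.code 60) (.seq (f.code 61) (.cos d 60 61))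
  | .sin d e f => .seq (e.code 60) (.seq (f.code 61) (.sin d 60 61))
  | .sample d d' e => .seq (e.code 60) (.sample d d' 60)
  | .seq p q => .seq p.code q.code
  | .ite e f p q => .seq (e.code 60) (.seq (f.code 61) (.ite 60 61 p.code q.code))
  | .loop r p => .loop r p.code

/-- The effect on the memory (registers and heap), if there are `c` cells. -/
def exec (N c : ℕ) (R : ZMod N → ℂ) : St → (ℕ → ℤ) → ℕ → ℤ
  | .skip, m => m
  | .asg d e, m => update m d (e.eval N m)
  -- Indirect access is fenced off below `100`. Otherwise a program could read the scratch cells,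
  -- about which `Agree` says nothing.
  | .load d e, m => update m d
      (if e.eval N m < 100 then 0 else wrap N (m (e.eval N m).toNat))
  | .store e f, m => if e.eval N m < 100 ∨ (c : ℤ) ≤ e.eval N m then m else
      update m (e.eval N m).toNat (f.eval N m)
  | .cos d e f, m => update m d (wrap N
      (toFixed N (Real.cos (2 * pi * (e.eval N m : ℝ) / (f.eval N m : ℝ)))))
  | .sin d e f, m => update m d (wrap N
      (toFixed N (Real.sin (2 * pi * (e.eval N m : ℝ) / (f.eval N m : ℝ)))))
  | .sample d d' e, m => update (update m d
      (wrap N (toFixed N (R ((e.eval N m : ℤ) : ZMod N)).re))) d'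
      (wrap N (toFixed N (R ((e.eval N m : ℤ) : ZMod N)).im))
  | .seq p q, m => q.exec N c R (p.exec N c R m)
  | .ite e f p q, m => if e.eval N m < f.eval N m then p.exec N c R m else q.exec N c R m
  | .loop r p, m => (p.exec N c R)^[(m r).toNat] m

/-- Register `i` is not assigned to. -/
def keeps (i : ℕ) : St → Bool
  | .skip | .store _ _ => true
  | .asg d _ | .load d _ | .cos d _ _ | .sin d _ _ => decide (d ≠ i)
  | .sample d d' _ => decide (d ≠ i) && decide (d' ≠ i)
  | .seq p q | .ite _ _ p q => p.keeps i && q.keeps i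
  | .loop _ p => p.keeps i

/-- No register below `i` is assigned to. -/
def keepsBelow (i : ℕ) : St → Bool
  | .skip | .store _ _ => true
  | .asg d _ | .load d _ | .cos d _ _ | .sin d _ _ => decide (i ≤ d)
  | .sample d d' _ => decide (i ≤ d) && decide (i ≤ d')
  | .seq p q | .ite _ _ p q => p.keepsBelow i && q.keepsBelow i
  | .loop _ p => p.keepsBelow i

/-- The heap is not written to. -/
def noStore : St → Bool
  | .store _ _ => false
  | .seq p q | .ite _ _ p q => p.noStore && q.noStore
  | .loop _ p => p.noStore
  | _ => true

/-- Well-formed statements, with loop counts in the registers from `F` only, which are never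
assigned to. -/
def ok (F : List ℕ) : St → Bool
  | .skip => true
  | .asg d e | .load d e => decide (d < 60) && decide (d ∉ F) && e.ok 60
  | .store e f => e.ok 60 && f.ok 61
  | .cos d e f | .sin d e f => decide (d < 60) && decide (d ∉ F) && e.ok 60 && f.ok 61
  | .sample d d' e => decide (d < 60) && decide (d' < 60) && decide (d ∉ F) && decide (d' ∉ F)
      && e.ok 60
  | .seq p q => p.ok F && q.ok F
  | .ite e f p q => e.ok 60 && f.ok 61 && p.ok F && q.ok F
  | .loop r p => decide (r ∈ F) && decide (r < 60) && p.ok F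

/-- A bound on the number of operations, if `ρ` bounds the loop counts. -/
def cost (ρ : ℕ → ℕ) : St → ℕ
  | .skip => 1
  | .asg _ e => e.size + 2
  | .load _ e => e.size + 3
  | .store e f => e.size + f.size + 3
  | .cos _ e f | .sin _ e f => e.size + f.size + 1
  | .sample _ _ e => e.size + 1
  | .seq p q => p.cost ρ + q.cost ρ
  | .ite e f p q => e.size + f.size + 1 + p.cost ρ + q.cost ρ
  | .loop r p => 1 + ρ r * (p.cost ρ + 1)

end St

/-- Agreement outside the cells for intermediate results. -/
def Agree (m m' : ℕ → ℤ) : Prop := ∀ i, i < 60 ∨ 100 ≤ i → m i = m' i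

lemma Config.write_ops (s : Config) (N c d : ℕ) (v : ℤ) : (s.write N c d v).ops = s.ops := by
  simp only [write]; split_ifs <;> rfl

lemma Config.write_samples (s : Config) (N c d : ℕ) (v : ℤ) : (s.write N c d v).samples = s.samples
  := by simp only [write]; split_ifs <;> rfl

attribute [local simp] write tick

/-- Evaluation uses the scratch cells as a stack: the value of `e` waits in cell `d` while `f` is
evaluated from cell `d + 1` on. -/
lemma Ex.run_code {N c : ℕ} (R : ZMod N → ℂ) (hc : 100 ≤ c) : ∀ (e : Ex) (d : ℕ) (s : Config) (m : ℕ
  → ℤ), 60 ≤ d → e.ok d → Agree s.mem m → ∃ s', (e.code d).run N c R s = PMF.pure s' ∧ s'.mem d =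
  e.eval N m ∧ (∀ i, i < d ∨ 100 ≤ i → s'.mem i = s.mem i) ∧ s'.ops = s.ops + e.size ∧ s'.samples =
  s.samples
  | .var i, d, s, m, hd, hok, hs => by
    simp [Ex.ok] at hok
    have hi : i ≠ d := by omega
    have hdc : d < c := by omega
    refine ⟨_, by simp only [Ex.code, Prog.run, PMF.pure_bind]; rfl, ?_, ?_, ?_, ?_⟩
    · simp [hdc, BinOp.eval, Ex.eval, hi, hs i (Or.inl hok.1)]
    · intro j hj
      have : j ≠ d := by omega
      simp [hdc, this]
    · simp [hdc, Ex.size]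
    · simp [hdc]
  | .lit z, d, s, m, hd, hok, hs => by
    simp [Ex.ok] at hok
    have hdc : d < c := by omega
    refine ⟨_, by simp only [Ex.code, Prog.run]; rfl, ?_, ?_, ?_, ?_⟩
    · simp [hdc, Ex.eval]
    · intro j hj
      have : j ≠ d := by omega
      simp [hdc, this]
    · simp [hdc, Ex.size]
    · simp [hdc]
  | .bin o e f, d, s, m, hd, hok, hs => by
    simp [Ex.ok] at hok
    obtain ⟨s1, h1, h1d, h1f, h1o, h1s⟩ := Ex.run_code R hc e d s m hd hok.1 hs
    obtain ⟨s2, h2, h2d, h2f, h2o, h2s⟩ := Ex.run_code R hc f (d + 1) s1 m (by omega) hok.2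
      (fun i hi => by rw [h1f i (by omega), hs i hi])
    have hd100 : ∀ (e : Ex) (d : ℕ), e.ok d → d < 100 := by
      intro e
      induction e with
      | var i => intro d h; simp [Ex.ok] at h; exact h.2
      | lit z => intro d h; simpa [Ex.ok] using h
      | bin o e f he hf => intro d h; simp [Ex.ok] at h; exact he d h.1
    have hdc : d < c := by have := hd100 e d hok.1; omega
    refine ⟨_, by simp only [Ex.code, Prog.run, h1, h2, PMF.pure_bind]; rfl, ?_, ?_, ?_, ?_⟩
    · simp [hdc, Ex.eval, h2d, h2f d (by omega), h1d]
    · intro j hj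
      have : j ≠ d := by have := hd100 e d hok.1; omega
      simp [hdc, this, h2f j (by omega), h1f j hj]
    · simp [hdc, Ex.size, h2o, h1o]; omega
    · simp [hdc, h2s, h1s]

lemma St.exec_keeps {N c : ℕ} {R : ZMod N → ℂ} {i : ℕ} (hi : i < 60) : ∀ {st : St} (m : ℕ → ℤ),
  st.keeps i → st.exec N c R m i = m i
  | .skip, _, _ => rfl
  | .asg d _, m, h | .load d _, m, h | .cos d _ _, m, h | .sin d _ _, m, h => by
    simp [keeps] at h; simp [exec, update_of_ne (Ne.symm h)]
  | .store e f, m, _ => by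
    rw [exec]; split_ifs with h
    · rfl
    · rw [update_of_ne]; omega
  | .sample d d' e, m, h => by
    simp [keeps] at h
    simp [exec, update_of_ne (Ne.symm h.1), update_of_ne (Ne.symm h.2)]
  | .seq p q, m, h => by
    simp [keeps] at h
    rw [exec, exec_keeps hi _ h.2, exec_keeps hi _ h.1]
  | .ite e f p q, m, h => by
    simp [keeps] at h
    rw [exec]; split_ifs
    · exact exec_keeps hi _ h.1
    · exact exec_keeps hi _ h.2
  | .loop r p, m, h => by
    rw [exec]
    induction (m r).toNat with
    | zero => rfl
    | succ n ih => rw [iterate_succ_apply', exec_keeps (st := p) hi _ h, ih]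

lemma St.keeps_of_keepsBelow {i j : ℕ} (hij : i < j) : ∀ {st : St}, st.keepsBelow j → st.keeps i
  | .skip, _ | .store _ _, _ => rfl
  | .asg d _, h | .load d _, h | .cos d _ _, h | .sin d _ _, h => by
    simp [keepsBelow] at h; simp [keeps]; omega
  | .sample d d' _, h => by
    simp [keepsBelow] at h; simp [keeps]; omega
  | .seq p q, h | .ite _ _ p q, h => by
    simp [keepsBelow] at h
    simp [keeps, keeps_of_keepsBelow hij h.1, keeps_of_keepsBelow hij h.2]
  | .loop _ p, h => keeps_of_keepsBelow (st := p) hij h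

lemma St.exec_keepsBelow {N c : ℕ} {R : ZMod N → ℂ} {i j : ℕ} {st : St} (m : ℕ → ℤ) (h :
  st.keepsBelow j) (hij : i < j) (hi : i < 60) : st.exec N c R m i = m i := exec_keeps hi m
  (keeps_of_keepsBelow hij h)

lemma St.exec_noStore {N c : ℕ} {R : ZMod N → ℂ} {F : List ℕ} {i : ℕ} (hi : 100 ≤ i) : ∀ {st : St}
  (m : ℕ → ℤ), st.noStore → st.ok F → st.exec N c R m i = m i
  | .skip, _, _, _ => rfl
  | .asg d e, m, _, h | .load d e, m, _, h => by
    simp [ok] at h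
    rw [exec, update_of_ne]; omega
  | .cos d e f, m, _, h | .sin d e f, m, _, h => by
    simp [ok] at h
    rw [exec, update_of_ne]; omega
  | .store e f, m, h, _ => by simp [noStore] at h
  | .sample d d' e, m, _, h => by
    simp [ok] at h
    rw [exec, update_of_ne (by omega), update_of_ne (by omega)]
  | .seq p q, m, h, h' => by
    simp [noStore] at h
    simp [ok] at h'
    rw [exec, exec_noStore hi _ h.2 h'.2, exec_noStore hi _ h.1 h'.1]
  | .ite e f p q, m, h, h' => by
    simp [noStore] at h
    simp [ok] at h'
    rw [exec]; split_ifs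
    · exact exec_noStore hi _ h.1 h'.1.2
    · exact exec_noStore hi _ h.2 h'.2
  | .loop r p, m, h, h' => by
    simp [ok] at h'
    rw [exec]
    induction (m r).toNat with
    | zero => rfl
    | succ n ih => rw [iterate_succ_apply', exec_noStore (st := p) hi _ h h'.2, ih]

/-- Loop counts are never reassigned. Hence a bound `ρ` on them at the start stays valid during the
whole run, and costs can be read off the text. -/
lemma St.keeps_of_ok {F : List ℕ} {i : ℕ} (hi : i ∈ F) : ∀ {st : St}, st.ok F → st.keeps i
  | .skip, _ | .store _ _, _ => rfl
  | .asg d e, h | .load d e, h => by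
    simp [ok] at h
    simp only [keeps, decide_eq_true_eq]; rintro rfl; exact h.1.2 hi
  | .cos d e f, h | .sin d e f, h => by
    simp [ok] at h
    simp only [keeps, decide_eq_true_eq]; rintro rfl; exact h.1.1.2 hi
  | .sample d d' e, h => by
    simp [ok] at h
    simp only [keeps, Bool.and_eq_true, decide_eq_true_eq]
    constructor <;> rintro rfl
    · exact h.1.1.2 hi
    · exact h.1.2 hi
  | .seq p q, h => by
    simp [ok] at h
    simp [keeps, keeps_of_ok hi h.1, keeps_of_ok hi h.2]
  | .ite e f p q, h => by
    simp [ok] at h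
    simp [keeps, keeps_of_ok hi h.1.2, keeps_of_ok hi h.2]
  | .loop r p, h => by
    simp [ok] at h
    exact keeps_of_ok (st := p) hi h.2

/-- Compiled statements are deterministic, have the effect `St.exec`, and run within the bound. -/
theorem St.run_code {N c : ℕ} (R : ZMod N → ℂ) (hc : 100 ≤ c) (h100 : wrap N 100 = 100) {F : List ℕ}
  (hF : ∀ r ∈ F, r < 60) (ρ : ℕ → ℕ) : ∀ (st : St) (s : Config) (m : ℕ → ℤ), st.ok F → Agree s.mem m
  → (∀ r ∈ F, (m r).toNat ≤ ρ r) → ∃ s', st.code.run N c R s = PMF.pure s' ∧ Agree s'.mem (st.exec N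
  c R m) ∧ s'.ops ≤ s.ops + st.cost ρ ∧ s'.samples + s.ops ≤ s.samples + s'.ops
  | .skip, s, m, _, hs, _ => by
    refine ⟨_, rfl, ?_, ?_, ?_⟩
    · intro i hi
      have : i ≠ 60 := by omega
      simp only [write, tick, exec]
      split_ifs <;> simp [this, hs i hi]
    · simp only [write, tick]; split_ifs <;> simp [cost]
    · simp only [write, tick]; split_ifs <;> simp
  | .asg d e, s, m, hok, hs, _ => by
    simp [ok] at hok
    obtain ⟨s1, h1, h1d, h1f, h1o, h1s⟩ := Ex.run_code R hc e 60 s m le_rfl hok.2 hs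
    have hdc : d < c := by omega
    have hd : 60 ≠ d := by omega
    refine ⟨_, by simp only [code, Prog.run, h1, PMF.pure_bind]; rfl, ?_, ?_, ?_⟩
    · intro i hi
      have h1i := h1f i (by omega)
      rcases eq_or_ne i d with rfl | hid
      · have : wrap N (e.eval N m) = e.eval N m := by cases e <;> simp [Ex.eval]
        simp [hdc, exec, BinOp.eval, hd, h1d, this]
      · simp [hdc, exec, hid, h1i, hs i hi]
    · simp [hdc, h1o, cost]; omega
    · simp [hdc, h1o, h1s]; omega
  | .load d e, s, m, hok, hs, _ => by
    simp [ok] at hok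
    obtain ⟨s1, h1, h1d, h1f, h1o, h1s⟩ := Ex.run_code R hc e 60 s m le_rfl hok.2 hs
    have hdc : d < c := by omega
    have h61 : 61 < c := by omega
    by_cases hlt : e.eval N m < 100
    · refine ⟨_, by
        simp only [code, Prog.run, h1, PMF.pure_bind]
        rw [if_pos (by simpa [h61, h1d, h100] using hlt)], ?_, ?_, ?_⟩
      · intro i hi
        have h1i := h1f i (by omega)
        have hi61 : i ≠ 61 := by omega
        rcases eq_or_ne i d with rfl | hid
        · simp [hdc, exec, hlt, wrap]
        · simp [hdc, h61, exec, hid, hi61, h1i, hs i hi]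
      · simp [hdc, h61, h1o, cost]; omega
      · simp [hdc, h61, h1o, h1s]; omega
    · refine ⟨_, by
        simp only [code, Prog.run, h1, PMF.pure_bind]
        rw [if_neg (by simpa [h61, h1d, h100] using hlt)], ?_, ?_, ?_⟩
      · intro i hi
        have h1i := h1f i (by omega)
        have hi61 : i ≠ 61 := by omega
        have h1j := h1f (e.eval N m).toNat (by omega)
        have hj61 : (e.eval N m).toNat ≠ 61 := by omega
        rcases eq_or_ne i d with rfl | hid
        · simp [hdc, h61, exec, hlt, h1d, hj61, h1j, hs (e.eval N m).toNat (by omega)]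
        · simp [hdc, h61, exec, hid, hi61, h1i, hs i hi]
      · simp [hdc, h61, h1o, cost]; omega
      · simp [hdc, h61, h1o, h1s]; omega
  | .store e f, s, m, hok, hs, _ => by
    simp [ok] at hok
    obtain ⟨s1, h1, h1d, h1f, h1o, h1s⟩ := Ex.run_code R hc e 60 s m le_rfl hok.1 hs
    obtain ⟨s2, h2, h2d, h2f, h2o, h2s⟩ := Ex.run_code R hc f 61 s1 m (by omega) hok.2
      (fun i hi => by rw [h1f i (by omega), hs i hi])
    have h60 : s2.mem 60 = e.eval N m := by rw [h2f 60 (by omega), h1d]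
    have h62 : 62 < c := by omega
    have hc60 : 60 < c := by omega
    have hw : wrap N (f.eval N m) = f.eval N m := by cases f <;> simp [Ex.eval]
    by_cases hlt : e.eval N m < 100
    · refine ⟨_, by
        simp only [code, Prog.run, h1, h2, PMF.pure_bind]
        rw [if_pos (by simpa [h62, h60, h100] using hlt)], ?_, ?_, ?_⟩
      · intro i hi
        have h1i := h1f i (by omega)
        have h2i := h2f i (by omega)
        have hi60 : i ≠ 60 := by omega
        have hi62 : i ≠ 62 := by omega
        simp [hc60, h62, exec, hlt, hi60, hi62, h2i, h1i, hs i hi]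
      · simp [hc60, h62, h2o, h1o, cost]; omega
      · simp [hc60, h62, h2o, h1o, h2s, h1s]; omega
    · refine ⟨(s2.tick.write N c 62 100).tick.tick.write N c (e.eval N m).toNat (f.eval N m), by
        simp only [code, Prog.run, h1, h2, PMF.pure_bind]
        rw [if_neg (by simpa [h62, h60, h100] using hlt)]
        simp [h62, h60, h2d], ?_, ?_, ?_⟩
      · intro i hi
        have h1i := h1f i (by omega)
        have h2i := h2f i (by omega)
        have hi62 : i ≠ 62 := by omega
        by_cases hle : (c : ℤ) ≤ e.eval N m
        · have : ¬ (e.eval N m).toNat < c := by omega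
          simp [h62, exec, hle, this, hi62, h2i, h1i, hs i hi]
        · have hlt' : (e.eval N m).toNat < c := by omega
          rw [exec, if_neg (by omega)]
          rcases eq_or_ne i (e.eval N m).toNat with rfl | hid
          · simp [hlt', hw]
          · simp [h62, hlt', hid, hi62, h2i, h1i, hs i hi]
      · simp [-write, Config.write_ops, h2o, h1o, cost]; omega
      · simp [-write, Config.write_ops, Config.write_samples, h2o, h1o, h2s, h1s]; omega
  | .cos d e f, s, m, hok, hs, _ | .sin d e f, s, m, hok, hs, _ => by
    simp [ok] at hok
    obtain ⟨s1, h1, h1d, h1f, h1o, h1s⟩ := Ex.run_code R hc e 60 s m le_rfl hok.1.2 hs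
    obtain ⟨s2, h2, h2d, h2f, h2o, h2s⟩ := Ex.run_code R hc f 61 s1 m (by omega) hok.2
      (fun i hi => by rw [h1f i (by omega), hs i hi])
    have hdc : d < c := by omega
    refine ⟨_, by simp only [code, Prog.run, h1, h2, PMF.pure_bind]; rfl, ?_, ?_, ?_⟩
    · intro i hi
      have h1i := h1f i (by omega)
      have h2i := h2f i (by omega)
      rcases eq_or_ne i d with rfl | hid
      · simp [hdc, exec, h2d, h2f 60 (by omega), h1d]
      · simp [hdc, exec, hid, h2i, h1i, hs i hi]
    · simp [hdc, h2o, h1o, cost]; omega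
    · simp [hdc, h2o, h1o, h2s, h1s]; omega
  | .sample d d' e, s, m, hok, hs, _ => by
    simp [ok] at hok
    obtain ⟨s1, h1, h1d, h1f, h1o, h1s⟩ := Ex.run_code R hc e 60 s m le_rfl hok.2 hs
    have hdc : d < c := by omega
    have hdc' : d' < c := by omega
    refine ⟨_, by simp only [code, Prog.run, h1, PMF.pure_bind]; rfl, ?_, ?_, ?_⟩
    · intro i hi
      have h1i := h1f i (by omega)
      rcases eq_or_ne i d' with rfl | hid'
      · simp [hdc, hdc', exec, h1d]
      rcases eq_or_ne i d with rfl | hid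
      · simp [hdc, hdc', exec, h1d, hid']
      · simp [hdc, hdc', exec, hid, hid', h1i, hs i hi]
    · simp [hdc, hdc', h1o, cost]
    -- Taking a sample is itself an operation, so samples never grow faster than operations. Written
    -- with sums in place of differences, this carries through all cases and lets the operation
    -- count bound the samples too.
    · simp [hdc, hdc', h1o, h1s]; omega
  | .seq p q, s, m, hok, hs, hρ => by
    simp [ok] at hok
    obtain ⟨s1, h1, h1m, h1o, h1s⟩ := run_code R hc h100 hF ρ p s m hok.1 hs hρ
    obtain ⟨s2, h2, h2m, h2o, h2s⟩ := run_code R hc h100 hF ρ q s1 _ hok.2 h1m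
      (fun r hr => by rw [exec_keeps (hF r hr) _ (keeps_of_ok hr hok.1)]; exact hρ r hr)
    refine ⟨s2, by simp only [code, Prog.run, h1, h2, PMF.pure_bind], h2m, ?_, by omega⟩
    simp only [cost]; omega
  | .ite e f p q, s, m, hok, hs, hρ => by
    simp [ok] at hok
    obtain ⟨s1, h1, h1d, h1f, h1o, h1s⟩ := Ex.run_code R hc e 60 s m le_rfl hok.1.1.1 hs
    obtain ⟨s2, h2, h2d, h2f, h2o, h2s⟩ := Ex.run_code R hc f 61 s1 m (by omega) hok.1.1.2
      (fun i hi => by rw [h1f i (by omega), hs i hi])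
    have hs2 : Agree s2.tick.mem m := fun i hi => by
      simp only [tick]; rw [h2f i (by omega), h1f i (by omega), hs i hi]
    have h60 : s2.mem 60 = e.eval N m := by rw [h2f 60 (by omega), h1d]
    by_cases hlt : e.eval N m < f.eval N m
    · obtain ⟨s3, h3, h3m, h3o, h3s⟩ := run_code R hc h100 hF ρ p s2.tick m hok.1.2 hs2 hρ
      refine ⟨s3, by simp only [code, Prog.run, h1, h2, PMF.pure_bind, h60, h2d, if_pos hlt, h3],
        by rw [exec, if_pos hlt]; exact h3m, ?_, ?_⟩ <;>
      simp only [tick, cost] at h3o h3s ⊢ <;> omega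
    · obtain ⟨s3, h3, h3m, h3o, h3s⟩ := run_code R hc h100 hF ρ q s2.tick m hok.2 hs2 hρ
      refine ⟨s3, by simp only [code, Prog.run, h1, h2, PMF.pure_bind, h60, h2d, if_neg hlt, h3],
        by rw [exec, if_neg hlt]; exact h3m, ?_, ?_⟩ <;>
      simp only [tick, cost] at h3o h3s ⊢ <;> omega
  | .loop r p, s, m, hok, hs, hρ => by
    simp [ok] at hok
    have hr := hs r (Or.inl hok.1.2)
    -- The iteration acts on distributions, but starts at a point mass and stays among point masses.
    have key : ∀ n : ℕ, ∃ s', (fun D : PMF Config => D.bind fun s' => p.code.run N c R s'.tick)^[n]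
      (PMF.pure s.tick) = PMF.pure s' ∧ Agree s'.mem ((p.exec N c R)^[n] m) ∧ (∀ r ∈ F, ((p.exec N c
      R)^[n] m r).toNat ≤ ρ r) ∧ s'.ops ≤ s.ops + (1 + n * (p.cost ρ + 1)) ∧ s'.samples + s.ops ≤
      s.samples + s'.ops := by
      intro n
      induction n with
      | zero => exact ⟨_, rfl, hs, hρ, by simp [tick], by simp [tick]⟩
      | succ n ih =>
        obtain ⟨s1, h1, h1m, h1ρ, h1o, h1s⟩ := ih
        obtain ⟨s2, h2, h2m, h2o, h2s⟩ := run_code R hc h100 hF ρ p s1.tick _ hok.2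
          (show Agree s1.tick.mem _ from h1m) h1ρ
        refine ⟨s2, by rw [iterate_succ_apply', h1, PMF.pure_bind, h2],
          by rw [iterate_succ_apply']; exact h2m, ?_, ?_, ?_⟩
        · intro r hr
          rw [iterate_succ_apply', exec_keeps (hF r hr) _ (keeps_of_ok hr hok.2)]
          exact h1ρ r hr
        · simp only [tick] at h2o; rw [Nat.succ_mul]; omega
        · simp only [tick] at h2o h2s; omega
    obtain ⟨s', h1, h2, -, h4, h5⟩ := key (m r).toNat
    refine ⟨s', by simp only [code, Prog.run, hr, h1], h2, h4.trans ?_, h5⟩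
    simp only [cost]
    have := Nat.mul_le_mul_right (p.cost ρ + 1) (hρ r hok.1.1)
    omega

open Ex (var lit bdd_var bdd_add bdd_mul bdd_lit bdd_mod bdd_sub eval_var eval_eq eval_lit eval_add eval_mul val_var val_mul val_add)
open St (exec exec_keepsBelow keeps_of_keepsBelow)

/-- `for i = 0, …, (register r) - 1 do p`. -/
def St.for (i r : ℕ) (p : St) : St := i ≔ lit 0 ;; .loop r (p ;; i ≔ var i + lit 1)

/-- Invariants of `for` loops. -/
lemma St.exec_for {N c : ℕ} {R : ZMod N → ℂ} {F : List ℕ} {i r n : ℕ} {p : St} {m : ℕ → ℤ} (hi : i <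
  60) (hir : i ≠ r) (hk : p.keeps i) (hok : p.ok F) (hn : (m r).toNat = n) (hnN : n + 2 ≤ wordLen N
  ∨ ∃ b, n ≤ 2 ^ b ∧ b + 2 ≤ wordLen N) (I : ℕ → (ℕ → ℤ) → Prop) (h0 : I 0 (update m i 0)) (hI : ∀ j
  m z, I j m → I j (update m i z)) (hstep : ∀ j < n, ∀ m' : ℕ → ℤ, m' i = j → (∀ r, r < 60 ∧ r ≠ i →
  p.keeps r → m' r = m r) → (p.noStore → ∀ a, 100 ≤ a → m' a = m a) → I j m' → I (j + 1) (p.exec N c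
  R m')) : I n ((St.for i r p).exec N c R m) := by
  obtain ⟨b, hb, hbN⟩ : ∃ b, n ≤ 2 ^ b ∧ b + 2 ≤ wordLen N := by
    rcases hnN with h | h
    · exact ⟨n, lt_two_pow_self.le, h⟩
    · exact h
  -- The counter reaches `n` after the last turn, so it must not overflow there either.
  have hw : ∀ j : ℕ, j ≤ n → wrap N j = j := fun j hj => by
    refine wrap_of_abs_le hbN ?_
    rw [abs_of_nonneg (by positivity)]
    exact_mod_cast hj.trans hb
  have hw1 : wrap N 0 = 0 := by simpa using hw 0 (Nat.zero_le _)
  set body : St := p ;; i ≔ var i + lit 1 with hbody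
  have key : ∀ j ≤ n, I j ((body.exec N c R)^[j] (update m i 0)) ∧ (body.exec N c R)^[j] (update m i
    0) i = j ∧ (∀ r, r < 60 ∧ r ≠ i → p.keeps r → (body.exec N c R)^[j] (update m i 0) r = m r) ∧
    (p.noStore → ∀ a, 100 ≤ a → (body.exec N c R)^[j] (update m i 0) a = m a) := by
    intro j
    induction j with
    | zero =>
      intro _
      refine ⟨h0, by simp, fun r h _ => by simp [h.2], fun _ a ha => ?_⟩
      have : a ≠ i := by omega
      simp [this]
    | succ j ih =>
      intro hj
      obtain ⟨h1, h2, h3, h4⟩ := ih (by omega)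
      rw [iterate_succ_apply']
      set m' := (body.exec N c R)^[j] (update m i 0)
      have hx : p.exec N c R m' i = j := by rw [exec_keeps hi _ hk, h2]
      have hw2 : wrap N ((j : ℤ) + 1) = (j : ℤ) + 1 := mod_cast hw (j + 1) hj
      have hbe : body.exec N c R m' = update (p.exec N c R m') i ((j : ℤ) + 1) := by
        simp only [hbody, exec, eval_add, eval_var, eval_lit, hx, wrap_wrap_add, wrap_add_wrap, hw2]
      rw [hbe]
      refine ⟨hI _ _ _ (hstep j (by omega) m' h2 h3 h4 h1), by simp, fun r hr hkr => ?_,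
        fun hs a ha => ?_⟩
      · rw [update_of_ne hr.2, exec_keeps hr.1 _ hkr, h3 r hr hkr]
      · rw [update_of_ne (by omega), exec_noStore ha _ hs hok, h4 hs a ha]
  have := (key n le_rfl).1
  simp only [St.for, exec, eval_lit, hw1, update_of_ne hir.symm, hn]
  exact this

/-! ## Random draws -/

/-- Two independent uniform draws are one uniform draw from the product. Used repeatedly, this
collects all randomness of a run in one uniform point. -/
lemma uniform_bind_bind {α β γ δ : Type*} [Fintype α] [Nonempty α] [Fintype β] [Nonempty β] [Fintype
  γ] [Nonempty γ] (e : α × β ≃ γ) (g : γ → PMF δ) : (uniformOfFintype α).bind (fun a =>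
  (uniformOfFintype β).bind fun b => g (e (a, b))) = (uniformOfFintype γ).bind g := by
  ext y
  have hcard : Fintype.card γ = Fintype.card α * Fintype.card β := by
    rw [← Fintype.card_congr e, Fintype.card_prod]
  simp only [PMF.bind_apply, tsum_fintype, PMF.uniformOfFintype_apply]
  rw [← Equiv.sum_comp e, Fintype.sum_prod_type]
  refine sum_congr rfl fun a _ => ?_
  rw [mul_sum]
  refine sum_congr rfl fun b _ => ?_
  rw [hcard, Nat.cast_mul, ENNReal.mul_inv (by simp) (by simp), mul_assoc]

lemma uniform_bind_snoc {α δ : Type*} [Fintype α] [Nonempty α] (n : ℕ) (g : (Fin (n + 1) → α) → PMF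
  δ) : (uniformOfFintype (Fin n → α)).bind (fun t => (uniformOfFintype α).bind fun x => g (Fin.snoc
  t x)) = (uniformOfFintype (Fin (n + 1) → α)).bind g := uniform_bind_bind ((Equiv.prodComm _
  _).trans (Fin.snocEquiv fun _ => α)) g

lemma run_rand {N c : ℕ} [NeZero N] (R : ZMod N → ℂ) {d : ℕ} (s : Config) (hs : s.mem 0 = N) :
  (Prog.rand d 0).run N c R s = (uniformOfFintype (Fin N)).bind fun i =>
      PMF.pure (s.tick.write N c d ((i : ℕ) : ℤ)) := by
  -- The type `Fin ((s.mem 0).toNat - 1 + 1)` agrees with `Fin N` only after rewriting, hence the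
  -- passage through a variable `n`.
  have key : ∀ n, [NeZero n] → n = N → (uniformOfFintype (Fin n)).bind (fun i =>
      PMF.pure (s.tick.write N c d ((i : ℕ) : ℤ))) = (uniformOfFintype (Fin N)).bind fun i =>
      PMF.pure (s.tick.write N c d ((i : ℕ) : ℤ)) := by
    rintro n _ rfl; rfl
  have hN : (s.mem 0).toNat - 1 + 1 = N := by
    rw [hs]; have := NeZero.pos N; simp; omega
  simp only [Prog.run]
  exact key _ hN

/-- Draw as many integers below register `0` as register `9` says, and store them from the address
in register `r` on. -/
def drawLoop (r : ℕ) : Prog := .seq (St.code (25 ≔ lit 0)) (.loop 9 (.seq (.rand 24 0) (St.code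
  (.store (var r + var 25) (var 24) ;; 25 ≔ var 25 + lit 1))))

/-- After `j` turns the configuration is a function of the first `j` draws, and these are a uniform
point of `Fin j → Fin N`; `Fin.snoc` appends the next draw. -/
lemma run_drawLoop {N c : ℕ} [NeZero N] (R : ZMod N → ℂ) (hc : 100 ≤ c) (h100 : wrap N 100 = 100) {r
  : ℕ} (hr : r < 24) {B n b : ℕ} (hB : 100 ≤ B) (hBn : B + n ≤ c) (hBb : B + n ≤ 2 ^ b) (hNb : N ≤ 2
  ^ b) (hb : b + 3 ≤ wordLen N) (s : Config) (h0 : s.mem 0 = N) (h9 : s.mem 9 = n) (hrB : s.mem r =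
  B) : ∃ f : (Fin n → Fin N) → Config, (drawLoop r).run N c R s = (uniformOfFintype (Fin n → Fin
  N)).bind (PMF.pure ∘ f) ∧ ∀ t, (∀ i < 60, i ≠ 24 → i ≠ 25 → (f t).mem i = s.mem i) ∧ (∀ j : Fin n,
  (f t).mem (B + j) = ((t j : ℕ) : ℤ)) ∧ (∀ i, 100 ≤ i → (i < B ∨ B + n ≤ i) → (f t).mem i = s.mem
  i) ∧ (f t).ops ≤ s.ops + 4 + n * 20 ∧ (f t).samples + s.ops ≤ s.samples + (f t).ops := by
  obtain ⟨s0, h1, h1m, h1o, h1s⟩ := St.run_code R hc h100 (F := []) (by simp) (fun _ => 0)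
    (25 ≔ lit 0) s s.mem rfl (fun _ _ => rfl) (by simp)
  have hw : ∀ z : ℤ, 0 ≤ z → z ≤ 2 * 2 ^ b → wrap N z = z := fun z h1 h2 => by
    refine wrap_of_abs_le (b := b + 1) (by omega) ?_
    rw [abs_of_nonneg h1, pow_succ]; linarith
  have hwn : ∀ x : ℕ, x ≤ 2 * 2 ^ b → wrap N x = x := fun x hx =>
    hw x (by positivity) (mod_cast hx)
  have hw0 : wrap N 0 = 0 := by simpa using hwn 0 (by positivity)
  have hs0 : ∀ i, i < 60 ∨ 100 ≤ i → i ≠ 25 → s0.mem i = s.mem i := fun i hi hi' => by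
    rw [h1m i hi]; simp [exec, hi']
  have hs25 : s0.mem 25 = 0 := by rw [h1m 25 (by omega)]; simp [exec, eval_lit, hw0]
  set body : Prog := .seq (.rand 24 0)
    (St.code (.store (var r + var 25) (var 24) ;; 25 ≔ var 25 + lit 1)) with hbody
  have hstep : ∀ (s : Config) (j : ℕ), j < n → s.mem 0 = N → s.mem 25 = j → s.mem r = B → ∃ g : Fin
    N → Config, body.run N c R s = (uniformOfFintype (Fin N)).bind (PMF.pure ∘ g) ∧ ∀ x, (∀ i < 60,
    i ≠ 24 → i ≠ 25 → (g x).mem i = s.mem i) ∧ (g x).mem 25 = (j + 1 : ℕ) ∧ (g x).mem (B + j) = ((x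
    : ℕ) : ℤ) ∧ (∀ i, 100 ≤ i → i ≠ B + j → (g x).mem i = s.mem i) ∧ (g x).ops ≤ s.ops + 19 ∧ (g
    x).samples + s.ops ≤ s.samples + (g x).ops := by
    intro s j hj hs0 hs25 hsr
    have hex : ∀ x : Fin N, ∃ s', (St.code (.store (var r + var 25) (var 24) ;; 25 ≔ var 25 + lit
      1)).run N c R (s.tick.write N c 24 ((x : ℕ) : ℤ)) = PMF.pure s' ∧ (∀ i < 60, i ≠ 24 → i ≠ 25 →
      s'.mem i = s.mem i) ∧ s'.mem 25 = (j + 1 : ℕ) ∧ s'.mem (B + j) = ((x : ℕ) : ℤ) ∧ (∀ i, 100 ≤ i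
      → i ≠ B + j → s'.mem i = s.mem i) ∧ s'.ops ≤ s.ops + 19 ∧ s'.samples + s.ops ≤ s.samples +
      s'.ops := by
      intro x
      have hx : wrap N ((x : ℕ) : ℤ) = ((x : ℕ) : ℤ) := hwn x (by have := x.2; omega)
      set s1 := s.tick.write N c 24 ((x : ℕ) : ℤ) with hs1
      have hs1m : s1.mem = update s.mem 24 ((x : ℕ) : ℤ) := by
        rw [hs1, write, if_pos (by omega)]; simp [tick, hx]
      have hs1o : s1.ops = s.ops + 1 := by
        rw [hs1, write, if_pos (by omega)]; simp [tick]
      have hs1s : s1.samples = s.samples := by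
        rw [hs1, write, if_pos (by omega)]; simp [tick]
      obtain ⟨s', h2, h2m, h2o, h2s⟩ := St.run_code R hc h100 (F := []) (by simp) (fun _ => 0)
        (.store (var r + var 25) (var 24) ;; 25 ≔ var 25 + lit 1) s1 s1.mem (by
          simp only [St.ok, Bool.and_eq_true]
          exact ⟨⟨show Ex.ok (.bin .add (var r) (var 25)) 60 by simp [Ex.ok]; omega, rfl⟩, ⟨rfl, rfl⟩, rfl⟩)
        (fun _ _ => rfl) (by simp)
      have hadr : wrap N ((B : ℤ) + j) = (B : ℤ) + j := by
        exact_mod_cast hwn (B + j) (by omega)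
      have hcadr : ¬ ((B : ℤ) + j < 100 ∨ (c : ℤ) ≤ (B : ℤ) + j) := by omega
      have htn : ((B : ℤ) + j).toNat = B + j := by omega
      have hj1 : wrap N ((j : ℤ) + 1) = (j : ℤ) + 1 := mod_cast hwn (j + 1) (by omega)
      have hr24 : r ≠ 24 := by omega
      have hexec : exec N c R (.store (var r + var 25) (var 24) ;; 25 ≔ var 25 + lit 1) s1.mem =
        update (update s1.mem (B + j) ((x : ℕ) : ℤ)) 25 ((j : ℤ) + 1) := by
        have hne : (25 : ℕ) ≠ B + j := by omega
        simp only [exec, eval_add, eval_var, eval_lit, hs1m, wrap_wrap_add, wrap_add_wrap,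
          update_of_ne hr24, hsr, ne_eq, not_false_eq_true, show (25 : ℕ) ≠ 24 by norm_num,
          update_of_ne, hs25, hadr, if_neg hcadr, htn, update_self, hx, hne, hj1]
      rw [hexec] at h2m
      refine ⟨s', h2, ?_, ?_, ?_, ?_, ?_, ?_⟩
      · intro i hi h24 h25
        have : i ≠ B + j := by omega
        rw [h2m i (by omega)]; simp [hs1m, h24, h25, this]
      · rw [h2m 25 (by omega)]; simp
      · have : B + j ≠ 25 := by omega
        rw [h2m _ (by omega)]; simp [this]
      · intro i hi hij
        have h24 : i ≠ 24 := by omega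
        have h25 : i ≠ 25 := by omega
        rw [h2m i (by omega)]; simp [hs1m, h24, h25, hij]
      · have : St.cost (fun _ => 0) (.store (var r + var 25) (var 24) ;;
          25 ≔ var 25 + lit 1) = 16 := rfl
        omega
      · omega
    choose g hg using hex
    refine ⟨g, ?_, fun x => (hg x).2⟩
    rw [hbody, Prog.run, run_rand R s hs0, PMF.bind_bind]
    congr 1
    funext x
    rw [PMF.pure_bind, (hg x).1]; rfl
  have key : ∀ k ≤ n, ∃ f : (Fin k → Fin N) → Config, (fun D : PMF Config => D.bind fun s' =>
    body.run N c R s'.tick)^[k] (PMF.pure s0.tick) = (uniformOfFintype (Fin k → Fin N)).bind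
    (PMF.pure ∘ f) ∧ ∀ t, (∀ i < 60, i ≠ 24 → i ≠ 25 → (f t).mem i = s.mem i) ∧ (f t).mem 25 = k ∧
    (∀ j : Fin k, (f t).mem (B + j) = ((t j : ℕ) : ℤ)) ∧ (∀ i, 100 ≤ i → (i < B ∨ B + k ≤ i) → (f
    t).mem i = s.mem i) ∧ (f t).ops ≤ s.ops + 4 + k * 20 ∧ (f t).samples + s.ops ≤ s.samples + (f
    t).ops := by
    intro k
    induction k with
    | zero =>
      intro _
      refine ⟨fun _ => s0.tick, ?_, fun t => ⟨?_, ?_, fun j => j.elim0, ?_, ?_, ?_⟩⟩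
      · simp only [Function.iterate_zero, id_eq]
        exact (PMF.bind_const _ _).symm
      · intro i hi _ h25; exact hs0 i (Or.inl hi) h25
      · exact hs25
      · intro i hi _; exact hs0 i (Or.inr hi) (by omega)
      · have : St.cost (fun _ => 0) (25 ≔ lit 0) = 3 := rfl
        simp only [tick]; omega
      · simp only [tick]; omega
    | succ k ih =>
      intro hk
      obtain ⟨f, hf, hf'⟩ := ih (by omega)
      have hstep' := fun t => hstep (f t).tick k (by omega) (((hf' t).1 0 (by omega) (by omega) (by
        omega)).trans h0) (hf' t).2.1 (((hf' t).1 r (by omega) (by omega) (by omega)).trans hrB)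
      choose g hg hg' using hstep'
      refine ⟨fun t => g (Fin.init t) (t (Fin.last k)), ?_, fun t => ?_⟩
      · rw [iterate_succ_apply', hf, PMF.bind_bind, ← uniform_bind_snoc]
        congr 1
        funext t
        simp only [Function.comp, PMF.pure_bind, hg, Fin.init_snoc, Fin.snoc_last]
        rfl
      · obtain ⟨a1, a2, a3, a4, a5, a6⟩ := hg' (Fin.init t) (t (Fin.last k))
        obtain ⟨b1, b2, b3, b4, b5, b6⟩ := hf' (Fin.init t)
        simp only [tick] at a1 a4 a5 a6
        refine ⟨fun i hi h24 h25 => by rw [a1 i hi h24 h25, b1 i hi h24 h25], a2, fun j => ?_,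
          fun i hi hi' => ?_, by
          show (g _ _).ops ≤ _; omega, by show (g _ _).samples + _ ≤ _ + (g _ _).ops; omega⟩
        · refine Fin.lastCases a3 (fun j => ?_) j
          rw [a4 _ (by omega) (by have := j.2; simp; omega)]
          exact b3 j
        · show (g _ _).mem i = _
          rw [a4 i hi (by omega), b4 i hi (by omega)]
  obtain ⟨f, hf, hf'⟩ := key n le_rfl
  refine ⟨f, ?_, fun t => ?_⟩
  · have : (s0.mem 9).toNat = n := by rw [hs0 9 (by omega) (by omega), h9]; simp
    simp only [drawLoop, Prog.run] at hf ⊢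
    rw [h1, PMF.pure_bind, this]
    exact hf
  · obtain ⟨a1, -, a3, a4, a5, a6⟩ := hf' t
    exact ⟨a1, a3, a4, a5, a6⟩

/-! ## The program

Registers: `0, …, 6` input; `7` `2 ^ L` with `L` the length of `N`; `8` window length `W`;
`9` number `M` of draws; `10` grid size `W ^ 2`; `11` `⌊√N⌋`; `12` `1 / 2` modulo `N`;
`13` random dilation; `14` `L + 2`; `15` `2 * L + 2`; `16`, `17` addresses of the draws;
`18`, `19`, `20` numbers of peaks; `21`, `22` slopes `a`, `b` of the chirp and of the line;
`23` `1 / (a - b)` modulo `N`; `24` number of peaks so far; `25` grid point; `26`, `27`, `28` binary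
expansion of the frequency, its denominator and the time step. -/

namespace Algo

/-- Multiply the conjugate of the sample at `i` by `exp (2πi x / y)`, and add to `re`, `im`. -/
def addTerm (i x y : Ex) (re im : ℕ) : St := .sample 46 47 i ;; .cos 48 x y ;; .sin 49 x y ;; re ≔
  var re + (var 46 * var 48 + var 47 * var 49) ;; im ≔ var im + (var 46 * var 49 - var 47 * var 48)

/-- The phase in a window sum. -/
def windowPhase (v : Ex) : Ex := (((var 12 * var 21) % var 0) * ((var 41 * var 41) % var 0)) % var 0
  * var 10 * var 27 - var 25 * var 40 * var 0 * var 27 - v * var 0 * var 10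

/-- The sum over the window at time `t`, with phase shift `v`. -/
def window (t v : Ex) (re im : ℕ) : St := re ≔ lit 0 ;; im ≔ lit 0 ;; St.for 40 8 (41 ≔ (t + var 13
  * var 40) % var 0 ;; addTerm (var 41) (windowPhase v) (var 0 * var 10 * var 27) re im) ;; re ≔ var
  re / (var 7 * var 7) ;; im ≔ var im / (var 7 * var 7)

/-- One vote on the next binary digit. -/
def vote : St := .load 32 (var 16 + var 31) ;; window (var 32) (lit 0) 33 34 ;; window (var 32 + var
  28) (var 26) 35 36 ;; .ite (var 35 * var 33 + var 36 * var 34) (lit 0) (30 ≔ var 30 + lit 1) .skip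

/-- Find one more binary digit. -/
def digit : St := 28 ≔ var 28 / lit 2 ;; 27 ≔ var 27 + var 27 ;; 30 ≔ lit 0 ;; St.for 31 9 vote ;;
  .ite (var 9) (var 30 + var 30) (26 ≔ var 26 + var 27 / lit 2) .skip

/-- Find the frequency, and with it the candidate `τ` (register `34`). -/
def candidate : St := 26 ≔ lit 0 ;; 27 ≔ lit 1 ;; 28 ≔ var 7 * lit 4 ;; St.for 29 14 digit ;; 33 ≔
  ((var 0 * var 26 + var 0 * var 26 + var 27) / (var 27 + var 27)) % var 0 ;; 34 ≔ (var 33 * var 23)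
  % var 0

/-- The phase in the estimate of an ambiguity value. -/
def estimatePhase : Ex := (((var 22 * var 34) % var 0) * var 38 + ((var 12 * var 21) % var 0) *
  (((var 38 - var 34) * (var 38 - var 34)) % var 0)) % var 0

/-- Scale and clamp an estimate. -/
def scaled (r : ℕ) : Ex := ((var r * var 11) / (var 9 * var 7 * var 7) + var 7 * var 7 * var 7) %
  (var 7 * var 7 * var 7 + var 7 * var 7 * var 7) - var 7 * var 7 * var 7

/-- Estimate the ambiguity function at the candidate. -/
def estimate : St := 35 ≔ lit 0 ;; 36 ≔ lit 0 ;; St.for 37 9 (.load 38 (var 17 + var 37) ;; addTerm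
  (var 38) estimatePhase (var 0) 35 36) ;; 35 ≔ scaled 35 ;; 36 ≔ scaled 36

/-- Look for the candidate in the list at address `B`. -/
def lookup (B : ℕ) : St := 42 ≔ lit 0 ;; St.for 39 2 (.ite (var 39) (var 24) (.load 43 (lit (B + 1 :
  ℕ) + lit 4 * var 39) ;; .ite ((var 43 - var 34) * (var 43 - var 34)) (lit 1) (42 ≔ lit 1) .skip)
  .skip)

/-- Append the candidate to the list at address `B`. -/
def append (B : ℕ) : St := .store (lit (B + 1 : ℕ) + lit 4 * var 24) (var 34) ;; .store (lit (B + 2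
  : ℕ) + lit 4 * var 24) ((var 22 * var 34) % var 0) ;; .store (lit (B + 3 : ℕ) + lit 4 * var 24)
  (var 35) ;; .store (lit (B + 4 : ℕ) + lit 4 * var 24) (var 36) ;; 24 ≔ var 24 + lit 1

/-- Append the candidate if its estimate is large and it is new. -/
def record (B : ℕ) : St := .ite ((var 3 + lit 1) * (var 3 + lit 1)) (var 35 * var 35 + var 36 * var
  36 + lit 1) (.ite (var 24) (var 2) (lookup B ;; .ite (var 42) (lit 1) (append B) .skip) .skip)
  .skip

/-- The inverse of `a - b` modulo `N`. -/
def inverse : St := 50 ≔ var 0 ;; 51 ≔ (var 21 - var 22) % var 0 ;; 52 ≔ lit 0 ;; 53 ≔ lit 1 ;;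
  .loop 15 (.ite (lit 0) (var 51) (54 ≔ var 50 / var 51 ;; 55 ≔ var 50 - var 54 * var 51 ;; 50 ≔ var
  51 ;; 51 ≔ var 55 ;; 55 ≔ (var 52 - var 54 * var 53) % var 0 ;; 52 ≔ var 53 ;; 53 ≔ var 55) .skip)
  ;; 23 ≔ var 52

/-- Find the peaks for the chirp and the line whose slopes are in the registers `ra` and `rb`;
put them into the list at address `B` and their number into register `rc`. -/
def peaks (ra rb rc B : ℕ) : St := 21 ≔ var ra ;; 22 ≔ var rb ;; inverse ;; 24 ≔ lit 0 ;; St.for 25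
  10 (candidate ;; estimate ;; record B) ;; .store (lit B) (var 24) ;; rc ≔ var 24

/-- Precomputation; the random draws are stored from address `D` on. -/
def setup (D : ℕ) : St := 7 ≔ lit 1 ;; .loop 1 (7 ≔ var 7 + var 7) ;; 8 ≔ lit 0 ;; .loop 1 (.ite
  (var 8 * var 8 * var 8 * var 8 * (var 8 * var 8 * var 8 * var 8)) (var 1) (8 ≔ var 8 + lit 1)
  .skip) ;; 9 ≔ var 1 * var 8 ;; 10 ≔ var 8 * var 8 ;; 14 ≔ var 1 + lit 2 ;; 15 ≔ var 1 + var 1 +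
  lit 2 ;; 12 ≔ (var 0 + lit 1) / lit 2 ;; 11 ≔ lit 0 ;; 21 ≔ var 7 ;; .loop 1 (21 ≔ var 21 / lit 2
  ;; .ite (var 0) ((var 11 + var 21) * (var 11 + var 21)) .skip (11 ≔ var 11 + var 21)) ;; 16 ≔ lit
  D ;; 17 ≔ var 16 + var 9

/-- Test one triple of peaks for incidence. -/
def incidence (B₃ : ℕ) : St := .ite ((var 36 - var 38 - var 6 * (var 35 - var 37)) % var 0) (lit 1)
  (.store (lit (B₃ + 1 : ℕ) + lit 2 * var 24) (var 35) ;; .store (lit (B₃ + 2 : ℕ) + lit 2 * var 24)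
  (var 36) ;; 24 ≔ var 24 + lit 1) .skip

/-- Load the points of the list at `A` into the registers `d` and `d + 1`, one after the other. -/
def forPoints (i n d A : ℕ) (p : St) : St := St.for i 2 (.ite (var i) (var n) (.load d (lit (A + 1 :
  ℕ) + lit 4 * var i) ;; .load (d + 1) (lit (A + 2 : ℕ) + lit 4 * var i) ;; p) .skip)

/-- Collect the points of triple incidence. -/
def triples (B₀ B₁ B₂ B₃ : ℕ) : St := 24 ≔ lit 0 ;; forPoints 25 18 31 B₀ (forPoints 26 19 33 B₁ (35
  ≔ (var 31 + var 33) % var 0 ;; 36 ≔ (var 32 + var 34) % var 0 ;; forPoints 27 20 37 B₂ (incidence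
  B₃))) ;; .store (lit B₃) (var 24)

/-- The deterministic part, after the random draws. -/
def main (B₀ B₁ B₂ B₃ : ℕ) : St :=
  peaks 4 5 18 B₀ ;; peaks 5 4 19 B₁ ;; peaks 6 5 20 B₂ ;; triples B₀ B₁ B₂ B₃

/-- Put the addresses of the lists in place. -/
def finish (B₀ B₁ B₂ B₃ : ℕ) : St := 0 ≔ lit B₀ ;; 1 ≔ lit B₁ ;; 2 ≔ lit B₂ ;; 3 ≔ lit B₃

end Algo

/-- The least `l` such that `L ≤ l ^ 8`. -/
def ell (L : ℕ) : ℕ := (fun l => if l ^ 8 < L then l + 1 else l)^[L] 0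

/-- Addresses of the lists of peaks. -/
def peakAddr (k i : ℕ) : ℕ := 100 + i * (4 * k + 1)

/-- Address of the list of shifts. -/
def shiftAddr (k : ℕ) : ℕ := peakAddr k 3

/-- Address of the random draws. -/
def drawAddr (k : ℕ) : ℕ := shiftAddr k + (2 * k ^ 3 + 1)

abbrev Algo.mainAt (k : ℕ) : St := main (peakAddr k 0) (peakAddr k 1) (peakAddr k 2) (shiftAddr k)

abbrev Algo.finishAt (k : ℕ) : St :=
  finish (peakAddr k 0) (peakAddr k 1) (peakAddr k 2) (shiftAddr k)

/-- The implementation of `SCE_μ`. -/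
def algorithm (k : ℕ) : Algorithm where
  prog := .seq (Algo.setup (drawAddr k)).code (.seq (.rand 13 0) (.seq (drawLoop 16) (.seq (drawLoop
    17) (.seq (Algo.mainAt k).code (Algo.finishAt k).code))))
  cells N := drawAddr k + 2 * (size N * ell (size N))

/-- Registers that hold loop counts. -/
def loopRegs : List ℕ := [2, 8, 9, 10, 14, 15]

lemma Algo.main_ok (B₀ B₁ B₂ B₃ : ℕ) : (Algo.main B₀ B₁ B₂ B₃).ok loopRegs := by
  have h1 : ∀ B, (Algo.peaks 4 5 18 B).ok loopRegs := fun _ => rfl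
  have h2 : ∀ B, (Algo.peaks 5 4 19 B).ok loopRegs := fun _ => rfl
  have h3 : ∀ B, (Algo.peaks 6 5 20 B).ok loopRegs := fun _ => rfl
  have h4 : (Algo.triples B₀ B₁ B₂ B₃).ok loopRegs := rfl
  simp [Algo.main, St.ok, h1, h2, h3, h4]

lemma Algo.setup_ok (D : ℕ) : (Algo.setup D).ok [1] := rfl

lemma Algo.finish_ok (B₀ B₁ B₂ B₃ : ℕ) : (Algo.finish B₀ B₁ B₂ B₃).ok [] := rfl

section size
variable (e f : Ex)
lemma Ex.size_var (i : ℕ) : (var i).size = 2 := rfl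
lemma Ex.size_lit (z : ℤ) : (lit z).size = 1 := rfl
lemma Ex.size_add : (e + f).size = e.size + f.size + 1 := rfl
lemma Ex.size_sub : (e - f).size = e.size + f.size + 1 := rfl
lemma Ex.size_mul : (e * f).size = e.size + f.size + 1 := rfl
lemma Ex.size_div : (e / f).size = e.size + f.size + 1 := rfl
lemma Ex.size_mod : (e % f).size = e.size + f.size + 1 := rfl
end size

lemma Algo.cost_peaks (ρ : ℕ → ℕ) (ra rb rc B : ℕ) : (Algo.peaks ra rb rc B).cost ρ ≤ 2000 * (1 + ρ
  15 + (1 + ρ 10) * ((1 + ρ 14) * ((1 + ρ 9) * (1 + ρ 8)) + ρ 2)) := by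
  simp only [Algo.peaks, Algo.candidate, Algo.estimate, Algo.record, Algo.inverse, Algo.lookup,
    Algo.append, Algo.digit, Algo.vote, Algo.window, Algo.addTerm, Algo.windowPhase,
    Algo.estimatePhase, Algo.scaled, St.cost, St.for, Ex.size_var, Ex.size_lit, Ex.size_add,
    Ex.size_sub, Ex.size_mul, Ex.size_div, Ex.size_mod]
  generalize ρ 15 = a; generalize ρ 10 = b; generalize ρ 14 = c; generalize ρ 9 = d
  generalize ρ 8 = e; generalize ρ 2 = f
  -- Both sides are polynomials with natural coefficients. Once they are expanded, `omega` treats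
  -- the monomials as atoms and compares coefficients.
  ring_nf
  omega

lemma Algo.cost_triples (ρ : ℕ → ℕ) (B₀ B₁ B₂ B₃ : ℕ) : (Algo.triples B₀ B₁ B₂ B₃).cost ρ ≤ 1000 *
  (1 + ρ 2) ^ 3 := by
  simp only [Algo.triples, Algo.forPoints, Algo.incidence, St.cost, St.for,
    Ex.size_var, Ex.size_lit, Ex.size_add, Ex.size_sub, Ex.size_mul, Ex.size_div, Ex.size_mod]
  generalize ρ 2 = a
  ring_nf
  omega

lemma Algo.cost_main (ρ : ℕ → ℕ) (B₀ B₁ B₂ B₃ : ℕ) : (Algo.main B₀ B₁ B₂ B₃).cost ρ ≤ 6000 * (1 + ρ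
  15 + (1 + ρ 10) * ((1 + ρ 14) * ((1 + ρ 9) * (1 + ρ 8)) + ρ 2)) + 1000 * (1 + ρ 2) ^ 3 := by
  have h1 := Algo.cost_peaks ρ 4 5 18 B₀
  have h2 := Algo.cost_peaks ρ 5 4 19 B₁
  have h3 := Algo.cost_peaks ρ 6 5 20 B₂
  have h4 := Algo.cost_triples ρ B₀ B₁ B₂ B₃
  simp only [Algo.main, St.cost]
  omega

lemma Algo.cost_setup (ρ : ℕ → ℕ) (D : ℕ) : (Algo.setup D).cost ρ ≤ 1000 * (1 + ρ 1) := by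
  simp only [Algo.setup, St.cost, Ex.size_var, Ex.size_lit, Ex.size_add,
    Ex.size_sub, Ex.size_mul, Ex.size_div, Ex.size_mod]
  omega

lemma Algo.cost_finish (ρ : ℕ → ℕ) (B₀ B₁ B₂ B₃ : ℕ) : (Algo.finish B₀ B₁ B₂ B₃).cost ρ = 12 := by
  simp only [Algo.finish, St.cost, Ex.size_lit]

/-! ## What the program computes -/

lemma wrap_mem_Ico {N : ℕ} (hN : 1 ≤ wordLen N) (x : ℤ) : -2 ^ (wordLen N - 1) ≤ wrap N x ∧ wrap N x
  < 2 ^ (wordLen N - 1) := by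
  obtain ⟨k, hk⟩ : ∃ k, wordLen N = k + 1 := ⟨wordLen N - 1, by omega⟩
  have h1 := Int.le_bmod (x := x) (m := 2 ^ (k + 1)) (by positivity)
  have h2 := Int.bmod_lt (x := x) (m := 2 ^ (k + 1)) (by positivity)
  rw [wrap, hk, Nat.add_sub_cancel]
  push_cast [pow_succ'] at h1 h2 ⊢
  omega

/-- Division of a word by a positive integer cannot overflow. So scaled sums are words even if the
sum itself has wrapped around, which may happen since the signal is arbitrary. -/
lemma wrap_wrap_div {N : ℕ} (hN : 1 ≤ wordLen N) (x : ℤ) {q : ℤ} (hq : 0 < q) : wrap N (wrap N x /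
  q) = wrap N x / q := by
  obtain ⟨h1, h2⟩ := wrap_mem_Ico hN x
  apply wrap_of_lt hN
  · rw [Int.le_ediv_iff_mul_le hq]; nlinarith
  · rw [Int.ediv_lt_iff_lt_mul hq]; nlinarith

/-- The parameters are in the range in which nothing overflows. -/
structure Admissible (N k D : ℕ) : Prop where
  size_ge : 40 ≤ size N
  D_ge : 100 ≤ D
  D_le : D + 2 * (size N * ell (size N)) + 8 * (k + 1) ^ 3 ≤ 2 ^ size N
  ell_le : ell (size N) ^ 8 ≤ 2 ^ size N

/-- Contents of the registers after the random draws; `x` stands for the input registers and the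
random dilation. -/
structure Ready (N k D : ℕ) (x m : ℕ → ℤ) : Prop where
  r0 : m 0 = N
  r2 : m 2 = k
  r3 : m 3 = x 3
  r4 : m 4 = x 4
  r5 : m 5 = x 5
  r6 : m 6 = x 6
  r7 : m 7 = 2 ^ size N
  r8 : m 8 = ell (size N)
  r9 : m 9 = size N * ell (size N)
  r10 : m 10 = ell (size N) * ell (size N)
  r11 : m 11 = Nat.sqrt N
  r12 : m 12 = (N + 1) / 2
  r13 : m 13 = x 13
  r14 : m 14 = size N + 2
  r15 : m 15 = 2 * size N + 2
  r16 : m 16 = D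
  r17 : m 17 = D + size N * ell (size N)

/-- The inputs are in range. -/
structure Inputs (N : ℕ) (x : ℕ → ℤ) : Prop where
  r3 : 0 ≤ x 3 ∧ x 3 ≤ 2 ^ (3 * size N)
  r4 : 0 ≤ x 4 ∧ x 4 < N
  r5 : 0 ≤ x 5 ∧ x 5 < N
  r6 : 0 ≤ x 6 ∧ x 6 < N
  r13 : 0 ≤ x 13 ∧ x 13 < N

section
variable {N k D c : ℕ} {R : ZMod N → ℂ} {x m : ℕ → ℤ}

lemma Ready.congr (h : Ready N k D x m) {m' : ℕ → ℤ} (hm : ∀ r < 18, m' r = m r) : Ready N k D x m'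
  := by
  constructor <;> rw [hm _ (by simp)]
  exacts [h.r0, h.r2, h.r3, h.r4, h.r5, h.r6, h.r7, h.r8, h.r9, h.r10, h.r11, h.r12, h.r13, h.r14,
    h.r15, h.r16, h.r17]

lemma Ready.exec (h : Ready N k D x m) {st : St} (hst : st.keepsBelow 18) : Ready N k D x (st.exec N
  c R m) := h.congr fun r hr => exec_keepsBelow m hst hr (by omega)

lemma Admissible.N_le' : (N : ℤ) ≤ 2 ^ size N := mod_cast (lt_size_self N).le

lemma Admissible.N_pos (h : Admissible N k D) : 0 < N := by
  rcases Nat.eq_zero_or_pos N with rfl | h'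
  · have := h.size_ge; simp at this
  · exact h'

lemma Admissible.le_wordLen (h : Admissible N k D) : 320 ≤ wordLen N := by
  have := h.size_ge; rw [wordLen]; omega

/-- A word has `8 L` bits; `7 L` is a convenient allowance for everything that must be exact. -/
lemma Admissible.wrap_small (h : Admissible N k D) {z : ℤ} {b : ℕ} (hz : |z| ≤ 2 ^ b) (hb : b ≤ 7 *
  size N := by omega) : wrap N z = z := wrap_of_abs_le (by have := h.size_ge; rw [wordLen]; omega)
  hz

/-- The common bound for registers is `2 ^ (L + 3)`. The three extra bits are for the time steps and
denominators of the binary expansion, which run up to `2 ^ (L + 2)`, and for doubling them. -/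
lemma abs_le_two_pow {L : ℕ} {z : ℤ} (h1 : z ≤ 2 ^ L) (h0 : 0 ≤ z := by positivity) :
    |z| ≤ 2 ^ (L + 3) := by
  rw [abs_of_nonneg h0, pow_add]; nlinarith

lemma abs_le_of_lt {z : ℤ} (h : 0 ≤ z ∧ z < N) : |z| ≤ 2 ^ (size N + 3) :=
  abs_le_two_pow (h.2.le.trans Admissible.N_le') h.1

lemma abs_le_of_le {z : ℤ} (h0 : 0 ≤ z) (h1 : z ≤ N) : |z| ≤ 2 ^ (size N + 3) :=
  abs_le_two_pow (h1.trans Admissible.N_le')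

lemma Admissible.cube_le (h : Admissible N k D) : ((k ^ 3 : ℕ) : ℤ) ≤ 2 ^ size N := by
  have h1 := h.D_le
  have : k ^ 3 ≤ (k + 1) ^ 3 := Nat.pow_le_pow_left (by omega) 3
  exact_mod_cast (by omega : k ^ 3 ≤ 2 ^ size N)

lemma Admissible.k_le (h : Admissible N k D) : (k : ℤ) ≤ 2 ^ size N :=
  le_trans (mod_cast Nat.le_self_pow (by simp) k) h.cube_le

lemma Admissible.abs_le (h : Admissible N k D) {j : ℕ} (hj : j ≤ k) :
    |(j : ℤ)| ≤ 2 ^ (size N + 3) :=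
  abs_le_two_pow (le_trans (mod_cast hj) h.k_le)

lemma Ready.abs_le (h : Ready N k D x m) (hA : Admissible N k D) (hI : Inputs N x) : ∀ r ∈ [0, 2, 4,
  5, 6, 7, 8, 9, 10, 11, 12, 13, 14, 15, 16, 17],
      |m r| ≤ 2 ^ (size N + 3) := by
  have hN := Admissible.N_le' (N := N)
  have hD : (D : ℤ) + 2 * (size N * ell (size N)) + 8 * ((k : ℤ) + 1) ^ 3 ≤ 2 ^ size N := by
    exact_mod_cast hA.D_le
  have hW : (ell (size N) : ℤ) * ell (size N) ≤ 2 ^ size N := by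
    have h1 := hA.ell_le
    rcases Nat.eq_zero_or_pos (ell (size N)) with h0 | h0
    · simp [h0]
    · have : ell (size N) ^ 2 ≤ ell (size N) ^ 8 := Nat.pow_le_pow_right h0 (by simp)
      rw [sq] at this
      exact_mod_cast this.trans h1
  have hW1 : (ell (size N) : ℤ) ≤ 2 ^ size N := by
    rcases Nat.eq_zero_or_pos (ell (size N)) with h0 | h0
    · simp [h0]
    · have : (1 : ℤ) ≤ ell (size N) := mod_cast h0
      nlinarith
  have hk : (0 : ℤ) ≤ k := by positivity
  have hk3 : (k : ℤ) ≤ ((k : ℤ) + 1) ^ 3 := by nlinarith [sq_nonneg (k : ℤ), mul_nonneg hk hk, mul_nonneg (mul_nonneg hk hk) hk]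
  have hL : (size N : ℤ) + 2 ≤ 2 ^ size N ∧ 2 * (size N : ℤ) + 2 ≤ 2 ^ (size N + 3) := by
    have := lt_two_pow_self (n := size N - 1)
    obtain ⟨n, hn⟩ : ∃ n, size N = n + 1 := ⟨size N - 1, by have := hA.size_ge; omega⟩
    have h40 := hA.size_ge
    rw [hn] at this h40 ⊢
    simp only [Nat.add_sub_cancel] at this
    constructor
    · push_cast; rw [pow_succ]; linarith
    · push_cast; rw [show n + 1 + 3 = n + 4 by ring, pow_add]; norm_num; linarith
  have hsq : (Nat.sqrt N : ℤ) ≤ N := mod_cast Nat.sqrt_le_self N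
  intro r hr
  simp only [List.mem_cons, List.not_mem_nil, or_false] at hr
  rcases hr with rfl | rfl | rfl | rfl | rfl | rfl | rfl | rfl | rfl | rfl | rfl | rfl | rfl | rfl |
    rfl | rfl
  · rw [h.r0]; exact abs_le_two_pow hN
  · rw [h.r2]; exact abs_le_two_pow (by nlinarith)
  · rw [h.r4]; exact abs_le_of_lt hI.r4
  · rw [h.r5]; exact abs_le_of_lt hI.r5
  · rw [h.r6]; exact abs_le_of_lt hI.r6
  · rw [h.r7]; exact abs_le_two_pow le_rfl
  · rw [h.r8]; exact abs_le_two_pow hW1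
  · rw [h.r9]; exact abs_le_two_pow (by nlinarith)
  · rw [h.r10]; exact abs_le_two_pow hW
  · rw [h.r11]; exact abs_le_two_pow (by linarith)
  · rw [h.r12]; exact abs_le_two_pow (by omega)
  · rw [h.r13]; exact abs_le_of_lt hI.r13
  · rw [h.r14]; exact abs_le_two_pow hL.1
  · rw [h.r15, abs_of_nonneg (by positivity)]; exact hL.2
  · rw [h.r16]; exact abs_le_two_pow (by nlinarith)
  · rw [h.r17]; exact abs_le_two_pow (by nlinarith)

lemma Ex.eval_eq_val {e : Ex} (b : ℕ := Nat.size N + 3)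
    (hb : e.bits b + 2 ≤ wordLen N := by simp [wordLen]; omega) (h : e.Bdd b m) :
    e.eval N m = e.val m :=
  (eval_eq h hb).1

lemma St.exec_asg {d : ℕ} {e : Ex} (b : ℕ := size N + 3)
    (hb : e.bits b + 2 ≤ wordLen N := by simp [wordLen]; omega) (h : e.Bdd b m) :
    (d ≔ e).exec N c R m = update m d (e.val m) := by
  rw [exec, (eval_eq h hb).1]

lemma St.exec_seq {p q : St} : (p ;; q).exec N c R m = q.exec N c R (p.exec N c R m) := rfl

/-! ### Samples -/

/-- Real part of `conj (R i) * exp (2πi x / y)`, in fixed point. -/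
def termRe (N : ℕ) (R : ZMod N → ℂ) (i x y : ℤ) : ℤ := toFixed N (R i).re * toFixed N (Real.cos (2 *
  pi * (x : ℝ) / (y : ℝ))) + toFixed N (R i).im * toFixed N (Real.sin (2 * pi * (x : ℝ) / (y : ℝ)))

/-- Imaginary part of `conj (R i) * exp (2πi x / y)`, in fixed point. -/
def termIm (N : ℕ) (R : ZMod N → ℂ) (i x y : ℤ) : ℤ := toFixed N (R i).re * toFixed N (Real.sin (2 *
  pi * (x : ℝ) / (y : ℝ))) - toFixed N (R i).im * toFixed N (Real.cos (2 * pi * (x : ℝ) / (y : ℝ)))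

/-- No bound on the signal is assumed. As `wrap` respects sums and products, the accumulator is the
wrapped exact sum, whatever the samples are; only the arguments of cosine and sine have to be exact.
-/
lemma exec_addTerm {i X Y : Ex} {re im : ℕ} (hre : re < 46) (him : im < 46) (hne : re ≠ im) {iv xv
  yv : ℤ} (hi : i.eval N m = iv) (hx : ∀ m' : ℕ → ℤ, (∀ r < 46, m' r = m r) → X.eval N m' = xv) (hy
  : ∀ m' : ℕ → ℤ, (∀ r < 46, m' r = m r) → Y.eval N m' = yv) : (Algo.addTerm i X Y re im).exec N c R
  m re = wrap N (m re + termRe N R iv xv yv) ∧ (Algo.addTerm i X Y re im).exec N c R m im = wrap N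
  (m im + termIm N R iv xv yv) := by
  simp only [Algo.addTerm, St.exec_seq]
  set m1 := (St.sample 46 47 i).exec N c R m with hm1
  have e1 : ∀ r < 46, m1 r = m r := fun r hr => by
    simp (disch := omega) only [hm1, exec, update_of_ne]
  have e46 : m1 46 = wrap N (toFixed N (R iv).re) := by
    rw [hm1, exec, update_of_ne (by omega), update_self, hi]
  have e47 : m1 47 = wrap N (toFixed N (R iv).im) := by
    rw [hm1, exec, update_self, hi]
  set m2 := (St.cos 48 X Y).exec N c R m1 with hm2
  have f1 : ∀ r < 48, m2 r = m1 r := fun r hr => by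
    rw [hm2, exec, update_of_ne (by omega)]
  have f48 : m2 48 = wrap N (toFixed N (Real.cos (2 * pi * (xv : ℝ) / (yv : ℝ)))) := by
    rw [hm2, exec, update_self, hx m1 e1, hy m1 e1]
  set m3 := (St.sin 49 X Y).exec N c R m2 with hm3
  have g1 : ∀ r < 49, m3 r = m2 r := fun r hr => by
    rw [hm3, exec, update_of_ne (by omega)]
  have hm2m : ∀ r < 46, m2 r = m r := fun r hr => by rw [f1 r (by omega), e1 r hr]
  have g49 : m3 49 = wrap N (toFixed N (Real.sin (2 * pi * (xv : ℝ) / (yv : ℝ)))) := by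
    rw [hm3, exec, update_self, hx m2 hm2m, hy m2 hm2m]
  have r46 : m3 46 = wrap N (toFixed N (R iv).re) := by
    rw [g1 46 (by omega), f1 46 (by omega), e46]
  have r47 : m3 47 = wrap N (toFixed N (R iv).im) := by
    rw [g1 47 (by omega), f1 47 (by omega), e47]
  have r48 : m3 48 = wrap N (toFixed N (Real.cos (2 * pi * (xv : ℝ) / (yv : ℝ)))) := by
    rw [g1 48 (by omega), f48]
  have rr : ∀ r < 46, m3 r = m r := fun r hr => by rw [g1 r (by omega), hm2m r hr]
  constructor
  · rw [exec, update_of_ne hne, exec, update_self]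
    simp only [eval_add, eval_mul, eval_var, r46, r47, r48, g49, rr re hre, wrap_wrap,
      wrap_wrap_mul, wrap_mul_wrap, wrap_wrap_add, wrap_add_wrap, termRe]
  · rw [exec, update_self, exec]
    simp (disch := omega) only [eval_add, Ex.eval_sub, eval_mul, eval_var, update_of_ne, r46, r47, r48, g49, rr im him, wrap_wrap,
      wrap_wrap_mul, wrap_mul_wrap, wrap_wrap_add, wrap_add_wrap, wrap_wrap_sub, wrap_sub_wrap,
      termIm]

/-! ### Windows -/

/-- The phase of the chirp of slope `a` at time `i`, as a residue. -/
def chirpPhase (N : ℕ) (a i : ℤ) : ℤ := (((N : ℤ) + 1) / 2 * a % N * (i * i % N)) % N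

/-- Position in the window. -/
def windowTime (N : ℕ) (bd t : ℤ) (w : ℕ) : ℤ := (t + bd * w) % N

/-- Numerator of the phase in the window sums. -/
def windowNum (N : ℕ) (a bd s t v P : ℤ) (w : ℕ) : ℤ := chirpPhase N a (windowTime N bd t w) * (ell
  (size N) * ell (size N)) * P - s * w * N * P - v * N * (ell (size N) * ell (size N))

/-- Denominator of the phase in the window sums. -/
def windowDen (N : ℕ) (P : ℤ) : ℤ := N * (ell (size N) * ell (size N)) * P

/-- Real part of the window sum. -/
def windowRe (N : ℕ) (R : ZMod N → ℂ) (a bd s t v P : ℤ) : ℤ := wrap N (∑ w ∈ range (ell (size N)),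
  termRe N R (windowTime N bd t w) (windowNum N a bd s t v P w) (windowDen N P)) / (2 ^ size N * 2 ^
  size N)

/-- Imaginary part of the window sum. -/
def windowIm (N : ℕ) (R : ZMod N → ℂ) (a bd s t v P : ℤ) : ℤ := wrap N (∑ w ∈ range (ell (size N)),
  termIm N R (windowTime N bd t w) (windowNum N a bd s t v P w) (windowDen N P)) / (2 ^ size N * 2 ^
  size N)

lemma keepsBelow_window {t v : Ex} {re im : ℕ} (hre : 33 ≤ re) (him : 33 ≤ im) : (Algo.window t v re
  im).keepsBelow 33 := by
  simp [Algo.window, Algo.addTerm, St.keepsBelow, St.for, hre, him]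

/-- The loop body only writes to registers from `33` on. It is therefore enough that the expressions
`t` and `v` keep their values in all memories that agree with `m` below `33`. -/
lemma exec_window (hA : Admissible N k D) (hI : Inputs N x) (hR : Ready N k D x m) {t v : Ex}
    {re im : ℕ} (hre : 33 ≤ re) (hre' : re < 40) (him : 33 ≤ im) (him' : im < 40) (hne : re ≠ im)
    {a s tv vv P : ℤ} (ha : m 21 = a) (hs : m 25 = s) (hP : m 27 = P)
    (ha' : |a| ≤ 2 ^ (size N + 3)) (hs' : |s| ≤ 2 ^ (size N + 3))
    (hP' : |P| ≤ 2 ^ (size N + 3))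
    (ht : ∀ m' : ℕ → ℤ, (∀ r < 33, m' r = m r) → t.Bdd (size N + 3) m' ∧ t.val m' = tv)
    (htb : t.bits (size N + 3) ≤ size N + 5) (htok : t.ok 60)
    (hv : ∀ m' : ℕ → ℤ, (∀ r < 33, m' r = m r) → v.Bdd (size N + 3) m' ∧ v.val m' = vv)
    (hvb : v.bits (size N + 3) ≤ size N + 3) (hvok : v.ok 61) :
    (Algo.window t v re im).exec N c R m re = windowRe N R a (x 13) s tv vv P ∧
    (Algo.window t v re im).exec N c R m im = windowIm N R a (x 13) s tv vv P := by
  have hL := hA.size_ge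
  have hw8 : (m 8).toNat = ell (size N) := by rw [hR.r8]; simp
  have hNpos : (0 : ℤ) < N := mod_cast hA.N_pos
  have hwl := hA.le_wordLen
  simp only [Algo.window, St.exec_seq]
  set m1 := (im ≔ lit 0).exec N c R ((re ≔ lit 0).exec N c R m) with hm1
  have e1 : ∀ r, r ≠ re ∧ r ≠ im → m1 r = m r := fun r h => by
    rw [hm1, exec, update_of_ne h.2, exec, update_of_ne h.1]
  have e2 : m1 re = 0 := by
    rw [hm1, exec, update_of_ne hne, exec, update_self, eval_lit, wrap_zero]
  have e3 : m1 im = 0 := by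
    rw [hm1, exec, update_self, eval_lit, wrap_zero]
  set body : St := 41 ≔ (t + var 13 * var 40) % var 0 ;;
    Algo.addTerm (var 41) (Algo.windowPhase v) (var 0 * var 10 * var 27) re im with hbody
  have hkb : body.keepsBelow 33 := by
    simp [hbody, Algo.addTerm, St.keepsBelow, hre, him]
  have hell : ell (size N) ≤ 2 ^ size N := by
    rcases Nat.eq_zero_or_pos (ell (size N)) with h0 | h0
    · simp [h0]
    · exact (Nat.le_self_pow (by simp) _).trans hA.ell_le
  have key := St.exec_for (N := N) (c := c) (R := R) (F := []) (i := 40) (r := 8)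
    (n := ell (size N)) (p := body) (m := m1) (by simp) (by simp)
    (by simp [hbody, Algo.addTerm, St.keeps]; omega)
    (by
      simp [hbody, Algo.addTerm, St.ok]
      refine ⟨?_, rfl, ⟨?_, rfl⟩, ⟨by omega, ?_⟩, by omega, ?_⟩
      · show (Ex.bin .mod (Ex.bin .add t _) _).ok 60 = true
        simp [Ex.ok, htok]
      · show (Ex.bin .sub (Ex.bin .sub _ _) (Ex.bin .mul (Ex.bin .mul v (var 0)) (var 10))).ok 60
          = true
        simp [Ex.ok, hvok]
      · show (Ex.bin .add (var re) _).ok 60 = true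
        simp [Ex.ok]; omega
      · show (Ex.bin .add (var im) _).ok 60 = true
        simp [Ex.ok]; exact ⟨by omega, rfl⟩)
    (by rw [e1 8 (by omega), hw8]) (Or.inr ⟨size N, hell, by rw [wordLen]; omega⟩)
    (fun j m' => m' re = wrap N (∑ w ∈ range j, termRe N R (windowTime N (x 13) tv w)
        (windowNum N a (x 13) s tv vv P w) (windowDen N P)) ∧
      m' im = wrap N (∑ w ∈ range j, termIm N R (windowTime N (x 13) tv w)
        (windowNum N a (x 13) s tv vv P w) (windowDen N P)))
    (by
      simp (disch := omega) [update_of_ne, e2, e3])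
    (fun j m z h => by
      rw [update_of_ne (by omega), update_of_ne (by omega)]; exact h)
    (by
      intro j hj m' h40 hfr _ ⟨hIre, hIim⟩
      have hlow : ∀ r < 33, m' r = m r := fun r hr => by
        rw [hfr r (by omega) (keeps_of_keepsBelow hr hkb),
          e1 r (by omega)]
      have hR' : Ready N k D x m' := hR.congr fun r hr => hlow r (by omega)
      have hb' := hR'.abs_le hA hI
      obtain ⟨ht1, ht2⟩ := ht m' hlow
      have h40' : |m' 40| ≤ 2 ^ (size N + 3) := by
        rw [h40]; refine abs_le_two_pow ?_
        exact_mod_cast (hj.le.trans hell)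
      have hidx : (41 ≔ (t + var 13 * var 40) % var 0).exec N c R m' =
          update m' 41 (windowTime N (x 13) tv j) := by
        rw [St.exec_asg]
        · simp [ht2, hR'.r13, h40, hR'.r0, windowTime]
        · simp [ht1, hb' 13 (by simp), hb' 0 (by simp), h40']
      rw [hbody, St.exec_seq, hidx]
      set m2 := update m' 41 (windowTime N (x 13) tv j) with hm2
      have f41 : m2 41 = windowTime N (x 13) tv j := by simp [hm2]
      have fr : ∀ r, r ≠ 41 → m2 r = m' r := fun r hr => by simp [hm2, hr]
      have hidxb : |windowTime N (x 13) tv j| ≤ 2 ^ (size N + 3) :=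
        abs_le_of_lt ⟨emod_nonneg _ hNpos.ne', emod_lt_of_pos _ hNpos⟩
      have big : ∀ m3 : ℕ → ℤ, (∀ r < 46, m3 r = m2 r) →
          (Algo.windowPhase v).eval N m3 = windowNum N a (x 13) s tv vv P j ∧
          (var 0 * var 10 * var 27 : Ex).eval N m3 = windowDen N P := by
        intro m3 h3
        have h3low : ∀ r < 33, m3 r = m r := fun r hr => by
          rw [h3 r (by omega), fr r (by omega), hlow r hr]
        have hR3 : Ready N k D x m3 := hR.congr fun r hr => h3low r (by omega)
        have hb3 := hR3.abs_le hA hI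
        obtain ⟨hv1, hv2⟩ := hv m3 h3low
        have c41 : m3 41 = windowTime N (x 13) tv j := by rw [h3 41 (by omega), f41]
        have c40 : m3 40 = j := by rw [h3 40 (by omega), fr 40 (by omega), h40]
        have c21 : m3 21 = a := by rw [h3low 21 (by omega), ha]
        have c25 : m3 25 = s := by rw [h3low 25 (by omega), hs]
        have c27 : m3 27 = P := by rw [h3low 27 (by omega), hP]
        constructor
        -- The phase has to be evaluated without overflow. Its syntactic length is about six
        -- register lengths, roughly `6 L`, which fits into a word.
        · rw [Algo.windowPhase, Ex.eval_eq_val]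
          · simp [ hR3.r12, c21, hR3.r0, c41, hR3.r10, c27, c25, c40, hv2,
              windowNum, chirpPhase]
          · rw [h40] at h40'
            simp [hb3 12 (by simp), c21, ha', hb3 0 (by simp), c41, hidxb,
              hb3 10 (by simp), c27, hP', c25, hs', c40, hv1]
            exact (le_abs_self _).trans h40'
        · rw [Ex.eval_eq_val]
          · simp [hR3.r0, hR3.r10, c27, windowDen]
          · simp [hb3 0 (by simp), hb3 10 (by simp), c27, hP']
      have hwi : (var 41).eval N m2 = windowTime N (x 13) tv j := by
        rw [eval_var, f41]; exact hA.wrap_small hidxb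
      obtain ⟨g1, g2⟩ := exec_addTerm (c := c) (R := R) (m := m2) (i := var 41)
        (X := Algo.windowPhase v) (Y := var 0 * var 10 * var 27) (re := re) (im := im) (by omega)
        (by omega) hne hwi (fun m3 h3 => (big m3 h3).1) (fun m3 h3 => (big m3 h3).2)
      rw [g1, g2, fr re (by omega), fr im (by omega), hIre, hIim, Finset.sum_range_succ,
        Finset.sum_range_succ, wrap_wrap_add, wrap_wrap_add]
      exact ⟨rfl, rfl⟩)
  obtain ⟨k1, k2⟩ := key
  set m4 := (St.for 40 8 body).exec N c R m1 with hm4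
  have h7 : m4 7 = 2 ^ size N := by
    rw [hm4, exec_keepsBelow (j := 33) _ _ (by omega) (by omega), e1 7 (by omega),
      hR.r7]
    simp [St.for, St.keepsBelow, hkb]
  have hq : wrap N (2 ^ size N * 2 ^ size N) = 2 ^ size N * 2 ^ size N := by
    refine hA.wrap_small (b := 2 * size N) ?_
    rw [abs_of_nonneg (by positivity), two_mul, pow_add]
  have hdiv : ∀ r y, m4 r = wrap N y → r ≠ 7 → (var r / (var 7 * var 7) : Ex).eval N m4 =
      wrap N y / (2 ^ size N * 2 ^ size N) := by
    intro r y hy _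
    simp only [Ex.eval_div, eval_mul, eval_var, hy, h7, wrap_wrap, wrap_wrap_mul,
      wrap_mul_wrap, hq]
    exact wrap_wrap_div (by omega) _ (by positivity)
  constructor
  · rw [exec, update_of_ne hne, exec, update_self, hdiv re _ k1 (by omega)]
    rfl
  · rw [exec, update_self]
    have : ((re ≔ var re / (var 7 * var 7)).exec N c R m4) =
        update m4 re (wrap N (∑ w ∈ range (ell (size N)),
          termRe N R (windowTime N (x 13) tv w) (windowNum N a (x 13) s tv vv P w)
            (windowDen N P)) / (2 ^ size N * 2 ^ size N)) := by
      rw [exec, hdiv re _ k1 (by omega)]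
    rw [this]
    have h7re : 7 ≠ re := by omega
    simp only [Ex.eval_div, eval_mul, eval_var, update_of_ne hne.symm,
      update_of_ne h7re, k2, h7, wrap_wrap, wrap_wrap_mul, wrap_mul_wrap, hq]
    exact wrap_wrap_div (by omega) _ (by positivity)

end

/-! ### Binary digits of a frequency, by majority vote. -/

open Ex (eval_eq_val)

/-- The product of two window sums votes for the digit `1`. -/
def VoteOne (N : ℕ) (R : ZMod N → ℂ) (a bd s t H v P : ℤ) : Prop := wrap N (windowRe N R a bd s (t +
  H) v P * windowRe N R a bd s t 0 P + windowIm N R a bd s (t + H) v P * windowIm N R a bd s t 0 P)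
  < 0

open Classical in
/-- Number of votes for the digit `1`. -/
def votes (N : ℕ) (R : ZMod N → ℂ) (a bd s : ℤ) (t : ℕ → ℤ) (H v P : ℤ) (n : ℕ) : ℕ :=
  ((range n).filter fun j => VoteOne N R a bd s (t j) H v P).card

/-- Number of draws. -/
def draws (N : ℕ) : ℕ := size N * ell (size N)

/-- The binary expansion found in `j` steps. -/
def expansion (N : ℕ) (R : ZMod N → ℂ) (a bd s : ℤ) (t : ℕ → ℤ) : ℕ → ℤ
  | 0 => 0
  | j + 1 =>
    if draws N < 2 * votes N R a bd s t (2 ^ (size N + 2 - (j + 1))) (expansion N R a bd s t j) (2 ^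
      (j + 1)) (draws N)
    then expansion N R a bd s t j + 2 ^ j else expansion N R a bd s t j

/-- The frequency with the binary expansion `v / 2 ^ (L + 2)`, rounded. -/
def roundFreq (N : ℕ) (v : ℤ) : ℤ := ((2 * N * v + 2 ^ (size N + 2)) / (2 * 2 ^ (size N + 2))) % N

/-- The candidate found from the grid point `s`; `u` is the inverse of the difference of slopes. -/
def candTau (N : ℕ) (R : ZMod N → ℂ) (a u bd s : ℤ) (t : ℕ → ℤ) : ℤ :=
  (roundFreq N (expansion N R a bd s t (size N + 2)) * u) % N

section
variable {N k D c : ℕ} {R : ZMod N → ℂ} {x m : ℕ → ℤ}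

lemma Admissible.draws_le (hA : Admissible N k D) : (draws N : ℤ) ≤ 2 ^ size N := by
  have : draws N ≤ 2 ^ size N := by rw [draws]; have := hA.D_le; omega
  exact_mod_cast this

lemma Ready.r9' (h : Ready N k D x m) : m 9 = draws N := by rw [h.r9, draws]; push_cast; rfl

lemma expansion_bounds (N : ℕ) (R : ZMod N → ℂ) (a bd s : ℤ) (t : ℕ → ℤ) (j : ℕ) : 0 ≤ expansion N R
  a bd s t j ∧ expansion N R a bd s t j < 2 ^ j := by
  induction j with
  | zero => simp [expansion]
  | succ j ih =>
    rw [expansion, pow_succ]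
    split_ifs <;> constructor <;> linarith [ih.1, ih.2]

/-- The draws are on the heap. -/
def Drawn (D n : ℕ) (N : ℕ) (t m : ℕ → ℤ) : Prop := ∀ j < n, m (D + j) = t j ∧ 0 ≤ t j ∧ t j < N

lemma St.exec_skip : St.skip.exec N c R m = m := rfl

lemma St.exec_load {d : ℕ} {e : Ex} {A : ℕ} (b : ℕ := size N + 3) (hb : e.bits b + 2 ≤ wordLen N :=
  by simp [wordLen]; omega) (h : e.Bdd b m) (hA : e.val m = A) (hA' : 100 ≤ A) (hw : wrap N (m A) =
  m A) : (St.load d e).exec N c R m = update m d (m A) := by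
  rw [exec, (eval_eq h hb).1, hA, if_neg (by omega)]
  simp [hw]

lemma exec_vote (hA : Admissible N k D) (hI : Inputs N x) (hR : Ready N k D x m) {a s v P H tj : ℤ}
  {j : ℕ} {n : ℕ} (ha : m 21 = a) (hs : m 25 = s) (hv : m 26 = v) (hP : m 27 = P) (hH : m 28 = H)
  (h30 : m 30 = n) (h31 : m 31 = j) (hj : j < draws N) (htj : m (D + j) = tj) (ht : 0 ≤ tj ∧ tj < N)
  (ha' : |a| ≤ 2 ^ (size N + 3)) (hs' : |s| ≤ 2 ^ (size N + 3)) (hv' : |v| ≤ 2 ^ (size N + 3)) (hP'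
  : |P| ≤ 2 ^ (size N + 3)) (hH' : |H| ≤ 2 ^ (size N + 3)) (hn : n ≤ j) [Decidable (VoteOne N R a (x
  13) s tj H v P)] : Algo.vote.exec N c R m 30 = ((n + if VoteOne N R a (x 13) s tj H v P then 1
  else 0 : ℕ) : ℤ) := by
  have hb := hR.abs_le hA hI
  have hL := hA.size_ge
  have htb := abs_le_of_lt ht
  have hd := hA.draws_le
  have hjb : |(j : ℤ)| ≤ 2 ^ (size N + 3) := abs_le_two_pow (le_trans (mod_cast hj.le) hd)
  simp only [Algo.vote, St.exec_seq]
  have h1 : (St.load 32 (var 16 + var 31)).exec N c R m = update m 32 tj := by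
    rw [St.exec_load (A := D + j)]
    · rw [htj]
    · simp only [bdd_add, bdd_var, h31]; exact ⟨hb 16 (by simp), hjb⟩
    · simp [hR.r16, h31]
    · have := hA.D_ge; omega
    · rw [htj]; exact hA.wrap_small htb
  rw [h1]
  set m1 := update m 32 tj with hm1
  have e1 : ∀ r, r ≠ 32 → m1 r = m r := fun r hr => by simp [hm1, hr]
  have e32 : m1 32 = tj := by simp [hm1]
  have hR1 : Ready N k D x m1 := hR.congr fun r hr => e1 r (by omega)
  obtain ⟨y1, y2⟩ := exec_window (c := c) (R := R) hA hI hR1 (t := var 32) (v := lit 0) (re := 33)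
    (im := 34) (tv := tj) (vv := 0) (by simp) (by simp) (by simp) (by simp) (by simp) ((e1 21 (by
    simp)).trans ha) ((e1 25 (by simp)).trans hs) ((e1 27 (by simp)).trans hP) ha' hs' hP' (fun m' h
    => by simp [h 32 (by simp), e32, htb]) (by simp) rfl (fun m' h => by simp) (by simp) rfl
  set m2 := (Algo.window (var 32) (lit 0) 33 34).exec N c R m1 with hm2
  have f1 : ∀ r < 33, m2 r = m1 r := fun r hr =>
    exec_keepsBelow m1 (keepsBelow_window (by simp) (by simp)) hr (by omega)
  have hR2 : Ready N k D x m2 := hR1.congr fun r hr => f1 r (by omega)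
  have f32 : m2 32 = tj := by rw [f1 32 (by simp), e32]
  have ff : ∀ r < 32, m2 r = m r := fun r hr => by rw [f1 r (by omega), e1 r (by omega)]
  obtain ⟨z1, z2⟩ := exec_window (c := c) (R := R) hA hI hR2 (t := var 32 + var 28) (v := var 26)
    (re := 35) (im := 36) (tv := tj + H) (vv := v) (by simp) (by simp) (by simp) (by simp) (by simp)
    ((ff 21 (by simp)).trans ha) ((ff 25 (by simp)).trans hs) ((ff 27 (by simp)).trans hP) ha' hs'
    hP' (fun m' h => by
      simp only [bdd_add, bdd_var, val_add, val_var, h 32 (by simp),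
        h 28 (by simp), ff 28 (by simp), f32, hH]
      exact ⟨⟨htb, hH'⟩, trivial⟩)
    (by simp) rfl
    (fun m' h => by
      simp only [bdd_var, val_var, h 26 (by simp), ff 26 (by simp), hv]
      exact ⟨hv', trivial⟩) (by simp) rfl
  set m3 := (Algo.window (var 32 + var 28) (var 26) 35 36).exec N c R m2 with hm3
  have g33 : m3 33 = windowRe N R a (x 13) s tj 0 P := by
    rw [hm3, St.exec_keeps (by simp) _ rfl, y1]
  have g34 : m3 34 = windowIm N R a (x 13) s tj 0 P := by
    rw [hm3, St.exec_keeps (by simp) _ rfl, y2]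
  have g30 : m3 30 = n := by
    rw [hm3, St.exec_keeps (by simp) _ rfl, ff 30 (by simp), h30]
  have hlit : ∀ m' : ℕ → ℤ, (lit 0 : Ex).eval N m' = 0 := fun m' =>
    hA.wrap_small (b := 0) (by simp)
  rw [exec]
  -- For a wild signal this inner product may overflow. `VoteOne` is formulated with `wrap`, so the
  -- equivalence needs no bound.
  have hcond : (var 35 * var 33 + var 36 * var 34 : Ex).eval N m3 < (lit 0 : Ex).eval N m3 ↔ VoteOne
    N R a (x 13) s tj H v P := by
    simp only [hlit, eval_add, eval_mul, eval_var, z1, z2, g33, g34, wrap_wrap_mul,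
      wrap_mul_wrap, wrap_wrap_add, wrap_add_wrap, VoteOne]
  by_cases hV : VoteOne N R a (x 13) s tj H v P
  · rw [if_pos (hcond.2 hV), if_pos hV, St.exec_asg]
    · simp [g30]
    · simp only [bdd_add, bdd_var, g30, bdd_lit, and_true]
      refine abs_le_two_pow (le_trans ?_ hd)
      exact_mod_cast (by omega)
  · rw [if_neg (fun h => hV (hcond.1 h)), if_neg hV, St.exec_skip, g30, add_zero]

open Classical in
lemma exec_digit (hA : Admissible N k D) (hI : Inputs N x) (hR : Ready N k D x m)
    {a s v P H : ℤ} {t : ℕ → ℤ} (hD : Drawn D (draws N) N t m)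
    (ha : m 21 = a) (hs : m 25 = s) (hv : m 26 = v) (hP : m 27 = P) (hH : m 28 = H)
    (ha' : |a| ≤ 2 ^ (size N + 3)) (hs' : |s| ≤ 2 ^ (size N + 3))
    (hv' : |v| ≤ 2 ^ (size N + 3)) (hP0 : 0 ≤ P) (hP' : 2 * P ≤ 2 ^ (size N + 3))
    (hH0 : 0 ≤ H) (hH' : H ≤ 2 ^ (size N + 3)) :
    Algo.digit.exec N c R m 28 = H / 2 ∧ Algo.digit.exec N c R m 27 = P + P ∧
    Algo.digit.exec N c R m 26 =
      if draws N < 2 * votes N R a (x 13) s t (H / 2) v (P + P) (draws N)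
      then v + (P + P) / 2 else v := by
  have hL := hA.size_ge
  have hd := hA.draws_le
  simp only [Algo.digit, St.exec_seq]
  have h1 : (30 ≔ lit 0).exec N c R ((27 ≔ var 27 + var 27).exec N c R
      ((28 ≔ var 28 / lit 2).exec N c R m)) = update (update
        (update m 28 (H / 2)) 27 (P + P)) 30 0 := by
    rw [St.exec_asg (d := 28), St.exec_asg (d := 27),
      St.exec_asg (d := 30)]
    · simp [hH, hP]
    · simp
    · have h27 : update m 28 ((var 28 / lit 2 : Ex).val m) 27 = P := by simp [hP]
      simp only [bdd_add, bdd_var, h27, abs_of_nonneg hP0, and_self]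
      linarith
    · simp only [Ex.bdd_div, bdd_var, bdd_lit, hH, and_true, abs_of_nonneg hH0]; exact hH'
  rw [h1]
  set m1 := update (update (update m 28 (H / 2)) 27 (P + P)) 30 0
    with hm1
  have e1 : ∀ r, r ≠ 28 ∧ r ≠ 27 ∧ r ≠ 30 → m1 r = m r := fun r h => by
    simp [hm1, h]
  have e28 : m1 28 = H / 2 := by simp [hm1]
  have e27 : m1 27 = P + P := by simp [hm1]
  have e30 : m1 30 = 0 := by simp [hm1]
  have hkb : Algo.vote.keepsBelow 30 := rfl
  have hPP : |P + P| ≤ 2 ^ (size N + 3) := by rw [abs_of_nonneg (by positivity)]; linarith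
  have hHH : |H / 2| ≤ 2 ^ (size N + 3) := by
    rw [abs_of_nonneg (by positivity)]
    exact (Int.ediv_le_self 2 hH0).trans hH'
  have key := St.exec_for (N := N) (c := c) (R := R) (F := loopRegs) (i := 31) (r := 9) (n := draws N)
    (p := Algo.vote) (m := m1) (by simp) (by simp) rfl rfl
    (by rw [e1 9 (by simp), hR.r9']; simp)
    (Or.inr ⟨size N, mod_cast hd, by rw [wordLen]; omega⟩)
    (fun j m' => m' 30 = votes N R a (x 13) s t (H / 2) v (P + P) j)
    (by simp [e30, votes]) (fun j m z h => by rw [update_of_ne (by simp)]; exact h)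
    (by
      intro j hj m' h31 hfr hheap hI'
      have hlow : ∀ r < 30, m' r = m1 r := fun r hr =>
        hfr r (by omega) (keeps_of_keepsBelow hr hkb)
      have hlow' : ∀ r < 27, m' r = m r := fun r hr => by
        rw [hlow r (by omega), e1 r (by omega)]
      obtain ⟨d1, d2⟩ := hD j hj
      have h100 := hA.D_ge
      have hn : votes N R a (x 13) s t (H / 2) v (P + P) j ≤ j := by
        rw [votes]; exact (Finset.card_filter_le _ _).trans (by simp)
      rw [exec_vote hA hI (hR.congr fun r hr => hlow' r (by omega)) ((hlow' 21 (by omega)).trans ha)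
        ((hlow' 25 (by omega)).trans hs) ((hlow' 26 (by omega)).trans hv)
        ((hlow 27 (by omega)).trans e27) ((hlow 28 (by omega)).trans e28) hI' h31 hj
        ((hheap rfl (D + j) (by omega)).trans ((e1 _ (by omega)).trans d1))
        d2 ha' hs' hv' hPP hHH hn]
      simp only [votes, Finset.range_add_one, Finset.filter_insert]
      split_ifs with h
      · rw [Finset.card_insert_of_notMem (by simp)]
      · simp)
  set m2 := (St.for 31 9 Algo.vote).exec N c R m1 with hm2
  have hfor : (St.for 31 9 Algo.vote).keepsBelow 30 := rfl
  have f1 : ∀ r < 30, m2 r = m1 r := fun r hr => exec_keepsBelow m1 hfor hr (by omega)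
  have hlow : ∀ r < 27, m2 r = m r := fun r hr => by
    rw [f1 r (by omega), e1 r (by omega)]
  have f27 : m2 27 = P + P := by rw [f1 27 (by omega), e27]
  have f28 : m2 28 = H / 2 := by rw [f1 28 (by omega), e28]
  have f26 : m2 26 = v := by rw [hlow 26 (by omega), hv]
  have f9 : m2 9 = draws N := by rw [hlow 9 (by omega), hR.r9']
  have hV : (votes N R a (x 13) s t (H / 2) v (P + P) (draws N) : ℤ) ≤ draws N := by
    rw [votes]; exact_mod_cast (Finset.card_filter_le _ _).trans (by simp)
  have hcond : (var 9 : Ex).eval N m2 < (var 30 + var 30 : Ex).eval N m2 ↔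
      draws N < 2 * votes N R a (x 13) s t (H / 2) v (P + P) (draws N) := by
    rw [eval_eq_val, eval_eq_val]
    · simp only [val_var, val_add, f9, key]; omega
    · simp only [bdd_add, bdd_var, key, and_self]
      exact abs_le_two_pow (hV.trans hd)
    · simp only [bdd_var, f9]; exact abs_le_two_pow hd
  rw [exec]
  by_cases h : draws N < 2 * votes N R a (x 13) s t (H / 2) v (P + P) (draws N)
  · rw [if_pos (hcond.2 h), if_pos h, St.exec_asg]
    · simp [f27, f28, f26]
    · simp only [bdd_add, Ex.bdd_div, bdd_var, bdd_lit, f26, f27, and_true]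
      exact ⟨hv', hPP⟩
  · rw [if_neg (fun h' => h (hcond.1 h')), if_neg h]
    rw [St.exec_skip]
    exact ⟨f28, f27, f26⟩

lemma exec_candidate (hA : Admissible N k D) (hI : Inputs N x) (hR : Ready N k D x m)
    {a s u : ℤ} {t : ℕ → ℤ} (hD : Drawn D (draws N) N t m)
    (ha : m 21 = a) (hs : m 25 = s) (hu : m 23 = u)
    (ha' : |a| ≤ 2 ^ (size N + 3)) (hs' : |s| ≤ 2 ^ (size N + 3))
    (hu' : |u| ≤ 2 ^ (size N + 3)) :
    Algo.candidate.exec N c R m 34 = candTau N R a u (x 13) s t := by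
  have hL := hA.size_ge
  have hb := hR.abs_le hA hI
  simp only [Algo.candidate, St.exec_seq]
  have h1 : (28 ≔ var 7 * lit 4).exec N c R ((27 ≔ lit 1).exec N c R
      ((26 ≔ lit 0).exec N c R m)) = update (update
        (update m 26 0) 27 1) 28 (2 ^ (size N + 2)) := by
    rw [St.exec_asg (d := 26), St.exec_asg (d := 27),
      St.exec_asg (d := 28)]
    · simp [hR.r7, pow_add]
    · simpa using hb 7 (by simp)
    · simp
    · simp
  rw [h1]
  set m1 := update (update (update m 26 0) 27 1) 28
    (2 ^ (size N + 2)) with hm1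
  have e1 : ∀ r, r ≠ 26 ∧ r ≠ 27 ∧ r ≠ 28 → m1 r = m r := fun r h => by
    simp [hm1, h]
  have hkb : Algo.digit.keepsBelow 26 := rfl
  have h14 : (m1 14).toNat = size N + 2 := by
    rw [e1 14 (by simp), hR.r14]; omega
  have key := St.exec_for (N := N) (c := c) (R := R) (F := loopRegs) (i := 29) (r := 14)
    (n := size N + 2) (p := Algo.digit) (m := m1) (by simp) (by simp) rfl rfl h14
    (Or.inl (by rw [wordLen]; omega))
    (fun j m' => m' 26 = expansion N R a (x 13) s t j ∧ m' 27 = 2 ^ j ∧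
      m' 28 = 2 ^ (size N + 2 - j))
    (by simp [hm1, expansion])
    (fun j m z h => by
      simpa using h)
    (by
      intro j hj m' h29 hfr hheap ⟨i26, i27, i28⟩
      have hlow : ∀ r < 26, m' r = m r := fun r hr => by
        rw [hfr r (by omega) (keeps_of_keepsBelow hr hkb),
          e1 r (by omega)]
      have h100 := hA.D_ge
      have hD' : Drawn D (draws N) N t m' := fun i hi => by
        rw [hheap rfl _ (by omega), e1 _ (by omega)]; exact hD i hi
      have hexp := expansion_bounds N R a (x 13) s t j
      have hj2 : (2 : ℤ) ^ j ≤ 2 ^ (size N + 2) := pow_le_pow_right₀ (by simp) (by omega)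
      have hj3 : (2 : ℤ) ^ (size N + 2 - j) ≤ 2 ^ (size N + 3) :=
        pow_le_pow_right₀ (by simp) (by omega)
      have hL3 : (2 : ℤ) ^ (size N + 3) = 2 * 2 ^ (size N + 2) := by ring
      obtain ⟨d1, d2, d3⟩ := exec_digit (c := c) (R := R) hA hI
        (hR.congr fun r hr => hlow r (by omega)) hD' ((hlow 21 (by omega)).trans ha)
        ((hlow 25 (by omega)).trans hs) i26 i27 i28 ha' hs'
        (by rw [abs_of_nonneg hexp.1]; linarith [hexp.2]) (by positivity) (by linarith)
        (by positivity) hj3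
      have e2 : (2 : ℤ) ^ (size N + 2 - j) / 2 = 2 ^ (size N + 2 - (j + 1)) := by
        obtain ⟨q, hq⟩ : ∃ q, size N + 2 - j = q + 1 := ⟨size N + 1 - j, by omega⟩
        have : size N + 2 - (j + 1) = q := by omega
        rw [hq, this, pow_succ]; simp
      have e3 : (2 : ℤ) ^ j + 2 ^ j = 2 ^ (j + 1) := by ring
      have e4 : ((2 : ℤ) ^ j + 2 ^ j) / 2 = 2 ^ j := by rw [e3, pow_succ]; simp
      refine ⟨?_, by rw [d2, e3], by rw [d1, e2]⟩
      rw [d3, e2, e4, e3, expansion])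
  obtain ⟨k26, k27, -⟩ := key
  set m2 := (St.for 29 14 Algo.digit).exec N c R m1 with hm2
  have hfor : (St.for 29 14 Algo.digit).keepsBelow 26 := rfl
  have f1 : ∀ r < 26, m2 r = m r := fun r hr => by
    rw [hm2, exec_keepsBelow m1 hfor hr (by omega), e1 r (by omega)]
  have hexp := expansion_bounds N R a (x 13) s t (size N + 2)
  have hL3 : (2 : ℤ) ^ (size N + 3) = 2 * 2 ^ (size N + 2) := by ring
  have hpos : (0 : ℤ) < 2 ^ (size N + 2) := by positivity
  have hNpos : (0 : ℤ) < N := mod_cast hA.N_pos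
  have h0 : m2 0 = N := by rw [f1 0 (by omega), hR.r0]
  rw [St.exec_asg (d := 33), St.exec_asg]
  · simp only [Ex.val_mod, val_mul, val_var, Ex.val_div, val_add, k26, k27, h0,
      update_self, ne_eq, Nat.reduceEqDiff, not_false_eq_true,
      update_of_ne, f1 23 (by simp), hu, candTau, roundFreq,
      show (0 : ℕ) ≠ 33 by norm_num]
    ring_nf
  · simp only [bdd_mod, bdd_mul, bdd_var, update_self, ne_eq,
      Nat.reduceEqDiff, not_false_eq_true,
      update_of_ne, f1 23 (by simp), hu, hu', Ex.val_mod, val_mul, val_var,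
      Ex.val_div, val_add, k26, k27, h0, show (0 : ℕ) ≠ 33 by norm_num, and_true]
    refine ⟨?_, abs_le_of_le hNpos.le le_rfl⟩
    refine abs_le_of_lt ⟨emod_nonneg _ hNpos.ne', emod_lt_of_pos _ hNpos⟩
  · simp only [bdd_mod, bdd_mul, bdd_var, Ex.bdd_div, bdd_add, k26, k27, h0,
      abs_of_nonneg hexp.1, abs_of_nonneg hpos.le]
    have hN3 := abs_le_of_le hNpos.le le_rfl
    have he : expansion N R a (x 13) s t (size N + 2) ≤ 2 ^ (size N + 3) := by linarith
    have hp : (2 : ℤ) ^ (size N + 2) ≤ 2 ^ (size N + 3) := by linarith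
    exact ⟨⟨⟨⟨⟨hN3, he⟩, ⟨hN3, he⟩⟩, hp⟩, ⟨hp, hp⟩⟩, hN3⟩

end

/-! ### The window length as an eighth root. -/

open St (exec_asg exec_seq exec_skip exec_for exec_load)

/-- The counter increases by one at each step until its eighth power reaches `L`. Since `L ≤ L ^ 8`,
the `L` steps suffice. -/
lemma ell_iterate (L j : ℕ) : let l := (fun l => if l ^ 8 < L then l + 1 else l)^[j] 0
    l ≤ j ∧ (L ≤ l ^ 8 ∨ l = j) ∧ (l = 0 ∨ (l - 1) ^ 8 < L) := by
  induction j with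
  | zero => simp
  | succ j ih =>
    simp only [iterate_succ_apply'] at ih ⊢
    set l := (fun l => if l ^ 8 < L then l + 1 else l)^[j] 0
    obtain ⟨h1, h2, h3⟩ := ih
    split_ifs with h
    · exact ⟨by omega, by omega, Or.inr (by simpa using h)⟩
    · exact ⟨by omega, Or.inl (by omega), h3⟩

lemma le_ell_pow (L : ℕ) : L ≤ ell L ^ 8 := by
  obtain ⟨-, h | h, -⟩ := ell_iterate L L
  · exact h
  · rw [ell, h]; exact Nat.le_self_pow (by simp) L

lemma ell_pred_pow_lt {L : ℕ} (hL : 0 < L) : (ell L - 1) ^ 8 < L := by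
  obtain ⟨-, -, h | h⟩ := ell_iterate L L
  · rw [ell, h]; simpa using hL
  · exact h

lemma ell_le (L : ℕ) : ell L ≤ L := (ell_iterate L L).1

lemma ell_pos {L : ℕ} (hL : 0 < L) : 0 < ell L := by
  by_contra h
  have h1 := le_ell_pow L
  have : ell L = 0 := by omega
  rw [this] at h1
  simp at h1
  omega

/-! ### Estimates of ambiguity values. -/

/-- Numerator of the phase in the estimate of the ambiguity function at `(τ, b τ)`. -/
def estNum (N : ℕ) (a b τ t : ℤ) : ℤ :=
  (b * τ % N * t + ((N : ℤ) + 1) / 2 * a % N * ((t - τ) * (t - τ) % N)) % N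

/-- Clamp to the interval from `- Q ^ 3` to `Q ^ 3`. -/
def clamp (Q x : ℤ) : ℤ := (x + Q * Q * Q) % (Q * Q * Q + Q * Q * Q) - Q * Q * Q

/-- Scale a sum of samples. -/
def scale (N : ℕ) (y : ℤ) : ℤ := clamp (2 ^ size N) (wrap N (y * Nat.sqrt N) / ((draws N : ℤ) * 2 ^
  size N * 2 ^ size N))

/-- Real part of the estimate at `(τ, b τ)`. -/
def estRe (N : ℕ) (R : ZMod N → ℂ) (a b τ : ℤ) (t : ℕ → ℤ) : ℤ :=
  scale N (∑ j ∈ range (draws N), termRe N R (t j) (estNum N a b τ (t j)) N)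

/-- Imaginary part of the estimate at `(τ, b τ)`. -/
def estIm (N : ℕ) (R : ZMod N → ℂ) (a b τ : ℤ) (t : ℕ → ℤ) : ℤ :=
  scale N (∑ j ∈ range (draws N), termIm N R (t j) (estNum N a b τ (t j)) N)

/-- Clamping is done by a remainder, so the bound holds for every `x`. It keeps estimates of
arbitrary signals so short that their squares can be compared exactly. -/
lemma abs_clamp_le {Q : ℤ} (hQ : 0 < Q) (x : ℤ) : |clamp Q x| ≤ Q * Q * Q := by
  have h : 0 < Q * Q * Q := by positivity
  have h1 := emod_nonneg (x + Q * Q * Q) (show Q * Q * Q + Q * Q * Q ≠ 0 by linarith)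
  have h2 := emod_lt_of_pos (x + Q * Q * Q) (show 0 < Q * Q * Q + Q * Q * Q by linarith)
  rw [clamp, abs_le]
  constructor <;> linarith

lemma abs_scale_le (N : ℕ) (y : ℤ) : |scale N y| ≤ 2 ^ (3 * size N) := by
  refine (abs_clamp_le (by positivity) _).trans (le_of_eq ?_)
  ring

section
variable {N k D c : ℕ} {R : ZMod N → ℂ} {x m : ℕ → ℤ}

lemma Admissible.draws_pos (hA : Admissible N k D) : 0 < draws N := by
  have := hA.size_ge
  have := ell_pos (L := size N) (by omega)
  rw [draws]; positivity

/-- The sum may have wrapped, but its quotient by `M Q^2`, with `Q = 2 ^ L`, is below `2 ^ (6 L)` in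
any case. Hence the additions in the clamp are exact, and the result has at most `3 L` bits. -/
lemma eval_scaled (hA : Admissible N k D) (hI : Inputs N x) (hR : Ready N k D x m) {r : ℕ} {y : ℤ}
  (hy : m r = wrap N y) : (Algo.scaled r).eval N m = scale N y := by
  have hb := hR.abs_le hA hI
  have hL := hA.size_ge
  have hwl := hA.le_wordLen
  have hQ : (0 : ℤ) < 2 ^ size N := by positivity
  have hM : (1 : ℤ) ≤ draws N := mod_cast hA.draws_pos
  have e1 : (var 9 * var 7 * var 7 : Ex).eval N m = draws N * 2 ^ size N * 2 ^ size N := by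
    rw [eval_eq_val]
    · simp [hR.r9', hR.r7]
    · simp only [bdd_mul, bdd_var]; exact ⟨⟨hb 9 (by simp), hb 7 (by simp)⟩, hb 7 (by simp)⟩
  have e2 : (var 7 * var 7 * var 7 : Ex).eval N m = 2 ^ size N * 2 ^ size N * 2 ^ size N := by
    rw [eval_eq_val]
    · simp [hR.r7]
    · simp only [bdd_mul, bdd_var]; exact ⟨⟨hb 7 (by simp), hb 7 (by simp)⟩, hb 7 (by simp)⟩
  set Q : ℤ := 2 ^ size N with hQdef
  have hq : 0 < (draws N : ℤ) * Q * Q := by positivity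
  set z := wrap N (y * Nat.sqrt N) / ((draws N : ℤ) * Q * Q) with hz
  have e3 : ((var r * var 11) / (var 9 * var 7 * var 7) : Ex).eval N m = z := by
    rw [Ex.eval_div, e1, eval_mul, eval_var, eval_var, hy, hR.r11]
    simp only [wrap_wrap, wrap_wrap_mul, wrap_mul_wrap]
    exact wrap_wrap_div (by omega) _ hq
  have hzb : |z| ≤ 2 ^ (6 * size N) := by
    obtain ⟨h1, h2⟩ := wrap_mem_Ico (N := N) (by omega) (y * Nat.sqrt N)
    have h3 : (2 : ℤ) ^ (wordLen N - 1) ≤ 2 ^ (6 * size N) * (draws N * Q * Q) := by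
      have : (2 : ℤ) ^ (wordLen N - 1) ≤ 2 ^ (6 * size N) * (Q * Q) := by
        rw [hQdef, ← pow_add, ← pow_add]
        exact pow_le_pow_right₀ (by simp) (by rw [wordLen]; omega)
      nlinarith
    rw [abs_le]
    constructor
    · rw [hz, Int.le_ediv_iff_mul_le hq]; linarith
    · exact (Int.ediv_lt_of_lt_mul hq (by linarith)).le
  have hQ3 : Q * Q * Q = 2 ^ (3 * size N) := by rw [hQdef]; ring
  have hQ6 : Q * Q * Q ≤ 2 ^ (6 * size N) := by
    rw [hQ3]; exact pow_le_pow_right₀ (by simp) (by omega)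
  have hQ3' : 0 < Q * Q * Q := by positivity
  have hw : ∀ y : ℤ, -2 ^ (6 * size N) ≤ y ∧ y ≤ 2 ^ (6 * size N) * 2 → wrap N y = y := fun y h =>
    hA.wrap_small (b := 6 * size N + 1) (by rw [pow_succ, abs_le]; constructor <;> linarith)
  have h1 := emod_nonneg (z + Q * Q * Q) (show Q * Q * Q + Q * Q * Q ≠ 0 by linarith)
  have h2 := emod_lt_of_pos (z + Q * Q * Q) (show 0 < Q * Q * Q + Q * Q * Q by linarith)
  rw [abs_le] at hzb
  rw [Algo.scaled, Ex.eval_sub, Ex.eval_mod, eval_add, e3, eval_add, e2, hw (z + _), hw (_ + _), hw (_ % _)]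
  rotate_left
  iterate 3 constructor <;> linarith
  refine hA.wrap_small (b := 3 * size N) ?_
  rw [← hQ3]
  exact abs_clamp_le hQ z

lemma exec_estimate (hA : Admissible N k D) (hI : Inputs N x) (hR : Ready N k D x m) {a b τ : ℤ} {t
  : ℕ → ℤ} (hD : Drawn (D + draws N) (draws N) N t m) (ha : m 21 = a) (hb : m 22 = b) (hτ : m 34 =
  τ) (ha' : 0 ≤ a ∧ a < N) (hb' : 0 ≤ b ∧ b < N) (hτ' : 0 ≤ τ ∧ τ < N) : Algo.estimate.exec N c R m
  35 = estRe N R a b τ t ∧ Algo.estimate.exec N c R m 36 = estIm N R a b τ t := by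
  have hL := hA.size_ge
  simp only [Algo.estimate, exec_seq]
  have h1 : (36 ≔ lit 0).exec N c R ((35 ≔ lit 0).exec N c R m) = update (update m 35 0) 36 0 := by
    simp only [exec, eval_lit, wrap_zero]
  rw [h1]
  set m1 := update (update m 35 0) 36 0 with hm1
  have e1 : ∀ r, r ≠ 35 ∧ r ≠ 36 → m1 r = m r := fun r h => by
    simp [hm1, h]
  set body : St := .load 38 (var 17 + var 37) ;;
    Algo.addTerm (var 38) Algo.estimatePhase (var 0) 35 36 with hbody
  have hkb : body.keepsBelow 35 := rfl
  have hdr := hA.draws_le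
  have key := exec_for (N := N) (c := c) (R := R) (F := []) (i := 37) (r := 9) (n := draws N) (p :=
    body) (m := m1) (by simp) (by simp) rfl rfl (by rw [e1 9 (by simp), hR.r9']; simp) (Or.inr ⟨size
    N, mod_cast hdr, by rw [wordLen]; omega⟩) (fun j m' => m' 35 = wrap N (∑ i ∈ range j, termRe N R
    (t i) (estNum N a b τ (t i)) N) ∧ m' 36 = wrap N (∑ i ∈ range j, termIm N R (t i) (estNum N a b
    τ (t i)) N)) (by simp [hm1, wrap_zero]) (fun j m z h => by
      rw [update_of_ne (by simp), update_of_ne (by simp)]; exact h)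
    (by
      intro j hj m' h37 hfr hheap ⟨i35, i36⟩
      have hlow : ∀ r < 35, m' r = m r := fun r hr => by
        rw [hfr r (by omega) (keeps_of_keepsBelow hr hkb), e1 r (by omega)]
      obtain ⟨d1, d2, d3⟩ := hD j hj
      have h100 := hA.D_ge
      have hR' : Ready N k D x m' := hR.congr fun r hr => hlow r (by omega)
      have hb1 := hR'.abs_le hA hI
      have htj : m' (D + draws N + j) = t j := by
        rw [hheap rfl _ (by omega), e1 _ (by omega), d1]
      have hld : (St.load 38 (var 17 + var 37)).exec N c R m' = update m' 38 (t j) := by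
        rw [exec_load (A := D + draws N + j)]
        · rw [htj]
        · simp only [bdd_add, bdd_var, h37]
          exact ⟨hb1 17 (by simp), abs_le_two_pow (le_trans (mod_cast hj.le) hdr)⟩
        · simp [hR'.r17, h37, draws]
        · omega
        · rw [htj]; exact hA.wrap_small (abs_le_of_lt ⟨d2, d3⟩)
      rw [hbody, exec_seq, hld]
      set m2 := update m' 38 (t j) with hm2
      have f38 : m2 38 = t j := by simp [hm2]
      have fr : ∀ r, r ≠ 38 → m2 r = m' r := fun r hr => by simp [hm2, hr]
      have big : ∀ m3 : ℕ → ℤ, (∀ r < 46, m3 r = m2 r) → Algo.estimatePhase.eval N m3 = estNum N a b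
        τ (t j) ∧ (var 0 : Ex).eval N m3 = N := by
        intro m3 h3
        have h3low : ∀ r < 35, m3 r = m r := fun r hr => by
          rw [h3 r (by omega), fr r (by omega), hlow r hr]
        have hR3 : Ready N k D x m3 := hR.congr fun r hr => h3low r (by omega)
        have hb3 := hR3.abs_le hA hI
        have c38 : m3 38 = t j := by rw [h3 38 (by omega), f38]
        have c21 : m3 21 = a := by rw [h3low 21 (by omega), ha]
        have c22 : m3 22 = b := by rw [h3low 22 (by omega), hb]
        have c34 : m3 34 = τ := by rw [h3low 34 (by omega), hτ]
        constructor
        · rw [Algo.estimatePhase, eval_eq_val]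
          · simp [hR3.r12, c21, hR3.r0, c22, c34, c38, estNum]
          · have k1 := hb3 0 (by simp)
            have k2 := hb3 12 (by simp)
            have k3 := abs_le_of_lt ha'
            have k4 := abs_le_of_lt hb'
            have k5 := abs_le_of_lt hτ'
            have k6 := abs_le_of_lt ⟨d2, d3⟩
            simp only [bdd_mod, bdd_add, bdd_sub, bdd_mul,
              bdd_var, c21, c22, c34, c38, k1, k2, k3, k4, k5, k6, and_self]
        · rw [eval_var, hR3.r0]
          exact hA.wrap_small (abs_le_of_le (by positivity) le_rfl)
      have hwi : (var 38).eval N m2 = t j := by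
        rw [eval_var, f38]; exact hA.wrap_small (abs_le_of_lt ⟨d2, d3⟩)
      obtain ⟨g1, g2⟩ := exec_addTerm (c := c) (R := R) (m := m2) (i := var 38)
        (X := Algo.estimatePhase) (Y := var 0) (re := 35) (im := 36) (by omega)
        (by omega) (by omega) hwi (fun m3 h3 => (big m3 h3).1) (fun m3 h3 => (big m3 h3).2)
      rw [g1, g2, fr 35 (by omega), fr 36 (by omega), i35, i36, Finset.sum_range_succ,
        Finset.sum_range_succ, wrap_wrap_add, wrap_wrap_add]
      exact ⟨rfl, rfl⟩)
  obtain ⟨k35, k36⟩ := key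
  set m2 := (St.for 37 9 body).exec N c R m1 with hm2
  have hfor : (St.for 37 9 body).keepsBelow 35 := rfl
  have hR2 : Ready N k D x m2 := hR.congr fun r hr => by
    rw [hm2, exec_keepsBelow m1 hfor (by omega) (by omega), e1 r (by omega)]
  have h3 : (35 ≔ Algo.scaled 35).exec N c R m2 = update m2 35 (estRe N R a b τ t) := by
    rw [exec, eval_scaled hA hI hR2 k35, estRe]
  rw [h3, exec, eval_scaled hA hI (hR2.congr fun r hr => update_of_ne (by omega) _ _)
    ((update_of_ne (by simp) _ _).trans k36)]
  constructor
  · rw [update_of_ne (by simp), update_self]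
  · rw [update_self, estIm]

lemma St.exec_loop {r n : ℕ} {p : St} (hn : (m r).toNat = n) (I : ℕ → (ℕ → ℤ) → Prop) (h0 : I 0 m)
  (hstep : ∀ j < n, ∀ m', I j m' → I (j + 1) (p.exec N c R m')) : I n ((St.loop r p).exec N c R m)
  := by
  rw [exec, hn]
  have key : ∀ j ≤ n, I j ((p.exec N c R)^[j] m) := by
    intro j
    induction j with
    | zero => intro _; exact h0
    | succ j ih =>
      intro hj
      rw [iterate_succ_apply']
      exact hstep j (by omega) _ (ih (by omega))
  exact key n le_rfl

/-! ### The Euclidean algorithm for an inverse modulo `N`. -/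

/-- Invariant of the Euclidean algorithm for the inverse of `d` modulo `N`. -/
structure Euclid (N : ℕ) (d : ℤ) (j : ℕ) (r₀ r₁ s₀ s₁ : ℤ) : Prop where
  r₁_nonneg : 0 ≤ r₁
  r₁_lt : r₁ < r₀
  r₀_le : r₀ ≤ N
  gcd_eq : Int.gcd r₀ r₁ = 1
  s₀_mem : 0 ≤ s₀ ∧ s₀ < N
  s₁_mem : 0 ≤ s₁ ∧ s₁ < N
  mod₀ : s₀ * d ≡ r₀ [ZMOD N]
  mod₁ : s₁ * d ≡ r₁ [ZMOD N]
  decay : r₀ * r₁ * 2 ^ j ≤ N * N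

/-- Since `r₁ < r₀`, the quotient is at least 1. So `r₀ ≥ r₁ + r₀ % r₁ ≥ 2 (r₀ % r₁)`, and the
product of consecutive remainders is at least halved. -/
lemma Euclid.step {d : ℤ} {j : ℕ} {r₀ r₁ s₀ s₁ : ℤ} (h : Euclid N d j r₀ r₁ s₀ s₁) (h1 : 0 < r₁) :
  Euclid N d (j + 1) r₁ (r₀ - r₀ / r₁ * r₁) s₁ ((s₀ - r₀ / r₁ * s₁) % N) := by
  have hN : (0 : ℤ) < N := by linarith [h.r₀_le, h.r₁_lt]
  have hr : r₀ - r₀ / r₁ * r₁ = r₀ % r₁ := by rw [Int.emod_def]; ring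
  have hr0 := emod_nonneg r₀ h1.ne'
  have hr1 := emod_lt_of_pos r₀ h1
  refine ⟨by rw [hr]; exact hr0, by rw [hr]; exact hr1, by linarith [h.r₀_le, h.r₁_lt], ?_,
    h.s₁_mem, ⟨emod_nonneg _ hN.ne', emod_lt_of_pos _ hN⟩, h.mod₁, ?_, ?_⟩
  · rw [hr, Int.gcd_comm, ← h.gcd_eq, Int.gcd_emod]
  · have h3 : (s₀ - r₀ / r₁ * s₁) * d ≡ r₀ - r₀ / r₁ * r₁ [ZMOD N] := by
      have := h.mod₀.sub (h.mod₁.mul_left (r₀ / r₁))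
      calc (s₀ - r₀ / r₁ * s₁) * d = s₀ * d - r₀ / r₁ * (s₁ * d) := by ring
        _ ≡ _ [ZMOD N] := this
    exact ((Int.mod_modEq _ _).mul_right d).trans h3
  · have hq : 1 ≤ r₀ / r₁ := by rw [Int.le_ediv_iff_mul_le h1]; linarith [h.r₁_lt]
    have h2 : 2 * (r₀ % r₁) ≤ r₀ := by
      nlinarith
    have h4 := h.decay
    rw [hr]
    calc r₁ * (r₀ % r₁) * 2 ^ (j + 1) = r₁ * (2 * (r₀ % r₁)) * 2 ^ j := by ring
      _ ≤ r₁ * r₀ * 2 ^ j := by gcongr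
      _ = r₀ * r₁ * 2 ^ j := by ring
      _ ≤ _ := h4

lemma exec_inverse (hA : Admissible N k D) (hI : Inputs N x) (hR : Ready N k D x m) {a b : ℤ} (ha :
  m 21 = a) (hb : m 22 = b) (ha' : 0 ≤ a ∧ a < N) (hb' : 0 ≤ b ∧ b < N) (hgcd : Int.gcd (a - b) N =
  1) : ∃ u : ℤ, Algo.inverse.exec N c R m 23 = u ∧ (0 ≤ u ∧ u < N) ∧ u * (a - b) ≡ 1 [ZMOD N] := by
  have hL := hA.size_ge
  have hbd := hR.abs_le hA hI
  have hNle := Admissible.N_le' (N := N)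
  have hN1 : (1 : ℤ) < N := by
    have : 1 < N := by
      by_contra h
      have : N = 0 ∨ N = 1 := by omega
      rcases this with rfl | rfl <;> simp at hL
    exact_mod_cast this
  have hN0 : (0 : ℤ) < N := by linarith
  simp only [Algo.inverse, exec_seq]
  have h1 : (53 ≔ lit 1).exec N c R ((52 ≔ lit 0).exec N c R ((51 ≔ (var 21 - var 22) % var 0).exec
    N c R ((50 ≔ var 0).exec N c R m))) = update (update (update (update m 50 N) 51 ((a - b) % N))
    52 0) 53 1 := by
    rw [exec_asg (d := 50), exec_asg (d := 51), exec_asg (d := 52), exec_asg (d := 53)]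
    · simp [ha, hb, hR.r0]
    · simp
    · simp
    · simp only [bdd_mod, bdd_sub, bdd_var, ne_eq, Nat.reduceEqDiff, not_false_eq_true,
        update_of_ne, ha, hb, show (0 : ℕ) ≠ 50 by norm_num]
      exact ⟨⟨abs_le_of_lt ha', abs_le_of_lt hb'⟩, hbd 0 (by simp)⟩
    · exact hbd 0 (by simp)
  rw [h1]
  set m1 := update (update (update (update m 50 (N : ℤ)) 51 ((a - b) % N)) 52 0) 53 1 with hm1
  have e1 : ∀ r < 50, m1 r = m r := fun r hr => by
    rw [hm1]; repeat rw [update_of_ne (by omega)]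
  have h15 : (m1 15).toNat = 2 * size N + 2 := by rw [e1 15 (by simp), hR.r15]; omega
  have key := St.exec_loop (N := N) (c := c) (R := R) (m := m1) (r := 15) (p := .ite (lit 0) (var
    51) (54 ≔ var 50 / var 51 ;; 55 ≔ var 50 - var 54 * var 51 ;; 50 ≔ var 51 ;; 51 ≔ var 55 ;; 55 ≔
    (var 52 - var 54 * var 53) % var 0 ;; 52 ≔ var 53 ;; 53 ≔ var 55) .skip) h15 (fun j m' => m' 0 =
    N ∧ Euclid N (a - b) j (m' 50) (m' 51) (m' 52) (m' 53)) (by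
      refine ⟨by rw [e1 0 (by simp), hR.r0], ?_⟩
      have h0 := emod_nonneg (a - b) hN0.ne'
      have hl := emod_lt_of_pos (a - b) hN0
      have e50 : m1 50 = N := by simp [hm1]
      have e51 : m1 51 = (a - b) % N := by simp [hm1]
      have e52 : m1 52 = 0 := by simp [hm1]
      have e53 : m1 53 = 1 := by simp [hm1]
      rw [e50, e51, e52, e53]
      refine ⟨h0, hl, le_rfl, ?_, ⟨le_rfl, hN0⟩, ⟨zero_le_one, hN1⟩, ?_, ?_, ?_⟩
      · rw [Int.gcd_comm, Int.gcd_emod]; exact hgcd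
      · rw [zero_mul]; exact (Int.modEq_zero_iff_dvd.2 dvd_rfl).symm
      · rw [one_mul]; exact (Int.mod_modEq _ _).symm
      · rw [pow_zero, mul_one]; nlinarith)
    (by
      intro j hj m' ⟨h0, hE⟩
      have b50 := abs_le_of_le (hE.r₁_nonneg.trans hE.r₁_lt.le) hE.r₀_le
      have b51 := abs_le_of_le hE.r₁_nonneg (hE.r₁_lt.le.trans hE.r₀_le)
      have b52 := abs_le_of_lt hE.s₀_mem
      have b53 := abs_le_of_lt hE.s₁_mem
      have b0 : |m' 0| ≤ 2 ^ (size N + 3) := by rw [h0]; exact abs_le_of_le hN0.le le_rfl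
      rw [exec]
      have hc : (lit 0 : Ex).eval N m' < (var 51 : Ex).eval N m' ↔ 0 < m' 51 := by
        rw [eval_lit, hA.wrap_small (z := 0) (b := 0) (by simp), eval_var, hA.wrap_small b51]
      by_cases hpos : 0 < m' 51
      · rw [if_pos (hc.2 hpos)]
        set q := m' 50 / m' 51 with hq
        have hE' := hE.step hpos
        have bq : |q| ≤ 2 ^ (size N + 3) := by
          refine abs_le_of_le (Int.ediv_nonneg (hE.r₁_nonneg.trans hE.r₁_lt.le) hE.r₁_nonneg) ?_
          exact (Int.ediv_le_self _ (hE.r₁_nonneg.trans hE.r₁_lt.le)).trans hE.r₀_le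
        have b2 := abs_le_of_le hE'.r₁_nonneg (hE'.r₁_lt.le.trans hE'.r₀_le)
        have b3 := abs_le_of_lt hE'.s₁_mem
        simp only [exec_seq]
        have s1 : (54 ≔ var 50 / var 51).exec N c R m' = update m' 54 q :=
          exec_asg (h := ⟨b50, b51⟩)
        have s2 : (55 ≔ var 50 - var 54 * var 51).exec N c R (update m' 54 q) = update (update m' 54
          q) 55 (m' 50 - q * m' 51) := by
          rw [exec_asg]
          · simp
          · simp [b50, b51, bq]
        rw [s1, s2]
        set m2 := update (update m' 54 q) 55 (m' 50 - q * m' 51) with hm2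
        have s3 : (51 ≔ var 55).exec N c R ((50 ≔ var 51).exec N c R m2) = update (update m2 50 (m'
          51)) 51 (m' 50 - q * m' 51) := by
          rw [exec_asg (d := 50), exec_asg]
          · simp [hm2]
          · simpa [hm2] using b2
          · simpa [hm2] using b51
        rw [s3]
        set m3 := update (update m2 50 (m' 51)) 51 (m' 50 - q * m' 51) with hm3
        have s4 : (55 ≔ (var 52 - var 54 * var 53) % var 0).exec N c R m3 = update m3 55 ((m' 52 - q
          * m' 53) % N) := by
          rw [exec_asg]
          · simp [hm3, hm2, h0]
          · simp only [bdd_sub, bdd_mul, bdd_var, bdd_mod]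
            simp only [hm3, hm2, ne_eq, Nat.reduceEqDiff, not_false_eq_true, update_of_ne,
              update_self, OfNat.zero_ne_ofNat]
            exact ⟨⟨b52, bq, b53⟩, b0⟩
        rw [s4]
        have s5 : (53 ≔ var 55).exec N c R ((52 ≔ var 53).exec N c R (update m3 55 ((m' 52 - q * m'
          53) % N))) = update (update (update m3 55 ((m' 52 - q * m' 53) % N)) 52 (m' 53)) 53 ((m'
          52 - q * m' 53) % N) := by
          rw [exec_asg (d := 52), exec_asg]
          · simp [hm3, hm2]
          · simpa using b3
          · simpa [hm3, hm2] using b53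
        rw [s5]
        refine ⟨by simp [hm3, hm2, h0], ?_⟩
        simpa [hm3, hm2] using hE'
      -- Once the remainder is 0 the loop idles. The decay condition then holds trivially, because
      -- the product is 0.
      · rw [if_neg (fun h => hpos (hc.1 h)), exec_skip]
        have h51 : m' 51 = 0 := le_antisymm (not_lt.1 hpos) hE.r₁_nonneg
        exact ⟨h0, hE.r₁_nonneg, hE.r₁_lt, hE.r₀_le, hE.gcd_eq, hE.s₀_mem, hE.s₁_mem, hE.mod₀,
          hE.mod₁, by rw [h51, mul_zero, zero_mul]; positivity⟩)
  obtain ⟨-, hE⟩ := key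
  set m2 := (St.loop 15 (.ite (lit 0) (var 51) (54 ≔ var 50 / var 51 ;; 55 ≔ var 50 - var 54 * var
    51 ;; 50 ≔ var 51 ;; 51 ≔ var 55 ;; 55 ≔ (var 52 - var 54 * var 53) % var 0 ;; 52 ≔ var 53 ;; 53
    ≔ var 55) .skip)).exec N c R m1
  refine ⟨m2 52, ?_, hE.s₀_mem, ?_⟩
  · rw [exec_asg]
    · simp
    · exact abs_le_of_lt hE.s₀_mem
  · have h51 : m2 51 = 0 := by
      by_contra hne
      have hpos : 1 ≤ m2 51 := by have := hE.r₁_nonneg; omega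
      have h50 : 1 ≤ m2 50 := by have := hE.r₁_lt; omega
      -- After `2 L + 2` turns a product `r₀ r₁ ≥ 1` would contradict the decay, as `N^2 < 2 ^ (2
      -- L)`.
      have hNN : (N : ℤ) * N < 2 ^ (2 * size N + 2) := by
        have : (2 : ℤ) ^ (2 * size N + 2) = 4 * (2 ^ size N * 2 ^ size N) := by ring
        nlinarith
      have h2 := hE.decay
      nlinarith [mul_nonneg (sub_nonneg.2 hpos) (sub_nonneg.2 h50)]
    have h50 : m2 50 = 1 := by
      have := hE.gcd_eq
      rw [h51, Int.gcd_zero_right] at this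
      have h0 : 0 < m2 50 := by have := hE.r₁_lt; have := hE.r₁_nonneg; omega
      omega
    have := hE.mod₀
    rwa [h50] at this

end

/-! ### Collecting the peaks without repetition. -/

/-- The list at address `B` holds `cnt` peaks, found from the first `n` of the candidates `τ` with
estimates `e`. -/
structure PeakList (N k B : ℕ) (μ b : ℤ) (τ e₁ e₂ : ℕ → ℤ) (n cnt : ℕ) (m : ℕ → ℤ) : Prop where
  cnt_le : cnt ≤ k
  entry : ∀ i < cnt, ∃ s < n, (μ + 1) * (μ + 1) < e₁ s * e₁ s + e₂ s * e₂ s + 1 ∧ m (B + 1 + 4 * i)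
    = τ s ∧ m (B + 2 + 4 * i) = b * τ s % N ∧ m (B + 3 + 4 * i) = e₁ s ∧ m (B + 4 + 4 * i) = e₂ s
  distinct : ∀ i < cnt, ∀ j < i, m (B + 1 + 4 * i) ≠ m (B + 1 + 4 * j)
  complete : ∀ s < n, (μ + 1) * (μ + 1) < e₁ s * e₁ s + e₂ s * e₂ s + 1 →
    cnt = k ∨ ∃ i < cnt, m (B + 1 + 4 * i) = τ s

section
variable {N k D c B : ℕ} {R : ZMod N → ℂ} {x m : ℕ → ℤ}

lemma PeakList.congr {μ b : ℤ} {τ e₁ e₂ : ℕ → ℤ} {n cnt : ℕ} (h : PeakList N k B μ b τ e₁ e₂ n cnt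
  m) {m' : ℕ → ℤ} (hm : ∀ A, B + 1 ≤ A → A ≤ B + 4 * k → m' A = m A) : PeakList N k B μ b τ e₁ e₂ n
  cnt m' := by
  have hc := h.cnt_le
  refine ⟨h.cnt_le, fun i hi => ?_, fun i hi j hj => ?_, fun s hs hT => ?_⟩
  · simp (disch := omega) only [hm]
    exact h.entry i hi
  · rw [hm _ (by omega) (by omega), hm _ (by omega) (by omega)]
    exact h.distinct i hi j hj
  · rcases h.complete s hs hT with h | ⟨i, hi, h'⟩
    · exact Or.inl h
    · exact Or.inr ⟨i, hi, by rw [hm _ (by omega) (by omega), h']⟩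

lemma St.exec_store {e f : Ex} {A : ℕ} (b : ℕ := size N + 3) (hb : e.bits b + 2 ≤ wordLen N := by
  simp [wordLen]; omega) (hfb : f.bits b + 2 ≤ wordLen N := by simp [wordLen]; omega) (h : e.Bdd b
  m) (hA : e.val m = A) (hA' : 100 ≤ A) (hc : A < c) (hf : f.Bdd b m) : (St.store e f).exec N c R m
  = update m A (f.val m) := by
  rw [exec, (eval_eq h hb).1, (eval_eq hf hfb).1, hA, if_neg (by omega)]
  simp

/-- The only test is `<`, so equality of integers is tested as `(x - y)^2 < 1`. Loop counts come
from fixed registers, so the loop runs `k` times and skips the turns from `cnt` on. -/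
lemma exec_lookup (hA : Admissible N k D) (hR : Ready N k D x m)
    (hB : 100 ≤ B) (hBs : B + 4 * k + 4 ≤ size N) {cnt : ℕ} {τ : ℤ}
    (hcnt : cnt ≤ k) (h24 : m 24 = cnt) (h34 : m 34 = τ) (hτ : 0 ≤ τ ∧ τ < N)
    (hm : ∀ i < cnt, 0 ≤ m (B + 1 + 4 * i) ∧ m (B + 1 + 4 * i) < N) :
    (Algo.lookup B).exec N c R m 42 =
      if ∃ i < cnt, m (B + 1 + 4 * i) = τ then 1 else 0 := by
  have hw1 : wrap N 1 = 1 := hA.wrap_small (b := 0) (by simp)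
  simp only [Algo.lookup, exec_seq]
  have h1 : (42 ≔ lit 0).exec N c R m = update m 42 0 := by
    simp only [exec, eval_lit, wrap_zero]
  rw [h1]
  set m1 := update m 42 0 with hm1
  have e1 : ∀ r, r ≠ 42 → m1 r = m r := fun r h => by simp [hm1, h]
  classical
  have key := exec_for (N := N) (c := c) (R := R) (F := []) (i := 39) (r := 2) (n := k)
    (p := .ite (var 39) (var 24)
      (.load 43 (lit (B + 1 : ℕ) + lit 4 * var 39) ;;
        .ite ((var 43 - var 34) * (var 43 - var 34)) (lit 1) (42 ≔ lit 1) .skip) .skip) (m := m1)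
    (by simp) (by simp) rfl rfl
    (by rw [e1 2 (by simp), hR.r2]; simp) (Or.inl (by rw [wordLen]; omega))
    (fun j m' => m' 42 = if ∃ i < cnt, i < j ∧ m (B + 1 + 4 * i) = τ then 1 else 0)
    (by simp [hm1]) (fun j m z h => by rw [update_of_ne (by simp)]; exact h)
    (by
      intro j hj m' h39 hfr hheap hI'
      have f24 : m' 24 = cnt := by
        rw [hfr 24 (by simp) rfl, e1 24 (by simp), h24]
      have f34 : m' 34 = τ := by
        rw [hfr 34 (by simp) rfl, e1 34 (by simp), h34]
      have b39 : |m' 39| ≤ 2 ^ (size N + 3) := by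
        rw [h39]; exact hA.abs_le hj.le
      have b24 : |m' 24| ≤ 2 ^ (size N + 3) := by
        rw [f24]; exact hA.abs_le hcnt
      have hc : (var 39 : Ex).eval N m' < (var 24 : Ex).eval N m' ↔ j < cnt := by
        rw [eval_var, eval_var, hA.wrap_small b39, hA.wrap_small b24,
          h39, f24]
        exact Nat.cast_lt
      rw [exec]
      by_cases hjc : j < cnt
      · rw [if_pos (hc.2 hjc), exec_seq]
        have hh : m' (B + 1 + 4 * j) = m (B + 1 + 4 * j) := by
          rw [hheap rfl _ (by omega), e1 _ (by omega)]
        rw [exec_load (A := B + 1 + 4 * j)]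
        · rw [hh]
          set m2 := update m' 43 (m (B + 1 + 4 * j)) with hm2
          have g43 : m2 43 = m (B + 1 + 4 * j) := by simp [hm2]
          have g34 : m2 34 = τ := by simp [hm2, f34]
          have g42 : m2 42 = m' 42 := by simp [hm2]
          have hc2 : ((var 43 - var 34) * (var 43 - var 34) : Ex).eval N m2 <
              (lit 1 : Ex).eval N m2 ↔ m (B + 1 + 4 * j) = τ := by
            rw [eval_eq_val, eval_lit, hw1]
            · simp only [val_mul, Ex.val_sub, val_var, g43, g34]
              constructor
              · intro h; nlinarith [sq_nonneg (m (B + 1 + 4 * j) - τ)]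
              · intro h; rw [h]; simp
            · simp only [bdd_mul, bdd_sub, bdd_var, g43, g34, and_self]
              exact ⟨abs_le_of_lt (hm j hjc), abs_le_of_lt hτ⟩
          rw [exec]
          by_cases heq : m (B + 1 + 4 * j) = τ
          · rw [if_pos (hc2.2 heq), exec, update_self, eval_lit, hw1,
              if_pos ⟨j, hjc, by omega, heq⟩]
          · rw [if_neg (fun h => heq (hc2.1 h)), exec_skip, g42, hI']
            exact if_congr (by grind) rfl rfl
        · simp only [bdd_add, bdd_mul, bdd_lit, bdd_var, true_and]; exact b39
        · simp [h39]
        · omega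
        · rw [hh]; exact hA.wrap_small (abs_le_of_lt (hm j hjc))
      · rw [if_neg (fun h => hjc (hc.1 h)), exec_skip, hI']
        exact if_congr (by grind) rfl rfl)
  exact key.trans (if_congr (by grind) rfl rfl)

lemma exec_append (hA : Admissible N k D) (hR : Ready N k D x m) (hB : 100 ≤ B) (hBD : B + 4 * k + 4
  ≤ D) (hDc : D ≤ c) (hBs : B + 4 * k + 4 ≤ size N) {cnt : ℕ} {b τ e₁ e₂ : ℤ} (hcnt : cnt < k) (h24
  : m 24 = cnt) (h22 : m 22 = b) (h34 : m 34 = τ) (h35 : m 35 = e₁) (h36 : m 36 = e₂) (hb : 0 ≤ b ∧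
  b < N) (hτ : 0 ≤ τ ∧ τ < N) (he₁ : |e₁| ≤ 2 ^ (3 * size N)) (he₂ : |e₂| ≤ 2 ^ (3 * size N)) :
  (Algo.append B).exec N c R m = update (update (update (update (update m (B + 1 + 4 * cnt) τ) (B +
  2 + 4 * cnt) (b * τ % N)) (B + 3 + 4 * cnt) e₁) (B + 4 + 4 * cnt) e₂) 24 ((cnt : ℤ) + 1) := by
  have hsm : ∀ z : ℤ, 0 ≤ z → z ≤ N → |z| ≤ 2 ^ (3 * size N) := fun z h0 h1 =>
    (abs_le_of_le h0 h1).trans (pow_le_pow_right₀ (by simp) (by omega))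
  have b24 : |(cnt : ℤ)| ≤ 2 ^ (3 * size N) :=
    (hA.abs_le hcnt.le).trans (pow_le_pow_right₀ (by simp) (by omega))
  have hst : ∀ (m' : ℕ → ℤ) (i : ℕ) (f : Ex) (v : ℤ), (∀ r < 60, m' r = m r) → i < 5 → f.Bdd (3 *
    size N) m' → f.bits (3 * size N) + 2 ≤ wordLen N → f.val m' = v → (St.store (lit (B + i : ℕ) +
    lit 4 * var 24) f).exec N c R m' = update m' (B + i + 4 * cnt) v ∧ ∀ r < 60, update m' (B + i +
    4 * cnt) v r = m r := by
    intro m' i f v h hi hf hfb hv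
    refine ⟨?_, fun r hr => by rw [update_of_ne (by omega), h r hr]⟩
    rw [← hv]
    exact St.exec_store (3 * size N) (by simp [wordLen]; omega) hfb (by simpa [h, h24] using b24)
      (by simp [h, h24]) (by omega) (by omega) hf
  obtain ⟨h1, e1⟩ := hst m 1 (var 34) τ (fun _ _ => rfl) (by simp)
    (by simpa [h34] using hsm _ hτ.1 hτ.2.le) (by simp [wordLen]; omega) h34
  obtain ⟨h2, e2⟩ := hst _ 2 (var 22 * var 34 % var 0) (b * τ % N) e1 (by simp) (by
      simp only [bdd_var, bdd_mod, bdd_mul, e1 22 (by simp), e1 34 (by simp), e1 0 (by simp), h22,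
        h34, hR.r0]
      exact ⟨⟨hsm _ hb.1 hb.2.le, hsm _ hτ.1 hτ.2.le⟩, hsm _ (by positivity) le_rfl⟩)
    (by simp [wordLen]; omega)
    (by simp [e1 22 (by simp), e1 34 (by simp), e1 0 (by simp), h22, h34, hR.r0])
  obtain ⟨h3, e3⟩ := hst _ 3 (var 35) e₁ e2 (by simp) (by simpa only [bdd_var, e2 35 (by simp),
    h35]) (by simp [wordLen]; omega) (by rw [val_var, e2 35 (by simp), h35])
  obtain ⟨h4, e4⟩ := hst _ 4 (var 36) e₂ e3 (by simp) (by simpa only [bdd_var, e3 36 (by simp),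
    h36]) (by simp [wordLen]; omega) (by rw [val_var, e3 36 (by simp), h36])
  simp only [Algo.append, exec_seq, h1, h2, h3, h4]
  rw [exec_asg (b := 3 * size N)]
  · rw [val_add, val_var, e4 24 (by simp), h24]; rfl
  · simpa only [bdd_add, bdd_var, bdd_lit, e4 24 (by simp), h24, and_true]

/-- Four cases: the estimate is too small, the list is full, the point is already listed, or it is
appended. Since repetitions are dropped, a full list contains `k` different points, which is
decisive for completeness later on. -/
lemma exec_record (hA : Admissible N k D) (hI : Inputs N x) (hR : Ready N k D x m) (hB : 100 ≤ B)
  (hBD : B + 4 * k + 4 ≤ D) (hDc : D ≤ c) (hBs : B + 4 * k + 4 ≤ size N) {cnt n : ℕ} {b : ℤ} {τ e₁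
  e₂ : ℕ → ℤ} (h24 : m 24 = cnt) (h22 : m 22 = b) (h34 : m 34 = τ n) (h35 : m 35 = e₁ n) (h36 : m 36
  = e₂ n) (hb : 0 ≤ b ∧ b < N) (hτ : ∀ s, 0 ≤ τ s ∧ τ s < N) (he₁ : ∀ s, |e₁ s| ≤ 2 ^ (3 * size N))
  (he₂ : ∀ s, |e₂ s| ≤ 2 ^ (3 * size N)) (hP : PeakList N k B (x 3) b τ e₁ e₂ n cnt m) : ∃ cnt' : ℕ,
  (Algo.record B).exec N c R m 24 = cnt' ∧ PeakList N k B (x 3) b τ e₁ e₂ (n + 1) cnt' ((Algo.record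
  B).exec N c R m) ∧ ∀ A, 100 ≤ A → (A < B ∨ B + 4 * k < A) → (Algo.record B).exec N c R m A = m A
  := by
  have hcnt := hP.cnt_le
  have hw1 : wrap N 1 = 1 := hA.wrap_small (b := 0) (by simp)
  have b3 : |x 3| ≤ 2 ^ (3 * size N) := by rw [abs_of_nonneg hI.r3.1]; exact hI.r3.2
  have hc1 : ((var 3 + lit 1) * (var 3 + lit 1) : Ex).eval N m < (var 35 * var 35 + var 36 * var 36
    + lit 1 : Ex).eval N m ↔ (x 3 + 1) * (x 3 + 1) < e₁ n * e₁ n + e₂ n * e₂ n + 1 := by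
    rw [eval_eq_val (b := 3 * size N), eval_eq_val (b := 3 * size N)]
    · simp [hR.r3, h35, h36]
    · simp only [bdd_add, bdd_mul, bdd_var, bdd_lit, h35, h36, and_true, and_self]
      exact ⟨he₁ n, he₂ n⟩
    · simp only [bdd_add, bdd_mul, bdd_var, bdd_lit, hR.r3, and_true, and_self]
      exact b3
  have hsucc : ∀ m' : ℕ → ℤ, (∀ A, B + 1 ≤ A → A ≤ B + 4 * k → m' A = m A) → ((x 3 + 1) * (x 3 + 1)
    < e₁ n * e₁ n + e₂ n * e₂ n + 1 → cnt = k ∨ ∃ i < cnt, m (B + 1 + 4 * i) = τ n) → PeakList N k B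
    (x 3) b τ e₁ e₂ (n + 1) cnt m' := by
    intro m' hm' hn
    refine PeakList.congr ⟨hP.cnt_le, fun i hi => ?_, hP.distinct, fun s hs hT => ?_⟩ hm'
    · obtain ⟨s, hs, h⟩ := hP.entry i hi
      exact ⟨s, by omega, h⟩
    · rcases lt_succ_iff_lt_or_eq.1 hs with h | rfl
      · exact hP.complete s h hT
      · exact hn hT
  rw [Algo.record, exec]
  by_cases hT : (x 3 + 1) * (x 3 + 1) < e₁ n * e₁ n + e₂ n * e₂ n + 1
  swap
  · rw [if_neg (fun h => hT (hc1.1 h)), exec_skip]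
    exact ⟨cnt, h24, hsucc m (fun _ _ _ => rfl) (fun h => absurd h hT), fun _ _ _ => rfl⟩
  rw [if_pos (hc1.2 hT), exec]
  have hc2 : (var 24 : Ex).eval N m < (var 2 : Ex).eval N m ↔ cnt < k := by
    rw [eval_var, eval_var, h24, hR.r2, hA.wrap_small (hA.abs_le le_rfl), hA.wrap_small (hA.abs_le hcnt)]
    exact Nat.cast_lt
  by_cases hck : cnt < k
  swap
  · rw [if_neg (fun h => hck (hc2.1 h)), exec_skip]
    exact ⟨cnt, h24, hsucc m (fun _ _ _ => rfl) (fun _ => Or.inl (by omega)), fun _ _ _ => rfl⟩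
  rw [if_pos (hc2.2 hck), exec_seq]
  have hent : ∀ i < cnt, 0 ≤ m (B + 1 + 4 * i) ∧ m (B + 1 + 4 * i) < N := fun i hi => by
    obtain ⟨s, -, -, h, -⟩ := hP.entry i hi
    rw [h]; exact hτ s
  classical
  have hlk := exec_lookup (c := c) (R := R) hA hR hB hBs hcnt h24 h34 (hτ n) hent
  set m1 := (Algo.lookup B).exec N c R m with hm1
  have f1 : ∀ r < 39, m1 r = m r := fun r hr =>
    exec_keepsBelow (st := Algo.lookup B) (j := 39) m rfl hr (by omega)
  have f2 : ∀ A, 100 ≤ A → m1 A = m A := fun A hA' =>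
    St.exec_noStore (F := [2]) hA' m (st := Algo.lookup B) rfl rfl
  have hc3 : (var 42 : Ex).eval N m1 < (lit 1 : Ex).eval N m1 ↔ ¬ ∃ i < cnt, m (B + 1 + 4 * i) = τ n
    := by
    rw [eval_var, eval_lit, hw1, hlk]
    split_ifs with h
    · rw [hw1]; simp [h]
    · rw [hA.wrap_small (b := 0) (z := 0) (by simp)]; simp [h]
  rw [exec]
  by_cases hex : ∃ i < cnt, m (B + 1 + 4 * i) = τ n
  · rw [if_neg (fun h => hc3.1 h hex), exec_skip]
    exact ⟨cnt, (f1 24 (by simp)).trans h24, hsucc m1 (fun A h _ => f2 A (by omega))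
      (fun _ => Or.inr hex), fun A h _ => f2 A h⟩
  · rw [if_pos (hc3.2 hex)]
    have hR1 : Ready N k D x m1 := hR.congr fun r hr => f1 r (by omega)
    rw [exec_append hA hR1 hB hBD hDc hBs hck ((f1 24 (by simp)).trans h24) ((f1 22 (by simp)).trans
      h22) ((f1 34 (by simp)).trans h34) ((f1 35 (by simp)).trans h35) ((f1 36 (by simp)).trans h36)
      hb (hτ n) (he₁ n) (he₂ n)]
    set m2 := update (update (update (update (update m1 (B + 1 + 4 * cnt) (τ n)) (B + 2 + 4 * cnt)
      (b * τ n % N)) (B + 3 + 4 * cnt) (e₁ n)) (B + 4 + 4 * cnt) (e₂ n)) 24 ((cnt : ℤ) + 1) with hm2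
    have g0 : ∀ A, 100 ≤ A → (A < B + 1 + 4 * cnt ∨ B + 4 + 4 * cnt < A) → m2 A = m A := by
      intro A h1 h2
      simp (disch := omega) only [hm2, update_of_ne, f2]
    have g : m2 (B + 1 + 4 * cnt) = τ n ∧ m2 (B + 2 + 4 * cnt) = b * τ n % N ∧ m2 (B + 3 + 4 * cnt)
      = e₁ n ∧ m2 (B + 4 + 4 * cnt) = e₂ n := by
      simp (disch := omega) [hm2, update_of_ne]
    refine ⟨cnt + 1, by simp [hm2], ⟨by omega, ?_, ?_, ?_⟩, fun A h1 h2 => g0 A h1 (by omega)⟩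
    · intro i hi
      rcases lt_succ_iff_lt_or_eq.1 hi with h | rfl
      · obtain ⟨s, hs, h1, h2, h3, h4, h5⟩ := hP.entry i h
        refine ⟨s, by omega, h1, ?_⟩
        simp (disch := omega) only [g0]
        exact ⟨h2, h3, h4, h5⟩
      · exact ⟨n, by omega, hT, g⟩
    · intro i hi j hj
      rcases lt_succ_iff_lt_or_eq.1 hi with h | rfl
      · rw [g0 _ (by omega) (by omega), g0 _ (by omega) (by omega)]
        exact hP.distinct i h j hj
      · rw [g.1, g0 _ (by omega) (by omega)]
        exact fun h => hex ⟨j, hj, h.symm⟩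
    · intro s hs hTs
      rcases lt_succ_iff_lt_or_eq.1 hs with h | rfl
      · rcases hP.complete s h hTs with h' | ⟨i, hi, h'⟩
        · omega
        · exact Or.inr ⟨i, by omega, by rw [g0 _ (by omega) (by omega), h']⟩
      · exact Or.inr ⟨cnt, by omega, g.1⟩

/-- What the search for peaks leaves behind. -/
structure PeaksFound (N k B : ℕ) (R : ZMod N → ℂ) (μ a b u bd : ℤ) (t t' : ℕ → ℤ) (cnt : ℕ)
    (m : ℕ → ℤ) : Prop where
  count : m B = cnt
  list : PeakList N k B μ b (fun s => candTau N R a u bd s t) (fun s => estRe N R a b (candTau N R a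
    u bd s t) t') (fun s => estIm N R a b (candTau N R a u bd s t) t') (ell (size N) * ell (size N))
    cnt m

lemma PeaksFound.congr {μ a b u bd : ℤ} {t t' : ℕ → ℤ} {cnt : ℕ} (h : PeaksFound N k B R μ a b u bd
  t t' cnt m) {m' : ℕ → ℤ} (hm : ∀ A, B ≤ A → A ≤ B + 4 * k → m' A = m A) : PeaksFound N k B R μ a b
  u bd t t' cnt m' := ⟨by rw [hm _ le_rfl (by omega), h.count], h.list.congr fun A h1 h2 => hm A (by
  omega) h2⟩

lemma exec_peaks (hA : Admissible N k D) (hI : Inputs N x) (hR : Ready N k D x m)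
    (hB : 100 ≤ B) (hBD : B + 4 * k + 4 ≤ D) (hDc : D ≤ c) (hBs : B + 4 * k + 4 ≤ size N)
    {ra rb rc : ℕ} (hra : ra ∈ [4, 5, 6]) (hrb : rb ∈ [4, 5, 6]) (hrc : rc ∈ [18, 19, 20])
    (hgcd : Int.gcd (x ra - x rb) N = 1) {t t' : ℕ → ℤ} (hD : Drawn D (draws N) N t m)
    (hD' : Drawn (D + draws N) (draws N) N t' m) :
    ∃ u : ℤ, ∃ cnt : ℕ, u * (x ra - x rb) ≡ 1 [ZMOD N] ∧
      (Algo.peaks ra rb rc B).exec N c R m rc = cnt ∧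
      PeaksFound N k B R (x 3) (x ra) (x rb) u (x 13) t t' cnt
        ((Algo.peaks ra rb rc B).exec N c R m) ∧
      ∀ A, 100 ≤ A → (A < B ∨ B + 4 * k < A) →
        (Algo.peaks ra rb rc B).exec N c R m A = m A := by
  have hin : ∀ r ∈ [4, 5, 6], m r = x r ∧ 0 ≤ x r ∧ x r < N := by
    intro r hr
    simp only [List.mem_cons, List.not_mem_nil, or_false] at hr
    rcases hr with rfl | rfl | rfl
    · exact ⟨hR.r4, hI.r4⟩
    · exact ⟨hR.r5, hI.r5⟩
    · exact ⟨hR.r6, hI.r6⟩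
  obtain ⟨ea, ha⟩ := hin ra hra
  obtain ⟨eb, hb⟩ := hin rb hrb
  have hrb' : rb < 18 := by
    simp only [List.mem_cons, List.not_mem_nil, or_false] at hrb; omega
  have hrc' : 18 ≤ rc ∧ rc < 21 := by
    simp only [List.mem_cons, List.not_mem_nil, or_false] at hrc; omega
  simp only [Algo.peaks, exec_seq]
  have h1 : (22 ≔ var rb).exec N c R ((21 ≔ var ra).exec N c R m) =
      update (update m 21 (x ra)) 22 (x rb) := by
    have hrb21 : rb ≠ 21 := by omega
    rw [exec_asg (d := 21), exec_asg]
    · simp [ea, eb, hrb21]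
    · simp only [bdd_var, update_of_ne hrb21, eb]; exact abs_le_of_lt hb
    · simp only [bdd_var, ea]; exact abs_le_of_lt ha
  rw [h1]
  set m1 := update (update m 21 (x ra)) 22 (x rb) with hm1
  have e1 : ∀ r, r ≠ 21 ∧ r ≠ 22 → m1 r = m r := fun r h => by
    simp [hm1, h]
  have e21 : m1 21 = x ra := by simp [hm1]
  have e22 : m1 22 = x rb := by simp [hm1]
  have hR1 : Ready N k D x m1 := hR.congr fun r hr => e1 r (by omega)
  obtain ⟨u, hu, hu0, hu1⟩ := exec_inverse (c := c) (R := R) hA hI hR1 e21 e22 ha hb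
    hgcd
  set m2 := Algo.inverse.exec N c R m1 with hm2
  have f1 : ∀ r < 23, m2 r = m1 r := fun r hr =>
    exec_keepsBelow (st := Algo.inverse) (j := 23) m1 rfl hr (by omega)
  have f2 : ∀ A, 100 ≤ A → m2 A = m A := fun A hA' => by
    rw [hm2, St.exec_noStore (F := [15]) hA' m1 (st := Algo.inverse) rfl rfl,
      e1 A (by omega)]
  have h3 : (24 ≔ lit 0).exec N c R m2 = update m2 24 0 := by
    simp only [exec, eval_lit, wrap_zero]
  rw [h3]
  set m3 := update m2 24 0 with hm3
  have g1 : ∀ r, r ≠ 24 → m3 r = m2 r := fun r h => by simp [hm3, h]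
  have hR3 : Ready N k D x m3 := hR1.congr fun r hr => by rw [g1 r (by omega), f1 r (by omega)]
  set τ : ℕ → ℤ := fun s => candTau N R (x ra) u (x 13) s t with hτ
  set E₁ : ℕ → ℤ := fun s => estRe N R (x ra) (x rb) (τ s) t' with hE₁
  set E₂ : ℕ → ℤ := fun s => estIm N R (x ra) (x rb) (τ s) t' with hE₂
  have hNpos : (0 : ℤ) < N := mod_cast hA.N_pos
  have hτb : ∀ s, 0 ≤ τ s ∧ τ s < N := fun s =>
    ⟨emod_nonneg _ hNpos.ne', emod_lt_of_pos _ hNpos⟩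
  set body : St := Algo.candidate ;; Algo.estimate ;; Algo.record B with hbody
  have hkb : body.keepsBelow 24 := rfl
  have hWW : (ell (size N) * ell (size N) : ℕ) ≤ 2 ^ size N := by
    have h1 := hA.ell_le
    have h0 := ell_pos (L := size N) (by omega)
    have : ell (size N) ^ 2 ≤ ell (size N) ^ 8 := Nat.pow_le_pow_right h0 (by simp)
    rw [sq] at this
    exact this.trans h1
  have key := exec_for (N := N) (c := c) (R := R) (F := loopRegs) (i := 25) (r := 10)
    (n := ell (size N) * ell (size N)) (p := body) (m := m3) (by simp) (by simp)
    rfl rfl (by rw [hR3.r10]; norm_cast) (Or.inr ⟨size N, hWW, by rw [wordLen]; omega⟩)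
    (fun j m' => (∃ cnt : ℕ, m' 24 = cnt ∧ PeakList N k B (x 3) (x rb) τ E₁ E₂ j cnt m') ∧
      ∀ A, 100 ≤ A → (A < B ∨ B + 4 * k < A) → m' A = m A)
    (by
      refine ⟨⟨0, by simp [hm3], ⟨by omega, by simp, by simp, by simp⟩⟩, fun A h1 h2 => ?_⟩
      rw [update_of_ne (by omega), g1 A (by omega), f2 A h1])
    (by
      rintro j m' z ⟨⟨cnt, h1, h2⟩, h3⟩
      refine ⟨⟨cnt, by rw [update_of_ne (by simp), h1],
        h2.congr fun A h _ => update_of_ne (by omega) _ _⟩, fun A h4 h5 => ?_⟩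
      rw [update_of_ne (by omega), h3 A h4 h5])
    (by
      rintro j hj m' h25 hfr - ⟨⟨cnt, i24, iP⟩, iH⟩
      have hlow : ∀ r < 24, m' r = m2 r := fun r hr => by
        rw [hfr r (by omega) (keeps_of_keepsBelow hr hkb), g1 r (by omega)]
      have hlow' : ∀ r < 18, m' r = m r := fun r hr => by
        rw [hlow r (by omega), f1 r (by omega), e1 r (by omega)]
      have hR' : Ready N k D x m' := hR.congr hlow'
      have j21 : m' 21 = x ra := by rw [hlow 21 (by omega), f1 21 (by omega), e21]
      have j22 : m' 22 = x rb := by rw [hlow 22 (by omega), f1 22 (by omega), e22]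
      have j23 : m' 23 = u := by rw [hlow 23 (by omega), hu]
      have hDm : Drawn D (draws N) N t m' := fun i hi => by
        rw [iH _ (by omega) (by omega)]; exact hD i hi
      have hDm' : Drawn (D + draws N) (draws N) N t' m' := fun i hi => by
        rw [iH _ (by omega) (by omega)]; exact hD' i hi
      have hsb : |(j : ℤ)| ≤ 2 ^ (size N + 3) :=
        abs_le_two_pow (mod_cast hj.le.trans hWW)
      have hcand := exec_candidate (c := c) (R := R) hA hI hR' hDm j21 h25 j23 (abs_le_of_lt ha) hsb
        (abs_le_of_lt hu0)
      rw [hbody, exec_seq, exec_seq]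
      set m4 := Algo.candidate.exec N c R m' with hm4
      have k1 : ∀ r < 26, m4 r = m' r := fun r hr =>
        exec_keepsBelow (st := Algo.candidate) (j := 26) m' rfl hr (by omega)
      have k2 : ∀ A, 100 ≤ A → m4 A = m' A := fun A hA' =>
        St.exec_noStore (F := loopRegs) hA' m' (st := Algo.candidate) rfl rfl
      have hR4 : Ready N k D x m4 := hR'.congr fun r hr => k1 r (by omega)
      obtain ⟨est1, est2⟩ := exec_estimate (c := c) (R := R) hA hI hR4
        (fun i hi => by rw [k2 _ (by have := hA.D_ge; omega)]; exact hDm' i hi)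
        ((k1 21 (by omega)).trans j21) ((k1 22 (by omega)).trans j22) hcand ha hb
        (hτb j)
      set m5 := Algo.estimate.exec N c R m4 with hm5
      have l1 : ∀ r < 35, m5 r = m4 r := fun r hr =>
        exec_keepsBelow (st := Algo.estimate) (j := 35) m4 rfl hr (by omega)
      have l2 : ∀ A, 100 ≤ A → m5 A = m' A := fun A hA' => by
        rw [hm5, St.exec_noStore (F := loopRegs) hA' m4 (st := Algo.estimate) rfl rfl, k2 A hA']
      have hR5 : Ready N k D x m5 := hR4.congr fun r hr => l1 r (by omega)
      obtain ⟨cnt', r1, r2, r3⟩ := exec_record (c := c) (R := R) (n := j) (τ := τ) (e₁ := E₁)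
        (e₂ := E₂) hA hI hR5 hB hBD hDc hBs
        ((l1 24 (by omega)).trans ((k1 24 (by omega)).trans i24))
        ((l1 22 (by omega)).trans ((k1 22 (by omega)).trans j22))
        ((l1 34 (by omega)).trans hcand) est1 est2 hb hτb (fun s => abs_scale_le _ _)
        (fun s => abs_scale_le _ _) (iP.congr fun A h _ => l2 A (by omega))
      exact ⟨⟨cnt', r1, r2⟩, fun A h4 h5 => by rw [r3 A h4 h5, l2 A h4, iH A h4 h5]⟩)
  obtain ⟨⟨cnt, k24, kP⟩, kH⟩ := key
  set m4 := (St.for 25 10 body).exec N c R m3 with hm4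
  have hcb := hA.abs_le kP.cnt_le
  have hst : (St.store (lit B) (var 24)).exec N c R m4 = update m4 B (cnt : ℤ) := by
    rw [St.exec_store (A := B) (h := by simp) (hA := by simp) (hA' := hB) (hc := by omega)]
    · rw [val_var, k24]
    · simp only [bdd_var, k24]; exact hcb
  rw [hst]
  have hB24 : 24 ≠ B := by omega
  rw [exec_asg (h := by simp only [bdd_var, update_of_ne hB24, k24]; exact hcb)]
  refine ⟨u, cnt, hu1, ?_, ⟨?_, ?_⟩, fun A h1 h2 => ?_⟩
  · rw [update_self, val_var, update_of_ne hB24, k24]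
  · rw [update_of_ne (by omega), update_self]
  · exact kP.congr fun A h1 h2 => by
      rw [update_of_ne (by omega), update_of_ne (by omega)]
  · rw [update_of_ne (by omega), update_of_ne (by omega), kH A h1 h2]

end

/-! ### Points of triple incidence. -/

/-- The list of shifts under construction at address `B`, with at most `K` entries, consists of the
pairs that satisfy `Q`; the remaining memory is as in `m₀`. -/
structure Collected (B k K : ℕ) (Q : ℤ → ℤ → Prop) (m₀ m : ℕ → ℤ) : Prop where
  list : ∃ cnt : ℕ, cnt ≤ K ∧ m 24 = cnt ∧ ∀ q₁ q₂, Q q₁ q₂ ↔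
    ∃ e < cnt, m (B + 1 + 2 * e) = q₁ ∧ m (B + 2 + 2 * e) = q₂
  frame : ∀ A, 100 ≤ A → (A ≤ B ∨ B + 2 * k ^ 3 < A) → m A = m₀ A

/-- The modulus and the slope in the test for incidence. -/
structure Regs (N k : ℕ) (g : ℤ) (m : ℕ → ℤ) : Prop where
  r0 : m 0 = N
  r2 : m 2 = k
  r6 : m 6 = g

section
variable {N k D c B K : ℕ} {R : ZMod N → ℂ} {g : ℤ} {Q : ℤ → ℤ → Prop} {m m₀ : ℕ → ℤ}

lemma Regs.congr (h : Regs N k g m) {m' : ℕ → ℤ} (hm : ∀ r < 18, m' r = m r) : Regs N k g m' := ⟨by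
  rw [hm _ (by simp), h.r0], by rw [hm _ (by simp), h.r2], by rw [hm _ (by simp), h.r6]⟩

lemma Collected.congr (h : Collected B k K Q m₀ m) {m' : ℕ → ℤ} (h24 : m' 24 = m 24) (hm : ∀ A, 100
  ≤ A → m' A = m A) (hB : 100 ≤ B) {K' : ℕ} (hK : K ≤ K') {Q' : ℤ → ℤ → Prop} (hQ : ∀ q₁ q₂, Q q₁ q₂
  ↔ Q' q₁ q₂) : Collected B k K' Q' m₀ m' := by
  obtain ⟨cnt, h1, h2, h3⟩ := h.list
  refine ⟨⟨cnt, h1.trans hK, by rw [h24, h2], fun q₁ q₂ => ?_⟩, fun A h4 h5 => by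
    rw [hm A h4, h.frame A h4 h5]⟩
  rw [← hQ, h3]
  refine exists_congr fun e => and_congr_right fun _ => ?_
  rw [hm _ (by omega), hm _ (by omega)]

/-- Divisibility by `N` is tested as `z % N < 1`. Each test adds at most one entry, so the bound `K`
on the length grows by one and the list stays within its `2 k ^ 3` cells. -/
lemma exec_incidence (hA : Admissible N k D) (hR : Regs N k g m) (hg : 0 ≤ g ∧ g < N) (hB : 100 ≤ B)
  (hBc : B + 2 * k ^ 3 + 1 ≤ c) (hBs : B + 3 ≤ size N) {q₁ q₂ p₁ p₂ : ℤ} (h35 : m 35 = q₁) (h36 : m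
  36 = q₂) (h37 : m 37 = p₁) (h38 : m 38 = p₂) (hq₁ : 0 ≤ q₁ ∧ q₁ < N) (hq₂ : 0 ≤ q₂ ∧ q₂ < N) (hp₁
  : 0 ≤ p₁ ∧ p₁ < N) (hp₂ : 0 ≤ p₂ ∧ p₂ < N) (hK : K < k ^ 3) (hC : Collected B k K Q m₀ m) :
  Collected B k (K + 1) (fun y₁ y₂ => Q y₁ y₂ ∨ ((N : ℤ) ∣ q₂ - p₂ - g * (q₁ - p₁) ∧ q₁ = y₁ ∧ q₂ =
  y₂)) m₀ ((Algo.incidence B).exec N c R m) := by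
  have hNpos : (0 : ℤ) < N := mod_cast hA.N_pos
  obtain ⟨cnt, h1, h24, h3⟩ := hC.list
  have b24 : |(cnt : ℤ)| ≤ 2 ^ (size N + 3) :=
    abs_le_two_pow (le_trans (by exact_mod_cast (by omega : cnt ≤ k ^ 3)) hA.cube_le)
  have hc : ((var 36 - var 38 - var 6 * (var 35 - var 37)) % var 0 : Ex).eval N m < (lit 1 :
    Ex).eval N m ↔ (N : ℤ) ∣ q₂ - p₂ - g * (q₁ - p₁) := by
    rw [eval_eq_val, eval_lit, hA.wrap_small (b := 0) (z := 1) (by simp)]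
    · simp only [Ex.val_mod, Ex.val_sub, val_mul, val_var, h35, h36, h37, h38, hR.r0, hR.r6]
      rw [Int.dvd_iff_emod_eq_zero]
      have := emod_nonneg (q₂ - p₂ - g * (q₁ - p₁)) hNpos.ne'
      omega
    · simp only [bdd_mod, bdd_sub, bdd_mul, bdd_var, h35, h36, h37, h38, hR.r0, hR.r6]
      exact ⟨⟨⟨abs_le_of_lt hq₂, abs_le_of_lt hp₂⟩, abs_le_of_lt hg, abs_le_of_lt hq₁,
        abs_le_of_lt hp₁⟩, abs_le_of_le hNpos.le le_rfl⟩
  rw [Algo.incidence, exec]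
  by_cases hd : (N : ℤ) ∣ q₂ - p₂ - g * (q₁ - p₁)
  swap
  · rw [if_neg (fun h => hd (hc.1 h)), exec_skip]
    exact hC.congr rfl (fun _ _ => rfl) hB (by omega) (by simp [hd])
  rw [if_pos (hc.2 hd)]
  have hst : ∀ (m' : ℕ → ℤ) (i r : ℕ) (v : ℤ), (∀ r < 60, m' r = m r) → i < 3 → r < 60 → m r = v →
    |v| ≤ 2 ^ (size N + 3) → (St.store (lit (B + i : ℕ) + lit 2 * var 24) (var r)).exec N c R m' =
    update m' (B + i + 2 * cnt) v ∧ ∀ r < 60, update m' (B + i + 2 * cnt) v r = m r := by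
    intro m' i r v h hi hr hv hb
    refine ⟨?_, fun r hr => by rw [update_of_ne (by omega), h r hr]⟩
    rw [← hv, ← h r hr]
    exact St.exec_store (size N + 3) (by simp [wordLen]; omega) (by simp [wordLen]; omega) (by simpa
      [h, h24] using b24) (by simp [h, h24]) (by omega) (by omega) (by rwa [bdd_var, h r hr, hv])
  obtain ⟨s1, e1⟩ := hst m 1 35 q₁ (fun _ _ => rfl) (by simp) (by simp) h35 (abs_le_of_lt hq₁)
  obtain ⟨s2, e2⟩ := hst _ 2 36 q₂ e1 (by simp) (by simp) h36 (abs_le_of_lt hq₂)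
  simp only [exec_seq, s1, s2]
  rw [exec_asg (h := by simpa only [bdd_add, bdd_var, bdd_lit, e2 24 (by simp), h24, and_true]),
    val_add, val_var, e2 24 (by simp), h24, Ex.val_lit]
  set m3 := update (update (update m (B + 1 + 2 * cnt) q₁) (B + 2 + 2 * cnt) q₂) 24
    ((cnt : ℤ) + 1) with hm3
  have g0 : ∀ A, 100 ≤ A → A ≠ B + 1 + 2 * cnt → A ≠ B + 2 + 2 * cnt → m3 A = m A := by
    intro A h1 h2 h3
    rw [hm3, update_of_ne (by omega), update_of_ne h3, update_of_ne h2]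
  have g1 : m3 (B + 1 + 2 * cnt) = q₁ := by
    rw [hm3, update_of_ne (by omega), update_of_ne (by omega), update_self]
  have g2 : m3 (B + 2 + 2 * cnt) = q₂ := by rw [hm3, update_of_ne (by omega), update_self]
  refine ⟨⟨cnt + 1, by omega, by simp [hm3], fun y₁ y₂ => ?_⟩, fun A h1 h2 => ?_⟩
  · rw [h3]
    constructor
    · rintro (⟨e, he, h4, h5⟩ | ⟨-, h4, h5⟩)
      · exact ⟨e, by omega, by rw [g0 _ (by omega) (by omega) (by omega), h4],
          by rw [g0 _ (by omega) (by omega) (by omega), h5]⟩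
      · exact ⟨cnt, by omega, by rw [g1, h4], by rw [g2, h5]⟩
    · rintro ⟨e, he, h4, h5⟩
      rcases lt_succ_iff_lt_or_eq.1 he with h | rfl
      · rw [g0 _ (by omega) (by omega) (by omega)] at h4 h5
        exact Or.inl ⟨e, h, h4, h5⟩
      · exact Or.inr ⟨hd, by rw [← g1, h4], by rw [← g2, h5]⟩
  · rw [g0 A h1 (by omega) (by omega), hC.frame A h1 h2]

/-- The list at address `A` holds `n` points, with coordinates `p`. -/
structure Listed (N k A n : ℕ) (p : ℕ → ℤ × ℤ) (m : ℕ → ℤ) : Prop where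
  le : n ≤ k
  entry : ∀ i < n, m (A + 1 + 4 * i) = (p i).1 ∧ m (A + 2 + 4 * i) = (p i).2
  range : ∀ i < n, (0 ≤ (p i).1 ∧ (p i).1 < N) ∧ 0 ≤ (p i).2 ∧ (p i).2 < N

lemma Listed.congr {A n : ℕ} {p : ℕ → ℤ × ℤ} (h : Listed N k A n p m) {m' : ℕ → ℤ} (hm : ∀ A', A <
  A' → A' ≤ A + 4 * k → m' A' = m A') : Listed N k A n p m' := ⟨h.le, fun i hi => by
    have := h.le
    rw [hm _ (by omega) (by omega), hm _ (by omega) (by omega)]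
    exact h.entry i hi, h.range⟩

lemma Listed.of_collected {A n : ℕ} {p : ℕ → ℤ × ℤ} (h : Listed N k A n p m₀) (hA : 100 ≤ A) (hAB :
  A + 4 * k < B) (hC : Collected B k K Q m₀ m) : Listed N k A n p m := h.congr fun A' h1 h2 =>
  hC.frame A' (by omega) (by omega)

/-- The loop runs `k` times whatever the length `n` of the list is, and the turns from `n` on do
nothing; hence `min j n` in the invariant. The number `w` bounds how many entries one pass through
the body can add. -/
lemma exec_forPoints (hA : Admissible N k D) {i rn d A n w : ℕ} {p : St} {pt : ℕ → ℤ × ℤ}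
    {P : ℕ → ℤ → ℤ → Prop} (hr : 24 < i ∧ i < d ∧ d < 59 ∧ 17 < rn ∧ rn < 21) (hk : p.keeps i)
    (hkrn : p.keeps rn) (hok : p.ok loopRegs) (hA' : 100 ≤ A) (hAB : A + 4 * k < B)
    (hBs : B + 3 ≤ size N) (hP : Listed N k A n pt m₀) (h2 : m 2 = k) (hmn : m rn = n)
    (hC : Collected B k K Q m₀ m)
    (hstep : ∀ j < n, ∀ m' : ℕ → ℤ, m' d = (pt j).1 → m' (d + 1) = (pt j).2 →
      (∀ r, r < 60 ∧ r ≠ i ∧ r ≠ d ∧ r ≠ d + 1 → p.keeps r → m' r = m r) → ∀ Q',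
      Collected B k (K + j * w) Q' m₀ m' →
      Collected B k (K + j * w + w) (fun y₁ y₂ => Q' y₁ y₂ ∨ P j y₁ y₂) m₀ (p.exec N c R m')) :
    Collected B k (K + n * w) (fun y₁ y₂ => Q y₁ y₂ ∨ ∃ j < n, P j y₁ y₂) m₀
      ((Algo.forPoints i rn d A p).exec N c R m) := by
  have hn := hP.le
  have hkp : ∀ r < 60, r ≠ d ∧ r ≠ d + 1 → p.keeps r → (St.ite (var i) (var rn)
      (.load d (lit (A + 1 : ℕ) + lit 4 * var i) ;;
        .load (d + 1) (lit (A + 2 : ℕ) + lit 4 * var i) ;; p) .skip).keeps r := fun r _ h h' => by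
    simp [St.keeps, h', h.1.symm, h.2.symm]
  have key := exec_for (N := N) (c := c) (R := R) (F := loopRegs) (i := i) (r := 2) (n := k)
    (m := m) (by omega) (by omega) (hkp i (by omega) (by omega) hk)
    (by simp [St.ok, Ex.ok, hok]; simp [loopRegs]; omega)
    (by rw [h2]; simp) (Or.inr ⟨size N, mod_cast hA.k_le, by rw [wordLen]; omega⟩)
    (fun j m' => Collected B k (K + min j n * w)
      (fun y₁ y₂ => Q y₁ y₂ ∨ ∃ l < min j n, P l y₁ y₂) m₀ m')
    (hC.congr (update_of_ne (by omega) _ _) (fun A hA => update_of_ne (by omega) _ _) (by omega)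
      (by simp) (by simp))
    (fun j m z h => h.congr (update_of_ne (by omega) _ _)
      (fun A hA => update_of_ne (by omega) _ _) (by omega) le_rfl (fun _ _ => Iff.rfl))
    (by
      intro j hj m' hi' hfr _ hI
      have hc : (var i : Ex).eval N m' < (var rn : Ex).eval N m' ↔ j < n := by
        rw [eval_var, eval_var, hi', hfr rn (by omega) (hkp rn (by omega) (by omega) hkrn),
          hmn, hA.wrap_small (hA.abs_le hj.le), hA.wrap_small (hA.abs_le hn)]
        exact Nat.cast_lt
      rw [exec]
      by_cases hjn : j < n
      · rw [show min j n = j by omega] at hI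
        rw [if_pos (hc.2 hjn), show min (j + 1) n = j + 1 by omega]
        have hl : ∀ (m' : ℕ → ℤ) (e a : ℕ) (z : ℤ), e < 100 → a < 3 → m' i = j →
            m' (A + a + 4 * j) = z → 0 ≤ z ∧ z < N →
            (St.load e (lit (A + a : ℕ) + lit 4 * var i)).exec N c R m' = update m' e z := by
          intro m' e a z he ha hi' hz hzN
          rw [exec_load (A := A + a + 4 * j) (h := by simpa [hi'] using hA.abs_le hj.le), hz]
          · simp [hi']
          · omega
          · rw [hz]; exact hA.wrap_small (abs_le_of_lt hzN)
        have hPm := hP.of_collected hA' hAB hI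
        obtain ⟨e1, e2⟩ := hPm.entry j hjn
        obtain ⟨r1, r2⟩ := hPm.range j hjn
        rw [exec_seq, hl m' d 1 _ (by omega) (by simp) hi' e1 r1, exec_seq,
          hl _ (d + 1) 2 _ (by omega) (by simp) (by rw [update_of_ne (by omega), hi'])
            (by rw [update_of_ne (by omega), e2]) r2]
        refine (hstep j hjn _ (by simp) (by simp) (fun r hr hkr => ?_) _ (hI.congr ?_ ?_
          (by omega) le_rfl fun _ _ => Iff.rfl)).congr rfl (fun _ _ => rfl) (by omega)
          (by rw [Nat.succ_mul]; omega) fun y₁ y₂ => ?_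
        · rw [update_of_ne hr.2.2.2, update_of_ne hr.2.2.1, hfr r (by omega) (hkp r hr.1 hr.2.2 hkr)]
        · rw [update_of_ne (by omega), update_of_ne (by omega)]
        · intro A hA
          rw [update_of_ne (by omega), update_of_ne (by omega)]
        · simp only [lt_succ_iff_lt_or_eq, or_and_right, exists_or, exists_eq_left, or_assoc]
      · rw [if_neg (fun h => hjn (hc.1 h)), exec_skip]
        rwa [show min (j + 1) n = min j n by omega])
  rwa [show min k n = n by omega] at key

/-- The points of triple incidence are stored at address `B`. -/
lemma exec_triples (hA : Admissible N k D) (hR : Regs N k g m) (hg : 0 ≤ g ∧ g < N) (hBc : B + 2 * k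
  ^ 3 + 1 ≤ c) (hBs : B + 3 ≤ size N) {B₀ B₁ B₂ n₀ n₁ n₂ : ℕ} {p₀ p₁ p₂ : ℕ → ℤ × ℤ} (hB₀ : 100 ≤
  B₀) (hB₀B : B₀ + 4 * k < B) (hP₀ : Listed N k B₀ n₀ p₀ m) (h18 : m 18 = n₀) (hB₁ : 100 ≤ B₁) (hB₁B
  : B₁ + 4 * k < B) (hP₁ : Listed N k B₁ n₁ p₁ m) (h19 : m 19 = n₁) (hB₂ : 100 ≤ B₂) (hB₂B : B₂ + 4
  * k < B) (hP₂ : Listed N k B₂ n₂ p₂ m) (h20 : m 20 = n₂) : (∃ cnt : ℕ, (Algo.triples B₀ B₁ B₂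
  B).exec N c R m B = cnt ∧ ∀ y₁ y₂, (∃ i < n₀, ∃ j < n₁, ∃ l < n₂, ((N : ℤ) ∣ ((p₀ i).2 + (p₁ j).2)
  % N - (p₂ l).2 - g * (((p₀ i).1 + (p₁ j).1) % N - (p₂ l).1) ∧ ((p₀ i).1 + (p₁ j).1) % N = y₁ ∧
  ((p₀ i).2 + (p₁ j).2) % N = y₂)) ↔ ∃ e < cnt, (Algo.triples B₀ B₁ B₂ B).exec N c R m (B + 1 + 2 *
  e) = y₁ ∧ (Algo.triples B₀ B₁ B₂ B).exec N c R m (B + 2 + 2 * e) = y₂) ∧ ∀ A, 100 ≤ A → A < B →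
  (Algo.triples B₀ B₁ B₂ B).exec N c R m A = m A := by
  have hNpos : (0 : ℤ) < N := mod_cast hA.N_pos
  have hmod : ∀ z : ℤ, 0 ≤ z % N ∧ z % N < N := fun z =>
    ⟨emod_nonneg _ hNpos.ne', emod_lt_of_pos _ hNpos⟩
  have hnn : n₀ * (n₁ * n₂) ≤ k ^ 3 :=
    (Nat.mul_le_mul hP₀.le (Nat.mul_le_mul hP₁.le hP₂.le)).trans_eq (by ring)
  have h1 : (24 ≔ lit 0).exec N c R m = update m 24 0 := by simp [exec, eval_lit]
  simp only [Algo.triples, exec_seq, h1]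
  set m1 := update m 24 0 with hm1
  have e1 : ∀ r, r ≠ 24 → m1 r = m r := fun r h => by rw [hm1, update_of_ne h]
  have hR1 : Regs N k g m1 := hR.congr fun r hr => e1 r (by omega)
  have hl : ∀ {A n : ℕ} {p : ℕ → ℤ × ℤ}, 100 ≤ A → Listed N k A n p m → Listed N k A n p m1 :=
    fun hA' h => h.congr fun A' h1 h2 => e1 A' (by omega)
  have key := exec_forPoints (c := c) (R := R) (K := 0) (w := n₁ * n₂) (Q := fun _ _ => False) (P :=
    fun i y₁ y₂ => ∃ j < n₁, ∃ l < n₂, ((N : ℤ) ∣ ((p₀ i).2 + (p₁ j).2) % N - (p₂ l).2 - g * (((p₀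
    i).1 + (p₁ j).1) % N - (p₂ l).1) ∧ ((p₀ i).1 + (p₁ j).1) % N = y₁ ∧ ((p₀ i).2 + (p₁ j).2) % N =
    y₂)) (m := m1) (p := Algo.forPoints 26 19 33 B₁ (35 ≔ (var 31 + var 33) % var 0 ;; 36 ≔ (var 32
    + var 34) % var 0 ;; Algo.forPoints 27 20 37 B₂ (Algo.incidence B))) hA (i := 25) (rn := 18) (d
    := 31) (by simp) rfl rfl rfl hB₀ hB₀B hBs (hl hB₀ hP₀) hR1.r2 (by rw [e1 18 (by simp), h18])
    ⟨⟨0, by simp, by simp [hm1], by simp⟩, fun _ _ _ => rfl⟩ (by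
      intro i hi m' f31 f32 hfr Q' hC'
      have hle : (i + 1) * (n₁ * n₂) ≤ n₀ * (n₁ * n₂) := Nat.mul_le_mul_right _ hi
      rw [Nat.succ_mul] at hle
      have hR' : Regs N k g m' := hR1.congr fun r hr =>
        hfr r (by omega) (keeps_of_keepsBelow (j := 24) (by omega) rfl)
      refine exec_forPoints hA (by simp) rfl rfl rfl hB₁ hB₁B hBs (hl hB₁ hP₁) hR'.r2
        (by rw [hfr 19 (by simp) rfl, e1 19 (by simp), h19]) hC' ?_
      intro j hj m2 f33 f34 hfr2 Q2 hC2
      have hle2 : (j + 1) * n₂ ≤ n₁ * n₂ := Nat.mul_le_mul_right _ hj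
      rw [Nat.succ_mul] at hle2
      have hR2 : Regs N k g m2 := hR'.congr fun r hr =>
        hfr2 r (by omega) (keeps_of_keepsBelow (j := 24) (by omega) rfl)
      obtain ⟨s1, s2⟩ := (hl hB₀ hP₀).range i hi
      obtain ⟨r1, r2⟩ := (hl hB₁ hP₁).range j hj
      replace f31 := (hfr2 31 (by simp) rfl).trans f31
      replace f32 := (hfr2 32 (by simp) rfl).trans f32
      have bN := abs_le_of_le hNpos.le le_rfl
      rw [exec_seq, exec_asg (d := 35) (h := by
        simp only [bdd_mod, bdd_add, bdd_var, f31, f33, hR2.r0]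
        exact ⟨⟨abs_le_of_lt s1, abs_le_of_lt r1⟩, bN⟩), exec_seq, exec_asg (d := 36) (h := by
        simp [-Nat.abs_cast, f32, f34, hR2.r0]
        exact ⟨⟨abs_le_of_lt s2, abs_le_of_lt r2⟩, bN⟩)]
      simp only [Ex.val_mod, val_add, val_var, f31, f33, hR2.r0]
      set m3 := update (update m2 35 _) 36 _ with hm3
      have e3 : ∀ r, r ≠ 35 ∧ r ≠ 36 → m3 r = m2 r := fun r h => by
        rw [hm3, update_of_ne h.2, update_of_ne h.1]
      have hR3 : Regs N k g m3 := hR2.congr fun r hr => e3 r (by omega)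
      have := exec_forPoints (w := 1) (c := c) (R := R) hA (i := 27) (rn := 20) (d := 37) (P := fun
        l y₁ y₂ => (N : ℤ) ∣ ((p₀ i).2 + (p₁ j).2) % N - (p₂ l).2 - g * (((p₀ i).1 + (p₁ j).1) % N -
        (p₂ l).1) ∧ ((p₀ i).1 + (p₁ j).1) % N = y₁ ∧ ((p₀ i).2 + (p₁ j).2) % N = y₂) (p :=
        Algo.incidence B) (by simp) rfl rfl rfl hB₂ hB₂B hBs (hl hB₂ hP₂) hR3.r2 (by rw [e3 20 (by
        simp), hfr2 20 (by simp) rfl, hfr 20 (by simp) rfl, e1 20 (by simp), h20]) (hC2.congr (e3 _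
        (by simp)) (fun A hA => e3 A (by omega)) (by omega) le_rfl fun _ _ => Iff.rfl) (fun l hl' m4
        f37 f38 hfr4 Q4 hC4 => by
          obtain ⟨q1, q2⟩ := (hl hB₂ hP₂).range l hl'
          exact exec_incidence hA (hR3.congr fun r hr =>
              hfr4 r (by omega) (keeps_of_keepsBelow (j := 24) (by omega) rfl)) hg
            (by omega) hBc hBs
            (by rw [hfr4 35 (by simp) rfl]; simp [hm3])
            (by rw [hfr4 36 (by simp) rfl]; simp [hm3, f32, f34, hR2.r0])
            f37 f38 (hmod _) (hmod _) q1 q2 (by omega) hC4)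
      simpa using this)
  set m2 := (Algo.forPoints 25 18 31 _ _).exec N c R m1 with hm2
  obtain ⟨cnt, c1, c2, c3⟩ := key.list
  have b24 : |(cnt : ℤ)| ≤ 2 ^ (size N + 3) :=
    abs_le_two_pow (le_trans (by exact_mod_cast (by omega : cnt ≤ k ^ 3)) hA.cube_le)
  have hst : (St.store (lit B) (var 24)).exec N c R m2 = update m2 B (cnt : ℤ) := by
    rw [St.exec_store (A := B) (h := by simp) (hA := by simp) (hA' := by omega) (hc := by omega)]
    · rw [val_var, c2]
    · simpa only [bdd_var, c2]
  rw [hst]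
  refine ⟨⟨cnt, by simp, fun y₁ y₂ => ?_⟩, fun A h1 h2 => ?_⟩
  · rw [← false_or (∃ _, _), c3]
    refine exists_congr fun e => and_congr_right fun _ => ?_
    rw [update_of_ne (by omega), update_of_ne (by omega)]
  · rw [update_of_ne (by omega), key.frame A h1 (by omega), e1 A (by omega)]

end

/-! ### Precomputation. -/

/-- Registers after the precomputation. -/
structure SetUp (N D : ℕ) (m₀ m : ℕ → ℤ) : Prop where
  low : ∀ r < 7, m r = m₀ r
  r7 : m 7 = 2 ^ size N
  r8 : m 8 = ell (size N)
  r9 : m 9 = size N * ell (size N)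
  r10 : m 10 = ell (size N) * ell (size N)
  r11 : m 11 = Nat.sqrt N
  r12 : m 12 = (N + 1) / 2
  r14 : m 14 = size N + 2
  r15 : m 15 = 2 * size N + 2
  r16 : m 16 = D
  r17 : m 17 = D + size N * ell (size N)

section
variable {N k D c : ℕ} {R : ZMod N → ℂ} {m : ℕ → ℤ}

lemma exec_powerLoop (hA : Admissible N k D) (h1 : m 1 = size N) (h7 : m 7 = 1) : (St.loop 1 (7 ≔
  var 7 + var 7)).exec N c R m = update m 7 (2 ^ size N) := by
  refine St.exec_loop (n := size N) (by rw [h1]; simp) (fun j m' => m' = update m 7 (2 ^ j)) ?_ ?_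
  · rw [pow_zero, ← h7, Function.update_eq_self]
  · rintro j hj m' rfl
    rw [exec_asg (b := size N)]
    · simp [pow_succ, mul_two]
    · simp only [bdd_add, bdd_var, update_self, and_self]
      rw [abs_of_nonneg (by positivity)]
      exact pow_le_pow_right₀ (by simp) hj.le

lemma abs_natCast_le {z n : ℕ} (h : z ≤ 2 ^ n) : |(z : ℤ)| ≤ 2 ^ n := by
  rw [Nat.abs_cast]; exact_mod_cast h

lemma exec_ellLoop (hA : Admissible N k D) (h1 : m 1 = size N) (h8 : m 8 = 0) : (St.loop 1 (.ite
  (var 8 * var 8 * var 8 * var 8 * (var 8 * var 8 * var 8 * var 8)) (var 1) (8 ≔ var 8 + lit 1)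
  .skip)).exec N c R m = update m 8 (ell (size N)) := by
  refine St.exec_loop (n := size N) (by rw [h1]; simp) (fun j m' => m' = update m 8
    (((fun l => if l ^ 8 < size N then l + 1 else l)^[j] 0 : ℕ) : ℤ)) ?_ ?_
  · simp [← h8]
  · rintro j hj m' rfl
    rw [iterate_succ_apply']
    have hl := (ell_iterate (size N) j).1
    set l := (fun l => if l ^ 8 < size N then l + 1 else l)^[j] 0
    set m1 := update m 8 (l : ℤ) with hm1
    have e8 : m1 8 = l := by simp [hm1]
    have e1 : m1 1 = size N := by simp [hm1, h1]
    -- One bit less than for other registers: the program forms an eighth power, and `8 (L - 1) + 2`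
    -- bits fit into the word while `8 L + 2` would not.
    have hLb : size N ≤ 2 ^ (size N - 1) := by
      have := lt_two_pow_self (n := size N - 1); omega
    have b8 : |(l : ℤ)| ≤ 2 ^ (size N - 1) := abs_natCast_le (by omega)
    have b1 := abs_natCast_le hLb
    have hc : (var 8 * var 8 * var 8 * var 8 * (var 8 * var 8 * var 8 * var 8) : Ex).eval N m1 <
      (var 1 : Ex).eval N m1 ↔ l ^ 8 < size N := by
      rw [eval_eq_val (b := size N - 1), eval_var, e1, hA.wrap_small b1]
      · simp only [val_mul, val_var, e8]
        rw [show (l : ℤ) * l * l * l * (l * l * l * l) = ((l ^ 8 : ℕ) : ℤ) by push_cast; ring]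
        exact Nat.cast_lt
      · simp only [bdd_mul, bdd_var, e8, b8, and_self]
    rw [exec]
    by_cases h : l ^ 8 < size N
    · rw [if_pos (hc.2 h), exec_asg (b := size N - 1) (h := by simp [e8]; simpa using b8)]
      simp [hm1, h]
    · rw [if_neg (fun h' => h (hc.1 h')), exec_skip]
      simp [h, hm1]

/-- The square root is found bit by bit from the top: the invariant `q^2 ≤ N < (q + 2 ^ (L - j))^2`
ends with consecutive squares around `N`. -/
lemma exec_sqrtLoop (hA : Admissible N k D) (h0 : m 0 = N) (h1 : m 1 = size N)
    (h11 : m 11 = 0) (h21 : m 21 = 2 ^ size N) :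
    let p : St := .loop 1 (21 ≔ var 21 / lit 2 ;;
      .ite (var 0) ((var 11 + var 21) * (var 11 + var 21)) .skip (11 ≔ var 11 + var 21))
    p.exec N c R m 11 = Nat.sqrt N ∧ ∀ r, r ≠ 11 → r ≠ 21 → p.exec N c R m r = m r := by
  intro p
  have hN : N < 2 ^ size N := lt_size_self N
  have key := St.exec_loop (N := N) (c := c) (R := R) (m := m) (r := 1) (n := size N)
    (p := 21 ≔ var 21 / lit 2 ;;
      .ite (var 0) ((var 11 + var 21) * (var 11 + var 21)) .skip (11 ≔ var 11 + var 21))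
    (by rw [h1]; simp)
    (fun j m' => (∃ q : ℕ, m' 11 = q ∧ m' 21 = 2 ^ (size N - j) ∧ q * q ≤ N ∧
      N < (q + 2 ^ (size N - j)) * (q + 2 ^ (size N - j))) ∧
      ∀ r, r ≠ 11 → r ≠ 21 → m' r = m r)
    ⟨⟨0, by simp [h11], by simp [h21], by simp, by
      simp only [Nat.sub_zero, zero_add]
      nlinarith⟩, fun _ _ _ => rfl⟩
    (by
      rintro j hj m' ⟨⟨q, i11, i21, iq, iN⟩, ifr⟩
      obtain ⟨n, hn⟩ : ∃ n, size N - j = n + 1 := ⟨size N - j - 1, by omega⟩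
      have hn' : size N - (j + 1) = n := by omega
      rw [hn] at i21 iN
      rw [hn']
      have hqN : q ≤ N := by nlinarith
      have bq : |(q : ℤ)| ≤ 2 ^ size N := abs_natCast_le (by omega)
      have bN := abs_natCast_le hN.le
      have h2 : ∀ i ≤ n + 1, |(2 : ℤ) ^ i| ≤ 2 ^ size N := fun i hi => by
        rw [abs_of_nonneg (by positivity)]; exact pow_le_pow_right₀ (by simp) (by omega)
      have bn := h2 n (by simp)
      have bn1 := h2 _ le_rfl
      have hv : (var 21 / lit 2 : Ex).val m' = 2 ^ n := by
        simp only [Ex.val_div, val_var, Ex.val_lit, i21, pow_succ]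
        exact Int.mul_ediv_cancel _ (by simp)
      rw [exec_seq, exec_asg (b := size N) (h := by simp [i21]; simpa using bn1), hv]
      set m1 := update m' 21 ((2 : ℤ) ^ n) with hm1
      have e21 : m1 21 = 2 ^ n := by simp [hm1]
      have e11 : m1 11 = q := by simp [hm1, i11]
      have e0 : m1 0 = N := by simp [hm1, ifr, h0]
      have hc : (var 0 : Ex).eval N m1 < ((var 11 + var 21) * (var 11 + var 21) : Ex).eval N m1 ↔
          N < (q + 2 ^ n) * (q + 2 ^ n) := by
        rw [eval_var, e0, hA.wrap_small bN,
          eval_eq_val (b := size N)]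
        · simp only [val_mul, val_add, val_var, e11, e21]
          exact_mod_cast Iff.rfl
        · simp only [bdd_mul, bdd_add, bdd_var, e11, e21, bq, bn, and_self]
      rw [exec]
      by_cases h : N < (q + 2 ^ n) * (q + 2 ^ n)
      · rw [if_pos (hc.2 h), exec_skip]
        exact ⟨⟨q, e11, e21, iq, h⟩, fun r h1 h2 => by
          rw [hm1, update_of_ne h2, ifr r h1 h2]⟩
      · rw [if_neg (fun h' => h (hc.1 h')), exec_asg (b := size N)
          (h := by simp only [bdd_add, bdd_var, e11, e21, bq, bn, and_self])]
        refine ⟨⟨q + 2 ^ n, by simp [e11, e21], by simp [e21], by omega, ?_⟩, fun r h1 h2 => ?_⟩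
        · rw [pow_succ] at iN
          rwa [show q + 2 ^ n + 2 ^ n = q + 2 ^ n * 2 by ring]
        · rw [update_of_ne h1, hm1, update_of_ne h2, ifr r h1 h2])
  obtain ⟨⟨q, i11, -, iq, iN⟩, ifr⟩ := key
  rw [Nat.sub_self, pow_zero] at iN
  refine ⟨?_, ifr⟩
  rw [i11, (Nat.eq_sqrt).2 ⟨iq, iN⟩]

lemma St.exec_asg_eq (m : ℕ → ℤ) (d : ℕ) (e : Ex) (z : ℤ) (h : e.Bdd (Nat.size N) m) (hz : e.val m =
  z) (hb : e.bits (Nat.size N) + 2 ≤ wordLen N := by simp [wordLen]; omega) : (d ≔ e).exec N c R m =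
  update m d z := by
  rw [exec_asg _ hb h, hz]

lemma exec_setup (hA : Admissible N k D) (hDs : D ≤ size N) (h0 : m 0 = N)
    (h1 : m 1 = size N) :
    SetUp N D m ((Algo.setup D).exec N c R m) := by
  have hL := hA.size_ge
  have hWL : ell (size N) ≤ size N := ell_le _
  have hLb : size N ≤ 2 ^ size N := lt_two_pow_self.le
  have bL := abs_natCast_le hLb
  have bW := abs_natCast_le (hWL.trans hLb)
  have bN := abs_natCast_le (lt_size_self N).le
  have low := fun r (hr : r < 7) => exec_keepsBelow (N := N) (c := c) (R := R)
    (st := Algo.setup D) (j := 7) m rfl hr (by omega)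
  simp only [Algo.setup, exec_seq] at low ⊢
  rw [St.exec_asg_eq m 7 (lit 1) 1 (by simp) rfl] at low ⊢
  rw [exec_powerLoop hA (by simp [h1]) (by simp)] at low ⊢
  rw [St.exec_asg_eq _ 8 (lit 0) 0 (by simp) rfl] at low ⊢
  rw [exec_ellLoop hA (by simp [h1]) (by simp)] at low ⊢
  set m1 := update (update (update (update m 7 1) 7
    (2 ^ size N)) 8 0) 8 (ell (size N) : ℤ) with hm1
  have a1 : m1 1 = size N := by simp [hm1, h1]
  have a0 : m1 0 = N := by simp [hm1, h0]
  have a7 : m1 7 = 2 ^ size N := by simp [hm1]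
  have a8 : m1 8 = ell (size N) := by simp [hm1]
  clear_value m1
  rw [St.exec_asg_eq m1 9 (var 1 * var 8) (size N * ell (size N)) (by
    simp only [bdd_mul, bdd_var, a1, a8]; exact ⟨bL, bW⟩) (by simp [a1, a8])] at low ⊢
  rw [St.exec_asg_eq _ 10 (var 8 * var 8) (ell (size N) * ell (size N))
    (by simp [a8]; simpa using bW) (by simp [a8])] at low ⊢
  rw [St.exec_asg_eq _ 14 (var 1 + lit 2) (size N + 2)
    (by simp [a1]; simpa using bL) (by simp [a1])] at low ⊢
  rw [St.exec_asg_eq _ 15 (var 1 + var 1 + lit 2) (2 * size N + 2)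
    (by simp [a1]; simpa using bL) (by simp [a1]; ring)] at low ⊢
  rw [St.exec_asg_eq _ 12 ((var 0 + lit 1) / lit 2) ((N + 1) / 2)
    (by simp [a0]; simpa using bN) (by simp [a0])] at low ⊢
  rw [St.exec_asg_eq _ 11 (lit 0) 0 (by simp) rfl] at low ⊢
  rw [St.exec_asg_eq _ 21 (var 7) (2 ^ size N) (by simp [a7]) (by simp [a7])] at low ⊢
  set m2 := update (update (update (update (update
    (update (update m1 9 ((size N : ℤ) * ell (size N))) 10
    ((ell (size N) : ℤ) * ell (size N))) 14 ((size N : ℤ) + 2)) 15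
    (2 * (size N : ℤ) + 2)) 12 (((N : ℤ) + 1) / 2)) 11 0) 21 (2 ^ size N) with hm2
  obtain ⟨s1, s2⟩ := exec_sqrtLoop (c := c) (R := R) (m := m2) hA (by simp [hm2, a0])
    (by simp [hm2, a1]) (by simp [hm2]) (by simp [hm2])
  set m3 := (St.loop 1 _).exec N c R m2 with hm3
  have c9 : m3 9 = size N * ell (size N) := by
    rw [s2 9 (by simp) (by simp)]; simp [hm2]
  have bD : |((size N : ℤ) * ell (size N))| ≤ 2 ^ size N := by
    have := hA.D_le
    exact_mod_cast abs_natCast_le (z := size N * ell (size N)) (by omega)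
  have bDD := abs_natCast_le (hDs.trans hLb)
  rw [St.exec_asg_eq m3 16 (lit (D : ℤ)) D (by simp) rfl] at low ⊢
  rw [St.exec_asg_eq _ 17 (var 16 + var 9) (D + size N * ell (size N))
    (by
      simp only [bdd_add, bdd_var, update_self, c9,
        update_of_ne (show (9 : ℕ) ≠ 16 by norm_num)]
      exact ⟨bDD, bD⟩) (by simp [c9])] at low ⊢
  have fin : ∀ r ∈ [7, 8, 9, 10, 12, 14, 15], update (update m3 16 (D : ℤ))
      17 ((D : ℤ) + size N * ell (size N)) r = m2 r := fun r h => by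
    simp only [List.mem_cons, List.not_mem_nil, or_false] at h
    rw [update_of_ne (by omega), update_of_ne (by omega), s2 r (by omega) (by omega)]
  refine ⟨low, ?_, ?_, ?_, ?_, by simp [s1], ?_, ?_, ?_, by simp, by simp⟩ <;> rw [fin _ (by simp)] <;>
    simp [hm2, a7, a8]

end

/-! ### From the final memory to peaks and shifts. -/

/-- The words and addresses are large enough for the parameters. -/
structure Fits (N k : ℕ) (μ : ℝ) : Prop where
  adm : Admissible N k (drawAddr k)
  one_le : 1 ≤ k
  addr_le : drawAddr k ≤ size N
  nonneg : 0 ≤ μ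
  le : toFixed N μ ≤ 2 ^ (3 * size N)

/-- The number of grid points. -/
def grid (N : ℕ) : ℕ := ell (size N) * ell (size N)

/-- The list of peaks that the program finds. -/
structure PeakOutput (N k : ℕ) (R : ZMod N → ℂ) (μ a b u bd : ℤ) (t t' : ℕ → ℤ)
    (l : List (Peak N)) : Prop where
  length_le : l.length ≤ k
  mem : ∀ x ∈ l, ∃ s < grid N,
    let τ := candTau N R a u bd s t
    (μ + 1) * (μ + 1) < estRe N R a b τ t' * estRe N R a b τ t' +
      estIm N R a b τ t' * estIm N R a b τ t' + 1 ∧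
    x = ⟨((τ : ZMod N), (b : ZMod N) * (τ : ZMod N)),
      ⟨ofFixed N (estRe N R a b τ t'), ofFixed N (estIm N R a b τ t')⟩⟩
  nodup : (l.map fun x => x.pt.1).Nodup
  complete : ∀ s < grid N,
    let τ := candTau N R a u bd s t
    (μ + 1) * (μ + 1) < estRe N R a b τ t' * estRe N R a b τ t' +
      estIm N R a b τ t' * estIm N R a b τ t' + 1 →
    l.length = k ∨ ∃ x ∈ l, x.pt.1 = (τ : ZMod N)

section
variable {N k c : ℕ} {R : ZMod N → ℂ} {m x : ℕ → ℤ}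

lemma addr_eq (k : ℕ) : peakAddr k 0 = 100 ∧ peakAddr k 1 = 101 + 4 * k ∧ peakAddr k 2 = 102 + 8 * k
  ∧ shiftAddr k = 103 + 12 * k ∧ drawAddr k = 104 + 12 * k + 2 * k ^ 3 := by
  simp [peakAddr, shiftAddr, drawAddr]; omega

lemma PeaksFound.output {B : ℕ} {μ a b u bd : ℤ} {t t' : ℕ → ℤ} {cnt : ℕ} (hN : 0 < N)
    (h : PeaksFound N k B R μ a b u bd t t' cnt m) {s : Config} (hs : s.mem = m) {i : ℕ}
    (hi : m i = B) : PeakOutput N k R μ a b u bd t t' (s.peaks N i) := by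
  have hlen : (m B).toNat = cnt := by rw [h.count]; simp
  have hl : s.peaks N i = (List.range cnt).map fun j =>
      { pt := (((m (B + 1 + 4 * j) : ℤ) : ZMod N), ((m (B + 2 + 4 * j) : ℤ) : ZMod N))
        est := ⟨ofFixed N (m (B + 3 + 4 * j)), ofFixed N (m (B + 4 + 4 * j))⟩ } := by
    simp only [Config.peaks, hs, hi, Int.toNat_natCast, hlen]
  have hNpos : (0 : ℤ) < N := mod_cast hN
  have hτ : ∀ s, 0 ≤ candTau N R a u bd s t ∧ candTau N R a u bd s t < N := fun s =>
    ⟨emod_nonneg _ hNpos.ne', emod_lt_of_pos _ hNpos⟩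
  rw [hl]
  refine ⟨by simpa using h.list.cnt_le, ?_, ?_, ?_⟩
  · intro y hy
    simp only [List.mem_map, List.mem_range] at hy
    obtain ⟨j, hj, rfl⟩ := hy
    obtain ⟨s, hs, h1, h2, h3, h4, h5⟩ := h.list.entry j hj
    refine ⟨s, hs, h1, ?_⟩
    rw [h2, h3, h4, h5]
    simp
  · rw [List.map_map]
    refine List.Nodup.map_on ?_ List.nodup_range
    intro i hi j hj hij
    simp only [List.mem_range] at hi hj
    simp only [Function.comp] at hij
    obtain ⟨s, -, -, e1, -⟩ := h.list.entry i hi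
    obtain ⟨s', -, -, e2, -⟩ := h.list.entry j hj
    -- Candidates are reduced modulo `N`, so entries that differ as integers differ as residues.
    rw [ZMod.intCast_eq_intCast_iff, Int.ModEq, e1, e2, emod_eq_of_lt (hτ s).1 (hτ s).2,
      emod_eq_of_lt (hτ s').1 (hτ s').2] at hij
    by_contra hne
    rcases lt_or_gt_of_ne hne with h' | h'
    · exact h.list.distinct j hj i h' (by rw [e1, e2, hij])
    · exact h.list.distinct i hi j h' (by rw [e1, e2, hij])
  · intro s hs _ hT
    rcases h.list.complete s hs hT with h' | ⟨i, hi, h'⟩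
    · exact Or.inl (by simpa using h')
    · refine Or.inr ⟨_, List.mem_map_of_mem (List.mem_range.2 hi), ?_⟩
      rw [h']

lemma exec_main (hA : Admissible N k (drawAddr k)) (hk : 1 ≤ k) (hDs : drawAddr k ≤ size N) (hc :
  drawAddr k ≤ c) (hI : Inputs N x) (hR : Ready N k (drawAddr k) x m) (hg₀ : Int.gcd (x 4 - x 5) N =
  1) (hg₁ : Int.gcd (x 5 - x 4) N = 1) (hg₂ : Int.gcd (x 6 - x 5) N = 1) {t t' : ℕ → ℤ} (hD : Drawn
  (drawAddr k) (draws N) N t m) (hD' : Drawn (drawAddr k + draws N) (draws N) N t' m) {m' : ℕ → ℤ}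
  (hm' : m' = (Algo.mainAt k).exec N c R m) : ∃ u₀ u₁ u₂ : ℤ, ∃ n₀ n₁ n₂ : ℕ, u₀ * (x 4 - x 5) ≡ 1
  [ZMOD N] ∧ u₁ * (x 5 - x 4) ≡ 1 [ZMOD N] ∧ u₂ * (x 6 - x 5) ≡ 1 [ZMOD N] ∧ PeaksFound N k
  (peakAddr k 0) R (x 3) (x 4) (x 5) u₀ (x 13) t t' n₀ m' ∧ PeaksFound N k (peakAddr k 1) R (x 3) (x
  5) (x 4) u₁ (x 13) t t' n₁ m' ∧ PeaksFound N k (peakAddr k 2) R (x 3) (x 6) (x 5) u₂ (x 13) t t'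
  n₂ m' ∧ ∃ cnt : ℕ, m' (shiftAddr k) = cnt ∧ ∀ y₁ y₂, (∃ i < n₀, ∃ j < n₁, ∃ l < n₂, ((N : ℤ) ∣ (m'
  (peakAddr k 0 + 2 + 4 * i) + m' (peakAddr k 1 + 2 + 4 * j)) % N - m' (peakAddr k 2 + 2 + 4 * l) -
  x 6 * ((m' (peakAddr k 0 + 1 + 4 * i) + m' (peakAddr k 1 + 1 + 4 * j)) % N - m' (peakAddr k 2 + 1
  + 4 * l)) ∧ (m' (peakAddr k 0 + 1 + 4 * i) + m' (peakAddr k 1 + 1 + 4 * j)) % N = y₁ ∧ (m'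
  (peakAddr k 0 + 2 + 4 * i) + m' (peakAddr k 1 + 2 + 4 * j)) % N = y₂)) ↔ ∃ e < cnt, m' (shiftAddr
  k + 1 + 2 * e) = y₁ ∧ m' (shiftAddr k + 2 + 2 * e) = y₂ := by
  have hNpos : (0 : ℤ) < N := mod_cast hA.N_pos
  have hmod : ∀ z : ℤ, 0 ≤ z % N ∧ z % N < N := fun z =>
    ⟨emod_nonneg _ hNpos.ne', emod_lt_of_pos _ hNpos⟩
  have hk3 : 1 ≤ k ^ 3 := Nat.one_le_pow _ _ hk
  obtain ⟨a0, a1, a2, a3, aD⟩ := addr_eq k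
  simp only [Algo.mainAt, Algo.main, exec_seq] at hm'
  obtain ⟨u₀, n₀, hu₀, c₀, F₀, H₀⟩ := exec_peaks (c := c) (R := R) (B := peakAddr k 0) hA hI hR
    (by omega) (by omega) hc (by omega) (ra := 4) (rb := 5) (rc := 18) (by simp) (by simp) (by simp)
    hg₀ hD hD'
  set m1 := (Algo.peaks 4 5 18 (peakAddr k 0)).exec N c R m with hm1
  have hR1 : Ready N k (drawAddr k) x m1 := hR.exec rfl
  obtain ⟨u₁, n₁, hu₁, c₁, F₁, H₁⟩ := exec_peaks (c := c) (R := R) (B := peakAddr k 1) hA hI hR1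
    (by omega) (by omega) hc (by omega) (ra := 5) (rb := 4) (rc := 19) (by simp) (by simp) (by simp)
    hg₁ (t := t) (t' := t') (fun i hi => by rw [H₀ _ (by omega) (by omega)]; exact hD i hi)
    (fun i hi => by rw [H₀ _ (by omega) (by omega)]; exact hD' i hi)
  set m2 := (Algo.peaks 5 4 19 (peakAddr k 1)).exec N c R m1 with hm2
  have hR2 : Ready N k (drawAddr k) x m2 := hR1.exec rfl
  obtain ⟨u₂, n₂, hu₂, c₂, F₂, H₂⟩ := exec_peaks (c := c) (R := R) (B := peakAddr k 2) hA hI hR2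
    (by omega) (by omega) hc (by omega) (ra := 6) (rb := 5) (rc := 20) (by simp) (by simp) (by simp)
    hg₂ (t := t) (t' := t')
    (fun i hi => by rw [H₁ _ (by omega) (by omega), H₀ _ (by omega) (by omega)]; exact hD i hi)
    (fun i hi => by rw [H₁ _ (by omega) (by omega), H₀ _ (by omega) (by omega)]; exact hD' i hi)
  set m3 := (Algo.peaks 6 5 20 (peakAddr k 2)).exec N c R m2 with hm3
  have hR3 : Ready N k (drawAddr k) x m3 := hR2.exec rfl
  have G₁ : PeaksFound N k (peakAddr k 1) R (x 3) (x 5) (x 4) u₁ (x 13) t t' n₁ m3 :=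
    F₁.congr fun A h1 h2 => H₂ A (by omega) (by omega)
  have G₀ : PeaksFound N k (peakAddr k 0) R (x 3) (x 4) (x 5) u₀ (x 13) t t' n₀ m3 :=
    F₀.congr fun A h1 h2 => by rw [H₂ A (by omega) (by omega), H₁ A (by omega) (by omega)]
  have d₀ : m3 18 = n₀ := by
    rw [hm3, St.exec_keeps (by simp) _ rfl, hm2, St.exec_keeps (by simp) _ rfl, c₀]
  have d₁ : m3 19 = n₁ := by
    rw [hm3, St.exec_keeps (by simp) _ rfl, c₁]
  have lst : ∀ {B : ℕ} {a b u : ℤ} {n : ℕ}, PeaksFound N k B R (x 3) a b u (x 13) t t' n m3 → Listed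
    N k B n (fun i => (m3 (B + 1 + 4 * i), m3 (B + 2 + 4 * i))) m3 := by
    intro B a b u n h
    refine ⟨h.list.cnt_le, fun i hi => ⟨rfl, rfl⟩, fun i hi => ?_⟩
    obtain ⟨s, -, -, h1, h2, -⟩ := h.list.entry i hi
    simp only [h1, h2]
    exact ⟨hmod _, hmod _⟩
  obtain ⟨⟨cnt, t1, t2⟩, t3⟩ := exec_triples (c := c) (R := R) (B := shiftAddr k) hA ⟨hR3.r0,
    hR3.r2, hR3.r6⟩ hI.r6 (by omega) (by omega) (B₀ := peakAddr k 0) (by omega) (by omega) (lst G₀)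
    d₀ (B₁ := peakAddr k 1) (by omega) (by omega) (lst G₁) d₁ (B₂ := peakAddr k 2) (by omega) (by
    omega) (lst F₂) c₂
  rw [← hm'] at t1 t2 t3
  refine ⟨u₀, u₁, u₂, n₀, n₁, n₂, hu₀, hu₁, hu₂, G₀.congr fun A h1 h2 => t3 A (by omega) (by omega),
    G₁.congr fun A h1 h2 => t3 A (by omega) (by omega),
    F₂.congr fun A h1 h2 => t3 A (by omega) (by omega), cnt, t1, fun y₁ y₂ => ?_⟩
  rw [← t2]
  refine exists_congr fun i => and_congr_right fun hi => exists_congr fun j =>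
    and_congr_right fun hj => exists_congr fun l => and_congr_right fun hl => ?_
  have := F₂.list.cnt_le
  have := G₁.list.cnt_le
  have := G₀.list.cnt_le
  have h : ∀ A, 100 ≤ A ∧ A < shiftAddr k → m' A = m3 A := fun A hA => t3 A hA.1 hA.2
  rw [h (peakAddr k 0 + 1 + 4 * i) (by omega), h (peakAddr k 0 + 2 + 4 * i) (by omega),
    h (peakAddr k 1 + 1 + 4 * j) (by omega), h (peakAddr k 1 + 2 + 4 * j) (by omega),
    h (peakAddr k 2 + 1 + 4 * l) (by omega), h (peakAddr k 2 + 2 + 4 * l) (by omega)]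

end

/-- The draws, as a sequence of integers. -/
def drawSeq {n N : ℕ} (t : Fin n → Fin N) (j : ℕ) : ℤ :=
  if h : j < n then ((t ⟨j, h⟩ : ℕ) : ℤ) else 0

/-- The output of the program. -/
structure Output (N k : ℕ) (μ : ℤ) (a : ZMod N × ZMod N × ZMod N) (R : ZMod N → ℂ) (bd : ℤ)
    (t t' : ℕ → ℤ) (s : Config) : Prop where
  peaks₀ : ∃ u : ℤ, u * ((a.1.val : ℤ) - a.2.1.val) ≡ 1 [ZMOD N] ∧
    PeakOutput N k R μ a.1.val a.2.1.val u bd t t' (s.peaks N 0)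
  peaks₁ : ∃ u : ℤ, u * ((a.2.1.val : ℤ) - a.1.val) ≡ 1 [ZMOD N] ∧
    PeakOutput N k R μ a.2.1.val a.1.val u bd t t' (s.peaks N 1)
  peaks₂ : ∃ u : ℤ, u * ((a.2.2.val : ℤ) - a.2.1.val) ≡ 1 [ZMOD N] ∧
    PeakOutput N k R μ a.2.2.val a.2.1.val u bd t t' (s.peaks N 2)
  shifts : ∀ q, q ∈ s.shifts N ↔ ∃ x ∈ s.peaks N 0, ∃ y ∈ s.peaks N 1, ∃ z ∈ s.peaks N 2, q - x.pt ∈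
    line a.1 ∧ q - y.pt ∈ line a.2.1 ∧ q - z.pt ∈ line a.2.2

/-- Bound for the number of operations. -/
def opBound (k L : ℕ) : ℕ := 1000 * (1 + L) + 40 * (L * ell L) + 6000 * (1 + (2 * L + 2) + (1 + ell
  L * ell L) * ((1 + (L + 2)) * ((1 + L * ell L) * (1 + ell L)) + k)) + 1000 * (1 + k) ^ 3 + 30

section
variable {N k : ℕ} {μ : ℝ} {R : ZMod N → ℂ}

lemma mem_line {a : ZMod N} {p : ZMod N × ZMod N} : p ∈ line a ↔ p.2 = a * p.1 := Iff.rfl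

lemma intCast_val [NeZero N] (x : ZMod N) : (((x.val : ℕ) : ℤ) : ZMod N) = x := by
  rw [Int.cast_natCast, ZMod.natCast_zmod_val]

/-- If `(a - b) x = 0`, the point `(x, a x)` lies on both lines, so `x = 0`. Multiplication by `a -
b` is injective on a finite ring, hence surjective, and 1 is attained. -/
lemma Transversal.isUnit [NeZero N] {a b : ZMod N} (h : Transversal a b) : IsUnit (a - b) := by
  have hinj : Function.Injective fun x : ZMod N => (a - b) * x := by
    refine (injective_iff_map_eq_zero (AddMonoidHom.mulLeft (a - b))).2 fun x hx => ?_
    have hx' : (a - b) * x = 0 := hx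
    have hm : (x, a * x) ∈ line a ∩ line b := by
      refine ⟨rfl, mem_line.2 ?_⟩
      rw [sub_mul, sub_eq_zero] at hx'
      exact hx'
    rw [Transversal] at h
    rw [h] at hm
    exact congrArg Prod.fst hm
  obtain ⟨y, hy⟩ := (Finite.injective_iff_surjective.1 hinj) 1
  exact IsUnit.of_mul_eq_one y hy

lemma Transversal.gcd_eq [NeZero N] {a b : ZMod N} (h : Transversal a b) : Int.gcd ((a.val : ℤ) -
  b.val) N = 1 := by
  have h2 : IsUnit ((((a.val : ℤ) - b.val : ℤ)) : ZMod N) := by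
    rw [Int.cast_sub, intCast_val, intCast_val]; exact h.isUnit
  rw [ZMod.coe_int_isUnit_iff_isCoprime] at h2
  rw [Int.gcd_comm]
  exact Int.isCoprime_iff_gcd_eq_one.1 h2

lemma Transversal.symm {a b : ZMod N} (h : Transversal a b) : Transversal b a := by
  rw [Transversal, Set.inter_comm]; exact h

lemma mem_slopeTriples [NeZero N] {a : ZMod N × ZMod N × ZMod N} : a ∈ slopeTriples N ↔ Transversal
  a.1 a.2.1 ∧ Transversal a.1 a.2.2 ∧ Transversal a.2.1 a.2.2 := by
  simp [slopeTriples]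

/-- Transversal lines through `x ∈ L` in direction `K` and through `y ∈ K` in direction `L` meet in
the single point `x + y`. So the program forms this sum and tests only the third incidence. -/
lemma incidence_iff {a b g : ZMod N} (h : Transversal a b) {q x y z : ZMod N × ZMod N} (hx : x ∈
  line b) (hy : y ∈ line a) : (q - x ∈ line a ∧ q - y ∈ line b ∧ q - z ∈ line g) ↔ x + y = q ∧ (x +
  y) - z ∈ line g := by
  simp only [mem_line, snd_sub, fst_sub] at hx hy ⊢
  constructor
  · rintro ⟨h1, h2, h3⟩
    have h0 : q - x - y = 0 := by
      have : q - x - y ∈ line a ∩ line b := by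
        constructor
        · simp only [mem_line, snd_sub, fst_sub]; linear_combination h1 - hy
        · simp only [mem_line, snd_sub, fst_sub]; linear_combination h2 - hx
      rw [Transversal] at h
      rwa [h] at this
    have hq : q = x + y := by rw [sub_sub, sub_eq_zero] at h0; exact h0
    subst hq
    exact ⟨rfl, h3⟩
  · rintro ⟨rfl, h3⟩
    refine ⟨?_, ?_, h3⟩
    · simp only [Prod.snd_add, Prod.fst_add]; linear_combination hy
    · simp only [Prod.snd_add, Prod.fst_add]; linear_combination hx

lemma run_main_finish [NeZero N] (hF : Fits N k μ) {a : ZMod N × ZMod N × ZMod N}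
    (ha : a ∈ slopeTriples N) {c : ℕ} (hc : drawAddr k ≤ c) {x : ℕ → ℤ} (hI : Inputs N x)
    (h4 : x 4 = a.1.val) (h5 : x 5 = a.2.1.val) (h6 : x 6 = a.2.2.val) {s : Config}
    (hR : Ready N k (drawAddr k) x s.mem)
    {t t' : ℕ → ℤ} (hD : Drawn (drawAddr k) (draws N) N t s.mem)
    (hD' : Drawn (drawAddr k + draws N) (draws N) N t' s.mem) :
    ∃ s', (Prog.seq (Algo.mainAt k).code (Algo.finishAt k).code).run N c R s = PMF.pure s' ∧ Output N k (x 3) a R (x 13) t t' s' ∧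
      s'.ops ≤ s.ops + 6000 * (1 + (2 * size N + 2) + (1 + ell (size N) * ell (size N)) *
        ((1 + (size N + 2)) * ((1 + size N * ell (size N)) * (1 + ell (size N))) + k))
        + 1000 * (1 + k) ^ 3 + 12 ∧
      s'.samples + s.ops ≤ s.samples + s'.ops := by
  have hA := hF.adm
  have hL := hA.size_ge
  have hDs := hF.addr_le
  have hk := hF.one_le
  have hc100 : 100 ≤ c := hA.D_ge.trans hc
  have h100 : wrap N 100 = 100 := hA.wrap_small (b := 7) (by simp)
  obtain ⟨t1, t2, t3⟩ := mem_slopeTriples.1 ha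
  obtain ⟨ρ, hρ⟩ : ∃ ρ : ℕ → ℕ, ∀ r, ρ r = (s.mem r).toNat := ⟨_, fun _ => rfl⟩
  obtain ⟨a0, a1, a2, a3, aD⟩ := addr_eq k
  obtain ⟨s1, r1, ag1, op1, sm1⟩ := St.run_code R hc100 h100 (F := loopRegs) (by decide) ρ
    (Algo.mainAt k) s s.mem
    (Algo.main_ok _ _ _ _) (fun _ _ => rfl) (fun r _ => (hρ r).ge)
  obtain ⟨u₀, u₁, u₂, n₀, n₁, n₂, hu₀, hu₁, hu₂, F₀, F₁, F₂, cnt, hcnt, hsh⟩ := exec_main (R := R)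
    hA hk hDs hc hI hR (by rw [h4, h5]; exact t1.gcd_eq) (by rw [h4, h5]; exact t1.symm.gcd_eq)
    (by rw [h6, h5]; exact t3.symm.gcd_eq) hD hD' rfl
  set m1 := (Algo.mainAt k).exec N c R s.mem
    with hm1
  obtain ⟨s2, r2, ag2, op2, sm2⟩ := St.run_code R hc100 h100 (F := []) (by simp) ρ
    (Algo.finishAt k) s1 m1
    (Algo.finish_ok _ _ _ _) ag1 (by simp)
  refine ⟨s2, by rw [Prog.run, r1, PMF.pure_bind, r2], ?_, ?_, by omega⟩
  swap
  · have h1 : (Algo.mainAt k).cost ρ ≤ _ := Algo.cost_main ..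
    have h2 : (Algo.finishAt k).cost ρ = 12 := Algo.cost_finish ..
    have e15 : ρ 15 = 2 * size N + 2 := by rw [hρ, hR.r15]; omega
    have e14 : ρ 14 = size N + 2 := by rw [hρ, hR.r14]; omega
    have e10 : ρ 10 = ell (size N) * ell (size N) := by rw [hρ, hR.r10]; norm_cast
    have e9 : ρ 9 = size N * ell (size N) := by rw [hρ, hR.r9]; norm_cast
    have e8 : ρ 8 = ell (size N) := by rw [hρ, hR.r8]; simp
    have e2 : ρ 2 = k := by rw [hρ, hR.r2]; simp
    rw [e15, e14, e10, e9, e8, e2] at h1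
    omega
  have hfin : (Algo.finishAt k).exec N c R m1 =
      update (update (update (update m1 0 (peakAddr k 0 : ℤ)) 1
        (peakAddr k 1 : ℤ)) 2 (peakAddr k 2 : ℤ)) 3 (shiftAddr k : ℤ) := by
    simp only [Algo.finish, exec_seq]
    rw [exec_asg (d := 0) (h := by simp),
      exec_asg (d := 1) (b := 0) (h := by simp),
      exec_asg (d := 2) (b := 0) (h := by simp),
      exec_asg (d := 3) (b := 0) (h := by simp)]
    simp only [Ex.val_lit]
  rw [hfin] at ag2
  have g0 : s2.mem 0 = peakAddr k 0 := by rw [ag2 0 (by simp)]; simp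
  have g1 : s2.mem 1 = peakAddr k 1 := by rw [ag2 1 (by simp)]; simp
  have g2 : s2.mem 2 = peakAddr k 2 := by rw [ag2 2 (by simp)]; simp
  have g3 : s2.mem 3 = shiftAddr k := by rw [ag2 3 (by simp)]; simp
  have gh : ∀ A, 100 ≤ A → s2.mem A = m1 A := fun A hA => by
    rw [ag2 A (by omega)]
    repeat rw [update_of_ne (by omega)]
  have gp : ∀ i j, s2.mem (peakAddr k i + 1 + 4 * j) = m1 (peakAddr k i + 1 + 4 * j) ∧
      s2.mem (peakAddr k i + 2 + 4 * j) = m1 (peakAddr k i + 2 + 4 * j) := fun i j =>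
    ⟨gh _ (by rw [peakAddr]; omega), gh _ (by rw [peakAddr]; omega)⟩
  have G₀ := F₀.congr (m' := s2.mem) fun A h1 h2 => gh A (by omega)
  have G₁ := F₁.congr (m' := s2.mem) fun A h1 h2 => gh A (by omega)
  have G₂ := F₂.congr (m' := s2.mem) fun A h1 h2 => gh A (by omega)
  have pk : ∀ {i B n : ℕ} {a b u : ℤ}, s2.mem i = B →
      PeaksFound N k B R (x 3) a b u (x 13) t t' n s2.mem → ∀ P : Peak N → Prop,
      (∃ y ∈ s2.peaks N i, P y) ↔ ∃ j < n, P
      { pt := (((s2.mem (B + 1 + 4 * j) : ℤ) : ZMod N), ((s2.mem (B + 2 + 4 * j) : ℤ) : ZMod N))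
        est := ⟨ofFixed N (s2.mem (B + 3 + 4 * j)), ofFixed N (s2.mem (B + 4 + 4 * j))⟩ } := by
    intro i B n a b u hi h P
    simp only [Config.peaks, hi, Int.toNat_natCast, h.count, List.mem_map, List.mem_range]
    constructor
    · rintro ⟨_, ⟨j, hj, rfl⟩, h⟩; exact ⟨j, hj, h⟩
    · rintro ⟨j, hj, h⟩; exact ⟨_, ⟨j, hj, rfl⟩, h⟩
  have pl : ∀ {B n : ℕ} {a b u : ℤ},
      PeaksFound N k B R (x 3) a b u (x 13) t t' n s2.mem → ∀ j < n,
      (((s2.mem (B + 1 + 4 * j) : ℤ) : ZMod N), ((s2.mem (B + 2 + 4 * j) : ℤ) : ZMod N)) ∈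
        line (b : ZMod N) := by
    intro B n a b u h j hj
    obtain ⟨s, -, -, e1, e2, -⟩ := h.list.entry j hj
    simp only [mem_line]
    rw [e1, e2]; simp
  refine ⟨⟨u₀, by rw [← h4, ← h5]; exact hu₀, by rw [← h4, ← h5]; exact G₀.output hA.N_pos rfl g0⟩,
    ⟨u₁, by rw [← h4, ← h5]; exact hu₁, by rw [← h4, ← h5]; exact G₁.output hA.N_pos rfl g1⟩,
    ⟨u₂, by rw [← h6, ← h5]; exact hu₂, by rw [← h6, ← h5]; exact G₂.output hA.N_pos rfl g2⟩,
    fun q => ?_⟩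
  have hq : q ∈ s2.shifts N ↔ ∃ y₁ y₂ : ℤ, (∃ e < cnt, m1 (shiftAddr k + 1 + 2 * e) = y₁ ∧
      m1 (shiftAddr k + 2 + 2 * e) = y₂) ∧ q = ((y₁ : ZMod N), (y₂ : ZMod N)) := by
    have hc : (s2.mem (s2.mem 3).toNat).toNat = cnt := by
      rw [g3, Int.toNat_natCast, gh _ (by omega), hcnt, Int.toNat_natCast]
    simp only [Config.shifts, hc, List.mem_map, List.mem_range]
    rw [g3, Int.toNat_natCast]
    constructor
    · rintro ⟨e, he, rfl⟩
      rw [gh _ (by omega), gh _ (by omega)]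
      exact ⟨_, _, ⟨e, he, rfl, rfl⟩, rfl⟩
    · rintro ⟨_, _, ⟨e, he, rfl, rfl⟩, rfl⟩
      refine ⟨e, he, ?_⟩
      rw [gh _ (by omega), gh _ (by omega)]
  rw [hq, pk g0 G₀]
  simp only [pk g1 G₁, pk g2 G₂]
  simp only [← hsh]
  constructor
  · rintro ⟨y₁, y₂, ⟨i, hi, j, hj, l, hl, h1, h2, h3⟩, rfl⟩
    refine ⟨i, hi, j, hj, l, hl, ?_⟩
    have lx := pl G₀ i hi
    have ly := pl G₁ j hj
    rw [h5] at lx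
    rw [h4] at ly
    simp only [intCast_val] at lx ly
    rw [incidence_iff t1 lx ly]
    rw [← h2, ← h3]
    refine ⟨by ext <;> simp [gp], ?_⟩
    rw [← ZMod.intCast_zmod_eq_zero_iff_dvd] at h1
    simp only [mem_line, snd_sub, fst_sub, Prod.snd_add, Prod.fst_add, gp]
    rw [h6] at h1
    simp only [Int.cast_sub, Int.cast_mul, ZMod.intCast_mod, Int.cast_add, intCast_val] at h1
    linear_combination h1
  · rintro ⟨i, hi, j, hj, l, hl, h⟩
    have lx := pl G₀ i hi
    have ly := pl G₁ j hj
    rw [h5] at lx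
    rw [h4] at ly
    simp only [intCast_val] at lx ly
    rw [incidence_iff t1 lx ly] at h
    obtain ⟨h1, h2⟩ := h
    simp only [gp] at h1 h2
    refine ⟨_, _, ⟨i, hi, j, hj, l, hl, ?_, rfl, rfl⟩, by rw [← h1]; ext <;> simp⟩
    rw [← ZMod.intCast_zmod_eq_zero_iff_dvd, h6]
    simp only [mem_line, snd_sub, fst_sub, Prod.snd_add, Prod.fst_add] at h2
    simp only [Int.cast_sub, Int.cast_mul, ZMod.intCast_mod, Int.cast_add, intCast_val]
    linear_combination h2

end

section
variable {N k : ℕ} {μ : ℝ} {R : ZMod N → ℂ}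

lemma drawSeq_apply {n : ℕ} (t : Fin n → Fin N) (j : Fin n) : drawSeq t j = ((t j : ℕ) : ℤ) := by
  simp [drawSeq]

lemma exists_mem_initial [NeZero N] (hF : Fits N k μ) (a : ZMod N × ZMod N × ZMod N) {c : ℕ} (hc :
  100 ≤ c) : ∀ i < 7, (initial N k μ a c).mem i = ([(N : ℤ), (size N : ℤ), (k : ℤ), toFixed N μ,
  (a.1.val : ℤ), (a.2.1.val : ℤ), (a.2.2.val : ℤ)] : List ℤ).getD i 0 := by
  have hA := hF.adm
  have hL := hA.size_ge
  have hNle := Admissible.N_le' (N := N)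
  have hkL := hA.k_le
  have hLL : ((size N : ℕ) : ℤ) ≤ 2 ^ size N := mod_cast lt_two_pow_self.le
  have hμ : 0 ≤ toFixed N μ := Int.floor_nonneg.2 (mul_nonneg (by positivity) hF.nonneg)
  have hsm : ∀ z : ℕ, (z : ℤ) ≤ 2 ^ size N → wrap N z = z := fun z h1 =>
    hA.wrap_small (abs_le_two_pow h1)
  have hv : ∀ x : ZMod N, (x.val : ℤ) ≤ 2 ^ size N := fun x =>
    le_trans (mod_cast (ZMod.val_lt x).le) hNle
  intro i hi
  simp only [initial, if_pos (show i < c by omega)]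
  interval_cases i
  · exact hsm _ hNle
  · exact hsm _ hLL
  · exact hsm _ hkL
  · exact hA.wrap_small (b := 3 * size N) (by
      show |toFixed N μ| ≤ _
      rw [abs_of_nonneg hμ]; exact hF.le)
  · exact hsm _ (hv _)
  · exact hsm _ (hv _)
  · exact hsm _ (hv _)

/-- A run consists of random draws, followed by a deterministic computation. -/
theorem exists_run_eq [NeZero N] (hF : Fits N k μ) {a : ZMod N × ZMod N × ZMod N} (ha : a ∈
  slopeTriples N) (R : ZMod N → ℂ) : ∃ f : Fin N × (Fin (draws N) → Fin N) × (Fin (draws N) → Fin N)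
  → Config, (algorithm k).run N k μ a R = (uniformOfFintype _).bind (PMF.pure ∘ f) ∧ ∀ r, Output N k
  (toFixed N μ) a R (r.1 : ℕ) (drawSeq r.2.1) (drawSeq r.2.2) (f r) ∧ (f r).ops ≤ opBound k (size N)
  ∧ (f r).samples ≤ (f r).ops := by
  have hA := hF.adm
  have hDs := hF.addr_le
  set c := (algorithm k).cells N with hc
  have hcD : c = drawAddr k + 2 * draws N := rfl
  have hD100 : 100 ≤ drawAddr k := hA.D_ge
  have hc100 : 100 ≤ c := by omega
  have h100 : wrap N 100 = 100 := hA.wrap_small (b := 7) (by simp)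
  set s0 := initial N k μ a c with hs0
  have m0 := exists_mem_initial hF a hc100
  rw [← hs0] at m0
  have hDb : drawAddr k + 2 * draws N ≤ 2 ^ size N := by
    have := hA.D_le; rw [draws]; omega
  have hNb : N ≤ 2 ^ size N := (lt_size_self N).le
  have hμ : 0 ≤ toFixed N μ := Int.floor_nonneg.2 (mul_nonneg (by positivity) hF.nonneg)
  -- precomputation
  obtain ⟨s1, r1, ag1, op1, sm1⟩ := St.run_code R hc100 h100 (F := [1]) (by decide)
    (fun r => (s0.mem r).toNat) (Algo.setup (drawAddr k)) s0 s0.mem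
    (Algo.setup_ok _) (fun _ _ => rfl) (fun _ _ => le_rfl)
  have hcs := Algo.cost_setup (fun r => (s0.mem r).toNat) (drawAddr k)
  have hS := exec_setup (c := c) (R := R) (m := s0.mem) hA hDs (m0 0 (by simp)) (m0 1 (by simp))
  have e1 : (s0.mem 1).toNat = size N := by rw [m0 1 (by simp)]; simp
  have i0 : s0.ops = 0 := rfl
  have i1 : s0.samples = 0 := rfl
  simp only [e1] at hcs
  have hs1 : ∀ r < 60, s1.mem r = (Algo.setup (drawAddr k)).exec N c R s0.mem r := fun r hr =>
    ag1 r (Or.inl hr)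
  -- the dilation
  set s2 : Fin N → Config := fun b => s1.tick.write N c 13 ((b : ℕ) : ℤ) with hs2
  have hbw : ∀ b : Fin N, wrap N ((b : ℕ) : ℤ) = ((b : ℕ) : ℤ) := fun b =>
    hA.wrap_small (abs_le_two_pow (mod_cast b.2.le.trans hNb))
  have s2m : ∀ b, (s2 b).mem = update s1.mem 13 ((b : ℕ) : ℤ) := fun b => by
    simp only [hs2, write, tick]; rw [if_pos (by omega), hbw]
  have s2o : ∀ b, (s2 b).ops = s1.ops + 1 ∧ (s2 b).samples = s1.samples := fun b => by
    simp only [hs2, write, tick]; rw [if_pos (by omega)]; simp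
  have q0 : ∀ b, (s2 b).mem 0 = N := fun b => by
    rw [s2m, update_of_ne (by simp), hs1 0 (by simp), hS.low 0 (by simp)]
    exact m0 0 (by simp)
  have q9 : ∀ b, (s2 b).mem 9 = draws N := fun b => by
    rw [s2m, update_of_ne (by simp), hs1 9 (by simp), hS.r9]; simp [draws]
  have q16 : ∀ b, (s2 b).mem 16 = drawAddr k := fun b => by
    rw [s2m, update_of_ne (by simp), hs1 16 (by simp), hS.r16]
  have q17 : ∀ b, (s2 b).mem 17 = (drawAddr k + draws N : ℕ) := fun b => by
    rw [s2m, update_of_ne (by simp), hs1 17 (by simp), hS.r17]; simp [draws]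
  -- the draws
  have hd1 := fun b => run_drawLoop R hc100 h100 (r := 16) (by simp) (B := drawAddr k)
    (n := draws N) (b := size N) hD100 (by omega) (by omega) hNb (by rw [wordLen]; omega) (s2 b)
    (q0 b) (q9 b) (q16 b)
  choose f1 hf1 hf1' using hd1
  have hd2 := fun b t => run_drawLoop R hc100 h100 (r := 17) (by simp) (B := drawAddr k + draws N)
    (n := draws N) (b := size N) (by omega) (by omega) (by omega) hNb (by rw [wordLen]; omega) (f1 b
    t) (by rw [(hf1' b t).1 0 (by simp) (by simp) (by simp), q0]) (by rw [(hf1' b t).1 9 (by simp)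
    (by simp) (by simp), q9]) (by rw [(hf1' b t).1 17 (by simp) (by simp) (by simp), q17])
  choose f2 hf2 hf2' using hd2
  -- the deterministic part
  have hd3 : ∀ r : Fin N × (Fin (draws N) → Fin N) × (Fin (draws N) → Fin N), ∃ s', (Prog.seq
    (Algo.mainAt k).code (Algo.finishAt k).code).run N c R (f2 r.1 r.2.1 r.2.2) = PMF.pure s' ∧
    (Output N k (toFixed N μ) a R (r.1 : ℕ) (drawSeq r.2.1) (drawSeq r.2.2) s' ∧ s'.ops ≤ opBound k
    (size N) ∧ s'.samples ≤ s'.ops) := by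
    rintro ⟨b, t, t'⟩
    obtain ⟨a1, a2, a3, a4, a5⟩ := hf1' b t
    obtain ⟨b1, b2, b3, b4, b5⟩ := hf2' b t t'
    have hlow : ∀ i < 24, (f2 b t t').mem i = update ((Algo.setup (drawAddr k)).exec N c R s0.mem)
      13 ((b : ℕ) : ℤ) i := by
      intro i hi
      rw [b1 i (by omega) (by omega) (by omega), a1 i (by omega) (by omega) (by omega), s2m]
      by_cases h : i = 13
      · subst h; simp
      · rw [update_of_ne h, update_of_ne h, hs1 i (by omega)]
    have hne : ∀ i < 24, i ≠ 13 → (f2 b t t').mem i = (Algo.setup (drawAddr k)).exec N c R s0.mem i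
      := fun i hi h => by
      rw [hlow i hi, update_of_ne h]
    have hin : ∀ i < 7, (f2 b t t').mem i = _ := fun i hi => by
      rw [hne i (by omega) (by omega), hS.low i hi, m0 i hi]
    have h3 : (f2 b t t').mem 3 = toFixed N μ := hin 3 (by simp)
    have h4 : (f2 b t t').mem 4 = a.1.val := hin 4 (by simp)
    have h5 : (f2 b t t').mem 5 = a.2.1.val := hin 5 (by simp)
    have h6 : (f2 b t t').mem 6 = a.2.2.val := hin 6 (by simp)
    have h13 : (f2 b t t').mem 13 = (b : ℕ) := by rw [hlow 13 (by simp)]; simp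
    have hv : ∀ x : ZMod N, (0 : ℤ) ≤ x.val ∧ (x.val : ℤ) < N := fun x =>
      ⟨by positivity, mod_cast ZMod.val_lt x⟩
    have hR : Ready N k (drawAddr k) (f2 b t t').mem (f2 b t t').mem := by
      refine ⟨hin 0 (by simp), hin 2 (by simp), rfl, rfl, rfl, rfl, ?_, ?_, ?_, ?_, ?_, ?_,
        rfl, ?_, ?_, ?_, ?_⟩ <;> rw [hne _ (by simp) (by simp)]
      exacts [hS.r7, hS.r8, hS.r9, hS.r10, hS.r11, hS.r12, hS.r14, hS.r15, hS.r16, hS.r17]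
    have hI : Inputs N (f2 b t t').mem := by
      constructor <;> simp only [h3, h4, h5, h6, h13]
      exacts [⟨hμ, hF.le⟩, hv _, hv _, hv _, ⟨by positivity, mod_cast b.2⟩]
    have hdr : ∀ (t : Fin (draws N) → Fin N) (j : Fin (draws N)), ((t j : ℕ) : ℤ) = drawSeq t j ∧ 0
      ≤ drawSeq t j ∧ drawSeq t j < N := fun t j => by
      rw [drawSeq_apply]; exact ⟨rfl, by positivity, mod_cast (t j).2⟩
    have hD : Drawn (drawAddr k) (draws N) N (drawSeq t) (f2 b t t').mem := fun j hj => by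
      rw [b3 _ (by omega) (by omega), a2 ⟨j, hj⟩]; exact hdr t ⟨j, hj⟩
    have hD' : Drawn (drawAddr k + draws N) (draws N) N (drawSeq t') (f2 b t t').mem :=
      fun j hj => by rw [b2 ⟨j, hj⟩]; exact hdr t' ⟨j, hj⟩
    obtain ⟨s', z1, z2, z3, z4⟩ := run_main_finish (c := c) (R := R) hF ha (by omega) hI h4 h5 h6 hR hD hD'
    rw [h3, h13] at z2
    refine ⟨s', z1, z2, ?_, ?_⟩
    · have := (s2o b).1
      rw [opBound]
      rw [draws] at a4 b4
      omega
    · have := (s2o b).1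
      have := (s2o b).2
      omega
  choose f hf hf' using hd3
  refine ⟨f, ?_, hf'⟩
  have hrand : ∀ s : Config, s.mem 0 = N → (Prog.rand 13 0).run N c R s = (uniformOfFintype (Fin
    N)).bind fun i =>
        PMF.pure (s.tick.write N c 13 ((i : ℕ) : ℤ)) := fun s hs => run_rand R s hs
  have q1 : s1.mem 0 = N := by
    rw [hs1 0 (by simp), hS.low 0 (by simp)]; exact m0 0 (by simp)
  have hmf : ∀ r : Fin N × (Fin (draws N) → Fin N) × (Fin (draws N) → Fin N), ((Algo.mainAt
    k).code.run N c R (f2 r.1 r.2.1 r.2.2)).bind ((Algo.finishAt k).code.run N c R) = PMF.pure (f r)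
    := fun r => by
    have := hf r
    rwa [Prog.run] at this
  rw [Algorithm.run, ← hc, ← hs0, algorithm]
  simp only [Prog.run]
  have hr1 : (Algo.setup (drawAddr k)).code.run N c R s0 = PMF.pure s1 := r1
  rw [hr1, PMF.pure_bind, ← Prog.run, hrand s1 q1, PMF.bind_bind,
    ← uniform_bind_bind (Equiv.refl _)]
  congr 1
  funext b
  rw [PMF.pure_bind]
  change ((drawLoop 16).run N c R (s2 b)).bind _ = _
  rw [hf1, PMF.bind_bind, Equiv.coe_refl]
  simp only [id]
  rw [← uniform_bind_bind (Equiv.refl _) (g := fun y => (PMF.pure ∘ f) (b, y))]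
  congr 1
  funext t
  rw [Function.comp, PMF.pure_bind, hf2, PMF.bind_bind]
  congr 1
  funext t'
  rw [Function.comp, PMF.pure_bind]
  exact hmf (b, t, t')

end

/-! ## Resources -/

/-- For `L ≥ 2` the root is at least 2, so it is at most twice its predecessor, whose eighth power
is below `L`; and `256 = 2 ^ 8`. -/
lemma ell_pow_le {L : ℕ} (hL : 2 ≤ L) : ell L ^ 8 ≤ 256 * L := by
  have h1 := ell_pred_pow_lt (L := L) (by omega)
  have h2 := le_ell_pow L
  have h3 : 2 ≤ ell L := by
    by_contra h
    have : ell L ≤ 1 := by omega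
    have := Nat.pow_le_pow_left this 8
    omega
  calc ell L ^ 8 ≤ (2 * (ell L - 1)) ^ 8 := Nat.pow_le_pow_left (by omega) 8
    _ = 256 * (ell L - 1) ^ 8 := by rw [mul_pow]; norm_num
    _ ≤ 256 * L := by omega

lemma le_ell_pow_four {L B : ℕ} (h : B ^ 2 ≤ L) : B ≤ ell L ^ 4 := by
  have h1 := le_ell_pow L
  by_contra hlt
  have : (ell L ^ 4) ^ 2 < B ^ 2 := Nat.pow_lt_pow_left (by omega) (by simp)
  rw [← pow_mul, show 4 * 2 = 8 from rfl] at this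
  omega

/-- The leading term is the nest of loops over `W^2` grid points, `L + 2` digits, `L W` draws and
`W` samples. The contributions of `k` are absorbed in `(1 + k)^3`, which is fixed as `N` grows. -/
lemma opBound_le {k L : ℕ} (hL : 2 ≤ L) : opBound k L ≤ 1000000 * (1 + k) ^ 3 * (L ^ 2 * ell L ^ 4)
  := by
  have hW := ell_pos (L := L) (by omega)
  obtain ⟨w, hw⟩ : ∃ w, ell L = w + 1 := ⟨ell L - 1, by omega⟩
  obtain ⟨l, rfl⟩ : ∃ l, L = l + 2 := ⟨L - 2, by omega⟩
  set W := ell (l + 2) with hWdef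
  set X := (l + 2) ^ 2 * W ^ 4 with hX
  have hW1 : 1 ≤ W := hW
  have h1 : 1 ≤ X := Nat.one_le_iff_ne_zero.2 (by positivity)
  have h2 : (l + 2) * W ≤ X := by
    rw [hX, sq]
    calc (l + 2) * W = (l + 2) * 1 * (W * 1) := by ring
      _ ≤ (l + 2) * (l + 2) * (W * W ^ 3) := by gcongr <;> first | omega | exact Nat.one_le_pow _ _ hW1
      _ = _ := by ring
  have h3 : l + 2 ≤ X := le_trans (Nat.le_mul_of_pos_right _ hW) h2
  have h4 : (1 + W * W) * ((1 + (l + 2 + 2)) * ((1 + (l + 2) * W) * (1 + W)) + k) ≤ (24 + 2 * k) * X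
    := by
    have b1 : 1 + W * W ≤ 2 * (W * W) := by nlinarith
    have b2 : 1 + (l + 2 + 2) ≤ 3 * (l + 2) := by omega
    have b3 : 1 + (l + 2) * W ≤ 2 * ((l + 2) * W) := by nlinarith
    have b4 : 1 + W ≤ 2 * W := by omega
    have b5 : W * W ≤ X := by
      rw [hX]
      calc W * W = 1 * (W ^ 2 * 1) := by ring
        _ ≤ (l + 2) ^ 2 * (W ^ 2 * W ^ 2) := by
          gcongr <;> exact Nat.one_le_pow _ _ (by omega)
        _ = _ := by ring
    calc (1 + W * W) * ((1 + (l + 2 + 2)) * ((1 + (l + 2) * W) * (1 + W)) + k)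
        ≤ 2 * (W * W) * (3 * (l + 2) * (2 * ((l + 2) * W) * (2 * W)) + k) := by gcongr
      _ = 24 * X + 2 * k * (W * W) := by rw [hX]; ring
      _ ≤ 24 * X + 2 * k * X := by gcongr
      _ = _ := by ring
  have h5 : 1 ≤ (1 + k) ^ 3 := Nat.one_le_pow _ _ (by omega)
  have h6 : k ≤ (1 + k) ^ 3 := by nlinarith [Nat.zero_le k, Nat.zero_le (k * k), Nat.zero_le (k * k * k)]
  rw [opBound, ← hWdef]
  set C := (1 + k) ^ 3 with hC
  have e1 : X ≤ C * X := Nat.le_mul_of_pos_left _ h5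
  have e2 : k * X ≤ C * X := Nat.mul_le_mul_right _ h6
  have e3 : C ≤ C * X := Nat.le_mul_of_pos_right _ h1
  have e4 : (24 + 2 * k) * X = 24 * X + 2 * (k * X) := by ring
  rw [mul_assoc 1000000]
  omega

/-- As `W^8 ≤ 256 L`, the left side is of order `L^(5/2)`. Multiplying by `W^4` makes this visible:
it remains to have `256 c ≤ C W^4`, which holds once `W^4 ≥ B`. -/
lemma mul_pow_le_of_ell {C : ℝ} (hC : 0 < C) (c : ℕ) : ∃ L₀ : ℕ, ∀ L ≥ L₀, ((c * (L ^ 2 * ell L ^ 4)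
  : ℕ) : ℝ) ≤ C * (L : ℝ) ^ 3 := by
  obtain ⟨B, hB⟩ := exists_nat_ge (256 * c / C)
  refine ⟨max 2 (B ^ 2), fun L hL => ?_⟩
  have hL2 : 2 ≤ L := (le_max_left _ _).trans hL
  have h4 : B ≤ ell L ^ 4 := le_ell_pow_four ((le_max_right _ _).trans hL)
  have h8 := ell_pow_le hL2
  have hW := ell_pos (L := L) (by omega)
  have hW4 : (0 : ℝ) < (ell L : ℝ) ^ 4 := by positivity
  have h4' : (B : ℝ) ≤ (ell L : ℝ) ^ 4 := mod_cast h4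
  have h8' : (ell L : ℝ) ^ 8 ≤ 256 * L := mod_cast h8
  have h5 : 256 * c ≤ C * (ell L : ℝ) ^ 4 := by
    rw [div_le_iff₀ hC] at hB
    nlinarith
  push_cast
  refine le_of_mul_le_mul_right ?_ hW4
  calc (c : ℝ) * ((L : ℝ) ^ 2 * (ell L : ℝ) ^ 4) * (ell L : ℝ) ^ 4
      = c * (L : ℝ) ^ 2 * (ell L : ℝ) ^ 8 := by ring
    _ ≤ c * (L : ℝ) ^ 2 * (256 * L) := by gcongr
    _ = 256 * c * (L : ℝ) ^ 3 := by ring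
    _ ≤ C * (ell L : ℝ) ^ 4 * (L : ℝ) ^ 3 := by gcongr
    _ = _ := by ring

/-- `L ≤ 2 (L - 1)`, `(L - 1) log 2 ≤ log N`, and `log 2 > 1/2`. -/
lemma size_le_log {N : ℕ} (hN : 2 ≤ size N) : (size N : ℝ) ≤ 4 * Real.log N := by
  have h1 : 2 ^ (size N - 1) ≤ N := Nat.lt_size.1 (by omega)
  have h2 : ((2 : ℝ) ^ (size N - 1)) ≤ N := mod_cast h1
  have h3 := Real.log_le_log (by positivity) h2
  rw [Real.log_pow] at h3
  have h4 := Real.log_two_gt_d9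
  have h5 : ((size N - 1 : ℕ) : ℝ) = size N - 1 := by rw [Nat.cast_sub (by omega)]; simp
  have h6 : (2 : ℝ) ≤ size N := mod_cast hN
  rw [h5] at h3
  nlinarith

lemma le_size {N L : ℕ} (h : 2 ^ L ≤ N) : L ≤ size N := (Nat.lt_size.2 h).le

lemma fits_of_size {N k : ℕ} {μ : ℝ} (hk : 1 ≤ k) (hμ : 0 ≤ μ) (h40 : 40 ≤ size N) (hD : drawAddr k
  ≤ size N) (hμL : μ ≤ size N) : Fits N k μ := by
  set L := size N with hL
  -- The linear term covers the addresses and `8 (k + 1)^3 ≤ 64 k^3 ≤ 32 L`, and separately the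
  -- bound `256 L` for the eighth power of the window length.
  have hpow : 2 * (L * L) + 300 * L ≤ 2 ^ L := by
    refine Nat.le_induction (P := fun L _ => 2 * (L * L) + 300 * L ≤ 2 ^ L) (by simp)
      (fun n hn ih => ?_) L h40
    rw [pow_succ]
    have : 2 * ((n + 1) * (n + 1)) = 2 * (n * n) + 4 * n + 2 := by ring
    omega
  have hDk : drawAddr k = 104 + 12 * k + 2 * k ^ 3 := by
    simp only [drawAddr, shiftAddr, peakAddr]; ring
  have hk3 : (k + 1) ^ 3 ≤ 8 * k ^ 3 := by
    calc (k + 1) ^ 3 ≤ (2 * k) ^ 3 := Nat.pow_le_pow_left (by omega) 3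
      _ = _ := by ring
  have hell := ell_le L
  refine ⟨⟨h40, by omega, ?_, ?_⟩, hk, hD, hμ, ?_⟩
  · have : L * ell L ≤ L * L := Nat.mul_le_mul_left _ hell
    rw [← hL]
    omega
  · rw [← hL]; exact (ell_pow_le (by omega)).trans (by omega)
  · rw [toFixed, ← hL]
    have h1 : (L : ℝ) ≤ 2 ^ L := mod_cast lt_two_pow_self.le
    have h2 : (2 : ℝ) ^ (2 * L) * μ ≤ 2 ^ (3 * L) := by
      calc (2 : ℝ) ^ (2 * L) * μ ≤ 2 ^ (2 * L) * 2 ^ L := by gcongr; linarith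
        _ = _ := by rw [← pow_add]; congr 1; ring
    have h3 := (Int.floor_le ((2 : ℝ) ^ (2 * L) * μ)).trans h2
    exact_mod_cast h3

lemma cells_algorithm (k N : ℕ) : (algorithm k).cells N = drawAddr k + 2 * (size N * ell (size N))
  := rfl

/-- For large moduli everything fits and the resources are as small as we please. -/
lemma exists_resources {k : ℕ} {μ C : ℝ} (hk : 1 ≤ k) (hμ : 0 ≤ μ) (hC : 0 < C) : ∃ n₀ : ℕ, ∀ N ≥
  n₀, Fits N k μ ∧ (opBound k (size N) : ℝ) ≤ C * Real.log N ^ 3 ∧ ((algorithm k).memoryBits N : ℝ)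
  ≤ C * Real.log N ^ 3 := by
  -- The factor `64 = 4 ^ 3` pays for the passage from `L^3` to `(log N)^3` by `size_le_log`.
  obtain ⟨L₁, h₁⟩ := mul_pow_le_of_ell (C := C / 64) (by positivity) (1000000 * (1 + k) ^ 3)
  obtain ⟨L₂, h₂⟩ := mul_pow_le_of_ell (C := C / 64) (by positivity) 32
  obtain ⟨L₃, h₃⟩ := exists_nat_ge μ
  obtain ⟨d, hd⟩ : ∃ d, (algorithm k).prog.depth = d := ⟨_, rfl⟩
  refine ⟨2 ^ (40 + L₁ + L₂ + L₃ + d + drawAddr k), fun N hN => ?_⟩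
  have hL := le_size hN
  set L := size N with hLdef
  have hμL : μ ≤ L := h₃.trans (by exact_mod_cast (by omega : L₃ ≤ L))
  have hlog := size_le_log (N := N) (by omega)
  rw [← hLdef] at hlog
  have h3 : C / 64 * (L : ℝ) ^ 3 ≤ C * Real.log N ^ 3 := by
    have : (L : ℝ) ^ 3 ≤ (4 * Real.log N) ^ 3 := pow_le_pow_left₀ (Nat.cast_nonneg L) hlog 3
    calc C / 64 * (L : ℝ) ^ 3 ≤ C / 64 * (4 * Real.log N) ^ 3 := by gcongr
      _ = _ := by ring
  refine ⟨fits_of_size hk hμ (by omega) (by omega) hμL, ?_, ?_⟩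
  · refine le_trans ?_ ((h₁ L (by omega)).trans h3)
    exact_mod_cast opBound_le (by omega)
  · refine le_trans ?_ ((h₂ L (by omega)).trans h3)
    have hW := ell_pos (L := L) (by omega)
    have : (algorithm k).memoryBits N = (drawAddr k + 2 * (L * ell L) + d) * (8 * L) := by
      rw [Algorithm.memoryBits, hd, cells_algorithm, wordLen]
    rw [this]
    have h4 : drawAddr k + 2 * (L * ell L) + d ≤ 4 * (L * ell L) := by
      have : L ≤ L * ell L := Nat.le_mul_of_pos_right _ hW
      omega
    have h5 : ell L ≤ ell L ^ 4 := Nat.le_self_pow (by simp) _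
    have h6 : (drawAddr k + 2 * (L * ell L) + d) * (8 * L) ≤ 32 * (L ^ 2 * ell L ^ 4) := by
      calc (drawAddr k + 2 * (L * ell L) + d) * (8 * L) ≤ 4 * (L * ell L) * (8 * L) := by gcongr
        _ = 32 * (L ^ 2 * ell L) := by ring
        _ ≤ _ := by gcongr
    exact_mod_cast h6

/-! ## Every run ends in an output of `SCE` -/

section
variable {N k : ℕ} {μ : ℝ} {R : ZMod N → ℂ}

/-- With `q = 2 ^ (2 L)` the threshold is stored as the integer part of `q μ`, and `q μ < toFixed N
μ + 1`. Comparing with the rounded-up threshold makes the inequality strict for the real one; the `+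
1` on the right turns `<` of integers into `≤`. -/
lemma lt_norm_of_fixed {x y : ℤ} (h : (toFixed N μ + 1) * (toFixed N μ + 1) < x * x + y * y + 1) : μ
  < ‖(⟨ofFixed N x, ofFixed N y⟩ : ℂ)‖ := by
  by_contra! hle
  have hμ : 0 ≤ μ := (norm_nonneg _).trans hle
  have hq : (0 : ℝ) < 2 ^ (2 * size N) := by positivity
  have h1 : (2 : ℝ) ^ (2 * size N) * μ < toFixed N μ + 1 := Int.lt_floor_add_one _
  have h2 : ((toFixed N μ : ℝ) + 1) * (toFixed N μ + 1) ≤ x * x + y * y := by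
    exact_mod_cast Int.lt_add_one_iff.1 h
  have h3 : ‖(⟨ofFixed N x, ofFixed N y⟩ : ℂ)‖ ^ 2 ≤ μ ^ 2 := pow_le_pow_left₀ (norm_nonneg _) hle 2
  rw [sq_norm, Complex.normSq_mk] at h3
  simp only [ofFixed] at h3
  have h4 : (x : ℝ) * x + y * y ≤ (2 ^ (2 * size N) * μ) ^ 2 := by
    rw [div_mul_div_comm, div_mul_div_comm, ← add_div, div_le_iff₀ (by positivity)] at h3
    linarith
  nlinarith [mul_nonneg hq.le hμ]

lemma PeakOutput.lt_norm {a b u bd : ℤ} {t t' : ℕ → ℤ} {l : List (Peak N)} (h : PeakOutput N k R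
  (toFixed N μ) a b u bd t t' l) : ∀ x ∈ l, μ < ‖x.est‖ := by
  intro x hx
  obtain ⟨s, -, h1, rfl⟩ := h.mem x hx
  exact lt_norm_of_fixed h1

lemma PeakOutput.mem_line {a b u bd μ : ℤ} {t t' : ℕ → ℤ} {l : List (Peak N)} (h : PeakOutput N k R
  μ a b u bd t t' l) : ∀ x ∈ l, x.pt ∈ line (b : ZMod N) := by
  intro x hx
  obtain ⟨s, -, -, rfl⟩ := h.mem x hx
  exact rfl

lemma Output.isSCEOutput [NeZero N] {a : ZMod N × ZMod N × ZMod N} {bd : ℤ} {t t' : ℕ → ℤ} {s :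
  Config} (h : Output N k (toFixed N μ) a R bd t t' s) : IsSCEOutput k μ a s := by
  obtain ⟨u₀, -, p₀⟩ := h.peaks₀
  obtain ⟨u₁, -, p₁⟩ := h.peaks₁
  obtain ⟨u₂, -, p₂⟩ := h.peaks₂
  refine ⟨fun i hi => ?_, ?_, ?_, ?_, h.shifts⟩
  · interval_cases i
    exacts [⟨p₀.length_le, p₀.lt_norm⟩, ⟨p₁.length_le, p₁.lt_norm⟩, ⟨p₂.length_le, p₂.lt_norm⟩]
  · simpa only [intCast_val] using p₀.mem_line
  · simpa only [intCast_val] using p₁.mem_line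
  · simpa only [intCast_val] using p₂.mem_line

/-- The space of draws. -/
abbrev Draws (N : ℕ) : Type := Fin N × (Fin (draws N) → Fin N) × (Fin (draws N) → Fin N)

lemma implements [NeZero N] (hF : Fits N k μ) : Implements (algorithm k) N k μ := by
  intro a ha R s hs
  obtain ⟨f, hf, hf'⟩ := exists_run_eq hF ha R
  rw [hf, PMF.mem_support_bind_iff] at hs
  obtain ⟨r, -, hr⟩ := hs
  rw [Function.comp, PMF.mem_support_pure_iff] at hr
  subst hr
  exact (hf' r).1.isSCEOutput

lemma runsWithin [NeZero N] (hF : Fits N k μ) {n t : ℝ} (hn : (opBound k (size N) : ℝ) ≤ n) (ht :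
  (opBound k (size N) : ℝ) ≤ t) : RunsWithin (algorithm k) N k μ n t := by
  intro a ha R s hs
  obtain ⟨f, hf, hf'⟩ := exists_run_eq hF ha R
  rw [hf, PMF.mem_support_bind_iff] at hs
  obtain ⟨r, -, hr⟩ := hs
  rw [Function.comp, PMF.mem_support_pure_iff] at hr
  subst hr
  obtain ⟨-, h1, h2⟩ := hf' r
  exact ⟨le_trans (mod_cast h2.trans h1) hn, le_trans (mod_cast h1) ht⟩

open Classical in
/-- The probability of an event is at most that of bad draws. -/
lemma run_le [NeZero N] (hF : Fits N k μ) {a : ZMod N × ZMod N × ZMod N} (ha : a ∈ slopeTriples N)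
  (R : ZMod N → ℂ) (E : Set Config) (bad : Draws N → Prop) (h : ∀ r s, Output N k (toFixed N μ) a R
  (r.1 : ℕ) (drawSeq r.2.1) (drawSeq r.2.2) s → ¬ bad r → s ∉ E) : ((algorithm k).run N k μ a
  R).toOuterMeasure E ≤ ((univ.filter bad).card : ℝ≥0∞) / Fintype.card (Draws N) := by
  obtain ⟨f, hf, hf'⟩ := exists_run_eq hF ha R
  rw [hf, PMF.toOuterMeasure_bind_apply, tsum_fintype, Finset.card_filter]
  push_cast
  rw [div_eq_mul_inv, sum_mul]
  refine sum_le_sum fun r _ => ?_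
  rw [PMF.uniformOfFintype_apply, mul_comm, Function.comp, PMF.toOuterMeasure_pure_apply]
  gcongr
  split_ifs with h1 h2
  · exact le_rfl
  · exact absurd h1 (h r (f r) (hf' r).1 h2)
  · exact zero_le
  · exact le_rfl

/-- Subadditivity of the outer measure is enough here, so lower bounds for probabilities need no
measurability of events. -/
lemma run_compl [NeZero N] (a : ZMod N × ZMod N × ZMod N) (R : ZMod N → ℂ) (E : Set Config) : 1 ≤
  ((algorithm k).run N k μ a R).toOuterMeasure E + ((algorithm k).run N k μ a R).toOuterMeasure Eᶜ
  := by
  set p := (algorithm k).run N k μ a R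
  have h1 : p.toOuterMeasure Set.univ = 1 :=
    (PMF.toOuterMeasure_apply_eq_one_iff _ _).2 (Set.subset_univ _)
  rw [← h1, ← Set.union_compl_self E]
  exact measure_union_le _ _

end

/-! ## Fixed point arithmetic -/

/-- `exp (2πi x)` -/
def ez (x : ℝ) : ℂ := Complex.exp ((2 * pi * x : ℝ) * I)

lemma ez_add (x y : ℝ) : ez (x + y) = ez x * ez y := by
  rw [ez, ez, ez, ← Complex.exp_add]; congr 1; push_cast; ring

lemma norm_ez (x : ℝ) : ‖ez x‖ = 1 := Complex.norm_exp_ofReal_mul_I _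

lemma ez_zero : ez 0 = 1 := by simp [ez]

lemma ez_neg (x : ℝ) : ez (-x) = conj (ez x) := by
  rw [ez, ez, ← Complex.exp_conj, map_mul, Complex.conj_ofReal, Complex.conj_I]
  congr 1; push_cast; ring

lemma ez_eq (x : ℝ) : ez x = Real.cos (2 * pi * x) + Real.sin (2 * pi * x) * I := by
  rw [ez, Complex.exp_mul_I]; push_cast; rfl

lemma ez_div_eq {N : ℕ} [NeZero N] (j : ℤ) : ez (j / N) = stdAddChar (j : ZMod N) := by
  rw [ZMod.stdAddChar_coe, ez]; congr 1; push_cast; ring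

lemma norm_stdAddChar {N : ℕ} [NeZero N] (x : ZMod N) : ‖stdAddChar x‖ = 1 := by
  rw [← intCast_val x, ← ez_div_eq, norm_ez]

section
variable {N : ℕ} {R : ZMod N → ℂ}

lemma abs_toFixed_sub_le (N : ℕ) (x : ℝ) : |(toFixed N x : ℝ) - 2 ^ (2 * size N) * x| ≤ 1 := by
  rw [toFixed, abs_le]
  constructor
  · linarith [Int.lt_floor_add_one ((2 : ℝ) ^ (2 * size N) * x)]
  · linarith [Int.floor_le ((2 : ℝ) ^ (2 * size N) * x)]

lemma norm_le_two {x y : ℝ} (hx : |x| ≤ 1) (hy : |y| ≤ 1) : ‖(x : ℂ) + y * I‖ ≤ 2 := by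
  refine (norm_add_le _ _).trans ?_
  simp only [norm_mul, Complex.norm_I, norm_real, Real.norm_eq_abs]
  linarith

/-- Both factors, rounded to multiples of `1 / q`, are off by at most `2` units as complex numbers.
Multiplying out leaves `2 q ‖R i‖ + 2 (q + 2)`, and `q ≥ 1`. -/
lemma norm_term_sub_le (i x y : ℤ) : ‖((termRe N R i x y : ℂ) + termIm N R i x y * I) - 2 ^ (4 *
  size N) * (conj (R i) * ez (x / y))‖ ≤ 2 ^ (2 * size N) * (2 * ‖R i‖ + 6) := by
  set q : ℝ := 2 ^ (2 * size N) with hq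
  have hq1 : 1 ≤ q := one_le_pow₀ (by simp)
  set X := toFixed N (R i).re
  set Y := toFixed N (R i).im
  set C := toFixed N (Real.cos (2 * pi * (x : ℝ) / (y : ℝ)))
  set S := toFixed N (Real.sin (2 * pi * (x : ℝ) / (y : ℝ)))
  set z := conj (R i) with hz
  set e := ez (x / y) with he
  set d₁ : ℂ := (((X : ℝ) - q * (R i).re : ℝ) : ℂ) + ((-((Y : ℝ) - q * (R i).im) : ℝ) : ℂ) *
    I with hd₁
  set d₂ : ℂ := (((C : ℝ) - q * Real.cos (2 * pi * (x : ℝ) / (y : ℝ)) : ℝ) : ℂ) +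
    (((S : ℝ) - q * Real.sin (2 * pi * (x : ℝ) / (y : ℝ)) : ℝ) : ℂ) * I with hd₂
  have h1 : ‖d₁‖ ≤ 2 := norm_le_two (abs_toFixed_sub_le N _)
    (by rw [abs_neg]; exact abs_toFixed_sub_le N _)
  have h2 : ‖d₂‖ ≤ 2 := norm_le_two (abs_toFixed_sub_le N _) (abs_toFixed_sub_le N _)
  have e1 : (X : ℂ) - Y * I = q * z + d₁ := by
    have : z = (R i).re - (R i).im * I := by
      rw [hz]; apply Complex.ext <;> simp
    rw [this, hd₁]; push_cast; ring
  have e2 : (C : ℂ) + S * I = q * e + d₂ := by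
    rw [he, ez_eq, hd₂, mul_div_assoc]; push_cast; ring
  have e3 : ((termRe N R i x y : ℂ) + termIm N R i x y * I) = ((X : ℂ) - Y * I) * (C + S * I) := by
    simp only [termRe, termIm]
    push_cast
    linear_combination ((Y : ℂ) * S) * Complex.I_sq
  have e4 : (2 : ℂ) ^ (4 * size N) = q * q := by
    rw [hq]; push_cast; rw [← pow_add]; congr 1; ring
  rw [e3, e1, e2, e4]
  have : (q * z + d₁) * (q * e + d₂) - q * q * (z * e) = q * z * d₂ + d₁ * (q * e + d₂) := by ring
  rw [this]
  have hzn : ‖z‖ = ‖R i‖ := RCLike.norm_conj _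
  have hqn : ‖(q : ℂ)‖ = q := by rw [norm_real, Real.norm_of_nonneg (by positivity)]
  have h3 : ‖q * e + d₂‖ ≤ q + 2 := by
    refine (norm_add_le _ _).trans ?_
    rw [norm_mul, hqn, he, norm_ez]; linarith
  calc ‖q * z * d₂ + d₁ * (q * e + d₂)‖ ≤ q * ‖R i‖ * 2 + 2 * (q + 2) := by
        refine (norm_add_le _ _).trans (add_le_add ?_ ?_)
        · rw [norm_mul, norm_mul, hqn, hzn]; gcongr
        · rw [norm_mul]; gcongr
    _ ≤ _ := by nlinarith

/-- The dechirped signal, normalised. -/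
def dechirp [NeZero N] (a : ZMod N) (R : ZMod N → ℂ) (t : ZMod N) : ℂ :=
  √N * (stdAddChar ((2 : ZMod N)⁻¹ * a * t ^ 2) * conj (R t))

/-- Average of `f` over a window of length `W` with dilation `b`, at frequency `θ`. -/
def windowAvg [NeZero N] (f : ZMod N → ℂ) (W : ℕ) (b : ZMod N) (θ : ℝ) (t : ZMod N) : ℂ :=
  (W : ℂ)⁻¹ * ∑ w ∈ range W, f (t + b * w) * ez (-(θ * w))

lemma natCast_half (hN : Odd N) : ((((N : ℤ) + 1) / 2 : ℤ) : ZMod N) = (2 : ZMod N)⁻¹ := by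
  obtain ⟨m, rfl⟩ := hN
  have h1 : (((2 * m + 1 : ℕ) : ℤ) + 1) / 2 = m + 1 := by omega
  rw [h1]
  have h2 : (2 : ZMod (2 * m + 1)) * ((m : ℕ) + 1 : ZMod (2 * m + 1)) = 1 := by
    have : ((2 * m + 1 : ℕ) : ZMod (2 * m + 1)) = 0 := ZMod.natCast_self _
    push_cast at this
    linear_combination this
  rw [ZMod.inv_eq_of_mul_eq_one _ _ _ h2]
  push_cast; rfl

lemma chirpPhase_cast (hN : Odd N) (a i : ℤ) : ((chirpPhase N a i : ℤ) : ZMod N) = (2 : ZMod N)⁻¹ *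
  a * (i : ZMod N) ^ 2 := by
  rw [chirpPhase]
  simp only [ZMod.intCast_mod, Int.cast_mul, natCast_half hN]
  ring

lemma abs_re_im_le {x y : ℝ} {z : ℂ} {E : ℝ} (h : ‖((x : ℂ) + y * I) - z‖ ≤ E) :
    |x| ≤ ‖z‖ + E ∧ |y| ≤ ‖z‖ + E := by
  have h1 : ‖(x : ℂ) + y * I‖ ≤ ‖z‖ + E := by
    have := norm_add_le (((x : ℂ) + y * I) - z) z
    rw [sub_add_cancel] at this; linarith
  constructor
  · refine le_trans ?_ h1
    simpa using Complex.abs_re_le_norm ((x : ℂ) + y * I)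
  · refine le_trans ?_ h1
    simpa using Complex.abs_im_le_norm ((x : ℂ) + y * I)

lemma abs_ediv_sub_le (z : ℤ) {q : ℤ} (hq : 0 < q) : |((z / q : ℤ) : ℝ) - (z : ℝ) / q| ≤ 1 := by
  have hq' : (0 : ℝ) < q := mod_cast hq
  rw [abs_le, le_sub_iff_add_le, sub_le_iff_le_add, ← sub_eq_neg_add, sub_le_iff_le_add,
    div_le_iff₀ hq', add_comm (1 : ℝ), ← sub_le_iff_le_add, le_div_iff₀ hq']
  have h1 := Int.emod_add_mul_ediv z q
  have h2 := emod_nonneg z hq.ne'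
  have h3 := emod_lt_of_pos z hq
  constructor
  · exact_mod_cast (by nlinarith : z ≤ (z / q + 1) * q)
  · exact_mod_cast (by nlinarith : (z / q - 1) * q ≤ z)

/-- Rounding after a sum of terms has been divided by `2 ^ (2 * L)`. -/
lemma norm_fixed_sum_sub_le {n : ℕ} {B K : ℝ} (hB : ∀ t, ‖R t‖ ≤ B) {F : ℕ → ℤ × ℤ × ℤ}
    (hK : n * (3 * B + 6) ≤ K) :
    let x := ∑ w ∈ range n, termRe N R (F w).1 (F w).2.1 (F w).2.2
    let y := ∑ w ∈ range n, termIm N R (F w).1 (F w).2.1 (F w).2.2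
    ‖((x : ℂ) + y * I) - 2 ^ (4 * size N) * ∑ w ∈ range n,
      conj (R (F w).1) * ez ((F w).2.1 / (F w).2.2)‖ ≤
      2 ^ (2 * size N) * (n * (2 * B + 6)) ∧
    |(x : ℝ)| ≤ 2 ^ (4 * size N) * K ∧ |(y : ℝ)| ≤ 2 ^ (4 * size N) * K := by
  intro x y
  have hB0 : 0 ≤ B := (norm_nonneg _).trans (hB 0)
  have h1 : ‖((x : ℂ) + y * I) - 2 ^ (4 * size N) * ∑ w ∈ range n,
      conj (R (F w).1) * ez ((F w).2.1 / (F w).2.2)‖ ≤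
      2 ^ (2 * size N) * (n * (2 * B + 6)) := by
    have : ((x : ℂ) + y * I) - 2 ^ (4 * size N) * ∑ w ∈ range n,
        conj (R (F w).1) * ez ((F w).2.1 / (F w).2.2) =
        ∑ w ∈ range n, (((termRe N R (F w).1 (F w).2.1 (F w).2.2 : ℂ) +
          termIm N R (F w).1 (F w).2.1 (F w).2.2 * I) - 2 ^ (4 * size N) *
          (conj (R (F w).1) * ez ((F w).2.1 / (F w).2.2))) := by
      rw [sum_sub_distrib, sum_add_distrib, ← sum_mul, ← mul_sum]
      simp only [x, y, Int.cast_sum]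
    rw [this]
    refine (norm_sum_le _ _).trans ?_
    calc _ ≤ ∑ w ∈ range n, 2 ^ (2 * size N) * (2 * B + 6) :=
          sum_le_sum fun w _ => (norm_term_sub_le _ _ _).trans (by gcongr; exact hB _)
      _ = _ := by rw [sum_const, card_range, nsmul_eq_mul]; ring
  have h2 : ‖(2 : ℂ) ^ (4 * size N) * ∑ w ∈ range n,
      conj (R (F w).1) * ez ((F w).2.1 / (F w).2.2)‖ ≤ 2 ^ (4 * size N) * (n * B) := by
    rw [norm_mul, norm_pow, Complex.norm_ofNat]
    gcongr
    refine (norm_sum_le _ _).trans ?_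
    calc _ ≤ ∑ w ∈ range n, B := sum_le_sum fun w _ => by
          rw [norm_mul, norm_ez, mul_one, RCLike.norm_conj]; exact hB _
      _ = _ := by rw [sum_const, card_range, nsmul_eq_mul]
  have h3 : ‖(2 : ℂ) ^ (4 * size N) * ∑ w ∈ range n,
      conj (R (F w).1) * ez ((F w).2.1 / (F w).2.2)‖ +
      2 ^ (2 * size N) * (n * (2 * B + 6)) ≤ 2 ^ (4 * size N) * K := by
    have h4 : (2 : ℝ) ^ (2 * size N) ≤ 2 ^ (4 * size N) :=
      pow_le_pow_right₀ (by simp) (by omega)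
    have h5 : (2 : ℝ) ^ (2 * size N) * (n * (2 * B + 6)) ≤
        2 ^ (4 * size N) * (n * (2 * B + 6)) := by gcongr
    calc _ ≤ (2 : ℝ) ^ (4 * size N) * (n * B) + 2 ^ (4 * size N) * (n * (2 * B + 6)) := by
          linarith
      _ = 2 ^ (4 * size N) * (n * (3 * B + 6)) := by ring
      _ ≤ _ := by gcongr
  have h4 := abs_re_im_le (x := x) (y := y) (by push_cast; exact h1)
  exact ⟨h1, h4.1.trans h3, h4.2.trans h3⟩

lemma wrap_of_real_le (hL : 1 ≤ size N) {z : ℤ} (h : |(z : ℝ)| ≤ 2 ^ (6 * size N)) : wrap N z = z :=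
  wrap_of_abs_le (b := 6 * size N) (by rw [wordLen]; omega) (mod_cast h)

/-- The error has two sources: `2 B + 6` per sample from fixed point, and `2` from rounding the
quotients of both parts. The digits found so far enter as the constant phase `ez (-(v / P))`, and
`√N` comes from the normalisation of `dechirp`. -/
lemma norm_window_sub_le [NeZero N] (hN : Odd N) (hL : 1 ≤ size N) {B : ℝ} (hB : ∀ t, ‖R t‖ ≤ B) (hK
  : ell (size N) * (3 * B + 6) ≤ 2 ^ size N) (a bd s t v : ℤ) {P : ℤ} (hP : P ≠ 0) : ‖(√N *
  ((windowRe N R a bd s t v P : ℂ) + windowIm N R a bd s t v P * I)) - 2 ^ (2 * size N) * ell (size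
  N) * (ez (-(v / P)) * windowAvg (dechirp (a : ZMod N) R) (ell (size N)) bd (s / grid N) t)‖ ≤ √N *
  (ell (size N) * (2 * B + 6) + 2) := by
  set W := ell (size N) with hW
  have hW0 : 0 < W := ell_pos (by omega)
  have hNR : (N : ℝ) ≠ 0 := mod_cast NeZero.ne N
  obtain ⟨h1, h2, h3⟩ := norm_fixed_sum_sub_le (n := W) hB hK
    (F := fun w => (windowTime N bd t w, windowNum N a bd s t v P w, windowDen N P))
  simp only at h1 h2 h3
  set x := ∑ w ∈ range W, termRe N R (windowTime N bd t w) (windowNum N a bd s t v P w)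
    (windowDen N P) with hx
  set y := ∑ w ∈ range W, termIm N R (windowTime N bd t w) (windowNum N a bd s t v P w)
    (windowDen N P) with hy
  have h5 : (2 : ℝ) ^ (4 * size N) * 2 ^ size N ≤ 2 ^ (6 * size N) := by
    rw [← pow_add]; exact pow_le_pow_right₀ (by simp) (by omega)
  have wx : windowRe N R a bd s t v P = x / (2 ^ size N * 2 ^ size N) := by
    rw [windowRe, ← hW, ← hx, wrap_of_real_le hL (h2.trans h5)]
  have wy : windowIm N R a bd s t v P = y / (2 ^ size N * 2 ^ size N) := by
    rw [windowIm, ← hW, ← hy, wrap_of_real_le hL (h3.trans h5)]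
  set Z := ∑ w ∈ range W, conj (R (windowTime N bd t w)) *
    ez (windowNum N a bd s t v P w / windowDen N P) with hZ
  set q : ℝ := 2 ^ (2 * size N) with hq
  have hq0 : 0 < q := by positivity
  have hqq : (2 : ℂ) ^ (4 * size N) = q * q := by
    rw [hq]; push_cast; rw [← pow_add]; congr 1; ring
  have hqi : (((2 ^ size N * 2 ^ size N : ℤ)) : ℝ) = q := by
    rw [hq]; push_cast; rw [← pow_add]; congr 1; ring
  have hZ' : √N * Z = W * (ez (-(v / P)) * windowAvg (dechirp (a : ZMod N) R) W bd (s / grid N) t)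
    := by
    have hWc : (W : ℂ) ≠ 0 := mod_cast hW0.ne'
    rw [windowAvg, mul_left_comm (ez _), mul_inv_cancel_left₀ hWc, hZ, mul_sum, mul_sum]
    refine sum_congr rfl fun w _ => ?_
    have ht : ((windowTime N bd t w : ℤ) : ZMod N) = (t : ZMod N) + bd * w := by
      simp [windowTime]
    -- Over the common denominator `N W^2 P` the phase is the sum of the chirp phase over `N`, the
    -- digit shift `-v / P` and the demodulation `-s w / W^2`.
    have hph : (windowNum N a bd s t v P w : ℝ) / windowDen N P = ((chirpPhase N a (windowTime N bd
      t w) : ℤ) : ℝ) / N + (-(v / P) + -(s / grid N * w)) := by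
      have hG : ((grid N : ℕ) : ℝ) ≠ 0 := by rw [grid]; positivity
      rw [grid, ← hW] at hG ⊢
      simp only [windowNum, windowDen, ← hW]
      push_cast
      field_simp
      ring
    rw [hph, ez_add, ez_add, ez_div_eq, chirpPhase_cast hN, ht, dechirp]
    ring
  have e1 : ‖((windowRe N R a bd s t v P : ℂ) + windowIm N R a bd s t v P * I) - q * Z‖ ≤ W * (2 * B
    + 6) + 2 := by
    have k1 := abs_ediv_sub_le x (q := 2 ^ size N * 2 ^ size N) (by positivity)
    have k2 := abs_ediv_sub_le y (q := 2 ^ size N * 2 ^ size N) (by positivity)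
    rw [hqi, ← wx] at k1
    rw [hqi, ← wy] at k2
    have k3 := norm_le_two k1 k2
    have k4 : ‖((x : ℂ) + y * I) - q * q * Z‖ / q ≤ W * (2 * B + 6) := by
      rw [div_le_iff₀ hq0, ← hqq]; linarith [h1]
    have hqn : ‖(q : ℂ)‖ = q := by rw [norm_real, Real.norm_of_nonneg hq0.le]
    have hqc : (q : ℂ) ≠ 0 := mod_cast hq0.ne'
    have k5 : ‖((x : ℂ) + y * I - q * q * Z) / q‖ ≤ W * (2 * B + 6) := by
      rw [norm_div, hqn]; exact k4
    calc _ = ‖((x : ℂ) + y * I - q * q * Z) / q +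
        (((windowRe N R a bd s t v P - x / q : ℝ) : ℂ) +
          ((windowIm N R a bd s t v P - y / q : ℝ) : ℂ) * I)‖ := by
          congr 1; push_cast; field_simp; ring
      _ ≤ _ := (norm_add_le _ _).trans (add_le_add k5 k3)
  have hs : ‖((√N : ℝ) : ℂ)‖ = √N := by
    rw [norm_real, Real.norm_of_nonneg (Real.sqrt_nonneg _)]
  have e2 : (√N * ((windowRe N R a bd s t v P : ℂ) + windowIm N R a bd s t v P * I)) - 2 ^ (2 * size
    N) * W * (ez (-(v / P)) * windowAvg (dechirp (a : ZMod N) R) W bd (s / grid N) t) = √N *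
    (((windowRe N R a bd s t v P : ℂ) + windowIm N R a bd s t v P * I) - q * Z) := by
    rw [mul_sub, mul_left_comm _ (q : ℂ) Z, hZ', hq]; push_cast; ring
  rw [e2, norm_mul, hs]
  gcongr

end

/-! ## Decoding -/

/-- The received signal is bounded, and the word length large enough for it. -/
structure Tame (N : ℕ) (R : ZMod N → ℂ) (B : ℝ) : Prop where
  odd : Odd N
  size_ge : 40 ≤ size N
  bound : ∀ t, ‖R t‖ ≤ B
  fits : (draws N * (3 * B + 9)) ^ 2 ≤ 2 ^ size N

/-- Error of the fixed point arithmetic. -/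
def fixErr (N : ℕ) (B : ℝ) : ℝ := (2 * B + 8) / 2 ^ size N

lemma cos_two_pi_ge {δ : ℝ} (h : |δ| ≤ 1 / 6) : 1 / 2 ≤ Real.cos (2 * pi * δ) := by
  rw [← Real.cos_abs, ← Real.cos_pi_div_three, abs_mul, abs_of_pos Real.two_pi_pos]
  apply Real.cos_le_cos_of_nonneg_of_le_pi
  · positivity
  · linarith [Real.pi_pos]
  · nlinarith [Real.pi_pos]

lemma cos_near_int {φ : ℝ} {n : ℤ} (h : |φ - n| ≤ 1 / 6) : 1 / 2 ≤ Real.cos (2 * pi * φ) := by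
  have := cos_two_pi_ge h
  rwa [show 2 * pi * (φ - n) = 2 * pi * φ - n * (2 * pi) by ring,
    Real.cos_sub_int_mul_two_pi] at this

lemma cos_near_half {φ : ℝ} {n : ℤ} (h : |φ - 1 / 2 - n| ≤ 1 / 6) : Real.cos (2 * pi * φ) ≤ -(1 / 2)
  := by
  have := cos_near_int h
  rw [show 2 * pi * (φ - 1 / 2) = 2 * pi * φ - pi by ring, Real.cos_sub_pi] at this
  linarith

/-- One binary digit: a decision `d` that is right unless `φ` is far from `ℤ / 2`. -/
lemma digit_step {φ e : ℝ} {n : ℤ} (h : |2 * φ - n| ≤ e) {d : Prop} [Decidable d] (h0 : ∀ m : ℤ, |φ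
  - m| ≤ 1 / 6 → ¬ d) (h1 : ∀ m : ℤ, |φ - 1 / 2 - m| ≤ 1 / 6 → d) : (e ≤ 1 / 3 → ∃ m : ℤ, |φ - (if d
  then 1 / 2 else 0) - m| ≤ e / 2) ∧ (e ≤ 1 / 2 → ∃ m : ℤ, |φ - (if d then 1 / 2 else 0) - m| ≤ 1 /
  3) := by
  obtain ⟨m, rfl | rfl⟩ := Int.even_or_odd' n
  · have h2 : |φ - m| ≤ e / 2 := by
      rw [abs_le] at h ⊢; push_cast at h; constructor <;> linarith [h.1, h.2]
    refine ⟨fun he => ⟨m, ?_⟩, fun he => ?_⟩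
    · rw [if_neg (h0 m (h2.trans (by linarith)))]; simpa using h2
    -- With `e ≤ 1 / 2` it is only known that `φ` is within `1 / 4` of `m`, and the decision may be
    -- wrong. But then `φ` is more than `1 / 6` away from `m`, hence within `1 / 2 - 1 / 6 = 1 / 3`
    -- of a half-integer next to it.
    · by_cases hd : d
      · have h3 : ¬ |φ - m| ≤ 1 / 6 := fun h => h0 m h hd
        rw [if_pos hd]
        rw [abs_le] at h2 h3
        by_cases hs : 0 ≤ φ - m
        · exact ⟨m, abs_le.2 ⟨by by_contra h; exact h3 ⟨by linarith, by linarith⟩, by linarith⟩⟩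
        · refine ⟨m - 1, abs_le.2 ⟨by push_cast; linarith, ?_⟩⟩
          by_contra h
          push_cast at h
          exact h3 ⟨by linarith, by linarith⟩
      · rw [if_neg hd]; exact ⟨m, by rw [sub_zero]; exact h2.trans (by linarith)⟩
  · have h2 : |φ - 1 / 2 - m| ≤ e / 2 := by
      rw [abs_le] at h ⊢; push_cast at h; constructor <;> linarith [h.1, h.2]
    refine ⟨fun he => ⟨m, ?_⟩, fun he => ?_⟩
    · rwa [if_pos (h1 m (h2.trans (by linarith)))]
    · by_cases hd : d
      · rw [if_pos hd]; exact ⟨m, h2.trans (by linarith)⟩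
      · have h3 : ¬ |φ - 1 / 2 - m| ≤ 1 / 6 := fun h => hd (h1 m h)
        rw [if_neg hd]
        rw [abs_le] at h2 h3
        by_cases hs : 0 ≤ φ - 1 / 2 - m
        · refine ⟨m + 1, abs_le.2 ⟨?_, by push_cast; linarith⟩⟩
          by_contra h
          push_cast at h
          exact h3 ⟨by linarith, by linarith⟩
        · exact ⟨m, abs_le.2 ⟨by linarith, by by_contra h; exact h3 ⟨by linarith, by linarith⟩⟩⟩

section
variable {N : ℕ} {R : ZMod N → ℂ} {B : ℝ}

lemma Tame.nonneg (h : Tame N R B) : 0 ≤ B := (norm_nonneg _).trans (h.bound 0)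

lemma Tame.draws_le (h : Tame N R B) : draws N * (3 * B + 9) ≤ 2 ^ size N := by
  have h1 := h.fits
  have h2 : (1 : ℝ) ≤ 2 ^ size N := one_le_pow₀ (by simp)
  by_contra! hlt
  nlinarith

lemma Tame.ell_le (h : Tame N R B) : ell (size N) * (3 * B + 9) ≤ 2 ^ size N := by
  refine le_trans ?_ h.draws_le
  have h3 := h.nonneg
  gcongr
  rw [draws]
  exact Nat.le_mul_of_pos_left _ (by have := h.size_ge; omega)

lemma sqrt_le_two_pow : √N ≤ 2 ^ size N := by
  have h1 : (N : ℝ) ≤ 2 ^ size N := mod_cast (lt_size_self N).le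
  have h2 : (1 : ℝ) ≤ 2 ^ size N := one_le_pow₀ (by simp)
  rw [Real.sqrt_le_left (by positivity)]
  nlinarith

variable [NeZero N]

lemma norm_dechirp (a : ZMod N) (R : ZMod N → ℂ) (t : ZMod N) : ‖dechirp a R t‖ = √N * ‖R t‖ := by
  rw [dechirp, norm_mul, norm_mul, norm_stdAddChar, RCLike.norm_conj, one_mul, norm_real,
    Real.norm_of_nonneg (Real.sqrt_nonneg _)]

lemma norm_windowAvg_le {f : ZMod N → ℂ} {C : ℝ} (hf : ∀ t, ‖f t‖ ≤ C) {W : ℕ} (hW : 0 < W) (b :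
  ZMod N) (θ : ℝ) (t : ZMod N) : ‖windowAvg f W b θ t‖ ≤ C := by
  have hW' : (0 : ℝ) < W := mod_cast hW
  rw [windowAvg, norm_mul, norm_inv, Complex.norm_natCast, inv_mul_le_iff₀ hW']
  refine (norm_sum_le _ _).trans ?_
  calc _ ≤ ∑ w ∈ range W, C := sum_le_sum fun w _ => by
        rw [norm_mul, norm_ez, mul_one]; exact hf _
    _ = _ := by rw [sum_const, card_range, nsmul_eq_mul]

/-- For a bounded signal both window sums are below `2 ^ (3 L)`, so the inner product does not wrap.
Scaling by `κ > 0` to approximate the true averages leaves its sign unchanged. -/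
lemma voteOne_iff (hT : Tame N R B) (a bd s t H v : ℤ) {P : ℤ} (hP : P ≠ 0) : ∃ V₀ V₁ : ℂ, (VoteOne
  N R a bd s t H v P ↔ (V₁ * conj V₀).re < 0) ∧ ‖V₀ - windowAvg (dechirp (a : ZMod N) R) (ell (size
  N)) bd (s / grid N) t‖ ≤ fixErr N B ∧ ‖V₁ - ez (-(v / P)) * windowAvg (dechirp (a : ZMod N) R)
  (ell (size N)) bd (s / grid N) (t + H)‖ ≤ fixErr N B := by
  have hL : 1 ≤ size N := by have := hT.size_ge; omega
  have hB := hT.nonneg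
  set W := ell (size N) with hW
  have hW0 : 0 < W := ell_pos (by omega)
  have hW1 : (1 : ℝ) ≤ W := mod_cast hW0
  have hKW := hT.ell_le
  rw [← hW] at hKW
  have hN0 : (0 : ℝ) < N := mod_cast NeZero.pos N
  have hs0 : 0 < √N := Real.sqrt_pos.2 hN0
  set q : ℝ := 2 ^ (2 * size N) with hq
  set κ : ℝ := √N / (q * W) with hκ
  have hκ0 : 0 < κ := by positivity
  set f := dechirp (a : ZMod N) R
  have main : ∀ t v : ℤ, ‖κ * ((windowRe N R a bd s t v P : ℂ) + windowIm N R a bd s t v P * I) - ez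
    (-(v / P)) * windowAvg f W bd (s / grid N) t‖ ≤ fixErr N B ∧
      |(windowRe N R a bd s t v P : ℝ)| ≤ 2 ^ (3 * size N) ∧
      |(windowIm N R a bd s t v P : ℝ)| ≤ 2 ^ (3 * size N) := by
    intro t v
    have h1 := norm_window_sub_le hT.odd hL hT.bound (by nlinarith) a bd s t v hP
    rw [← hW] at h1
    set y := ez (-(v / P)) * windowAvg f W bd (s / grid N) t with hy
    set z : ℂ := (windowRe N R a bd s t v P : ℂ) + windowIm N R a bd s t v P * I with hz
    have hqW : ((2 : ℂ) ^ (2 * size N) * W) = ((q * W : ℝ) : ℂ) := by rw [hq]; push_cast; ring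
    rw [hqW] at h1
    have hqW0 : (0 : ℝ) < q * W := by positivity
    have hnq : ‖((q * W : ℝ) : ℂ)‖ = q * W := by
      rw [norm_real, Real.norm_of_nonneg hqW0.le]
    have h2 : ‖κ * z - y‖ ≤ √N * (W * (2 * B + 6) + 2) / (q * W) := by
      rw [le_div_iff₀ hqW0, ← hnq, ← norm_mul]
      refine le_trans (le_of_eq ?_) h1
      have hκq : (κ : ℂ) * ((q * W : ℝ) : ℂ) = (√N : ℂ) := by
        rw [← Complex.ofReal_mul, hκ, div_mul_cancel₀ _ hqW0.ne']
      congr 1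
      linear_combination z * hκq
    have h3 : √N * (W * (2 * B + 6) + 2) / (q * W) ≤ fixErr N B := by
      rw [fixErr, div_le_div_iff₀ hqW0 (by positivity)]
      have h5 : W * (2 * B + 6) + 2 ≤ W * (2 * B + 8) := by nlinarith
      calc √N * (W * (2 * B + 6) + 2) * 2 ^ size N
          ≤ 2 ^ size N * (W * (2 * B + 8)) * 2 ^ size N := by
            gcongr; exact sqrt_le_two_pow
        _ = (2 * B + 8) * (q * W) := by rw [hq, show 2 * size N = size N + size N by ring, pow_add]; ring
    refine ⟨h2.trans h3, ?_⟩
    have h4 : ‖y‖ ≤ √N * B := by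
      rw [hy, norm_mul, norm_ez, one_mul]
      exact norm_windowAvg_le (fun t => by
        rw [norm_dechirp]; exact mul_le_mul_of_nonneg_left (hT.bound t) hs0.le) hW0 _ _ _
    have h5 : ‖z‖ ≤ 2 ^ (3 * size N) := by
      have h6 : ‖(κ : ℂ) * z‖ ≤ √N * B + √N * (W * (2 * B + 6) + 2) / (q * W) := by
        have := norm_add_le (κ * z - y) y
        rw [sub_add_cancel] at this
        linarith
      rw [norm_mul, norm_real, Real.norm_of_nonneg hκ0.le, hκ, div_mul_eq_mul_div,
        div_le_iff₀ hqW0, add_mul, div_mul_cancel₀ _ hqW0.ne', mul_assoc, ← mul_add] at h6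
      have h7 := le_of_mul_le_mul_left h6 hs0
      have hq1 : 1 ≤ q := one_le_pow₀ (by simp)
      calc ‖z‖ ≤ B * (q * W) + (W * (2 * B + 6) + 2) := h7
        _ ≤ q * (W * B) + q * (W * (2 * B + 8)) := by
          have : W * (2 * B + 6) + 2 ≤ W * (2 * B + 8) := by nlinarith
          have h8 : W * (2 * B + 8) ≤ q * (W * (2 * B + 8)) := le_mul_of_one_le_left (by positivity) hq1
          linarith
        _ ≤ q * (W * (3 * B + 9)) := by nlinarith
        _ ≤ q * 2 ^ size N := by gcongr
        _ = _ := by rw [hq, ← pow_add]; congr 1; ring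
    constructor
    · refine le_trans ?_ h5
      simpa [hz] using Complex.abs_re_le_norm z
    · refine le_trans ?_ h5
      simpa [hz] using Complex.abs_im_le_norm z
  obtain ⟨a0, b0, c0⟩ := main t 0
  obtain ⟨a1, b1, c1⟩ := main (t + H) v
  refine ⟨_, _, ?_, by simpa [ez_zero] using a0, by simpa using a1⟩
  have hw : |(((windowRe N R a bd s (t + H) v P * windowRe N R a bd s t 0 P + windowIm N R a bd s (t
    + H) v P * windowIm N R a bd s t 0 P : ℤ)) : ℝ)| ≤ 2 ^ (6 * size N + 1) := by
    push_cast
    refine (abs_add_le _ _).trans ?_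
    rw [abs_mul, abs_mul]
    have e1 : (2 : ℝ) ^ (6 * size N + 1) = 2 ^ (3 * size N) * 2 ^ (3 * size N) + 2 ^ (3 * size N) *
      2 ^ (3 * size N) := by
      rw [← pow_add, pow_succ, ← two_mul (3 * size N)]; ring
    rw [e1]
    gcongr
  rw [VoteOne, wrap_of_abs_le (b := 6 * size N + 1) (by rw [wordLen]; have := hT.size_ge; omega)
    (mod_cast hw)]
  have e2 : ∀ x₀ y₀ x₁ y₁ : ℤ, ((κ * ((x₁ : ℂ) + y₁ * I)) * conj (κ * ((x₀ : ℂ) + y₀ * I))).re = κ ^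
    2 * ((x₁ * x₀ + y₁ * y₀ : ℤ) : ℝ) := by
    intro x₀ y₀ x₁ y₁
    simp [Complex.mul_re, Complex.mul_im]
    ring
  rw [e2]
  have hκ2 : 0 < κ ^ 2 := by positivity
  rw [mul_neg_iff]
  constructor
  · intro h; exact Or.inl ⟨hκ2, mod_cast h⟩
  · rintro (⟨-, h⟩ | ⟨h, -⟩)
    · exact_mod_cast h
    · exact absurd h hκ2.not_gt

/-- The window at `t` sees almost only the frequency `x`, with coefficient `β`. -/
def Clean (f : ZMod N → ℂ) (bd : ZMod N) (θ : ℝ) (β : ℂ) (x : ZMod N) (t : ZMod N) : Prop :=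
  ‖windowAvg f (ell (size N)) bd θ t - β * stdAddChar (x * t)‖ ≤ ‖β‖ / 10

/-- `1/8 + 1/8 + 1/64 < 3/10`. What matters is that `3/10 < 1/2`, the value by which the cosine is
known to be away from zero. -/
lemma re_near {z u w : ℂ} {r : ℝ} (hr : 0 ≤ r) (hu : ‖u‖ = r) (hw : ‖w‖ = r) {z' : ℂ} (h1 : ‖z - u‖
  ≤ r / 8) (h2 : ‖z' - w‖ ≤ r / 8) :
    |(z * conj z').re - (u * conj w).re| ≤ 3 / 10 * r ^ 2 := by
  have e : z * conj z' - u * conj w = (z - u) * conj w + u * conj (z' - w) + (z - u) * conj (z' - w)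
    := by
    simp only [map_sub]; ring
  rw [← Complex.sub_re, e]
  refine (Complex.abs_re_le_norm _).trans ((norm_add₃_le).trans ?_)
  simp only [norm_mul, RCLike.norm_conj, hu, hw]
  have := mul_le_mul h1 h2 (norm_nonneg _) (by positivity)
  nlinarith

/-- In clean windows the product of the value at `t + H` with the conjugate value at `t` is nearly
`‖β‖^2 e(xi H / N - v / P)`: the time `t` cancels. The tolerances `1/10` of `Clean` and `1/40` of
the arithmetic add up to the `1/8` of `re_near`. -/
lemma vote_of_clean (hT : Tame N R B) {a bd s t H v P xi : ℤ} (hP : P ≠ 0) {β : ℂ} (hβ : β ≠ 0)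
  (hfix : fixErr N B ≤ ‖β‖ / 40) (h0 : Clean (dechirp (a : ZMod N) R) bd (s / grid N) β xi t) (h1 :
  Clean (dechirp (a : ZMod N) R) bd (s / grid N) β xi (t + H)) (m : ℤ) : (|(xi * H / N - v / P : ℝ)
  - m| ≤ 1 / 6 → ¬ VoteOne N R a bd s t H v P) ∧ (|(xi * H / N - v / P : ℝ) - 1 / 2 - m| ≤ 1 / 6 →
  VoteOne N R a bd s t H v P) := by
  obtain ⟨V₀, V₁, hV, hV₀, hV₁⟩ := voteOne_iff hT a bd s t H v hP
  have hβ0 : 0 < ‖β‖ := norm_pos_iff.2 hβ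
  set u₀ := β * stdAddChar ((xi : ZMod N) * (t : ZMod N)) with hu₀
  set u₁ := ez (-(v / P)) * (β * stdAddChar ((xi : ZMod N) * ((t : ZMod N) + (H : ZMod N)))) with hu₁
  have n₀ : ‖u₀‖ = ‖β‖ := by rw [hu₀, norm_mul, norm_stdAddChar, mul_one]
  have n₁ : ‖u₁‖ = ‖β‖ := by
    rw [hu₁, norm_mul, norm_mul, norm_stdAddChar, norm_ez, mul_one, one_mul]
  have d₀ : ‖V₀ - u₀‖ ≤ ‖β‖ / 8 := by
    have := norm_sub_le_norm_sub_add_norm_sub V₀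
      (windowAvg (dechirp (a : ZMod N) R) (ell (size N)) bd (s / grid N) t) u₀
    have h := h0
    rw [Clean] at h
    linarith
  have d₁ : ‖V₁ - u₁‖ ≤ ‖β‖ / 8 := by
    have := norm_sub_le_norm_sub_add_norm_sub V₁ (ez (-(v / P)) *
      windowAvg (dechirp (a : ZMod N) R) (ell (size N)) bd (s / grid N) (t + H)) u₁
    have h := h1
    rw [Clean] at h
    rw [hu₁, ← mul_sub, norm_mul, norm_ez, one_mul] at this
    rw [hu₁]
    linarith
  have hprod : u₁ * conj u₀ = ((‖β‖ ^ 2 : ℝ) : ℂ) * ez (xi * H / N - v / P) := by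
    have e1 : stdAddChar ((xi : ZMod N) * ((t : ZMod N) + (H : ZMod N))) = ez (xi * t / N) * ez (xi
      * H / N) := by
      rw [← ez_add, ← add_div]
      have := ez_div_eq (N := N) (xi * (t + H))
      push_cast at this
      rw [← this]; congr 1; ring
    have e2 : stdAddChar ((xi : ZMod N) * (t : ZMod N)) = ez (xi * t / N) := by
      have := ez_div_eq (N := N) (xi * t)
      push_cast at this
      rw [← this]
    have e3 : ez (xi * t / N) * conj (ez (xi * t / N)) = 1 := by
      rw [Complex.mul_conj, Complex.normSq_eq_norm_sq, norm_ez]; simp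
    have e4 : β * conj β = ((‖β‖ ^ 2 : ℝ) : ℂ) := by
      rw [Complex.mul_conj, Complex.normSq_eq_norm_sq]
    rw [hu₁, hu₀, e1, e2, map_mul, sub_eq_neg_add, ez_add, ← e4]
    linear_combination (ez (-(v / P)) * β * ez (xi * H / N) * conj β) * e3
  have hre : (u₁ * conj u₀).re = ‖β‖ ^ 2 * Real.cos (2 * pi * (xi * H / N - v / P)) := by
    rw [hprod, Complex.re_ofReal_mul, ez, Complex.exp_ofReal_mul_I_re]
  have key := re_near hβ0.le n₁ n₀ d₁ d₀
  rw [hre, abs_le] at key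
  have hβ2 : 0 < ‖β‖ ^ 2 := by positivity
  rw [hV]
  constructor
  · intro h
    have := cos_near_int h
    nlinarith
  · intro h
    have := cos_near_half h
    nlinarith

/-- The frequency `x` is found from the grid point `s`. -/
lemma roundFreq_eq (hT : Tame N R B) {a bd s xi : ℤ} {t : ℕ → ℤ} {β : ℂ} (hβ : β ≠ 0) (hfix : fixErr
  N B ≤ ‖β‖ / 40) {bad : ℕ → ℕ → Prop} [∀ j, DecidablePred (bad j)] (hbad : ∀ j < size N + 2, 2 *
  ((range (draws N)).filter (bad j)).card < draws N) (hclean : ∀ j < size N + 2, ∀ i < draws N, ¬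
  bad j i → Clean (dechirp (a : ZMod N) R) bd (s / grid N) β xi (t i) ∧ Clean (dechirp (a : ZMod N)
  R) bd (s / grid N) β xi (t i + ((2 ^ (size N + 2 - (j + 1)) : ℤ) : ZMod N))) : ((roundFreq N
  (expansion N R a bd s t (size N + 2)) : ℤ) : ZMod N) = xi := by
  classical
  set I := size N + 2 with hI
  have hNpos : (0 : ℝ) < N := mod_cast NeZero.pos N
  set v := expansion N R a bd s t with hv
  have step : ∀ j < I, ∃ (d : Prop) (_ : Decidable d), (v (j + 1) : ℝ) = v j + (if d then 2 ^ j else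
    0) ∧ (∀ m : ℤ, |(xi * 2 ^ (I - (j + 1)) / N - v j / 2 ^ (j + 1) : ℝ) - m| ≤ 1 / 6 → ¬ d) ∧ (∀ m
    : ℤ, |(xi * 2 ^ (I - (j + 1)) / N - v j / 2 ^ (j + 1) : ℝ) - 1 / 2 - m| ≤ 1 / 6 → d) := by
    intro j hj
    set n := votes N R a bd s t (2 ^ (I - (j + 1))) (v j) (2 ^ (j + 1)) (draws N) with hn
    have hP : (2 : ℤ) ^ (j + 1) ≠ 0 := by positivity
    refine ⟨draws N < 2 * n, inferInstance, ?_, ?_, ?_⟩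
    · simp only [hv, expansion, ← hI]
      split_ifs <;> push_cast <;> ring
    · intro m hm
      -- Good draws vote correctly when the phase is near an integer, so votes for 1 come only from
      -- the bad draws, a minority. Near a half-integer the roles are exchanged.
      have h1 : n ≤ ((range (draws N)).filter (bad j)).card := by
        rw [hn, votes]
        refine card_le_card fun i hi => ?_
        simp only [mem_filter, mem_range] at hi ⊢
        refine ⟨hi.1, by_contra fun hb => ?_⟩
        obtain ⟨c0, c1⟩ := hclean j hj i hi.1 hb
        exact (vote_of_clean (v := v j) hT hP hβ hfix c0 c1 m).1 (by push_cast; exact hm) hi.2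
      have := hbad j hj
      omega
    · intro m hm
      have h1 : draws N ≤ n + ((range (draws N)).filter (bad j)).card := by
        rw [hn, votes]
        conv_lhs => rw [← card_range (draws N), ← Finset.card_filter_add_card_filter_not (fun i =>
          VoteOne N R a bd s (t i) (2 ^ (I - (j + 1))) (v j) (2 ^ (j + 1)))]
        gcongr with i hi
        intro hv
        by_contra hb
        obtain ⟨c0, c1⟩ := hclean j hj i (mem_range.1 hi) hb
        exact hv ((vote_of_clean (v := v j) hT hP hβ hfix c0 c1 m).2 (by push_cast; exact hm))
      have := hbad j hj
      omega
  -- Modulo 1, the frequency times `2 ^ (I - j)` is known up to `2 / 3 / 2 ^ j`. Halving it for the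
  -- next digit leaves the choice between two values at distance `1 / 2`, which the vote decides,
  -- and halves the error.
  have key : ∀ j, 1 ≤ j → j ≤ I → ∃ n : ℤ,
      |(xi * 2 ^ (I - j) / N - v j / 2 ^ j : ℝ) - n| ≤ 2 / 3 / 2 ^ j := by
    intro j hj1
    induction j, hj1 using Nat.le_induction with
    | base =>
      intro h
      obtain ⟨d, hd, s1, s2, s3⟩ := step 0 (by omega)
      -- At the start nothing is known, except that every real number is within `1 / 2` of an
      -- integer. The first digit may thus be wrong, and the error is `1 / 3` in any case.
      have h1 := abs_sub_round (2 * (xi * 2 ^ (I - (0 + 1)) / N - v 0 / 2 ^ (0 + 1) : ℝ))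
      obtain ⟨m, hm⟩ := (digit_step h1 s2 s3).2 le_rfl
      refine ⟨m, ?_⟩
      rw [s1]
      simp only [zero_add, pow_one, pow_zero] at hm ⊢
      have : (2 : ℝ) / 3 / 2 = 1 / 3 := by norm_num
      rw [this]
      convert hm using 3
      split_ifs <;> ring
    | succ j hj ih =>
      intro h
      obtain ⟨n, hn⟩ := ih (by omega)
      obtain ⟨d, hd, s1, s2, s3⟩ := step j (by omega)
      have e1 : 2 * (xi * 2 ^ (I - (j + 1)) / N - v j / 2 ^ (j + 1) : ℝ) = xi * 2 ^ (I - j) / N - v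
        j / 2 ^ j := by
        rw [show I - j = I - (j + 1) + 1 by omega, pow_succ, pow_succ]; field_simp
      rw [← e1] at hn
      have h2j : (2 : ℝ) ≤ 2 ^ j := by
        calc (2 : ℝ) = 2 ^ 1 := by norm_num
          _ ≤ 2 ^ j := pow_le_pow_right₀ (by simp) hj
      obtain ⟨m, hm⟩ := (digit_step hn s2 s3).1 (by
        rw [div_le_iff₀ (by positivity)]; linarith)
      refine ⟨m, ?_⟩
      rw [s1, show (2 : ℝ) / 3 / 2 ^ (j + 1) = 2 / 3 / 2 ^ j / 2 by rw [pow_succ]; field_simp]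
      convert hm using 3
      have h2j' : (2 : ℝ) ^ j ≠ 0 := by positivity
      rw [pow_succ]
      split_ifs <;> field_simp <;> ring
  obtain ⟨n, hn⟩ := key I (by omega) le_rfl
  -- The final error is at most `2 N / 3` on the scale `2 ^ I`. As `I = L + 2`, `2 ^ I ≥ 4 N`, so
  -- rounding to the nearest integer is right.
  have hround : (2 * (N : ℤ) * v I + 2 ^ I) / (2 * 2 ^ I) = xi - n * N := by
    have hI0 : (0 : ℝ) < 2 ^ I := by positivity
    have hNI : 4 * (N : ℝ) ≤ 2 ^ I := by
      rw [hI, pow_add]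
      have : (N : ℝ) ≤ 2 ^ size N := mod_cast (lt_size_self N).le
      linarith
    rw [Nat.sub_self, pow_zero, mul_one, abs_le] at hn
    obtain ⟨n1, n2⟩ := hn
    have e1 : (xi : ℝ) / N - v I / 2 ^ I - n = (xi * 2 ^ I - v I * N - n * N * 2 ^ I) / (N * 2 ^ I) := by
      field_simp
    rw [e1, ← neg_div, div_le_div_iff₀ (by positivity) (by positivity)] at n1
    rw [e1, div_le_div_iff₀ (by positivity) (by positivity)] at n2
    have n1' : -(2 / 3) * (N : ℝ) ≤ xi * 2 ^ I - v I * N - n * N * 2 ^ I := by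
      nlinarith
    have n2' : xi * 2 ^ I - v I * N - n * N * 2 ^ I ≤ (2 / 3) * (N : ℝ) := by
      nlinarith
    have hN1 : (1 : ℝ) ≤ N := mod_cast NeZero.pos N
    rw [Int.ediv_eq_iff_of_pos (by positivity)]
    constructor
    · have : ((xi - n * N) * (2 * 2 ^ I) : ℝ) ≤ 2 * N * v I + 2 ^ I := by nlinarith
      exact_mod_cast this
    · have : (2 * N * v I + 2 ^ I : ℝ) < (xi - n * N) * (2 * 2 ^ I) + 2 * 2 ^ I := by nlinarith
      exact_mod_cast this
  rw [roundFreq, ← hI, hround]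
  simp [ZMod.intCast_mod]

end

/-! ## Estimates -/

/-- The Fourier coefficient of `f` at `x`. -/
def dft {N : ℕ} [NeZero N] (f : ZMod N → ℂ) (x : ZMod N) : ℂ :=
  (N : ℂ)⁻¹ * ∑ t, f t * stdAddChar (-(x * t))

/-- Estimate of the Fourier coefficient of `f` at `x` from `n` samples. -/
def sampledCoeff {N : ℕ} [NeZero N] (f : ZMod N → ℂ) (n : ℕ) (t : ℕ → ZMod N) (x : ZMod N) : ℂ :=
  (n : ℂ)⁻¹ * ∑ j ∈ range n, f (t j) * stdAddChar (-(x * t j))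

lemma clamp_of_abs_lt {Q x : ℤ} (h : |x| < Q * Q * Q) : clamp Q x = x := by
  rw [abs_lt] at h
  rw [clamp, emod_eq_of_lt] <;> linarith [h.1, h.2]

/-- With `q = 2 ^ L`, the hypothesis on `K` keeps the product with `⌊√N⌋` below `q^5`, so it does
not wrap. Division by `M q^2` with `M ≥ 2` gives at most `q^3 / 2`, so the clamp does nothing
either, and only the rounding of one division remains. -/
lemma abs_scale_sub_le {N : ℕ} {K : ℝ} (hN : 40 ≤ size N) (hK : K * √N ≤ 2 ^ size N) {y : ℤ} (hy :
  |(y : ℝ)| ≤ 2 ^ (4 * size N) * K) :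
    |ofFixed N (scale N y) - y * Nat.sqrt N / (draws N * 2 ^ (4 * size N))| ≤
      1 / 2 ^ (2 * size N) := by
  set q : ℝ := 2 ^ size N with hq
  have hq2 : (4 : ℝ) ≤ q := by
    calc (4 : ℝ) = 2 ^ 2 := by norm_num
      _ ≤ q := pow_le_pow_right₀ (by simp) (by omega)
  have p2 : (2 : ℝ) ^ (2 * size N) = q ^ 2 := by rw [hq, ← pow_mul, mul_comm]
  have p4 : (2 : ℝ) ^ (4 * size N) = q ^ 4 := by rw [hq, ← pow_mul, mul_comm]
  have p6 : (2 : ℝ) ^ (6 * size N) = q ^ 6 := by rw [hq, ← pow_mul, mul_comm]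
  have hM : 2 ≤ draws N := by
    rw [draws]
    have := ell_pos (L := size N) (by omega)
    nlinarith
  have hM' : (2 : ℝ) ≤ draws N := mod_cast hM
  have h1 : |(y : ℝ) * Nat.sqrt N| ≤ q ^ 5 := by
    rw [abs_mul, Nat.abs_cast]
    have : (Nat.sqrt N : ℝ) ≤ √N := Real.nat_sqrt_le_real_sqrt
    calc |(y : ℝ)| * Nat.sqrt N ≤ 2 ^ (4 * size N) * K * √N :=
          mul_le_mul hy this (by positivity) ((abs_nonneg _).trans hy)
      _ = q ^ 4 * (K * √N) := by rw [p4]; ring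
      _ ≤ q ^ 4 * q := by gcongr
      _ = _ := by ring
  have hw : wrap N (y * Nat.sqrt N) = y * Nat.sqrt N := by
    apply wrap_of_real_le (by omega)
    push_cast
    rw [p6]
    exact h1.trans (pow_le_pow_right₀ (by linarith) (by simp))
  set d : ℤ := (draws N : ℤ) * 2 ^ size N * 2 ^ size N with hd
  have hd' : (d : ℝ) = draws N * q ^ 2 := by rw [hd]; push_cast; ring
  have hd0 : (0 : ℤ) < d := by positivity
  have h2 := abs_ediv_sub_le (y * Nat.sqrt N) hd0
  rw [hd'] at h2
  push_cast at h2
  have h3 : |(y : ℝ) * Nat.sqrt N / (draws N * q ^ 2)| ≤ q ^ 3 / 2 := by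
    rw [abs_div, abs_of_pos (show (0 : ℝ) < draws N * q ^ 2 by positivity),
      div_le_div_iff₀ (by positivity) (by positivity)]
    calc |(y : ℝ) * Nat.sqrt N| * 2 ≤ q ^ 5 * draws N := by gcongr
      _ = _ := by ring
  have h4 : |(((y * Nat.sqrt N / d : ℤ)) : ℝ)| < q ^ 3 := by
    rw [abs_le] at h2 h3
    rw [abs_lt]
    have : (4 : ℝ) ^ 3 ≤ q ^ 3 := by gcongr
    constructor <;> linarith [h2.1, h2.2, h3.1, h3.2]
  have h5 : scale N y = y * Nat.sqrt N / d := by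
    rw [scale, hw, ← hd]
    apply clamp_of_abs_lt
    have : (((|y * Nat.sqrt N / d| : ℤ)) : ℝ) < ((2 ^ size N * 2 ^ size N * 2 ^ size N : ℤ) : ℝ) := by
      push_cast
      rw [← hq]
      calc _ < q ^ 3 := h4
        _ = _ := by ring
    exact_mod_cast this
  rw [h5, ofFixed, p2, p4, show (draws N * q ^ 4 : ℝ) = draws N * q ^ 2 * q ^ 2 by ring,
    ← div_div, ← sub_div, abs_div, abs_of_pos (show (0 : ℝ) < q ^ 2 by positivity)]
  gcongr

/-- Completing the square: `b τ t + a (t - τ)^2 / 2 = a τ^2 / 2 + a t^2 / 2 - (a - b) τ t`. So peaks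
on the line of slope `b` are large Fourier coefficients of the dechirped signal, at `(a - b) τ`; the
program inverts this factor. -/
lemma ambiguity_chirp {N : ℕ} [NeZero N] (a : ZMod N) (hN : Odd N) (R : ZMod N → ℂ) (b τ : ZMod N) :
  ambiguity (chirp a) R (τ, b * τ) = stdAddChar ((2 : ZMod N)⁻¹ * a * τ ^ 2) * dft (dechirp a R) ((a
  - b) * τ) := by
  have h2 : (2 : ZMod N)⁻¹ * 2 = 1 := by
    have := ZMod.coe_mul_inv_eq_one 2 (n := N) (by simpa using hN.coprime_two_left)
    rw [mul_comm]; exact_mod_cast this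
  rw [ambiguity, dft, mul_sum, mul_sum]
  refine sum_congr rfl fun t _ => ?_
  have e1 : (1 / √N : ℝ) = (N : ℝ)⁻¹ * √N := by
    rw [one_div, inv_eq_iff_eq_inv, mul_inv, inv_inv, ← div_eq_mul_inv, Real.div_sqrt]
  have e2 : (b * τ) * t + (2 : ZMod N)⁻¹ * a * (t - τ) ^ 2 = (2 : ZMod N)⁻¹ * a * τ ^ 2 + ((2 : ZMod
    N)⁻¹ * a * t ^ 2 + -((a - b) * τ * t)) := by
    linear_combination (-(a * t * τ)) * h2
  have e3 := congrArg (stdAddChar (N := N)) e2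
  simp only [AddChar.map_add_eq_mul] at e3
  simp only [tfShift, chirp, dechirp, e1]
  push_cast
  linear_combination ((N : ℂ)⁻¹ * (√N : ℂ) * conj (R t)) * e3

/-- Three errors: the final rounding, the fixed point errors in the sum, and the replacement of `√N`
by `⌊√N⌋`. The last is relative, of size at most `1 / √N`, hence the term `‖E‖ / √N`. -/
lemma norm_est_sub_le {N : ℕ} [NeZero N] {R : ZMod N → ℂ} {B : ℝ} (hT : Tame N R B) (a b τ : ℤ)
    (t : ℕ → ℤ) :
    let E := stdAddChar ((2 : ZMod N)⁻¹ * (a : ZMod N) * (τ : ZMod N) ^ 2) *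
      sampledCoeff (dechirp (a : ZMod N) R) (draws N) (fun j => (t j : ZMod N))
        (((a : ZMod N) - (b : ZMod N)) * (τ : ZMod N))
    ‖(⟨ofFixed N (estRe N R a b τ t), ofFixed N (estIm N R a b τ t)⟩ : ℂ) - E‖ ≤
      ‖E‖ / √N + fixErr N B := by
  intro E
  have h40 := hT.size_ge
  set M : ℝ := (draws N : ℝ) with hM
  set q : ℝ := 2 ^ size N with hq
  have p2 : (2 : ℝ) ^ (2 * size N) = q ^ 2 := by rw [hq, ← pow_mul, mul_comm]
  have p4 : (2 : ℝ) ^ (4 * size N) = q ^ 4 := by rw [hq, ← pow_mul, mul_comm]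
  have hN1 : (1 : ℝ) ≤ N := mod_cast NeZero.pos N
  have hNq : (N : ℝ) ≤ q := by rw [hq]; exact_mod_cast (lt_size_self N).le
  have hM0 : 0 < M := by
    rw [hM, draws]
    have := ell_pos (L := size N) (by omega)
    have : 0 < size N * ell (size N) := Nat.mul_pos (by omega) this
    exact_mod_cast this
  have hK : M * (3 * B + 9) * √N ≤ q := by
    refine le_of_sq_le_sq ?_ (by positivity)
    rw [mul_pow, Real.sq_sqrt (by linarith)]
    calc (M * (3 * B + 9)) ^ 2 * N ≤ q * q := by gcongr; exact hT.fits
      _ = _ := by ring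
  obtain ⟨h1, h2, h3⟩ := norm_fixed_sum_sub_le (N := N) (R := R) (n := draws N) (K := M * (3 * B + 9))
    hT.bound (F := fun j => (t j, estNum N a b τ (t j), N)) (by gcongr; norm_num)
  set x := ∑ w ∈ range (draws N), termRe N R (t w) (estNum N a b τ (t w)) N with hx
  set y := ∑ w ∈ range (draws N), termIm N R (t w) (estNum N a b τ (t w)) N with hy
  have s1 := abs_scale_sub_le h40 hK h2
  have s2 := abs_scale_sub_le h40 hK h3
  set Z := ∑ w ∈ range (draws N),
    conj (R (t w)) * ez ((estNum N a b τ (t w) : ℤ) / (N : ℤ)) with hZ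
  set r : ℝ := (Nat.sqrt N : ℝ) with hr
  have hr1 : r ≤ √N := Real.nat_sqrt_le_real_sqrt
  have hr2 : √N ≤ r + 1 := by
    rw [hr]; exact_mod_cast Real.real_sqrt_le_nat_sqrt_succ (a := N)
  have hE : E = (√N / M : ℝ) * Z := by
    simp only [E, sampledCoeff]
    rw [hZ, mul_sum, mul_sum, mul_sum]
    refine sum_congr rfl fun j _ => ?_
    have e1 : ((estNum N a b τ (t j) : ℤ) : ZMod N) = (2 : ZMod N)⁻¹ * (a : ZMod N) * (τ : ZMod N) ^ 2 +
      ((2 : ZMod N)⁻¹ * (a : ZMod N) * (t j : ZMod N) ^ 2 +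
        -(((a : ZMod N) - (b : ZMod N)) * (τ : ZMod N) * (t j : ZMod N))) := by
      rw [estNum]
      simp only [ZMod.intCast_mod, Int.cast_mul, Int.cast_add, Int.cast_sub, natCast_half hT.odd]
      have h2 : (2 : ZMod N)⁻¹ * 2 = 1 := by
        have := ZMod.coe_mul_inv_eq_one 2 (n := N) (by simpa using hT.odd.coprime_two_left)
        rw [mul_comm]; exact_mod_cast this
      linear_combination (-((a : ZMod N) * (t j : ZMod N) * τ)) * h2
    have e2 : ez ((estNum N a b τ (t j) : ℤ) / (N : ℤ)) =
        stdAddChar ((estNum N a b τ (t j) : ℤ) : ZMod N) := by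
      rw [← ez_div_eq]; push_cast; rfl
    rw [e2, e1, AddChar.map_add_eq_mul, AddChar.map_add_eq_mul, dechirp]
    push_cast
    rw [hM]
    push_cast
    ring
  have hZn : ‖E‖ = √N / M * ‖Z‖ := by
    rw [hE, norm_mul, norm_real, Real.norm_of_nonneg (by positivity)]
  rw [p2] at s1 s2 h1
  rw [p4] at s1 s2
  have p4c : (2 : ℂ) ^ (4 * size N) = (q : ℂ) ^ 4 := by
    have := congrArg (fun x : ℝ => (x : ℂ)) p4
    push_cast at this; exact this
  rw [p4c] at h1
  have hqc : (q : ℂ) ≠ 0 := mod_cast (show q ≠ 0 by positivity)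
  have hsplit : (⟨ofFixed N (estRe N R a b τ t), ofFixed N (estIm N R a b τ t)⟩ : ℂ) - E =
      (((ofFixed N (scale N x) - x * r / (M * q ^ 4) : ℝ) : ℂ) +
        ((ofFixed N (scale N y) - y * r / (M * q ^ 4) : ℝ) : ℂ) * I) +
      ((r / (M * q ^ 4) : ℝ) : ℂ) * (((x : ℂ) + y * I) - q ^ 4 * Z) +
      (((r - √N) / M : ℝ) : ℂ) * Z := by
    rw [hE, show (⟨ofFixed N (estRe N R a b τ t), ofFixed N (estIm N R a b τ t)⟩ : ℂ) =
      (ofFixed N (scale N x) : ℂ) + (ofFixed N (scale N y) : ℂ) * I from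
        Complex.mk_eq_add_mul_I _ _]
    push_cast
    field_simp
    ring
  rw [hsplit]
  have n1 : ‖((ofFixed N (scale N x) - x * r / (M * q ^ 4) : ℝ) : ℂ) +
        ((ofFixed N (scale N y) - y * r / (M * q ^ 4) : ℝ) : ℂ) * I‖ ≤ 2 / q ^ 2 := by
    refine (norm_add_le _ _).trans ?_
    simp only [norm_mul, Complex.norm_I, norm_real, Real.norm_eq_abs, mul_one]
    have : (2 : ℝ) / q ^ 2 = 1 / q ^ 2 + 1 / q ^ 2 := by ring
    linarith
  have hsq : √N ≤ q := sqrt_le_two_pow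
  have n2 : ‖((r / (M * q ^ 4) : ℝ) : ℂ) * (((x : ℂ) + y * I) - q ^ 4 * Z)‖ ≤
      (2 * B + 6) / q := by
    rw [norm_mul, norm_real, Real.norm_of_nonneg (by positivity)]
    calc _ ≤ q / (M * q ^ 4) * (q ^ 2 * (M * (2 * B + 6))) := by
          gcongr
          exact hr1.trans hsq
      _ = _ := by field_simp
  have n3 : ‖(((r - √N) / M : ℝ) : ℂ) * Z‖ ≤ ‖E‖ / √N := by
    rw [norm_mul, norm_real, Real.norm_eq_abs, abs_div, abs_of_pos hM0, hZn,
      div_mul_eq_mul_div, div_mul_eq_mul_div, div_div, div_le_div_iff₀ hM0 (by positivity)]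
    have : |r - √N| ≤ 1 := abs_le.2 ⟨by linarith, by linarith⟩
    calc |r - √N| * ‖Z‖ * (M * √N) ≤ 1 * ‖Z‖ * (M * √N) := by gcongr
      _ = _ := by ring
  have n4 : 2 / q ^ 2 + (2 * B + 6) / q ≤ fixErr N B := by
    rw [fixErr, ← hq]
    have : 2 / q ^ 2 ≤ 2 / q := by gcongr; nlinarith
    calc _ ≤ 2 / q + (2 * B + 6) / q := by linarith
      _ = _ := by rw [← add_div]; congr 1; ring
  refine (norm_add₃_le).trans ?_
  linarith

/-! ## Averages over independent draws -/

section
variable {α : Type*} [Fintype α] [Nonempty α]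

/-- Independence and mean zero make the cross terms vanish when one more draw is added. -/
lemma expect_norm_sq_sum {g : α → ℂ} (hg : ∑ a, g a = 0) (n : ℕ) : 𝔼 t : Fin n → α, ‖∑ j, g (t j)‖ ^
  2 = n * 𝔼 a, ‖g a‖ ^ 2 := by
  induction n with
  | zero => simp
  | succ n ih =>
    have h1 : 𝔼 t : Fin (n + 1) → α, ‖∑ j, g (t j)‖ ^ 2 = 𝔼 q : α × (Fin n → α), ‖g q.1 + ∑ j, g
      (q.2 j)‖ ^ 2 := by
      refine (Fintype.expect_equiv (Fin.consEquiv fun _ => α) _ _ fun q => ?_).symm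
      rw [Fin.sum_univ_succ]; rfl
    have h2 : ∀ (z w : ℂ), ‖z + w‖ ^ 2 = ‖z‖ ^ 2 + ‖w‖ ^ 2 + 2 * (z * conj w).re := by
      intro z w
      rw [sq_norm, sq_norm, sq_norm, Complex.normSq_add]
    have h3 : ∑ q : α × (Fin n → α), (g q.1 * conj (∑ j, g (q.2 j))).re = 0 := by
      rw [← Complex.re_sum, Fintype.sum_prod_type]
      simp only
      rw [← Finset.sum_mul_sum, hg, zero_mul, Complex.zero_re]
    rw [h1]
    simp only [h2, Finset.expect_add_distrib]
    rw [univ_product_univ.symm, expect_product, expect_product]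
    simp only [expect_const]
    rw [ih, univ_product_univ, ← mul_expect, expect_eq_sum_div_card (fun q : α × (Fin n → α) => _), h3]
    push_cast
    ring

/-- The variance of a mean of `n` independent draws is the variance of one divided by `n`, and a
variance is at most the second moment. -/
lemma expect_norm_sq_sub_le (g : α → ℂ) {n : ℕ} (hn : 0 < n) : 𝔼 t : Fin n → α, ‖(n : ℂ)⁻¹ * ∑ j, g
  (t j) - 𝔼 a, g a‖ ^ 2 ≤ (𝔼 a, ‖g a‖ ^ 2) / n := by
  have hn' : (0 : ℝ) < n := mod_cast hn
  have hnc : (n : ℂ) ≠ 0 := mod_cast hn.ne'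
  set m := 𝔼 a, g a with hm
  have hsum : ∑ a, g a = Fintype.card α * m := by
    rw [hm, expect_eq_sum_div_card]; field_simp
  have h0 : ∑ a, (g a - m) = 0 := by
    rw [sum_sub_distrib, hsum, sum_const, card_univ, nsmul_eq_mul, sub_self]
  have h1 : ∀ t : Fin n → α, ‖(n : ℂ)⁻¹ * ∑ j, g (t j) - m‖ ^ 2 = (n : ℝ)⁻¹ ^ 2 * ‖∑ j, (g (t j) -
    m)‖ ^ 2 := by
    intro t
    rw [← mul_pow, ← Complex.norm_natCast, ← norm_inv, ← norm_mul, sum_sub_distrib, sum_const,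
      card_univ, Fintype.card_fin, nsmul_eq_mul, mul_sub, inv_mul_cancel_left₀ hnc]
  simp only [h1]
  rw [← mul_expect, expect_norm_sq_sum h0]
  have h2 : 𝔼 a, ‖g a - m‖ ^ 2 ≤ 𝔼 a, ‖g a‖ ^ 2 := by
    have h3 : ∀ a, ‖g a‖ ^ 2 = ‖g a - m‖ ^ 2 + ‖m‖ ^ 2 + 2 * ((g a - m) * conj m).re := by
      intro a
      rw [sq_norm, sq_norm, sq_norm, ← Complex.normSq_add, sub_add_cancel]
    simp only [h3, Finset.expect_add_distrib]
    have h4 : 𝔼 a, 2 * ((g a - m) * conj m).re = 0 := by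
      rw [← mul_expect, expect_eq_sum_div_card, ← Complex.re_sum, ← sum_mul, h0]
      simp
    rw [h4, expect_const]
    nlinarith [norm_nonneg m]
  rw [inv_pow, sq, mul_inv, mul_assoc, inv_mul_cancel_left₀ hn'.ne', inv_mul_eq_div]
  gcongr

/-- The proportion of draws with a property is close to its probability. -/
lemma expect_filter_sub_le (p : α → Prop) [DecidablePred p] {n : ℕ} (hn : 0 < n) : 𝔼 t : Fin n → α,
  (((univ.filter fun j => p (t j)).card : ℝ) / n - ((univ.filter p).card : ℝ) / Fintype.card α) ^ 2
  ≤ 1 / n := by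
  have h := expect_norm_sq_sub_le (fun a => if p a then (1 : ℂ) else 0) hn
  have h1 : ∀ t : Fin n → α, ‖(n : ℂ)⁻¹ * ∑ j, (if p (t j) then (1 : ℂ) else 0) - 𝔼 a, (if p a then
    (1 : ℂ) else 0)‖ ^ 2 = (((univ.filter fun j => p (t j)).card : ℝ) / n - ((univ.filter p).card :
    ℝ) / Fintype.card α) ^ 2 := by
    intro t
    rw [expect_eq_sum_div_card, Finset.sum_boole, Finset.sum_boole, ← sq_abs (_ / _ - _),
      ← Real.norm_eq_abs, ← norm_real]
    push_cast
    rw [inv_mul_eq_div]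
  simp only [h1] at h
  refine h.trans ?_
  gcongr
  calc _ ≤ 𝔼 a : α, (1 : ℝ) := Finset.expect_le_expect fun a _ => by split_ifs <;> simp
    _ = 1 := expect_const 1

/-- Markov's inequality for counting. -/
lemma card_filter_div_le {Ω : Type*} [Fintype Ω] (p : Ω → Prop) [DecidablePred p] {X : Ω → ℝ} (h0 :
  ∀ ω, 0 ≤ X ω) (h : ∀ ω, p ω → 1 ≤ X ω) : ((univ.filter p).card : ℝ) / Fintype.card Ω ≤ 𝔼 ω, X ω :=
  by
  rw [expect_eq_sum_div_card]
  gcongr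
  rw [Finset.card_filter]
  push_cast
  refine sum_le_sum fun ω _ => ?_
  split_ifs with hp
  exacts [h ω hp, h0 ω]

end

/-! ## Fourier analysis on `ℤ_N` -/

section
variable {N : ℕ} [NeZero N]

lemma sum_stdAddChar_mul (y : ZMod N) : ∑ x : ZMod N, stdAddChar (x * y) = if y = 0 then (N : ℂ)
  else 0 := by
  rw [AddChar.sum_mulShift y (ZMod.isPrimitive_stdAddChar N), ZMod.card]
  split_ifs <;> simp

lemma conj_stdAddChar (x : ZMod N) : conj (stdAddChar x) = stdAddChar (-x) := by
  rw [← intCast_val x, ← Int.cast_neg, ← ez_div_eq, ← ez_div_eq, ← ez_neg]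
  congr 1; push_cast; ring

/-- Orthogonality of characters, where frequencies may coincide. With distinct ones it is Parseval's
identity; with coinciding ones it serves the average of a window over its dilation. -/
lemma sum_norm_sq_char {ι : Type*} (s : Finset ι) (F : ι → ℂ) (y : ι → ZMod N) : ((∑ t : ZMod N, ‖∑
  i ∈ s, F i * stdAddChar (y i * t)‖ ^ 2 : ℝ) : ℂ) = N * ∑ i ∈ s, ∑ j ∈ s, if y i = y j then F i *
  conj (F j) else 0 := by
  push_cast
  have h1 : ∀ t : ZMod N, (‖∑ i ∈ s, F i * stdAddChar (y i * t)‖ : ℂ) ^ 2 = ∑ i ∈ s, ∑ j ∈ s, F i *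
    conj (F j) * stdAddChar (t * (y i - y j)) := by
    intro t
    rw [← Complex.mul_conj', map_sum, Finset.sum_mul_sum]
    refine sum_congr rfl fun i _ => sum_congr rfl fun j _ => ?_
    rw [map_mul (conj), conj_stdAddChar, show t * (y i - y j) = y i * t + -(y j * t) by ring,
      AddChar.map_add_eq_mul]
    ring
  simp only [h1]
  rw [sum_comm, mul_sum]
  refine sum_congr rfl fun i _ => ?_
  rw [sum_comm, mul_sum]
  refine sum_congr rfl fun j _ => ?_
  rw [← mul_sum, sum_stdAddChar_mul]
  simp only [sub_eq_zero]
  split_ifs <;> ring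

lemma parseval (F : ZMod N → ℂ) : ∑ t, ‖∑ x, F x * stdAddChar (x * t)‖ ^ 2 = N * ∑ x, ‖F x‖ ^ 2 :=
  by
  have h := sum_norm_sq_char univ F (fun x : ZMod N => x)
  have h2 : ∀ x, ∑ j, (if x = j then F x * conj (F j) else 0) = ((‖F x‖ ^ 2 : ℝ) : ℂ) := by
    intro x
    rw [Finset.sum_ite_eq, if_pos (mem_univ _), Complex.mul_conj']
    push_cast; rfl
  simp only [h2] at h
  exact_mod_cast h

lemma sum_dft (f : ZMod N → ℂ) (t : ZMod N) : ∑ x, dft f x * stdAddChar (x * t) = f t := by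
  simp only [dft]
  have h1 : ∀ x, (N : ℂ)⁻¹ * (∑ s, f s * stdAddChar (-(x * s))) * stdAddChar (x * t) = ∑ s, (N :
    ℂ)⁻¹ * (f s * stdAddChar (x * (t - s))) := by
    intro x
    rw [mul_sum, sum_mul]
    refine sum_congr rfl fun s _ => ?_
    rw [show x * (t - s) = -(x * s) + x * t by ring, AddChar.map_add_eq_mul]
    ring
  simp only [h1]
  rw [sum_comm]
  have hN : (N : ℂ) ≠ 0 := mod_cast NeZero.ne N
  rw [Finset.sum_eq_single t]
  · rw [← mul_sum, ← mul_sum, sum_stdAddChar_mul, sub_self, if_pos rfl]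
    field_simp
  · intro s _ hs
    rw [← mul_sum, ← mul_sum, sum_stdAddChar_mul, if_neg (by simpa [sub_eq_zero] using hs.symm)]
    simp
  · simp

lemma sum_norm_sq_dft (f : ZMod N → ℂ) : ∑ x, ‖dft f x‖ ^ 2 = (∑ t, ‖f t‖ ^ 2) / N := by
  have h := parseval (dft f)
  simp only [sum_dft] at h
  rw [h, mul_div_cancel_left₀ _ (mod_cast NeZero.ne N)]

/-- The Fourier transform of a window, at a difference of frequencies. -/
def kernel (W : ℕ) (y : ZMod N) (θ : ℝ) : ℂ :=
  (W : ℂ)⁻¹ * ∑ w ∈ range W, stdAddChar (y * (w : ZMod N)) * ez (-(θ * w))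

lemma windowAvg_eq (f : ZMod N → ℂ) (W : ℕ) (b : ZMod N) (θ : ℝ) (t : ZMod N) : windowAvg f W b θ t
  = ∑ x, (dft f x * kernel W (b * x) θ) * stdAddChar (x * t) := by
  simp only [windowAvg, kernel]
  have h1 : ∀ w ∈ range W, f (t + b * (w : ZMod N)) * ez (-(θ * w)) = ∑ x, dft f x * (stdAddChar (b
    * x * (w : ZMod N)) * ez (-(θ * w))) * stdAddChar (x * t) := by
    intro w _
    rw [← sum_dft f (t + b * (w : ZMod N)), sum_mul]
    refine sum_congr rfl fun x _ => ?_
    rw [show x * (t + b * (w : ZMod N)) = b * x * (w : ZMod N) + x * t by ring, AddChar.map_add_eq_mul]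
    ring
  rw [sum_congr rfl h1, sum_comm, mul_sum]
  refine sum_congr rfl fun x _ => ?_
  rw [mul_sum, mul_sum, mul_sum, sum_mul]
  refine sum_congr rfl fun w _ => ?_
  ring

lemma sum_norm_sq_windowAvg (f : ZMod N → ℂ) (W : ℕ) (b : ZMod N) (θ : ℝ) : ∑ t, ‖windowAvg f W b θ
  t‖ ^ 2 = N * ∑ x, ‖dft f x‖ ^ 2 * ‖kernel W (b * x) θ‖ ^ 2 := by
  simp only [windowAvg_eq]
  rw [parseval]
  simp only [norm_mul, mul_pow]

lemma card_range_modEq_le (W w : ℕ) {m : ℕ} : ((range W).filter fun w' => w' ≡ w [MOD m]).card ≤ W /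
  m + 1 := by
  rw [← card_range (W / m + 1)]
  refine Finset.card_le_card_of_injOn (fun w' => w' / m) ?_ ?_
  · intro w' hw
    simp only [coe_filter, Set.mem_ofPred_eq, mem_range, Finset.coe_range, Set.mem_Iio] at hw ⊢
    exact Nat.lt_succ_of_le (Nat.div_le_div_right hw.1.le)
  · intro x hx y hy hxy
    simp only [coe_filter, Set.mem_ofPred_eq] at hx hy
    have h : x % m = y % m := hx.2.trans hy.2.symm
    rw [← Nat.div_add_mod x m, ← Nat.div_add_mod y m, h, show x / m = y / m from hxy]

/-- The order of a nonzero element divides `N` and is not 1. Here the smallest prime factor enters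
the Fourier analysis: short progressions have few repetitions. -/
lemma minFac_le_addOrderOf {d : ZMod N} (hd : d ≠ 0) : N.minFac ≤ addOrderOf d := by
  refine Nat.minFac_le_of_dvd ?_ ?_
  · have h1 : addOrderOf d ≠ 1 := by simpa using hd
    have h2 : 0 < addOrderOf d := addOrderOf_pos d
    omega
  · simpa using addOrderOf_dvd_card (x := d)

lemma card_filter_mul_eq_le {d : ZMod N} (hd : d ≠ 0) (W w : ℕ) : (((range W).filter fun w' : ℕ => d
  * (w : ZMod N) = d * (w' : ZMod N)).card : ℝ) ≤ W / N.minFac + 1 := by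
  have h1 : (range W).filter (fun w' : ℕ => d * (w : ZMod N) = d * (w' : ZMod N)) ⊆ (range W).filter
    fun w' => w' ≡ w [MOD addOrderOf d] := by
    intro w' h
    simp only [mem_filter] at h ⊢
    refine ⟨h.1, ?_⟩
    have h2 : w • d = w' • d := by rw [nsmul_eq_mul, nsmul_eq_mul, mul_comm, h.2, mul_comm]
    exact (nsmul_eq_nsmul_iff_modEq.1 h2).symm
  have h2 := (card_le_card h1).trans (card_range_modEq_le W w)
  have h3 : W / addOrderOf d ≤ W / N.minFac :=
    Nat.div_le_div_left (minFac_le_addOrderOf hd) (Nat.minFac_pos N)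
  calc _ ≤ ((W / N.minFac + 1 : ℕ) : ℝ) := mod_cast h2.trans (by omega)
    _ ≤ _ := by push_cast; gcongr; exact Nat.cast_div_le

/-- The random dilation at work. Averaging the square over `b` leaves the pairs `(w, w')` with `d w
= d w'`: for every `w` there are at most `W / p + 1`, out of `W`. So a frequency different from the
wanted one passes the window with energy `1 / p + 1 / W` on average. -/
lemma sum_norm_sq_kernel_le {d : ZMod N} (hd : d ≠ 0) {W : ℕ} (hW : 0 < W) : ∑ b : ZMod N, ‖kernel W
  (b * d) 0‖ ^ 2 ≤ N * (1 / N.minFac + 1 / W) := by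
  have h1 := sum_norm_sq_char (N := N) (range W) (fun _ => 1) (fun w : ℕ => d * (w : ZMod N))
  simp only [one_mul, map_one] at h1
  have h2 : ∑ i ∈ range W, ∑ j ∈ range W, (if d * (i : ZMod N) = d * (j : ZMod N) then (1 : ℂ) else
    0) = ((∑ i ∈ range W, (((range W).filter fun w' : ℕ => d * (i : ZMod N) = d * (w' : ZMod
    N)).card : ℝ) : ℝ) : ℂ) := by
    push_cast
    exact sum_congr rfl fun i _ => by rw [Finset.sum_boole]
  rw [h2] at h1
  have h3 : ∑ t : ZMod N, ‖∑ i ∈ range W, stdAddChar (d * (i : ZMod N) * t)‖ ^ 2 = N * ∑ i ∈ range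
    W, (((range W).filter fun w' : ℕ => d * (i : ZMod N) = d * (w' : ZMod N)).card : ℝ) := mod_cast
    h1
  have h4 : ∀ b : ZMod N, ‖kernel W (b * d) 0‖ ^ 2 = (W : ℝ)⁻¹ ^ 2 * ‖∑ i ∈ range W, stdAddChar (d *
    (i : ZMod N) * b)‖ ^ 2 := by
    intro b
    rw [kernel, norm_mul, mul_pow, norm_inv, Complex.norm_natCast]
    simp only [zero_mul, neg_zero, ez_zero, mul_one]
    have h5 : ∀ w : ℕ, b * d * (w : ZMod N) = d * (w : ZMod N) * b := fun w => by ring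
    simp only [h5]
  simp only [h4]
  rw [← mul_sum, h3]
  calc _ ≤ (W : ℝ)⁻¹ ^ 2 * (N * ∑ i ∈ range W, ((W : ℝ) / N.minFac + 1)) := by
        gcongr with i hi
        exact card_filter_mul_eq_le hd W i
    _ = _ := by
        rw [sum_const, card_range, nsmul_eq_mul]; field_simp

lemma norm_ez_sub_one_le (x : ℝ) : ‖ez x - 1‖ ≤ 2 * pi * |x| := by
  have h := Real.norm_exp_I_mul_ofReal_sub_one_le (x := 2 * pi * x)
  rw [mul_comm] at h
  rw [ez]
  refine h.trans (le_of_eq ?_)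
  rw [Real.norm_eq_abs, abs_mul, abs_of_pos Real.two_pi_pos]

/-- A frequency close to `z / N` may be moved there. -/
lemma norm_kernel_sub_le {W : ℕ} (hW : 0 < W) (y z : ZMod N) {θ : ℝ} (h : |θ - (z.val : ℝ) / N| ≤ 1
  / (W * W)) : ‖kernel W y θ - kernel W (y - z) 0‖ ≤ 2 * pi / W := by
  have hW' : (0 : ℝ) < W := mod_cast hW
  have hz : ∀ w : ℕ, stdAddChar ((y - z) * (w : ZMod N)) = stdAddChar (y * (w : ZMod N)) * ez
    (-(z.val / N * w)) := by
    intro w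
    have h1 := ez_div_eq (N := N) (-(z.val * w))
    rw [show ((-(z.val * w) : ℤ) : ZMod N) = -(z * w) by
      push_cast; rw [ZMod.natCast_zmod_val]] at h1
    rw [sub_mul, sub_eq_add_neg, AddChar.map_add_eq_mul, ← h1]
    congr 2; push_cast; ring
  rw [kernel, kernel, ← mul_sub, ← sum_sub_distrib, norm_mul, norm_inv, Complex.norm_natCast,
    inv_mul_le_iff₀ hW']
  refine (norm_sum_le _ _).trans ?_
  calc _ ≤ ∑ w ∈ range W, 2 * pi / W := by
        refine sum_le_sum fun w hw => ?_
        have hwW : (w : ℝ) ≤ W := mod_cast (mem_range.1 hw).le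
        rw [hz, zero_mul, neg_zero, ez_zero, mul_one,
          show -(θ * w) = -((z.val : ℝ) / N * w) + -((θ - z.val / N) * w) by ring, ez_add,
          ← mul_assoc, ← mul_sub_one, norm_mul, norm_mul, norm_stdAddChar, norm_ez, one_mul, one_mul]
        refine (norm_ez_sub_one_le _).trans ?_
        rw [abs_neg, abs_mul, Nat.abs_cast]
        calc 2 * pi * (|θ - z.val / N| * w) ≤ 2 * pi * (1 / (W * W) * (W : ℝ)) := by gcongr
          _ = _ := by field_simp
    _ = _ := by rw [sum_const, card_range, nsmul_eq_mul, mul_div_cancel₀ _ hW'.ne']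

/-- The grid point next to `x / N`. -/
def gridPoint (G : ℕ) (x : ZMod N) : ℕ := G * x.val / N

lemma gridPoint_lt {G : ℕ} (hG : 0 < G) (x : ZMod N) : gridPoint G x < G := by
  rw [gridPoint, Nat.div_lt_iff_lt_mul (NeZero.pos N)]
  exact Nat.mul_lt_mul_of_pos_left (ZMod.val_lt x) hG

lemma abs_gridPoint_sub_le {G : ℕ} (hG : 0 < G) (x : ZMod N) :
    |(gridPoint G x : ℝ) / G - (x.val : ℝ) / N| ≤ 1 / G := by
  have hG' : (0 : ℝ) < G := mod_cast hG
  have hN : (0 : ℝ) < N := mod_cast NeZero.pos N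
  have h1 : (gridPoint G x : ℝ) * N ≤ G * x.val := mod_cast Nat.div_mul_le_self _ _
  have h2 : (G * x.val : ℝ) < (gridPoint G x + 1) * N := by
    exact_mod_cast Nat.lt_mul_of_div_lt (Nat.lt_succ_self _) (NeZero.pos N)
  rw [div_sub_div _ _ hG'.ne' hN.ne', abs_div, abs_of_pos (show (0 : ℝ) < G * N by positivity),
    div_le_div_iff₀ (by positivity) hG']
  have h3 : |(gridPoint G x : ℝ) * N - G * x.val| ≤ N := abs_le.2 ⟨by nlinarith, by nlinarith⟩
  nlinarith

end

/-! ## Large frequencies are found -/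

section
lemma expect_draws₁ {N : ℕ} [Nonempty (Fin N)] (F : Fin N → ℝ) : 𝔼 r : Draws N, F r.1 = 𝔼 b, F b := by
  rw [← univ_product_univ, expect_product]
  simp only [expect_const]

lemma expect_draws₂ {N : ℕ} [Nonempty (Fin N)] (F : Fin N → (Fin (draws N) → Fin N) → ℝ) : 𝔼 r :
  Draws N, F r.1 r.2.1 = 𝔼 b, 𝔼 t, F b t := by
  rw [← univ_product_univ, expect_product]
  refine Finset.expect_congr rfl fun b _ => ?_
  rw [← univ_product_univ, expect_product]
  simp only [expect_const]

lemma expect_draws₃ {N : ℕ} [Nonempty (Fin N)] (F : Fin N → (Fin (draws N) → Fin N) → (Fin (draws N)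
  → Fin N) → ℝ) : 𝔼 r : Draws N, F r.1 r.2.1 r.2.2 = 𝔼 b, 𝔼 t, 𝔼 t', F b t t' := by
  rw [← univ_product_univ, expect_product]
  refine Finset.expect_congr rfl fun b _ => ?_
  rw [← univ_product_univ, expect_product]

variable {N : ℕ} [NeZero N]

/-- The signal without its component at the frequency `x`. -/
def residual (f : ZMod N → ℂ) (x t : ZMod N) : ℂ := f t - dft f x * stdAddChar (x * t)

lemma dft_char (x y : ZMod N) : dft (fun t => stdAddChar (x * t)) y = if y = x then 1 else 0 := by
  have h1 : ∀ t, stdAddChar (x * t) * stdAddChar (-(y * t)) = stdAddChar (t * (x - y)) := by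
    intro t
    rw [← AddChar.map_add_eq_mul]; congr 1; ring
  have hN : (N : ℂ) ≠ 0 := mod_cast NeZero.ne N
  simp only [dft, h1, sum_stdAddChar_mul, sub_eq_zero, eq_comm (a := x)]
  split_ifs <;> simp [hN]

lemma dft_residual (f : ZMod N → ℂ) (x y : ZMod N) : dft (residual f x) y = if y = x then 0 else dft
  f y := by
  have h : dft (residual f x) y = dft f y - dft f x * dft (fun t => stdAddChar (x * t)) y := by
    simp only [dft, residual, sub_mul, sum_sub_distrib, mul_sub, mul_sum]
    congr 1
    refine sum_congr rfl fun t _ => ?_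
    ring
  rw [h, dft_char]
  split_ifs with h1
  · rw [h1]; ring
  · ring

/-- The mean square of the residual in windows with dilation `b`, at the frequency of the grid that
belongs to `x`. -/
def leak (f : ZMod N → ℂ) (W : ℕ) (x b : ZMod N) : ℝ :=
  𝔼 t, ‖windowAvg (residual f x) W b (gridPoint (W * W) (b * x) / (W * W : ℕ)) t‖ ^ 2

lemma leak_nonneg (f : ZMod N → ℂ) (W : ℕ) (x b : ZMod N) : 0 ≤ leak f W x b :=
  Finset.expect_nonneg fun _ _ => by positivity

/-- A grid of spacing `1 / W^2` makes the phase drift over `W` steps at most `2 π / W`. This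
dictates the number `W^2` of grid points. -/
lemma norm_kernel_grid_sub_le {W : ℕ} (hW : 0 < W) (x y b : ZMod N) : ‖kernel W (b * y) (gridPoint
  (W * W) (b * x) / (W * W : ℕ)) - kernel W (b * (y - x)) 0‖ ≤ 2 * pi / W := by
  have := norm_kernel_sub_le hW (b * y) (b * x) (θ := gridPoint (W * W) (b * x) / (W * W : ℕ)) (by
      have := abs_gridPoint_sub_le (Nat.mul_pos hW hW) (b * x)
      push_cast at this ⊢
      exact this)
  rwa [← mul_sub] at this

/-- Parseval turns the mean over `t` into a sum over frequencies `y ≠ x` of energies times squared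
kernels. Moving the grid frequency to that of `x` costs `2 π / W`, by `u^2 ≤ 2 v^2 + 2 (2 π / W)^2`
for `u ≤ v + 2 π / W`; then the mean over `b` is taken. -/
lemma expect_leak_le (f : ZMod N → ℂ) {W : ℕ} (hW : 0 < W) (x : ZMod N) {B₂ : ℝ} (hf : ∑ y, ‖dft f
  y‖ ^ 2 ≤ B₂) : 𝔼 b, leak f W x b ≤ 2 * B₂ * (1 / N.minFac + 1 / W + (2 * pi / W) ^ 2) := by
  have hN : (0 : ℝ) < N := mod_cast NeZero.pos N
  have h1 : ∀ b, leak f W x b ≤ ∑ y, ‖dft (residual f x) y‖ ^ 2 * (2 * ‖kernel W (b * (y - x)) 0‖ ^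
    2 + 2 * (2 * pi / W) ^ 2) := by
    intro b
    rw [leak, expect_eq_sum_div_card, sum_norm_sq_windowAvg, ZMod.card,
      mul_div_cancel_left₀ _ hN.ne']
    refine sum_le_sum fun y _ => mul_le_mul_of_nonneg_left ?_ (by positivity)
    have h2 := norm_kernel_grid_sub_le hW x y b
    set u := kernel W (b * y) (gridPoint (W * W) (b * x) / (W * W : ℕ))
    set v := kernel W (b * (y - x)) 0
    have h3 : ‖u‖ ≤ ‖v‖ + 2 * pi / W := by
      have := norm_add_le (u - v) v
      rw [sub_add_cancel] at this; linarith
    calc ‖u‖ ^ 2 ≤ (‖v‖ + 2 * pi / W) ^ 2 := by gcongr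
      _ ≤ _ := by nlinarith [sq_nonneg (‖v‖ - 2 * pi / W)]
  rw [expect_eq_sum_div_card, ZMod.card, div_le_iff₀ hN]
  calc ∑ b, leak f W x b ≤ ∑ b, ∑ y, ‖dft (residual f x) y‖ ^ 2 *
        (2 * ‖kernel W (b * (y - x)) 0‖ ^ 2 + 2 * (2 * pi / W) ^ 2) :=
        sum_le_sum fun b _ => h1 b
    _ = ∑ y, ‖dft (residual f x) y‖ ^ 2 *
        (2 * ∑ b, ‖kernel W (b * (y - x)) 0‖ ^ 2 + N * (2 * (2 * pi / W) ^ 2)) := by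
        rw [sum_comm]
        refine sum_congr rfl fun y _ => ?_
        rw [← mul_sum, sum_add_distrib, ← mul_sum, sum_const, card_univ, ZMod.card, nsmul_eq_mul]
    _ ≤ ∑ y, ‖dft f y‖ ^ 2 *
        (2 * (N * (1 / N.minFac + 1 / W)) + N * (2 * (2 * pi / W) ^ 2)) := by
        refine sum_le_sum fun y _ => ?_
        rw [dft_residual]
        split_ifs with h
        · rw [norm_zero]
          have : (0 : ℝ) ≤ ‖dft f y‖ ^ 2 *
            (2 * (N * (1 / N.minFac + 1 / W)) + N * (2 * (2 * pi / W) ^ 2)) := by positivity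
          simpa using this
        · gcongr
          exact sum_norm_sq_kernel_le (sub_ne_zero.2 h) hW
    _ = (∑ y, ‖dft f y‖ ^ 2) * (2 * N * (1 / N.minFac + 1 / W + (2 * pi / W) ^ 2)) := by
        rw [← sum_mul]; ring
    _ ≤ B₂ * (2 * N * (1 / N.minFac + 1 / W + (2 * pi / W) ^ 2)) := by gcongr
    _ = _ := by ring

lemma kernel_zero {W : ℕ} (hW : 0 < W) : kernel W (0 : ZMod N) 0 = 1 := by
  have : (W : ℂ) ≠ 0 := mod_cast hW.ne'
  simp [kernel, ez_zero, this]

lemma windowAvg_residual (f : ZMod N → ℂ) (W : ℕ) (x b : ZMod N) (θ : ℝ) (t : ZMod N) : windowAvg f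
  W b θ t = windowAvg (residual f x) W b θ t + dft f x * kernel W (b * x) θ * stdAddChar (x * t) :=
  by
  rw [windowAvg_eq f, windowAvg_eq (residual f x), ← Finset.sum_erase_add _ _ (mem_univ x),
    ← Finset.sum_erase_add univ _ (mem_univ x), dft_residual, if_pos rfl]
  rw [zero_mul, zero_mul, add_zero]
  congr 1
  refine sum_congr rfl fun y hy => ?_
  rw [dft_residual, if_neg (Finset.ne_of_mem_erase hy)]

open Classical in
/-- The proportion of windows that are not clean. -/
lemma card_not_clean_le {f : ZMod N → ℂ} {x : ZMod N} {ρ : ℝ} (hρ : 0 < ρ) (hx : ρ ≤ ‖dft f x‖) (hW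
  : 40 * pi ≤ ell (size N)) (b : ZMod N) : ((univ.filter fun t => ¬ Clean f b (gridPoint (grid N) (b
  * x) / grid N) (dft f x) x t).card : ℝ) / N ≤ 400 / ρ ^ 2 * leak f (ell (size N)) x b := by
  set W := ell (size N) with hWdef
  have hW0' : (0 : ℝ) < W := by nlinarith [Real.pi_pos]
  have hW0 : 0 < W := mod_cast hW0'
  have h := card_filter_div_le (Ω := ZMod N) (fun t => ¬ Clean f b (gridPoint (grid N) (b * x) /
    grid N) (dft f x) x t) (X := fun t => 400 / ρ ^ 2 * ‖windowAvg (residual f x) W b (gridPoint (W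
    * W) (b * x) / (W * W : ℕ)) t‖ ^ 2) (fun t => by positivity) ?_
  · rw [← mul_expect, ZMod.card] at h
    exact h
  · intro t ht
    rw [Clean, not_le, grid, ← hWdef] at ht
    have h1 := norm_kernel_grid_sub_le hW0 x x b
    rw [sub_self, mul_zero, kernel_zero hW0] at h1
    -- Half of the tolerance `1 / 10` in `Clean` is used up by the grid. A window that is not clean
    -- thus has a residual above `‖dft f x‖ / 20`, and `400 = 20 ^ 2`.
    have h2 : 2 * pi / W ≤ 1 / 20 := by
      rw [div_le_div_iff₀ hW0' (by simp)]; linarith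
    rw [windowAvg_residual f W x] at ht
    set z := windowAvg (residual f x) W b (gridPoint (W * W) (b * x) / (W * W : ℕ)) t
    have h3 : ‖dft f x‖ / 20 ≤ ‖z‖ := by
      have e : z + dft f x * kernel W (b * x) (gridPoint (W * W) (b * x) / (W * W : ℕ)) * stdAddChar
        (x * t) - dft f x * stdAddChar (x * t) = z + dft f x * ((kernel W (b * x) (gridPoint (W * W)
        (b * x) / (W * W : ℕ)) - 1) * stdAddChar (x * t)) := by ring
      rw [e] at ht
      have h4 := ht.trans_le (norm_add_le _ _)
      rw [norm_mul, norm_mul, norm_stdAddChar, mul_one] at h4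
      have := mul_le_mul_of_nonneg_left (h1.trans h2) (norm_nonneg (dft f x))
      linarith
    have h5 : ρ / 20 ≤ ‖z‖ := by linarith
    rw [div_mul_eq_mul_div, le_div_iff₀ (by positivity)]
    nlinarith

/-- One of the windows for the `j`-th digit at the time `t` is not clean. -/
def unclean (f : ZMod N → ℂ) (x b : ZMod N) (j : ℕ) (t : ZMod N) : Prop := ¬ (Clean f b (gridPoint
  (grid N) (b * x) / grid N) (dft f x) x t ∧ Clean f b (gridPoint (grid N) (b * x) / grid N) (dft f
  x) x (t + ((2 ^ (size N + 2 - (j + 1)) : ℤ) : ZMod N)))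

open Classical in
/-- The proportion of pairs of windows that are not both clean. -/
lemma card_unclean_le {f : ZMod N → ℂ} {x : ZMod N} {ρ : ℝ} (hρ : 0 < ρ) (hx : ρ ≤ ‖dft f x‖) (hW :
  40 * pi ≤ ell (size N)) (b : ZMod N) (j : ℕ) : ((univ.filter (unclean f x b j)).card : ℝ) / N ≤
  800 / ρ ^ 2 * leak f (ell (size N)) x b := by
  have h := card_not_clean_le hρ hx hW b
  set H := ((2 ^ (size N + 2 - (j + 1)) : ℤ) : ZMod N)
  set C := fun t => Clean f b (gridPoint (grid N) (b * x) / grid N) (dft f x) x t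
  have h1 : (univ.filter fun t => ¬ C (t + H)).card = (univ.filter fun t => ¬ C t).card :=
    Finset.card_bij (fun t _ => t + H) (by simp) (by simp) (fun t ht => ⟨t - H, by simpa using ht, by simp⟩)
  have h2 : (univ.filter (unclean f x b j)).card ≤ (univ.filter fun t => ¬ C t).card + (univ.filter
    fun t => ¬ C (t + H)).card := by
    refine le_trans (card_le_card ?_) (card_union_le _ _)
    intro t ht
    simp only [mem_filter, Finset.mem_union, mem_univ, true_and] at ht ⊢
    exact not_and_or.1 ht
  rw [h1] at h2
  calc _ ≤ (((univ.filter fun t => ¬ C t).card + (univ.filter fun t => ¬ C t).card : ℕ) : ℝ) / N := by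
        gcongr
    _ = ((univ.filter fun t => ¬ C t).card : ℝ) / N + ((univ.filter fun t => ¬ C t).card : ℝ) / N := by
        push_cast; ring
    _ ≤ 400 / ρ ^ 2 * leak f (ell (size N)) x b + 400 / ρ ^ 2 * leak f (ell (size N)) x b := by
        gcongr
    _ = _ := by ring

lemma natCast_fin_bijective : Function.Bijective fun i : Fin N => ((i : ℕ) : ZMod N) := by
  rw [Fintype.bijective_iff_injective_and_card]
  refine ⟨fun i j h => ?_, by rw [ZMod.card, Fintype.card_fin]⟩
  have h1 := (ZMod.natCast_eq_natCast_iff' _ _ _).1 h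
  rw [Nat.mod_eq_of_lt i.2, Nat.mod_eq_of_lt j.2] at h1
  exact Fin.ext h1

lemma expect_fin {M : Type*} [AddCommMonoid M] [Module ℚ≥0 M] (F : ZMod N → M) : 𝔼 i : Fin N, F ((i
  : ℕ) : ZMod N) = 𝔼 x, F x := Fintype.expect_bijective _ natCast_fin_bijective _ _ fun _ => rfl

open Classical in
lemma card_filter_fin (p : ZMod N → Prop) : (univ.filter fun i : Fin N => p ((i : ℕ) : ZMod N)).card
  = (univ.filter p).card := by
  refine Finset.card_bij (fun i _ => ((i : ℕ) : ZMod N)) (by simp)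
    (fun i _ j _ h => natCast_fin_bijective.1 h) fun x hx => ?_
  obtain ⟨i, rfl⟩ := natCast_fin_bijective.2 x
  exact ⟨i, by simpa using hx, rfl⟩

/-- The frequency found from the grid point `s`. -/
def freq (R : ZMod N → ℂ) (a : ZMod N) (bd : ℤ) (s : ℕ) (t : ℕ → ℤ) : ZMod N :=
  (roundFreq N (expansion N R a.val bd s t (size N + 2)) : ℤ)

/-- The frequencies in `X` are found, and all estimates are good. -/
structure Decoded (R : ZMod N → ℂ) (a : ZMod N) (X : Finset (ZMod N)) (η : ℝ) (r : Draws N) :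
    Prop where
  found : ∀ x ∈ X, ∃ s < grid N, freq R a (r.1 : ℕ) s (drawSeq r.2.1) = x
  est : ∀ s < grid N, ‖sampledCoeff (dechirp a R) (draws N) (fun j => (drawSeq r.2.2 j : ZMod N))
    (freq R a (r.1 : ℕ) s (drawSeq r.2.1)) - dft (dechirp a R) (freq R a (r.1 : ℕ) s (drawSeq
    r.2.1))‖ ≤ η

lemma le_one_of_sum_lt {ι : Type*} {s : Finset ι} {F : ι → ℝ} (h0 : ∀ i ∈ s, 0 ≤ F i) (h : ∑ i ∈ s,
  F i < 1) {i : ι} (hi : i ∈ s) : F i < 1 := (Finset.single_le_sum h0 hi).trans_lt h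

open Classical in
/-- Deviation of the proportion of unclean draws from its mean. -/
def deviation (f : ZMod N → ℂ) (x b : ZMod N) (j : ℕ) (t : Fin (draws N) → Fin N) : ℝ :=
  (((univ.filter fun m => unclean f x b j (((t m : ℕ)) : ZMod N)).card : ℝ) / draws N -
  ((univ.filter fun i : Fin N => unclean f x b j ((i : ℕ) : ZMod N)).card : ℝ) / Fintype.card (Fin
  N)) ^ 2

/-- The constants are thresholds for Markov: `3200 = 4 * 800` makes the mean proportion of unclean
draws at most `1 / 4`, and `16 = 4 ^ 2` makes the deviation from it less than `1 / 4`. So fewer than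
half of the draws are bad for each digit. -/
lemma freq_eq {R : ZMod N → ℂ} {B : ℝ} (hT : Tame N R B) {a x : ZMod N} {ρ : ℝ} (hρ : 0 < ρ) (hx : ρ
  ≤ ‖dft (dechirp a R) x‖) (hW : 40 * pi ≤ ell (size N)) (hfix : fixErr N B ≤ ρ / 40) {b : Fin N} {t
  : Fin (draws N) → Fin N} (h1 : 3200 / ρ ^ 2 * leak (dechirp a R) (ell (size N)) x ((b : ℕ) : ZMod
  N) < 1) (h2 : ∀ j < size N + 2, 16 * deviation (dechirp a R) x ((b : ℕ) : ZMod N) j t < 1) : freq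
  R a (b : ℕ) (gridPoint (grid N) (((b : ℕ) : ZMod N) * x)) (drawSeq t) = x := by
  classical
  set f := dechirp a R
  set b' : ZMod N := ((b : ℕ) : ZMod N) with hb'
  have hM : 0 < draws N := by
    rw [draws]
    have := hT.size_ge
    exact Nat.mul_pos (by omega) (ell_pos (by omega))
  have hM' : (0 : ℝ) < draws N := mod_cast hM
  rw [freq]
  have key := roundFreq_eq hT (a := a.val) (bd := (b : ℕ)) (s := gridPoint (grid N) (b' * x)) (xi :=
    x.val) (t := drawSeq t) (β := dft f x) (norm_pos_iff.1 (hρ.trans_le hx)) (hfix.trans (by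
    linarith)) (bad := fun j i => unclean f x b' j ((drawSeq t i : ℤ) : ZMod N)) ?_ ?_
  · rw [key, intCast_val]
  · intro j hj
    have e1 : ((range (draws N)).filter fun i => unclean f x b' j ((drawSeq t i : ℤ) : ZMod N)).card
      = (univ.filter fun m => unclean f x b' j (((t m : ℕ)) : ZMod N)).card := by
      rw [Finset.card_filter, Finset.card_filter, Finset.sum_range]
      refine sum_congr rfl fun m _ => ?_
      rw [drawSeq_apply, Int.cast_natCast]
    rw [e1]
    have h3 := h2 j hj
    have h4 := card_unclean_le hρ hx hW b' j
    have h5 : ((univ.filter fun i : Fin N => unclean f x b' j ((i : ℕ) : ZMod N)).card : ℝ) /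
      Fintype.card (Fin N) ≤ 1 / 4 := by
      rw [card_filter_fin, Fintype.card_fin]
      refine h4.trans ?_
      have : 800 / ρ ^ 2 * leak f (ell (size N)) x b' =
        (3200 / ρ ^ 2 * leak f (ell (size N)) x b') / 4 := by ring
      rw [this]
      linarith
    rw [deviation] at h3
    set p := ((univ.filter fun m => unclean f x b' j (((t m : ℕ)) : ZMod N)).card : ℝ) /
      draws N with hp
    set p' := ((univ.filter fun i : Fin N => unclean f x b' j ((i : ℕ) : ZMod N)).card : ℝ) /
      Fintype.card (Fin N)
    have h6 : p < 1 / 2 := by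
      by_contra! hge
      nlinarith
    rw [hp, div_lt_div_iff₀ hM' (by simp)] at h6
    have h7 : 2 * ((univ.filter fun m => unclean f x b' j (((t m : ℕ)) : ZMod N)).card : ℝ) <
      draws N := by linarith
    exact_mod_cast h7
  · intro j _ i _ hbad
    have h3 := not_not.1 hbad
    simpa only [hb', Int.cast_natCast, ZMod.natCast_zmod_val] using h3

lemma expect_deviation_le (f : ZMod N → ℂ) (x b : ZMod N) (j : ℕ) (hM : 0 < draws N) : 𝔼 t,
  deviation f x b j t ≤ 1 / draws N := by
  classical
  simp only [deviation]
  exact expect_filter_sub_le (α := Fin N) (fun i => unclean f x b j ((i : ℕ) : ZMod N)) hM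

lemma expect_sampledCoeff_le (f : ZMod N → ℂ) (y : ZMod N) {B₂ : ℝ} (hM : 0 < draws N) (hB₂ : ∑ x,
  ‖dft f x‖ ^ 2 ≤ B₂) : 𝔼 t : Fin (draws N) → Fin N, ‖sampledCoeff f (draws N) (fun j => (drawSeq t
  j : ZMod N)) y - dft f y‖ ^ 2 ≤ B₂ / draws N := by
  have h1 := expect_norm_sq_sub_le (fun i : Fin N => f ((i : ℕ) : ZMod N) *
    stdAddChar (-(y * ((i : ℕ) : ZMod N)))) hM
  rw [expect_fin (fun x => f x * stdAddChar (-(y * x))),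
    expect_fin (fun x => ‖f x * stdAddChar (-(y * x))‖ ^ 2)] at h1
  have h2 : 𝔼 x, f x * stdAddChar (-(y * x)) = dft f y := by
    rw [expect_eq_sum_div_card, ZMod.card, dft, inv_mul_eq_div]
  have h3 : 𝔼 x, ‖f x * stdAddChar (-(y * x))‖ ^ 2 ≤ B₂ := by
    simp only [norm_mul, norm_stdAddChar, mul_one]
    rw [expect_eq_sum_div_card, ZMod.card, ← sum_norm_sq_dft]
    exact hB₂
  rw [h2] at h1
  refine le_trans (le_of_eq ?_) (h1.trans (by gcongr))
  refine Finset.expect_congr rfl fun t' _ => ?_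
  rw [sampledCoeff, Finset.sum_range]
  simp only [drawSeq_apply, Int.cast_natCast]

open Classical in
/-- Large frequencies are found and estimated with high probability. -/
lemma card_not_decoded_le {R : ZMod N → ℂ} {B : ℝ} (hT : Tame N R B) (a : ZMod N) {X : Finset (ZMod
  N)} {ρ η B₂ : ℝ} (hρ : 0 < ρ) (hη : 0 < η) (hX : ∀ x ∈ X, ρ ≤ ‖dft (dechirp a R) x‖) (hW : 40 * pi
  ≤ ell (size N)) (hfix : fixErr N B ≤ ρ / 40) (hB₂ : ∑ x, ‖dft (dechirp a R) x‖ ^ 2 ≤ B₂) :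
  ((univ.filter fun r : Draws N => ¬ Decoded R a X η r).card : ℝ) / Fintype.card (Draws N) ≤ X.card
  * (3200 / ρ ^ 2 * (2 * B₂ * (1 / N.minFac + 1 / ell (size N) + (2 * pi / ell (size N)) ^ 2))) +
  X.card * ((size N + 2) * (16 * (1 / draws N))) + grid N * (B₂ / draws N / η ^ 2) := by
  set f := dechirp a R with hf
  have hW0 : 0 < ell (size N) := ell_pos (by have := hT.size_ge; omega)
  have hM : 0 < draws N := by
    rw [draws]
    have := hT.size_ge
    exact Nat.mul_pos (by omega) hW0
  set X₁ : Fin N → ℝ := fun b => ∑ x ∈ X, 3200 / ρ ^ 2 *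
    leak f (ell (size N)) x ((b : ℕ) : ZMod N) with hX₁
  set X₂ : Fin N → (Fin (draws N) → Fin N) → ℝ := fun b t => ∑ x ∈ X,
    ∑ j ∈ range (size N + 2), 16 * deviation f x ((b : ℕ) : ZMod N) j t with hX₂
  set φ : Fin N → (Fin (draws N) → Fin N) → ℕ → ZMod N := fun b t s =>
    freq R a (b : ℕ) s (drawSeq t) with hφ
  set X₃ : Fin N → (Fin (draws N) → Fin N) → (Fin (draws N) → Fin N) → ℝ := fun b t t' =>
    ∑ s ∈ range (grid N), ‖sampledCoeff f (draws N) (fun j => (drawSeq t' j : ZMod N))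
      (φ b t s) - dft f (φ b t s)‖ ^ 2 / η ^ 2 with hX₃
  have n1 : ∀ b, 0 ≤ X₁ b := fun b => sum_nonneg fun x _ =>
    mul_nonneg (by positivity) (leak_nonneg _ _ _ _)
  have n2' : ∀ b x j t, 0 ≤ 16 * deviation f x b j t := fun b x j t => by
    rw [deviation]; positivity
  have n2 : ∀ b t, 0 ≤ X₂ b t := fun b t => sum_nonneg fun x _ =>
    sum_nonneg fun j _ => n2' _ _ _ _
  have n3 : ∀ b t t', 0 ≤ X₃ b t t' := fun b t t' => sum_nonneg fun s _ => by positivity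
  refine (card_filter_div_le _ (X := fun r : Draws N => X₁ r.1 + X₂ r.1 r.2.1 + X₃ r.1 r.2.1 r.2.2)
    (fun r => add_nonneg (add_nonneg (n1 _) (n2 _ _)) (n3 _ _ _)) ?_).trans ?_
  -- `X₁`, `X₂`, `X₃` measure the failures of the dilation, of the votes and of the estimates. If
  -- their sum is below 1, so is every nonnegative summand, and each one is scaled so that this
  -- gives success.
  · rintro ⟨b, t, t'⟩ hr
    by_contra! hlt
    simp only at hlt
    have l1 : X₁ b < 1 := by linarith [n2 b t, n3 b t t']
    have l2 : X₂ b t < 1 := by linarith [n1 b, n3 b t t']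
    have l3 : X₃ b t t' < 1 := by linarith [n1 b, n2 b t]
    refine hr ⟨fun x hx => ⟨_, gridPoint_lt (Nat.mul_pos hW0 hW0) _,
      freq_eq hT hρ (hX x hx) hW hfix ?_ ?_⟩, fun s hs => ?_⟩
    · exact le_one_of_sum_lt (fun x _ => mul_nonneg (by positivity) (leak_nonneg _ _ _ _)) l1 hx
    · intro j hj
      have := le_one_of_sum_lt (fun x _ => sum_nonneg fun j _ => n2' _ _ _ _) l2 hx
      exact le_one_of_sum_lt (fun j _ => n2' _ _ _ _) this (mem_range.2 hj)
    · have := le_one_of_sum_lt (fun s _ => by positivity) l3 (mem_range.2 hs)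
      rw [div_lt_one (by positivity)] at this
      exact (abs_le_of_sq_le_sq' this.le hη.le).2
  · rw [Finset.expect_add_distrib, Finset.expect_add_distrib, expect_draws₁, expect_draws₂,
      expect_draws₃]
    refine add_le_add (add_le_add ?_ ?_) ?_
    · rw [hX₁, Finset.expect_sum_comm, ← nsmul_eq_mul]
      refine sum_le_card_nsmul _ _ _ fun x _ => ?_
      rw [← mul_expect, expect_fin]
      exact mul_le_mul_of_nonneg_left (expect_leak_le f hW0 x hB₂) (by positivity)
    · refine (Finset.expect_le_expect (g := fun _ => (X.card : ℝ) * ((size N + 2) *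
        (16 * (1 / draws N)))) fun b _ => ?_).trans (expect_const _).le
      simp only [hX₂]
      rw [Finset.expect_sum_comm, ← nsmul_eq_mul]
      refine sum_le_card_nsmul _ _ _ fun x _ => ?_
      rw [Finset.expect_sum_comm]
      have : ((size N + 2 : ℝ) * (16 * (1 / draws N))) = (range (size N + 2)).card • (16 * (1 /
        draws N) : ℝ) := by
        rw [card_range, nsmul_eq_mul]; push_cast; ring
      rw [this]
      refine sum_le_card_nsmul _ _ _ fun j _ => ?_
      rw [← mul_expect]
      exact mul_le_mul_of_nonneg_left (expect_deviation_le _ _ _ _ hM) (by simp)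
    -- The frequencies found depend on `b` and `t` only. They are constants in the mean over the
    -- independent draws `t'`, so Chebyshev's bound applies to each of the `W^2` candidates.
    · refine (Finset.expect_le_expect (g := fun _ => (grid N : ℝ) * (B₂ / draws N / η ^ 2))
        fun b _ => ?_).trans (expect_const _).le
      refine (Finset.expect_le_expect (g := fun _ => (grid N : ℝ) * (B₂ / draws N / η ^ 2))
        fun t _ => ?_).trans (expect_const _).le
      simp only [hX₃]
      rw [Finset.expect_sum_comm]
      have : (grid N : ℝ) * (B₂ / draws N / η ^ 2) = (range (grid N)).card • (B₂ / draws N / η ^ 2)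
        := by
        rw [card_range, nsmul_eq_mul]
      rw [this]
      refine sum_le_card_nsmul _ _ _ fun s _ => ?_
      rw [← Finset.expect_div]
      exact div_le_div_of_nonneg_right (expect_sampledCoeff_le f _ hM hB₂) (by positivity)

end

/-! ## The output, when the frequencies are found -/

section
variable {N k : ℕ} {μ : ℝ}

/-- A converse of `lt_norm_of_fixed`: a margin of two units of the fixed point suffices to pass the
test. -/
lemma fixed_of_lt_norm (hμ : 0 ≤ μ) {x y : ℤ} (h : μ + 2 / 2 ^ (2 * size N) ≤ ‖(⟨ofFixed N x,
  ofFixed N y⟩ : ℂ)‖) : (toFixed N μ + 1) * (toFixed N μ + 1) < x * x + y * y + 1 := by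
  set q : ℝ := 2 ^ (2 * size N) with hq
  have hq0 : 0 < q := by positivity
  have h1 : (toFixed N μ : ℝ) ≤ q * μ := Int.floor_le _
  have h2 : (0 : ℝ) ≤ toFixed N μ := by
    have : 0 ≤ toFixed N μ := Int.floor_nonneg.2 (by positivity)
    exact_mod_cast this
  have h3 : (μ + 2 / q) ^ 2 ≤ ‖(⟨ofFixed N x, ofFixed N y⟩ : ℂ)‖ ^ 2 := by gcongr
  rw [sq_norm, Complex.normSq_mk] at h3
  simp only [ofFixed, ← hq] at h3
  rw [div_mul_div_comm, div_mul_div_comm, ← add_div, le_div_iff₀ (by positivity)] at h3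
  have h4 : (μ + 2 / q) ^ 2 * (q * q) = (q * μ + 2) ^ 2 := by field_simp
  rw [h4] at h3
  have h5 : ((toFixed N μ : ℝ) + 1) * (toFixed N μ + 1) ≤ (q * μ + 2) ^ 2 := by nlinarith
  have h6 : ((toFixed N μ : ℝ) + 1) * (toFixed N μ + 1) < x * x + y * y + 1 := by linarith
  exact_mod_cast h6

variable [NeZero N]

/-- The frequencies in `X` are large, by a margin, and all others are small. -/
structure Gap (f : ZMod N → ℂ) (μ η : ℝ) (X : Finset (ZMod N)) : Prop where
  large : ∀ x ∈ X, μ + 5 * η ≤ ‖dft f x‖ + 2 * η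
  small : ∀ x ∉ X, ‖dft f x‖ ≤ 2 * η

/-- The word length is large enough. -/
structure Precise (N : ℕ) (B B₂ η : ℝ) : Prop where
  unit : 2 / 2 ^ (2 * size N) ≤ η
  round : (√B₂ + η) / √N + fixErr N B ≤ η

/-- Estimates are off by at most `2 η`: `η` from sampling, `η` from arithmetic. Outside `X` they are
at most `4 η ≤ μ` and not listed; on `X` the true value is at least `μ + 3 η`, so the estimate is at
least `μ + η`, enough for the test. The capacity `k` is no obstacle because `X` has at most `k`
elements. -/
lemma PeakOutput.spec {R : ZMod N → ℂ} {B B₂ η : ℝ} (hT : Tame N R B) {a b : ZMod N} {u : ℤ} (hu :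
  (u : ZMod N) * (a - b) = 1) {X : Finset (ZMod N)} (hX : X.card ≤ k) {r : Draws N} (hr : Decoded R
  a X η r) (hG : Gap (dechirp a R) μ η X) (hη : 0 < η) (hμ : 4 * η ≤ μ) (hB₂ : ∑ x, ‖dft (dechirp a
  R) x‖ ^ 2 ≤ B₂) (hp : Precise N B B₂ η) {l : List (Peak N)} (h : PeakOutput N k R (toFixed N μ)
  a.val b.val u (r.1 : ℕ) (drawSeq r.2.1) (drawSeq r.2.2) l) : (∀ q, (∃ p ∈ l, p.pt = q) ↔ q ∈ line
  b ∧ a * q.1 - q.2 ∈ X) ∧ ∀ p ∈ l, ‖p.est - ambiguity (chirp a) R p.pt‖ ≤ 2 * η := by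
  set f := dechirp a R with hf
  have hle : ∀ x, ‖dft f x‖ ≤ √B₂ := fun x => Real.le_sqrt_of_sq_le ((Finset.single_le_sum (f := fun
    x => ‖dft f x‖ ^ 2) (fun _ _ => by positivity) (mem_univ x)).trans hB₂)
  set c : ℕ → ℤ := fun s => candTau N R a.val u (r.1 : ℕ) s (drawSeq r.2.1) with hc
  set φ : ℕ → ZMod N := fun s => freq R a (r.1 : ℕ) s (drawSeq r.2.1) with hφ
  have hcφ : ∀ s, ((c s : ℤ) : ZMod N) = φ s * u := by
    intro s
    simp only [hc, hφ, candTau, freq, ZMod.intCast_mod, Int.cast_mul]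
  have hφc : ∀ s, (a - b) * (c s : ZMod N) = φ s := by
    intro s
    rw [hcφ]; linear_combination (φ s) * hu
  have hest : ∀ s < grid N, ‖(⟨ofFixed N (estRe N R a.val b.val (c s) (drawSeq r.2.2)), ofFixed N
    (estIm N R a.val b.val (c s) (drawSeq r.2.2))⟩ : ℂ) - ambiguity (chirp a) R ((c s : ZMod N), b *
    (c s : ZMod N))‖ ≤ 2 * η := by
    intro s hs
    have h1 := norm_est_sub_le hT a.val b.val (c s) (drawSeq r.2.2)
    simp only [intCast_val, hφc] at h1
    have h2 := hr.est s hs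
    rw [ambiguity_chirp a hT.odd, hφc]
    set e := stdAddChar ((2 : ZMod N)⁻¹ * a * ((c s : ℤ) : ZMod N) ^ 2)
    set S := sampledCoeff (dechirp a R) (draws N) (fun j => (drawSeq r.2.2 j : ZMod N)) (φ s)
    have he : ‖e‖ = 1 := norm_stdAddChar _
    have h3 : ‖e * S - e * dft f (φ s)‖ ≤ η := by
      rw [← mul_sub, norm_mul, he, one_mul]; exact h2
    have h4 : ‖e * S‖ ≤ √B₂ + η := by
      have h5 := norm_add_le (e * S - e * dft f (φ s)) (e * dft f (φ s))
      rw [sub_add_cancel, norm_mul e (dft f _), he, one_mul] at h5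
      linarith [hle (φ s)]
    have h6 : ‖e * S‖ / √N ≤ (√B₂ + η) / √N := by gcongr
    have h7 := norm_sub_le_norm_sub_add_norm_sub (⟨ofFixed N (estRe N R a.val b.val (c s) (drawSeq
      r.2.2)), ofFixed N (estIm N R a.val b.val (c s) (drawSeq r.2.2))⟩ : ℂ) (e * S) (e * dft f (φ
      s))
    have := hp.round
    linarith
  have hamb : ∀ s, ‖ambiguity (chirp a) R ((c s : ZMod N), b * (c s : ZMod N))‖ = ‖dft f (φ s)‖ := by
    intro s
    rw [ambiguity_chirp a hT.odd, hφc, norm_mul, norm_stdAddChar, one_mul]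
  have hmem : ∀ s < grid N, μ < ‖(⟨ofFixed N (estRe N R a.val b.val (c s) (drawSeq r.2.2)), ofFixed
    N (estIm N R a.val b.val (c s) (drawSeq r.2.2))⟩ : ℂ)‖ → φ s ∈ X := by
    intro s hs hlt
    by_contra hn
    have h1 := hG.small _ hn
    have h2 := norm_sub_norm_le (⟨ofFixed N (estRe N R a.val b.val (c s) (drawSeq r.2.2)),
      ofFixed N (estIm N R a.val b.val (c s) (drawSeq r.2.2))⟩ : ℂ)
      (ambiguity (chirp a) R ((c s : ZMod N), b * (c s : ZMod N)))
    rw [hamb] at h2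
    linarith [hest s hs]
  have hpt : ∀ p ∈ l, ∃ x ∈ X, p.pt = (x * u, b * (x * u)) := by
    intro p hp'
    obtain ⟨s, hs, h1, rfl⟩ := h.mem p hp'
    refine ⟨φ s, hmem s hs (lt_norm_of_fixed h1), ?_⟩
    simp only [intCast_val]
    rw [← hcφ]
  have hall : ∀ x ∈ X, ∃ p ∈ l, p.pt.1 = x * u := by
    classical
    intro x hx
    obtain ⟨s, hs, hsx⟩ := hr.found x hx
    have hsx' : φ s = x := hsx
    have h1 := hG.large x hx
    rw [← hsx', ← hamb] at h1
    have h2 := norm_sub_norm_le (ambiguity (chirp a) R ((c s : ZMod N), b * (c s : ZMod N)))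
      (⟨ofFixed N (estRe N R a.val b.val (c s) (drawSeq r.2.2)), ofFixed N (estIm N R a.val b.val (c
      s) (drawSeq r.2.2))⟩ : ℂ)
    rw [norm_sub_rev] at h2
    have h3 := fixed_of_lt_norm (N := N) (μ := μ) (by linarith)
      (x := estRe N R a.val b.val (c s) (drawSeq r.2.2))
      (y := estIm N R a.val b.val (c s) (drawSeq r.2.2)) (by linarith [hest s hs, hp.unit])
    -- If the list is full, its `k` different points all come from `X`, which has at most `k`
    -- elements. So all of `X` is listed, in particular `x`.
    rcases h.complete s hs h3 with hk | ⟨p, hp', hp1⟩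
    · have h4 : (l.map fun p => p.pt.1).toFinset ⊆ X.image fun x => x * (u : ZMod N) := by
        intro y hy
        simp only [List.mem_toFinset, List.mem_map] at hy
        obtain ⟨p, hp', rfl⟩ := hy
        obtain ⟨x', hx', he⟩ := hpt p hp'
        rw [he]
        exact Finset.mem_image_of_mem _ hx'
      have h5 : (l.map fun p => p.pt.1).toFinset.card = k := by
        rw [List.toFinset_card_of_nodup h.nodup, List.length_map, hk]
      have h6 := Finset.eq_of_subset_of_card_le h4 (by
        rw [h5]; exact Finset.card_image_le.trans hX)
      have h7 : x * (u : ZMod N) ∈ (l.map fun p => p.pt.1).toFinset := by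
        rw [h6]; exact Finset.mem_image_of_mem _ hx
      simpa using h7
    · refine ⟨p, hp', ?_⟩
      rw [hp1, ← hsx']
      exact hcφ s
  refine ⟨fun q => ⟨?_, ?_⟩, ?_⟩
  · rintro ⟨p, hp', rfl⟩
    obtain ⟨x, hx, he⟩ := hpt p hp'
    rw [he]
    refine ⟨rfl, ?_⟩
    have : a * (x * (u : ZMod N)) - b * (x * u) = x := by linear_combination x * hu
    simpa only [this] using hx
  · rintro ⟨h1, h2⟩
    obtain ⟨p, hp', h3⟩ := hall _ h2
    refine ⟨p, hp', ?_⟩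
    obtain ⟨x', hx', he⟩ := hpt p hp'
    have h4 : q.2 = b * q.1 := h1
    have h5 : q.1 = p.pt.1 := by rw [h3, h4]; linear_combination (-q.1) * hu
    have h6 : p.pt.2 = b * p.pt.1 := by rw [he]
    exact Prod.ext h5.symm (by rw [h6, h4, h5])
  · intro p hp'
    obtain ⟨s, hs, h1, rfl⟩ := h.mem p hp'
    have := hest s hs
    simpa only [intCast_val] using this

end

/-! ## Random lines -/

section
lemma castHom_ne_zero {N : ℕ} {x : ZMod N} (h : IsUnit x) {q : ℕ} (hq : q.Prime) (hqN : q ∣ N) :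
  ZMod.castHom hqN (ZMod q) x ≠ 0 := by
  have : Fact q.Prime := ⟨hq⟩
  exact (h.map (ZMod.castHom hqN (ZMod q))).ne_zero

variable {N : ℕ} [NeZero N]

lemma transversal_iff {a b : ZMod N} : Transversal a b ↔ IsUnit (a - b) := by
  refine ⟨Transversal.isUnit, fun h => ?_⟩
  ext p
  simp only [Set.mem_inter_iff, mem_line, Set.mem_singleton_iff]
  constructor
  · rintro ⟨h1, h2⟩
    have h3 : p.1 = 0 := h.mul_right_eq_zero.1 (by linear_combination h2 - h1)
    exact Prod.ext h3 (by rw [h1, h3, mul_zero]; rfl)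
  · rintro rfl; simp

lemma isUnit_of_castHom_ne_zero {x : ZMod N} (h : ∀ q : ℕ, q.Prime → ∀ hq : q ∣ N, ZMod.castHom hq
  (ZMod q) x ≠ 0) : IsUnit x := by
  rw [← ZMod.natCast_zmod_val x, ZMod.isUnit_iff_coprime]
  refine Nat.coprime_of_dvd fun q hq h1 h2 => ?_
  refine h q hq h2 ?_
  rw [← ZMod.natCast_zmod_val x, map_natCast]
  exact (ZMod.natCast_eq_zero_iff _ _).2 h1

lemma card_affine_le_one {q : ℕ} [Fact q.Prime] {d : ZMod q} (hd : d ≠ 0) (x y : ZMod q) : ((range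
  q).filter fun i : ℕ => y - (x + i * d) = 0).card ≤ 1 := by
  refine Finset.card_le_one.2 fun i hi j hj => ?_
  simp only [mem_filter, mem_range] at hi hj
  have h1 : ((i : ZMod q) - j) * d = 0 := by linear_combination hj.2 - hi.2
  have h2 : (i : ZMod q) = j := sub_eq_zero.1 ((mul_eq_zero.1 h1).resolve_right hd)
  have h3 := (ZMod.natCast_eq_natCast_iff' _ _ _).1 h2
  rwa [Nat.mod_eq_of_lt hi.1, Nat.mod_eq_of_lt hj.1] at h3

open Classical in
/-- A given direction is rarely that of a random line transversal to two given ones. -/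
lemma card_line_mul_le (a b : ZMod N) {v : ZMod N × ZMod N} (hv : v ≠ 0) : (univ.filter fun c =>
  (Transversal a c ∧ Transversal b c) ∧ v ∈ line c).card * (N.minFac - 2) ≤ (univ.filter fun c =>
  Transversal a c ∧ Transversal b c).card := by
  set A := univ.filter fun c => (Transversal a c ∧ Transversal b c) ∧ v ∈ line c with hA
  set V := univ.filter fun c => Transversal a c ∧ Transversal b c with hV
  by_cases hv1 : v.1 = 0
  · have : A = ∅ := by
      refine Finset.filter_eq_empty_iff.2 fun c _ h => hv ?_
      have h2 : v.2 = c * v.1 := h.2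
      exact Prod.ext hv1 (by rw [h2, hv1, mul_zero]; rfl)
    rw [this]; simp
  -- The chosen prime `q` divides the order of `v.1`; this is what later detects a shift of the
  -- slope modulo `q`.
  set m := addOrderOf v.1 with hm
  have hm1 : m ≠ 1 := by rw [hm]; simpa using hv1
  have hmN : m ∣ N := by simpa using addOrderOf_dvd_card (x := v.1)
  set q := m.minFac with hq
  have hqp : q.Prime := Nat.minFac_prime hm1
  have : Fact q.Prime := ⟨hqp⟩
  have hqm : q ∣ m := Nat.minFac_dvd m
  have hqN : q ∣ N := hqm.trans hmN
  have hpq : N.minFac ≤ q := Nat.minFac_le_of_dvd hqp.two_le hqN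
  -- The part of `N` prime to `q`. Adding `i n'` to a slope changes nothing modulo the other primes
  -- and runs through all residues modulo `q`. At most two of the `q` values of `i` destroy
  -- transversality to `a` or `b`, so each slope whose line contains `v` has at least `q - 2`
  -- admissible shifts.
  set n' := ordCompl[q] N with hn'
  have hqn' : ¬ q ∣ n' := Nat.not_dvd_ordCompl hqp (NeZero.ne N)
  have hd : ((n' : ZMod q)) ≠ 0 := fun h => hqn' ((ZMod.natCast_eq_zero_iff _ _).1 h)
  have hother : ∀ q', q'.Prime → q' ∣ N → q' ≠ q → q' ∣ n' := by
    intro q' hq' h1 hne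
    rw [← Nat.ordProj_mul_ordCompl_eq_self N q] at h1
    refine (Nat.Coprime.dvd_mul_left ?_).1 h1
    exact Nat.Coprime.pow_right _ ((Nat.coprime_primes hq' hqp).2 hne)
  have hshift : ∀ (y c : ZMod N) (i : ℕ), Transversal y c → ZMod.castHom hqN (ZMod q) y -
    (ZMod.castHom hqN (ZMod q) c + i * (n' : ZMod q)) ≠ 0 → Transversal y (c + i * n') := by
    intro y c i h1 h2
    rw [transversal_iff] at h1 ⊢
    refine isUnit_of_castHom_ne_zero fun q' hq' hqN' => ?_
    by_cases hne : q' = q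
    · subst hne
      rw [map_sub, map_add, map_mul, map_natCast, map_natCast]
      exact h2
    · have h3 := castHom_ne_zero h1 hq' hqN'
      have h4 : (n' : ZMod q') = 0 := (ZMod.natCast_eq_zero_iff _ _).2 (hother q' hq' hqN' hne)
      rw [map_sub] at h3
      rw [map_sub, map_add, map_mul, map_natCast, map_natCast, h4, mul_zero, add_zero]
      exact h3
  set G := fun c : ZMod N => (range q).filter fun i : ℕ => c + i * n' ∈ V with hG
  have hGcard : ∀ c ∈ A, q - 2 ≤ (G c).card := by
    intro c hc
    simp only [hA, mem_filter, mem_univ, true_and] at hc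
    set Z := fun y : ZMod N => (range q).filter fun i : ℕ => ZMod.castHom hqN (ZMod q) y -
      (ZMod.castHom hqN (ZMod q) c + i * (n' : ZMod q)) = 0 with hZ
    have h1 : range q ⊆ G c ∪ (Z a ∪ Z b) := by
      intro i hi
      simp only [hG, hZ, hV, Finset.mem_union, mem_filter, mem_univ, true_and, hi]
      by_contra! h
      exact h.1 (hshift a c i hc.1.1 h.2.1) (hshift b c i hc.1.2 h.2.2)
    have h2 := (card_le_card h1).trans ((card_union_le _ _).trans
      (Nat.add_le_add_left (card_union_le _ _) _))
    have h3 : (Z a).card ≤ 1 := card_affine_le_one hd _ _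
    have h4 : (Z b).card ≤ 1 := card_affine_le_one hd _ _
    rw [card_range] at h2
    omega
  calc A.card * (N.minFac - 2) ≤ A.card * (q - 2) := Nat.mul_le_mul_left _ (by omega)
    _ ≤ ∑ c ∈ A, (G c).card := by
      rw [← smul_eq_mul]; exact Finset.card_nsmul_le_sum _ _ _ hGcard
    _ = (A.sigma G).card := (Finset.card_sigma _ _).symm
    _ ≤ V.card := by
      -- All shifted slopes are different: if `c + i n' = c' + i' n'` and `v` lies on both lines,
      -- then `(i - i') n' v.1 = 0`, so `q` divides `i - i'`.
      refine Finset.card_le_card_of_injOn (fun x => x.1 + x.2 * n') ?_ ?_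
      · rintro ⟨c, i⟩ h
        simp only [Finset.coe_sigma, Set.mem_sigma_iff, hG, coe_filter] at h
        exact h.2.2
      · rintro ⟨c, i⟩ h ⟨c', i'⟩ h' he
        simp only [Finset.coe_sigma, Set.mem_sigma_iff, hG, hA, Finset.mem_coe, mem_filter,
          mem_range, mem_univ, true_and] at h h' he
        have e1 : v.2 = c * v.1 := h.1.2
        have e2 : v.2 = c' * v.1 := h'.1.2
        have e3 : (i * n') • v.1 = (i' * n') • v.1 := by
          rw [nsmul_eq_mul, nsmul_eq_mul]; push_cast
          linear_combination v.1 * he + e1 - e2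
        have e4 := ((nsmul_eq_nsmul_iff_modEq.1 e3).of_dvd hqm).cancel_right_of_coprime
          ((Nat.Prime.coprime_iff_not_dvd hqp).2 hqn')
        have e5 : i = i' := e4.eq_of_lt_of_lt h.2.1 h'.2.1
        subst e5
        have e6 : c = c' := by linear_combination he
        rw [e6]

-- Given the first two lines, the event forces a nonzero vector `v`, determined by them, onto the
-- third line. Summing `card_line_mul_le` over the first two lines gives probability at most `1 / (p
-- - 2)`.
open Classical in
lemma card_slopeTriples_filter_mul_le {E : ZMod N → ZMod N → ZMod N → Prop} (h : ∀ a b, Transversal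
  a b → ∃ v : ZMod N × ZMod N, ∀ c, E a b c → v ≠ 0 ∧ v ∈ line c) : ((slopeTriples N).filter fun s
  => E s.1 s.2.1 s.2.2).card * (N.minFac - 2) ≤ (slopeTriples N).card := by
  rw [Finset.card_eq_sum_card_fiberwise (f := fun s => (s.1, s.2.1)) (t := (univ : Finset (ZMod N ×
    ZMod N))) (fun _ _ => Finset.mem_coe.2 (mem_univ _)), Finset.card_eq_sum_card_fiberwise (s :=
    slopeTriples N) (f := fun s => (s.1, s.2.1)) (t := (univ : Finset (ZMod N × ZMod N))) (fun _ _
    => Finset.mem_coe.2 (mem_univ _)), sum_mul]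
  refine sum_le_sum fun ab _ => ?_
  obtain ⟨a, b⟩ := ab
  by_cases hab : Transversal a b
  · obtain ⟨v, hE⟩ := h a b hab
    rcases eq_or_ne v 0 with rfl | hv
    · rw [Finset.filter_eq_empty_iff.2]
      · simp
      · rintro ⟨x, y, z⟩ hs h1
        simp only [mem_filter, Prod.mk.injEq] at hs h1
        obtain ⟨rfl, rfl⟩ := h1
        exact (hE z hs.2).1 rfl
    have hinj : Function.Injective fun c : ZMod N => (a, b, c) := fun c c' h => by simpa using h
    refine le_trans (Nat.mul_le_mul_right _ ?_) ((card_line_mul_le a b hv).trans ?_)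
    · rw [← Finset.card_image_of_injective _ hinj]
      refine card_le_card ?_
      rintro ⟨x, y, z⟩ hs
      simp only [mem_filter, mem_slopeTriples, Prod.mk.injEq] at hs
      obtain ⟨⟨⟨-, h2, h3⟩, h4⟩, rfl, rfl⟩ := hs
      simp only [Finset.mem_image, mem_filter, mem_univ, true_and]
      exact ⟨z, ⟨⟨h2, h3⟩, (hE z h4).2⟩, rfl⟩
    · rw [← Finset.card_image_of_injective _ hinj]
      refine card_le_card ?_
      intro s hs
      simp only [Finset.mem_image, mem_filter, mem_univ, true_and] at hs
      obtain ⟨z, ⟨h2, h3⟩, rfl⟩ := hs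
      simp only [mem_filter, mem_slopeTriples]
      exact ⟨⟨hab, h2, h3⟩, trivial⟩
  · rw [Finset.filter_eq_empty_iff.2]
    · simp
    · rintro ⟨x, y, z⟩ hs h1
      simp only [mem_filter, mem_slopeTriples, Prod.mk.injEq] at hs h1
      obtain ⟨rfl, rfl⟩ := h1
      exact hab hs.1.1

-- The set of transversal triples is symmetric, so each of the three lines may play the role of the
-- last one.
open Classical in
lemma card_filter_slope_mul_le {v : ZMod N × ZMod N} (hv : v ≠ 0) : ((slopeTriples N).filter fun s
  => v ∈ line s.1).card * (N.minFac - 2) ≤ (slopeTriples N).card ∧ ((slopeTriples N).filter fun s =>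
  v ∈ line s.2.1).card * (N.minFac - 2) ≤ (slopeTriples N).card ∧ ((slopeTriples N).filter fun s =>
  v ∈ line s.2.2).card * (N.minFac - 2) ≤ (slopeTriples N).card := by
  have h3 := card_slopeTriples_filter_mul_le (N := N) (E := fun _ _ c => v ∈ line c)
    fun a b _ => ⟨v, fun c h => ⟨hv, h⟩⟩
  refine ⟨le_trans (Nat.mul_le_mul_right _ (le_of_eq ?_)) h3,
    le_trans (Nat.mul_le_mul_right _ (le_of_eq ?_)) h3, h3⟩
  · refine Finset.card_nbij' (fun s => (s.2.2, s.2.1, s.1)) (fun s => (s.2.2, s.2.1, s.1)) ?_ ?_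
      (fun _ _ => rfl) (fun _ _ => rfl) <;>
    · intro s hs
      simp only [coe_filter, Set.mem_ofPred_eq, mem_slopeTriples] at hs ⊢
      exact ⟨⟨hs.1.2.2.symm, hs.1.2.1.symm, hs.1.1.symm⟩, hs.2⟩
  · refine Finset.card_nbij' (fun s => (s.1, s.2.2, s.2.1)) (fun s => (s.1, s.2.2, s.2.1)) ?_ ?_
      (fun _ _ => rfl) (fun _ _ => rfl) <;>
    · intro s hs
      simp only [coe_filter, Set.mem_ofPred_eq, mem_slopeTriples] at hs ⊢
      exact ⟨⟨hs.1.2.1, hs.1.1, hs.1.2.2.symm⟩, hs.2⟩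

variable {k : ℕ}

/-- Lines in general position to the targets. -/
structure GoodLines (T : Targets N k) (s : ZMod N × ZMod N × ZMod N) : Prop where
  distinct : ∀ i j, i ≠ j → T.shift i - T.shift j ∉ line s.1 ∧ T.shift i - T.shift j ∉ line s.2.1 ∧
    T.shift i - T.shift j ∉ line s.2.2
  incident : ∀ q, (∃ i, q - T.shift i ∈ line s.1) → (∃ i, q - T.shift i ∈ line s.2.1) →
    (∃ i, q - T.shift i ∈ line s.2.2) → q ∈ Set.range T.shift

-- There are at most `k^2` differences of targets for each of three lines. For the `k^3` triples of
-- targets: given the first two lines, their translates through two targets meet in at most one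
-- point `q`, and a false incidence needs the third line to contain `q` minus the third target.
open Classical in
lemma card_not_goodLines_mul_le (T : Targets N k) : ((slopeTriples N).filter fun s => ¬ GoodLines T
  s).card * (N.minFac - 2) ≤ (3 * k ^ 2 + k ^ 3) * (slopeTriples N).card := by
  set S := slopeTriples N
  set n := Fin T.num
  set P : Finset (n × n) := univ.filter fun x => x.1 ≠ x.2
  set E₁ := fun x : n × n => S.filter fun s => T.shift x.1 - T.shift x.2 ∈ line s.1
  set E₂ := fun x : n × n => S.filter fun s => T.shift x.1 - T.shift x.2 ∈ line s.2.1
  set E₃ := fun x : n × n => S.filter fun s => T.shift x.1 - T.shift x.2 ∈ line s.2.2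
  set E₄ := fun x : n × n × n => S.filter fun s => ∃ q, q - T.shift x.1 ∈ line s.1 ∧
    q - T.shift x.2.1 ∈ line s.2.1 ∧ q - T.shift x.2.2 ∈ line s.2.2 ∧ q ≠ T.shift x.2.2 with hE₄
  have hsub : S.filter (fun s => ¬ GoodLines T s) ⊆ ((P.biUnion E₁ ∪ P.biUnion E₂) ∪ P.biUnion E₃) ∪
    univ.biUnion E₄ := by
    intro s hs
    rw [mem_filter] at hs
    by_contra hn
    simp only [Finset.mem_union, Finset.mem_biUnion, not_or, not_exists, not_and, E₁, E₂, E₃, E₄, P,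
      mem_filter, mem_univ, true_and, hs.1, Prod.forall] at hn
    refine hs.2 ⟨fun i j hij => ⟨hn.1.1.1 i j hij, hn.1.1.2 i j hij, hn.1.2 i j hij⟩, ?_⟩
    rintro q ⟨i, hi⟩ ⟨j, hj⟩ ⟨l, hl⟩
    have := hn.2 i j l q.1 q.2 hi hj hl
    exact ⟨l, (not_not.1 this).symm⟩
  have hP : P.card ≤ k ^ 2 := by
    refine (Finset.card_le_univ _).trans ?_
    rw [Fintype.card_prod, Fintype.card_fin, sq]
    exact Nat.mul_le_mul T.num_le T.num_le
  have hQ : (univ : Finset (n × n × n)).card ≤ k ^ 3 := by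
    rw [card_univ, Fintype.card_prod, Fintype.card_prod, Fintype.card_fin, pow_succ' k, sq]
    exact Nat.mul_le_mul T.num_le (Nat.mul_le_mul T.num_le T.num_le)
  have hne : ∀ x ∈ P, T.shift x.1 - T.shift x.2 ≠ 0 := by
    intro x hx h
    exact (mem_filter.1 hx).2 (T.shift_injective (sub_eq_zero.1 h))
  have hun : ∀ {ι : Type} (I : Finset ι) (E : ι → Finset (ZMod N × ZMod N × ZMod N)) (c : ℕ), I.card
    ≤ c → (∀ i ∈ I, (E i).card * (N.minFac - 2) ≤ S.card) → (I.biUnion E).card * (N.minFac - 2) ≤ c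
    * S.card := by
    intro ι I E c hc h
    calc _ ≤ (∑ i ∈ I, (E i).card) * (N.minFac - 2) := Nat.mul_le_mul_right _ Finset.card_biUnion_le
      _ = ∑ i ∈ I, (E i).card * (N.minFac - 2) := sum_mul _ _ _
      _ ≤ I.card • S.card := sum_le_card_nsmul _ _ _ h
      _ ≤ _ := by rw [smul_eq_mul]; exact Nat.mul_le_mul_right _ hc
  have h1 := hun P E₁ _ hP fun x hx => (card_filter_slope_mul_le (hne x hx)).1
  have h2 := hun P E₂ _ hP fun x hx => (card_filter_slope_mul_le (hne x hx)).2.1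
  have h3 := hun P E₃ _ hP fun x hx => (card_filter_slope_mul_le (hne x hx)).2.2
  have h4 := hun univ E₄ _ hQ fun x _ => by
    refine le_trans (le_of_eq ?_) <| card_slopeTriples_filter_mul_le (N := N) (E := fun a b c => ∃ q, q - T.shift x.1 ∈ line a ∧
      q - T.shift x.2.1 ∈ line b ∧ q - T.shift x.2.2 ∈ line c ∧ q ≠ T.shift x.2.2) fun a b hab => ?_
    · congr!
    by_cases hex : ∃ q, q - T.shift x.1 ∈ line a ∧ q - T.shift x.2.1 ∈ line b ∧ q ≠ T.shift x.2.2
    · obtain ⟨q, hq1, hq2, hq3⟩ := hex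
      refine ⟨q - T.shift x.2.2, ?_⟩
      rintro c ⟨q', h1, h2, h3, -⟩
      have : q' - q ∈ line a ∩ line b := by
        simp only [mem_line, Set.mem_inter_iff, snd_sub, fst_sub] at hq1 hq2 h1 h2 ⊢
        exact ⟨by linear_combination h1 - hq1, by linear_combination h2 - hq2⟩
      rw [Transversal] at hab
      rw [hab] at this
      rw [← sub_eq_zero.1 this]
      refine ⟨?_, h3⟩
      rw [sub_eq_zero.1 this]
      exact sub_ne_zero.2 hq3
    · refine ⟨0, ?_⟩
      rintro c ⟨q, h1, h2, -, h4⟩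
      exact absurd ⟨q, h1, h2, h4⟩ hex
  have h5 := (card_le_card hsub).trans ((card_union_le _ _).trans (Nat.add_le_add_right
    ((card_union_le _ _).trans (Nat.add_le_add_right (card_union_le _ _) _)) _))
  have h6 := Nat.mul_le_mul_right (N.minFac - 2) h5
  simp only [add_mul] at h6 ⊢
  linarith

end

/-! ## The spectrum of the received signal -/

/-- The frequencies of the targets. -/
def targetFreqs {N k : ℕ} (T : Targets N k) (a : ZMod N) : Finset (ZMod N) :=
  univ.image fun j => a * (T.shift j).1 - (T.shift j).2

lemma card_targetFreqs_le {N k : ℕ} (T : Targets N k) (a : ZMod N) : (targetFreqs T a).card ≤ k :=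
  Finset.card_image_le.trans (by rw [card_univ, Fintype.card_fin]; exact T.num_le)

section
variable {N k : ℕ} [NeZero N]

/-- In the double sum for the square put `t = s + h`. The quadratic terms in `s` cancel, and the sum
over `s` of characters at `u h` vanishes unless `h = 0`, since `u` is a unit. -/
lemma norm_gauss_sum (hN : Odd N) {u : ZMod N} (hu : IsUnit u) (y : ZMod N) : ‖∑ t : ZMod N,
  stdAddChar ((2 : ZMod N)⁻¹ * u * t ^ 2 + y * t)‖ ^ 2 = N := by
  have h2 : (2 : ZMod N)⁻¹ * 2 = 1 := by
    have := ZMod.coe_mul_inv_eq_one 2 (n := N) (by simpa using hN.coprime_two_left)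
    rw [mul_comm]; exact_mod_cast this
  have h1 : (∑ t : ZMod N, stdAddChar ((2 : ZMod N)⁻¹ * u * t ^ 2 + y * t)) * conj (∑ t : ZMod N,
    stdAddChar ((2 : ZMod N)⁻¹ * u * t ^ 2 + y * t)) = N := by
    rw [map_sum, Finset.sum_mul_sum, sum_comm]
    have h3 : ∀ s : ZMod N, ∑ t, stdAddChar ((2 : ZMod N)⁻¹ * u * t ^ 2 + y * t) * conj (stdAddChar
      ((2 : ZMod N)⁻¹ * u * s ^ 2 + y * s)) = ∑ h, stdAddChar ((2 : ZMod N)⁻¹ * u * h ^ 2 + y * h) *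
      stdAddChar (s * (u * h)) := by
      intro s
      refine (Fintype.sum_equiv (Equiv.addRight s) _ _ fun h => ?_).symm
      rw [conj_stdAddChar, ← AddChar.map_add_eq_mul, ← AddChar.map_add_eq_mul]
      congr 1
      simp only [Equiv.coe_addRight]
      linear_combination (-(u * h * s)) * h2
    simp only [h3]
    rw [sum_comm]
    simp only [← mul_sum, sum_stdAddChar_mul, hu.mul_right_eq_zero]
    rw [Finset.sum_eq_single 0] <;> simp +contextual
  rw [Complex.mul_conj'] at h1
  exact_mod_cast h1

lemma dechirp_tfShift (hN : Odd N) (a c : ZMod N) (p : ZMod N × ZMod N) (t : ZMod N) : dechirp a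
  (tfShift p (chirp c)) t = stdAddChar (-((2 : ZMod N)⁻¹ * c * p.1 ^ 2)) * stdAddChar ((2 : ZMod
  N)⁻¹ * (a - c) * t ^ 2 + (c * p.1 - p.2) * t) := by
  have h2 : (2 : ZMod N)⁻¹ * 2 = 1 := by
    have := ZMod.coe_mul_inv_eq_one 2 (n := N) (by simpa using hN.coprime_two_left)
    rw [mul_comm]; exact_mod_cast this
  have hs : (√N : ℂ) * ((1 / √N : ℝ) : ℂ) = 1 := by
    rw [← Complex.ofReal_mul, mul_one_div, div_self, Complex.ofReal_one]
    exact (Real.sqrt_pos.2 (mod_cast NeZero.pos N)).ne'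
  have h3 : -((2 : ZMod N)⁻¹ * c * p.1 ^ 2) + ((2 : ZMod N)⁻¹ * (a - c) * t ^ 2 + (c * p.1 - p.2) *
    t) = (2 : ZMod N)⁻¹ * a * t ^ 2 + (-(p.2 * t) + -((2 : ZMod N)⁻¹ * c * (t - p.1) ^ 2)) := by
    linear_combination (-(c * p.1 * t)) * h2
  rw [← AddChar.map_add_eq_mul, h3, AddChar.map_add_eq_mul, AddChar.map_add_eq_mul, dechirp,
    tfShift, chirp, map_mul (conj), map_mul (conj), conj_stdAddChar, conj_stdAddChar, Complex.conj_ofReal]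
  linear_combination (stdAddChar ((2 : ZMod N)⁻¹ * a * t ^ 2) * stdAddChar (-(p.2 * t)) *
    stdAddChar (-((2 : ZMod N)⁻¹ * c * (t - p.1) ^ 2))) * hs

/-- The quadratic phases cancel and a single character is left, which carries all the energy of the
target. -/
lemma dft_dechirp_same (hN : Odd N) (a : ZMod N) (p : ZMod N × ZMod N) (x : ZMod N) : ‖dft (dechirp
  a (tfShift p (chirp a))) x‖ = if x = a * p.1 - p.2 then 1 else 0 := by
  have h : dft (dechirp a (tfShift p (chirp a))) x = stdAddChar (-((2 : ZMod N)⁻¹ * a * p.1 ^ 2)) *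
    dft (fun t => stdAddChar ((a * p.1 - p.2) * t)) x := by
    simp only [dft, dechirp_tfShift hN, sub_self, mul_zero, zero_mul, zero_add, mul_assoc,
      ← mul_sum]
    ring
  rw [h, norm_mul, norm_stdAddChar, one_mul, dft_char]
  split_ifs <;> simp

/-- A chirp of slope `a - c`, a unit, is left; each of its Fourier coefficients is a complete Gauss
sum. -/
lemma dft_dechirp_other (hN : Odd N) {a c : ZMod N} (h : IsUnit (a - c)) (p : ZMod N × ZMod N) (x :
  ZMod N) : ‖dft (dechirp a (tfShift p (chirp c))) x‖ = 1 / √N := by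
  have h1 : dft (dechirp a (tfShift p (chirp c))) x = (N : ℂ)⁻¹ * (stdAddChar (-((2 : ZMod N)⁻¹ * c
    * p.1 ^ 2)) * ∑ t, stdAddChar ((2 : ZMod N)⁻¹ * (a - c) * t ^ 2 + (c * p.1 - p.2 - x) * t)) :=
    by
    rw [dft, mul_sum (univ : Finset (ZMod N)) _ (stdAddChar _)]
    congr 1
    refine sum_congr rfl fun t _ => ?_
    rw [dechirp_tfShift hN, mul_assoc, ← AddChar.map_add_eq_mul]
    congr 2; ring
  have h2 := norm_gauss_sum hN h (c * p.1 - p.2 - x)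
  rw [h1, norm_mul, norm_mul, norm_stdAddChar, one_mul, norm_inv, Complex.norm_natCast,
    ← Real.sqrt_sq (norm_nonneg (∑ t, _)), h2, inv_mul_eq_div, Real.sqrt_div_self']

lemma dft_dechirp_received (a : ZMod N) (s : ZMod N × ZMod N × ZMod N) (T : Targets N k) (α :
  EuclideanSpace ℂ (Fin T.num)) (ν : ZMod N → ℂ) (x : ZMod N) : dft (dechirp a (received T
  (transmitted s) α ν)) x = ∑ j, conj (α j) * (dft (dechirp a (tfShift (T.shift j) (chirp s.1))) x +
  dft (dechirp a (tfShift (T.shift j) (chirp s.2.1))) x + dft (dechirp a (tfShift (T.shift j) (chirp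
  s.2.2))) x) + dft (dechirp a ν) x := by
  have h : ∀ t, dechirp a (received T (transmitted s) α ν) t = ∑ j, conj (α j) * (dechirp a (tfShift
    (T.shift j) (chirp s.1)) t + dechirp a (tfShift (T.shift j) (chirp s.2.1)) t + dechirp a
    (tfShift (T.shift j) (chirp s.2.2)) t) + dechirp a ν t := by
    intro t
    simp only [dechirp, received, transmitted, tfShift, map_add, map_sum, map_mul, mul_add,
      mul_sum, sum_add_distrib]
    congr 1
    simp only [← sum_add_distrib]
    exact sum_congr rfl fun j _ => by ring
  simp only [dft, h, add_mul, sum_mul, sum_add_distrib, mul_add, mul_sum]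
  congr 1
  refine congrArg₂ _ (congrArg₂ _ ?_ ?_) ?_ <;>
  · rw [sum_comm]
    exact sum_congr rfl fun j _ => sum_congr rfl fun t _ => by ring

/-- Admissible coefficients. -/
structure GoodCoeff {m : ℕ} (β A : ℝ) (α : EuclideanSpace ℂ (Fin m)) : Prop where
  norm : ‖α‖ ^ 2 = A
  large : ∀ j, β ≤ ‖α j‖

/-- `E` is the contribution of the chirp of the same slope, `F` that of the two others, `n` the
noise. As no difference of targets lies on the line of slope `a`, the target frequencies are
distinct; so at each of them exactly one term of `E` survives, and everything else is at most `2 η`.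
-/
lemma gap_of_cross {a : ZMod N} {T : Targets N k} {f : ZMod N → ℂ} {β A μ η : ℝ} {α : EuclideanSpace
  ℂ (Fin T.num)} (hα : GoodCoeff β A α) (hdist : ∀ i j, i ≠ j → T.shift i - T.shift j ∉ line a) {E :
  Fin T.num → ZMod N → ℂ} {F : Fin T.num → ZMod N → ℂ} {n : ZMod N → ℂ} (hf : ∀ x, dft f x = ∑ j,
  conj (α j) * (E j x + F j x) + n x) (hE : ∀ j x, ‖E j x‖ = if x = a * (T.shift j).1 - (T.shift
  j).2 then 1 else 0) (hF : ∀ j x, ‖F j x‖ ≤ 2 / √N) (hn : ∀ x, ‖n x‖ ≤ η) (hsmall : k * (√A * (2 /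
  √N)) ≤ η) (hβ : μ + 5 * η ≤ β) : Gap f μ η (targetFreqs T a) := by
  have hαA : ∀ j, ‖α j‖ ≤ √A := fun j => by
    rw [← hα.norm, Real.sqrt_sq (norm_nonneg _)]; exact PiLp.norm_apply_le α j
  have hrest : ∀ x, ‖∑ j, conj (α j) * F j x + n x‖ ≤ 2 * η := by
    intro x
    have h1 : ‖∑ j, conj (α j) * F j x‖ ≤ k * (√A * (2 / √N)) := by
      calc _ ≤ ∑ j : Fin T.num, √A * (2 / √N) := norm_sum_le_of_le _ fun j _ => by
            rw [norm_mul, RCLike.norm_conj]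
            exact mul_le_mul (hαA j) (hF j x) (norm_nonneg _) (Real.sqrt_nonneg _)
        _ ≤ _ := by
          rw [sum_const, card_univ, Fintype.card_fin, nsmul_eq_mul]
          gcongr
          exact T.num_le
    linarith [norm_add_le (∑ j, conj (α j) * F j x) (n x), hn x]
  have hf' : ∀ x, dft f x = ∑ j, conj (α j) * E j x + (∑ j, conj (α j) * F j x + n x) := by
    intro x
    rw [hf, ← add_assoc, ← sum_add_distrib]
    simp only [mul_add]
  have hzero : ∀ j x, x ≠ a * (T.shift j).1 - (T.shift j).2 → E j x = 0 := by
    intro j x h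
    rw [← norm_eq_zero, hE, if_neg h]
  constructor
  · intro x hx
    simp only [targetFreqs, Finset.mem_image, mem_univ, true_and] at hx
    obtain ⟨i, rfl⟩ := hx
    rw [hf', Finset.sum_eq_single i]
    · set x := a * (T.shift i).1 - (T.shift i).2
      have h1 : ‖conj (α i) * E i x‖ = ‖α i‖ := by
        rw [norm_mul, RCLike.norm_conj, hE, if_pos rfl, mul_one]
      have h2 := norm_sub_le (conj (α i) * E i x +
        (∑ j, conj (α j) * F j x + n x)) (∑ j, conj (α j) * F j x + n x)
      rw [add_sub_cancel_right, h1] at h2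
      linarith [hrest x, hα.large i]
    · intro j _ hj
      rw [hzero j _ fun h => hdist i j hj.symm ?_, mul_zero]
      rw [mem_line, snd_sub, fst_sub]
      linear_combination (-1 : ZMod N) * h
    · simp
  · intro x hx
    rw [hf', Finset.sum_eq_zero, zero_add]
    · exact hrest x
    · intro j _
      rw [hzero j x fun h => hx ?_, mul_zero]
      rw [h]
      exact Finset.mem_image_of_mem _ (mem_univ j)

/-- The spectra of the received signal show the targets. -/
lemma gap_received (hN : Odd N) {s : ZMod N × ZMod N × ZMod N} (hs : s ∈ slopeTriples N) {T :
  Targets N k} (hG : GoodLines T s) {β A μ η : ℝ} {α : EuclideanSpace ℂ (Fin T.num)} (hα : GoodCoeff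
  β A α) {ν : ZMod N → ℂ} (hν : ∀ a x, ‖dft (dechirp a ν) x‖ ≤ η) (hsmall : k * (√A * (2 / √N)) ≤ η)
  (hβ : μ + 5 * η ≤ β) : ∀ a ∈ [s.1, s.2.1, s.2.2], Gap (dechirp a (received T (transmitted s) α ν))
  μ η (targetFreqs T a) := by
  obtain ⟨h1, h2, h3⟩ := mem_slopeTriples.1 hs
  have hF : ∀ {a c d : ZMod N}, Transversal a c → Transversal a d → ∀ (j : Fin T.num) (x : ZMod N),
    ‖dft (dechirp a (tfShift (T.shift j) (chirp c))) x + dft (dechirp a (tfShift (T.shift j) (chirp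
    d))) x‖ ≤ 2 / √N := by
    intro a c d hc hd j x
    refine (norm_add_le _ _).trans (le_of_eq ?_)
    rw [dft_dechirp_other hN hc.isUnit, dft_dechirp_other hN hd.isUnit]; ring
  intro a ha
  simp only [List.mem_cons, List.not_mem_nil, or_false] at ha
  rcases ha with rfl | rfl | rfl
  · exact gap_of_cross hα (fun i j h => (hG.distinct i j h).1) (n := dft (dechirp s.1 ν))
      (fun x => by rw [dft_dechirp_received]; simp only [add_assoc])
      (fun j x => dft_dechirp_same hN _ _ x) (hF h1 h2) (hν _) hsmall hβ
  · exact gap_of_cross hα (fun i j h => (hG.distinct i j h).2.1) (n := dft (dechirp s.2.1 ν))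
      (fun x => by
        rw [dft_dechirp_received]
        simp only [add_assoc, add_left_comm (dft (dechirp s.2.1 (tfShift _ (chirp s.1))) x)])
      (fun j x => dft_dechirp_same hN _ _ x) (hF h1.symm h3) (hν _) hsmall hβ
  · exact gap_of_cross hα (fun i j h => (hG.distinct i j h).2.2) (n := dft (dechirp s.2.2 ν))
      (fun x => by
        rw [dft_dechirp_received]
        simp only [add_comm _ (dft (dechirp s.2.2 (tfShift _ (chirp s.2.2))) x)])
      (fun j x => dft_dechirp_same hN _ _ x) (hF h2.symm h3.symm) (hν _) hsmall hβ

/-- An energy bound independent of `N`. It bounds both the spectra, by Parseval, and every single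
sample, as the fixed point analysis requires. The factor `k` is from Cauchy–Schwarz. -/
lemma norm_received_sq_le {A : ℝ} {s : ZMod N × ZMod N × ZMod N} {T : Targets N k} {α :
  EuclideanSpace ℂ (Fin T.num)} (hα : ‖α‖ ^ 2 = A) (ν : ZMod N → ℂ) : ∑ t, ‖received T (transmitted
  s) α ν t‖ ^ 2 ≤ 2 * (k * (9 * A)) + 2 * ∑ t, ‖ν t‖ ^ 2 := by
  have hN0 : (0 : ℝ) < N := mod_cast NeZero.pos N
  have hS : ∀ t, ‖transmitted s t‖ ≤ 3 / √N := by
    intro t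
    have h1 : ∀ c : ZMod N, ‖chirp c t‖ = 1 / √N := fun c => by
      rw [chirp, norm_mul, norm_stdAddChar, mul_one, norm_real, Real.norm_of_nonneg (by positivity)]
    refine (norm_add₃_le).trans (le_of_eq ?_)
    rw [h1, h1, h1]; ring
  have h1 : ∀ t, ‖received T (transmitted s) α ν t‖ ^ 2 ≤ 2 * (k * (A * (9 / N))) + 2 * ‖ν t‖ ^ 2 := by
    intro t
    have h2 : ‖∑ j, α j * tfShift (T.shift j) (transmitted s) t‖ ^ 2 ≤ k * (A * (9 / N)) := by
      calc _ ≤ (∑ j, ‖α j‖ * (3 / √N)) ^ 2 := by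
            gcongr
            refine norm_sum_le_of_le _ fun j _ => ?_
            rw [norm_mul, tfShift, norm_mul, norm_stdAddChar, one_mul]
            gcongr
            exact hS _
        _ = (∑ j, ‖α j‖) ^ 2 * (9 / N) := by
            rw [← sum_mul, mul_pow, div_pow, Real.sq_sqrt hN0.le]; norm_num
        _ ≤ (T.num * ∑ j, ‖α j‖ ^ 2) * (9 / N) := by
            gcongr
            simpa using sq_sum_le_card_mul_sum_sq (s := univ) (f := fun j => ‖α j‖)
        _ ≤ (k * A) * (9 / N) := by
            rw [← EuclideanSpace.norm_sq_eq, hα]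
            have : 0 ≤ A := by rw [← hα]; positivity
            gcongr
            exact T.num_le
        _ = _ := by ring
    rw [received]
    calc _ ≤ (‖∑ j, α j * tfShift (T.shift j) (transmitted s) t‖ + ‖ν t‖) ^ 2 := by
          gcongr; exact norm_add_le _ _
      _ ≤ _ := by nlinarith [sq_nonneg (‖∑ j, α j * tfShift (T.shift j) (transmitted s) t‖ - ‖ν t‖)]
  calc _ ≤ ∑ t, (2 * (k * (A * (9 / N))) + 2 * ‖ν t‖ ^ 2) := sum_le_sum fun t _ => h1 t
    _ = _ := by
      rw [sum_add_distrib, sum_const, card_univ, ZMod.card, nsmul_eq_mul, ← mul_sum]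
      field_simp

end

/-! ## Noise -/

lemma hasSubgaussianMGF_mono {Ω : Type*} {_ : MeasurableSpace Ω} {P : Measure Ω} {X : Ω → ℝ} {c d :
  NNReal} (h : HasSubgaussianMGF X c P) (hcd : c ≤ d) : HasSubgaussianMGF X d P :=
  ⟨h.integrable_exp_mul, fun t => (h.mgf_le t).trans (Real.exp_le_exp.2 (by gcongr))⟩

section
variable {Q : Measure ℂ} {c : NNReal}

/-- Real and imaginary part need not be independent, so the square roots of their parameters add:
`(√c + √c)^2 = 4 c`. -/
lemma hasSubgaussianMGF_re_mul_conj (hre : HasSubgaussianMGF (fun z : ℂ => z.re) c Q) (him :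
  HasSubgaussianMGF (fun z : ℂ => z.im) c Q) {w : ℂ} (hw : ‖w‖ ≤ 1) : HasSubgaussianMGF (fun z : ℂ
  => (w * conj z).re) (4 * c) Q := by
  have h1 := (hre.const_mul w.re).add (him.const_mul w.im)
  have h2 : (fun z : ℂ => (w * conj z).re) = fun z => w.re * z.re + w.im * z.im := by
    ext z; simp [Complex.mul_re]
  rw [h2]
  refine hasSubgaussianMGF_mono h1 ?_
  have h3 : ∀ x : ℝ, |x| ≤ 1 → (NNReal.mk (x ^ 2) (sq_nonneg x)) * c ≤ c := by
    intro x hx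
    refine mul_le_of_le_one_left (zero_le) ?_
    rw [← NNReal.coe_le_coe]
    exact (sq_le_one_iff_abs_le_one x).2 hx
  have h4 := NNReal.sqrt_le_sqrt.2 (h3 w.re ((Complex.abs_re_le_norm w).trans hw))
  have h5 := NNReal.sqrt_le_sqrt.2 (h3 w.im ((Complex.abs_im_le_norm w).trans hw))
  calc _ ≤ (NNReal.sqrt c + NNReal.sqrt c) ^ 2 := pow_le_pow_left' (add_le_add h4 h5) 2
    _ = 4 * NNReal.sqrt c ^ 2 := by ring
    _ = 4 * c := by rw [NNReal.sq_sqrt]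

/-- `x^2 ≤ 2 (exp x + exp (-x))`, applied to `l x` with `l^2 = 1 / c`. Both exponential moments are
then at most `exp (1 / 2) ≤ 2`, which gives `8 c` for each of the two parts. -/
lemma lintegral_norm_sq_le (hre : HasSubgaussianMGF (fun z : ℂ => z.re) c Q) (him :
  HasSubgaussianMGF (fun z : ℂ => z.im) c Q) (hc : 0 < c) : ∫⁻ z, ofReal (‖z‖ ^ 2) ∂Q ≤ ofReal (16 *
  c) := by
  have hc' : (0 : ℝ) < c := hc
  set l := √(c : ℝ)⁻¹ with hl
  have hl2 : l ^ 2 = (c : ℝ)⁻¹ := Real.sq_sqrt (by positivity)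
  have hq : ∀ x : ℝ, x ^ 2 ≤ 2 * (exp x + exp (-x)) := by
    intro x
    have h1 := Real.quadratic_le_exp_of_nonneg (abs_nonneg x)
    rw [sq_abs] at h1
    have h2 : exp |x| ≤ exp x + exp (-x) := by
      rcases abs_cases x with ⟨h, -⟩ | ⟨h, -⟩ <;> rw [h] <;>
        linarith [Real.exp_pos x, Real.exp_pos (-x)]
    linarith [abs_nonneg x]
  have hb : ∀ x : ℝ, x ^ 2 ≤ 2 * c * (exp (l * x) + exp (-l * x)) := by
    intro x
    have := hq (l * x)
    rw [mul_pow, hl2, inv_mul_eq_div, div_le_iff₀ hc'] at this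
    rw [neg_mul]
    linarith
  have hexp : exp (1 / 2) ≤ 2 := by
    have h1 : exp (1 / 2) ^ 2 = exp 1 := by rw [← Real.exp_nat_mul]; norm_num
    nlinarith [Real.exp_one_lt_d9, Real.exp_pos (1 / 2 : ℝ)]
  have hmgf : ∀ {X : ℂ → ℝ}, HasSubgaussianMGF X c Q → ∫ z, 2 * c * (exp (l * X z) + exp (-l * X z))
    ∂Q ≤ 8 * c := by
    intro X hX
    rw [integral_const_mul, integral_add (hX.integrable_exp_mul l) (hX.integrable_exp_mul (-l))]
    have h1 := hX.mgf_le l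
    have h2 := hX.mgf_le (-l)
    rw [neg_sq] at h2
    rw [hl2, mul_inv_cancel₀ hc'.ne'] at h1 h2
    simp only [mgf] at h1 h2
    calc _ ≤ 2 * (c : ℝ) * (2 + 2) := by gcongr <;> linarith
      _ = _ := by ring
  have hint : ∀ {X : ℂ → ℝ}, HasSubgaussianMGF X c Q → Integrable (fun z => 2 * c * (exp (l * X z) +
    exp (-l * X z))) Q := fun hX =>
    ((hX.integrable_exp_mul l).add (hX.integrable_exp_mul (-l))).const_mul _
  calc _ ≤ ∫⁻ z : ℂ, ofReal (2 * c * (exp (l * z.re) + exp (-l * z.re)) +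
        2 * c * (exp (l * z.im) + exp (-l * z.im))) ∂Q := by
        refine lintegral_mono fun z => ofReal_le_ofReal ?_
        rw [sq_norm, Complex.normSq_apply, ← sq, ← sq]
        exact add_le_add (hb _) (hb _)
    _ = ofReal (∫ z : ℂ, (2 * c * (exp (l * z.re) + exp (-l * z.re)) +
        2 * c * (exp (l * z.im) + exp (-l * z.im))) ∂Q) :=
        (ofReal_integral_eq_lintegral_ofReal ((hint hre).add (hint him))
          (Filter.Eventually.of_forall fun z => show (0 : ℝ) ≤ 2 * c * (exp (l * z.re) + exp (-l *
          z.re)) + 2 * c * (exp (l * z.im) + exp (-l * z.im)) by positivity)).symm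
    _ ≤ _ := by
        refine ofReal_le_ofReal ?_
        rw [integral_add (hint hre) (hint him)]
        linarith [hmgf hre, hmgf him]

variable {N : ℕ} [NeZero N]

/-- Noise that is small in the spectra, and bounded in mean square. -/
def goodNoise (N : ℕ) [NeZero N] (η B : ℝ) : Set (ZMod N → ℂ) :=
  {ν | (∀ a x, ‖dft (dechirp a ν) x‖ ≤ η) ∧ ∑ t, ‖ν t‖ ^ 2 ≤ B}

lemma measurableSet_goodNoise (η B : ℝ) : MeasurableSet (goodNoise N η B) := by
  have h : goodNoise N η B = (⋂ a, ⋂ x, {ν : ZMod N → ℂ | ‖dft (dechirp a ν) x‖ ≤ η}) ∩ {ν | ∑ t, ‖ν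
    t‖ ^ 2 ≤ B} := by ext ν; simp [goodNoise]
  rw [h]
  refine IsClosed.measurableSet (IsClosed.inter (isClosed_iInter fun a => isClosed_iInter fun x =>
    isClosed_le ?_ continuous_const) (isClosed_le (by fun_prop) continuous_const))
  simp only [dft, dechirp]
  fun_prop

lemma measure_re_ge_le (hQ : IsProbabilityMeasure Q) (hre : HasSubgaussianMGF (fun z : ℂ => z.re) c
  Q) (him : HasSubgaussianMGF (fun z : ℂ => z.im) c Q) {w : ZMod N → ℂ} (hw : ∀ t, ‖w t‖ ≤ 1) {r :
  ℝ} (hr : 0 ≤ r) : (Measure.pi fun _ : ZMod N => Q) {ν | r ≤ (∑ t, w t * conj (ν t)).re} ≤ ofReal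
  (exp (-r ^ 2 / (8 * (N * c)))) := by
  have hind := iIndepFun_pi (μ := fun _ : ZMod N => Q)
    (X := fun t z => (w t * conj z).re) (fun t => by fun_prop)
  have hsub : ∀ t ∈ (univ : Finset (ZMod N)), HasSubgaussianMGF (fun ν : ZMod N → ℂ => (w t * conj
    (ν t)).re) (4 * c) (Measure.pi fun _ : ZMod N => Q) := by
    intro t _
    have hmp := measurePreserving_eval (fun _ : ZMod N => Q) t
    refine HasSubgaussianMGF.of_map (Y := Function.eval t) (X := fun z => (w t * conj z).re)
      hmp.measurable.aemeasurable ?_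
    rw [hmp.map_eq]
    exact hasSubgaussianMGF_re_mul_conj hre him (hw t)
  have h := (HasSubgaussianMGF.sum_of_iIndepFun hind hsub).measure_ge_le hr
  rw [← ENNReal.ofReal_toReal (measure_ne_top _ _)]
  refine ofReal_le_ofReal (le_trans (le_of_eq ?_) (h.trans (le_of_eq ?_)))
  · rw [Measure.real]
    simp only [Complex.re_sum]
  · rw [sum_const, card_univ, ZMod.card]
    congr 2
    push_cast [nsmul_eq_mul]
    ring

/-- A union bound over the `N^2` pairs of slope and frequency and over four directions, the real and
imaginary part with both signs. The threshold `r = η √N / 2` for sums of variables with parameter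
`σ^2 / N` gives an exponent linear in `N`, which beats `N^2`. The energy, of mean at most `16 σ^2`,
is controlled by Markov's inequality. -/
lemma measure_goodNoise_compl_le {σ : ℝ} (hσ : 0 < σ) (hQ : IsSubgaussianLaw Q (σ ^ 2 / N)) {η B :
  ℝ} (hη : 0 < η) (hB : 0 < B) : (Measure.pi fun _ : ZMod N => Q) (goodNoise N η B)ᶜ ≤ ofReal (4 * N
  ^ 2 * exp (-(η ^ 2 / (32 * σ ^ 2)) * N) + 16 * σ ^ 2 / B) := by
  obtain ⟨hp, -, hre, him⟩ := hQ
  have hN : (0 : ℝ) < N := mod_cast NeZero.pos N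
  set c := (σ ^ 2 / N).toNNReal with hc
  have hcr : (c : ℝ) = σ ^ 2 / N := Real.coe_toNNReal _ (by positivity)
  have hc0 : 0 < c := by rw [← NNReal.coe_pos, hcr]; positivity
  set P := Measure.pi fun _ : ZMod N => Q with hP
  set w : ZMod N → ZMod N → ZMod N → ℂ := fun a x t =>
    stdAddChar ((2 : ZMod N)⁻¹ * a * t ^ 2) * stdAddChar (-(x * t)) with hwdef
  have hw : ∀ a x t, ‖w a x t‖ = 1 := fun a x t => by
    rw [hwdef, norm_mul, norm_stdAddChar, norm_stdAddChar, one_mul]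
  have hd : ∀ a ν x, dft (dechirp a ν) x = (N : ℂ)⁻¹ * (√N * ∑ t, w a x t * conj (ν t)) := by
    intro a ν x
    rw [dft, mul_sum (a := (√N : ℂ))]
    congr 1
    exact sum_congr rfl fun t _ => by rw [dechirp]; ring
  set r := η * √N / 2 with hr
  set U : ZMod N × ZMod N → ℂ → Set (ZMod N → ℂ) := fun y z =>
    {ν | r ≤ (∑ t, (z * w y.1 y.2 t) * conj (ν t)).re} with hU
  have hsub : (goodNoise N η B)ᶜ ⊆ (⋃ y : ZMod N × ZMod N, ((U y 1 ∪ U y (-1)) ∪ (U y (-I) ∪ U y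
    I))) ∪ {ν | ofReal B ≤ ∑ t, ofReal (‖ν t‖ ^ 2)} := by
    intro ν hν
    rw [Set.mem_compl_iff, goodNoise] at hν
    by_contra hn
    simp only [Set.mem_union, Set.mem_iUnion, not_or, not_exists, hU, Set.mem_ofPred_eq, not_le,
      Prod.forall, mul_assoc, ← mul_sum] at hn
    refine hν ⟨fun a x => ?_, ?_⟩
    · obtain ⟨⟨h1, h2⟩, h3, h4⟩ := hn.1 a x
      set z := ∑ t, w a x t * conj (ν t)
      simp only [one_mul, neg_mul, Complex.neg_re, Complex.I_mul_re, neg_neg] at h1 h2 h3 h4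
      have h5 : ‖z‖ ≤ η * √N := by
        have h6 := Complex.norm_le_abs_re_add_abs_im z
        have h7 : |z.re| ≤ r := abs_le.2 ⟨by linarith, by linarith⟩
        have h8 : |z.im| ≤ r := abs_le.2 ⟨by linarith, by linarith⟩
        linarith
      rw [hd, norm_mul, norm_mul, norm_inv, Complex.norm_natCast, norm_real,
        Real.norm_of_nonneg (Real.sqrt_nonneg _), inv_mul_le_iff₀ hN]
      calc _ ≤ √N * (η * √N) := by gcongr
        _ = (√N * √N) * η := by ring
        _ = _ := by rw [Real.mul_self_sqrt hN.le]
    · have h1 := hn.2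
      rw [← ENNReal.ofReal_sum_of_nonneg fun _ _ => by positivity] at h1
      exact ((ENNReal.ofReal_lt_ofReal_iff hB).1 h1).le
  have hUb : ∀ y z, ‖z‖ = 1 → P (U y z) ≤ ofReal (exp (-(η ^ 2 / (32 * σ ^ 2)) * N)) := by
    intro y z hz
    refine (measure_re_ge_le hp hre him (w := fun t => z * w y.1 y.2 t) (fun t => by
      rw [norm_mul, hz, hw, one_mul]) (by positivity)).trans (le_of_eq ?_)
    congr 2
    rw [hcr, hr, div_pow, mul_pow, Real.sq_sqrt hN.le]
    field_simp
    ring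
  have h4 : ∀ y, P ((U y 1 ∪ U y (-1)) ∪ (U y (-I) ∪ U y I)) ≤ ofReal (4 * exp (-(η ^ 2 / (32 * σ ^
    2)) * N)) := by
    intro y
    set e := exp (-(η ^ 2 / (32 * σ ^ 2)) * N)
    have he : 0 ≤ e := Real.exp_nonneg _
    have : ofReal (4 * e) = (ofReal e + ofReal e) + (ofReal e + ofReal e) := by
      rw [← ENNReal.ofReal_add he he, ← ENNReal.ofReal_add (by positivity) (by positivity)]
      congr 1; ring
    rw [this]
    exact (measure_union_le _ _).trans (add_le_add ((measure_union_le _ _).trans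
      (add_le_add (hUb y _ (by simp)) (hUb y _ (by simp)))) ((measure_union_le _ _).trans
      (add_le_add (hUb y _ (by simp)) (hUb y _ (by simp)))))
  rw [ENNReal.ofReal_add (by positivity) (by positivity)]
  refine (measure_mono hsub).trans ((measure_union_le _ _).trans (add_le_add ?_ ?_))
  · refine (measure_iUnion_fintype_le _ _).trans ((sum_le_card_nsmul _ _ _ fun y _ =>
      h4 y).trans (le_of_eq ?_))
    rw [card_univ, Fintype.card_prod, ZMod.card, ← ENNReal.ofReal_nsmul]
    congr 1
    push_cast [nsmul_eq_mul]
    ring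
  · have hm := meas_ge_le_lintegral_div (μ := P) (f := fun ν : ZMod N → ℂ => ∑ t, ofReal (‖ν t‖ ^
      2)) (Measurable.aemeasurable (by fun_prop)) (ε := ofReal B) (by simpa using hB)
      ENNReal.ofReal_ne_top
    refine hm.trans ?_
    rw [ENNReal.ofReal_div_of_pos hB]
    gcongr
    rw [lintegral_finsetSum _ fun t _ => by fun_prop]
    have h5 : ∀ t ∈ (univ : Finset (ZMod N)), ∫⁻ ν : ZMod N → ℂ, ofReal (‖ν t‖ ^ 2) ∂P ≤ ofReal (16
      * c) := by
      intro t _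
      refine le_trans (le_of_eq ?_) (lintegral_norm_sq_le hre him hc0)
      exact (measurePreserving_eval (fun _ : ZMod N => Q) t).lintegral_comp
        (f := fun z : ℂ => ofReal (‖z‖ ^ 2)) (by fun_prop)
    refine (sum_le_card_nsmul _ _ _ h5).trans (le_of_eq ?_)
    rw [card_univ, ZMod.card, ← ENNReal.ofReal_nsmul, hcr]
    congr 1
    rw [nsmul_eq_mul]; field_simp

end

/-! ## The law of the coefficients -/

lemma measurableSet_targetSet (m k : ℕ) (A ε : ℝ) : MeasurableSet (targetSet m k A ε) := by
  have h : targetSet m k A ε = {x | ‖x‖ ^ 2 = A} ∩ ⋂ j, ({x | x j = 0} ∪ {x | ε * √(A / k) ≤ ‖x j‖})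
    := by
    ext x
    simp [targetSet, or_iff_not_imp_left]
  rw [h]
  refine (IsClosed.inter (isClosed_eq (by fun_prop) continuous_const) (isClosed_iInter fun j =>
    (isClosed_eq (by fun_prop) continuous_const).union (isClosed_le continuous_const (by
    fun_prop)))).measurableSet

/-- The cone over this set lies in a proper real subspace, which is null for Haar measure. -/
lemma toSphere_coord_eq_zero {m : ℕ} (j : Fin m) : (Measure.addHaar : Measure (EuclideanSpace ℂ (Fin
  m))).toSphere {x | x.1 j = 0} = 0 := by
  have hm : MeasurableSet {x : Metric.sphere (0 : EuclideanSpace ℂ (Fin m)) 1 | x.1 j = 0} :=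
    (isClosed_eq (by fun_prop) continuous_const).measurableSet
  rw [Measure.toSphere_apply' _ hm]
  set V : Submodule ℝ (EuclideanSpace ℂ (Fin m)) := LinearMap.ker ((EuclideanSpace.proj j :
    EuclideanSpace ℂ (Fin m) →L[ℂ] ℂ).toLinearMap.restrictScalars ℝ) with hV
  have hV' : V ≠ ⊤ := by
    intro h
    have h1 : EuclideanSpace.single j (1 : ℂ) ∈ V := h ▸ Submodule.mem_top
    simp [hV] at h1
  have h0 := Measure.addHaar_submodule Measure.addHaar V hV'
  refine mul_eq_zero_of_right _ (measure_mono_null ?_ h0)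
  rintro _ ⟨r, -, _, ⟨x, hx, rfl⟩, rfl⟩
  have hx' : x.1 j = 0 := hx
  simp [hV, hx']

section
variable {m k : ℕ} {A ε : ℝ}

/-- The set contains a nonempty relatively open part of the sphere, around the point with equal
coordinates `1 / √m`, since `1 / √m ≥ 1 / √k > ε / √k`. So the conditional law is a genuine
probability. -/
lemma measure_targetSet_ne_zero (hm : 1 ≤ m) (hmk : m ≤ k) (hA : 0 < A) (hε : ε < 1) : Measure.map
  (fun x : Metric.sphere (0 : EuclideanSpace ℂ (Fin m)) 1 =>
        √A • (x : EuclideanSpace ℂ (Fin m)))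
      (Measure.addHaar : Measure (EuclideanSpace ℂ (Fin m))).toSphere (targetSet m k A ε) ≠ 0 := by
  rw [Measure.map_apply (by fun_prop) (measurableSet_targetSet m k A ε)]
  have hm0 : (0 : ℝ) < m := mod_cast hm
  have hopen : IsOpen {x : Metric.sphere (0 : EuclideanSpace ℂ (Fin m)) 1 | ∀ j, ε / √k < ‖x.1 j‖}
    := by
    simp only [Set.ofPred_forall]
    exact isOpen_iInter_of_finite fun j => isOpen_lt continuous_const (by fun_prop)
  have hne : {x : Metric.sphere (0 : EuclideanSpace ℂ (Fin m)) 1 | ∀ j, ε / √k < ‖x.1 j‖}.Nonempty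
    := by
    refine ⟨⟨WithLp.toLp 2 fun _ => ((1 / √m : ℝ) : ℂ), ?_⟩, fun j => ?_⟩
    · rw [mem_sphere_zero_iff_norm, EuclideanSpace.norm_eq, Real.sqrt_eq_one]
      simp only [norm_real, Real.norm_eq_abs, sq_abs, div_pow, one_pow,
        Real.sq_sqrt hm0.le, sum_const, card_univ, Fintype.card_fin, nsmul_eq_mul]
      field_simp
    · simp only [norm_real, Real.norm_eq_abs]
      rw [abs_of_pos (by positivity)]
      have h1 : √m ≤ √k := Real.sqrt_le_sqrt (mod_cast hmk)
      have h2 : 0 < √m := Real.sqrt_pos.2 hm0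
      exact (div_lt_div_of_pos_right hε (h2.trans_le h1)).trans_le (one_div_le_one_div_of_le h2 h1)
  refine ((hopen.measure_pos _ hne).trans_le (measure_mono fun x hx => ?_)).ne'
  refine ⟨?_, fun j _ => ?_⟩
  · rw [norm_smul, norm_eq_of_mem_sphere, mul_one, Real.norm_eq_abs, sq_abs, Real.sq_sqrt hA.le]
  · rw [Real.sqrt_div hA.le, PiLp.smul_apply, norm_smul, Real.norm_eq_abs,
      abs_of_nonneg (Real.sqrt_nonneg _), mul_div_left_comm]
    exact mul_le_mul_of_nonneg_left (hx j).le (Real.sqrt_nonneg _)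

lemma isProbabilityMeasure_coeffLaw (hm : 1 ≤ m) (hmk : m ≤ k) (hA : 0 < A) (hε : ε < 1) : IsProbabilityMeasure (coeffLaw m k A ε) :=
  cond_isProbabilityMeasure (measure_targetSet_ne_zero hm hmk hA hε)

/-- The target set allows vanishing coordinates, for which no peak could be seen; they have
probability zero. -/
lemma ae_goodCoeff_coeffLaw (hA : 0 < A) : ∀ᵐ α ∂coeffLaw m k A ε, GoodCoeff (ε * √(A / k)) A α :=
  by
  have h1 : ∀ᵐ α ∂coeffLaw m k A ε, α ∈ targetSet m k A ε :=
    ae_cond_mem (measurableSet_targetSet m k A ε)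
  have h2 : ∀ᵐ α ∂coeffLaw m k A ε, ∀ j, α j ≠ 0 := by
    refine ae_all_iff.2 fun j => cond_absolutelyContinuous.ae_le ?_
    change ∀ᵐ α ∂Measure.map _ _, (α : EuclideanSpace ℂ (Fin m)) j ≠ 0
    rw [ae_map_iff (by fun_prop) (isOpen_ne_fun (by fun_prop) continuous_const).measurableSet, ae_iff]
    convert toSphere_coord_eq_zero j using 3 with x
    simp [(Real.sqrt_pos.2 hA).ne']
  filter_upwards [h1, h2] with α h1 h2
  exact ⟨h1.1, fun j => h1.2 j (h2 j)⟩

end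

/-! ## Correct outputs -/

/-- A peak `p` and a target with the same value of `a τ - ω` differ by a vector of the line of slope
`a`. So the translates of that line through the peaks and through the targets are the same. -/
lemma exists_peak_iff {N k : ℕ} {T : Targets N k} {a b u : ZMod N} (hu : u * (a - b) = 1) {l : List
  (Peak N)} (h : ∀ q, (∃ p ∈ l, p.pt = q) ↔ q ∈ line b ∧ a * q.1 - q.2 ∈ targetFreqs T a) (q : ZMod
  N × ZMod N) : (∃ p ∈ l, q - p.pt ∈ line a) ↔ ∃ i, q - T.shift i ∈ line a := by
  simp only [mem_line, snd_sub, fst_sub, targetFreqs, Finset.mem_image, mem_univ, true_and] at h ⊢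
  constructor
  · rintro ⟨p, hp, hq⟩
    obtain ⟨-, i, hi⟩ := (h p.pt).1 ⟨p, hp, rfl⟩
    exact ⟨i, by linear_combination hq + hi⟩
  · rintro ⟨i, hi⟩
    obtain ⟨p, hp, hq⟩ := (h (u * (a * (T.shift i).1 - (T.shift i).2), b * (u * (a * (T.shift i).1 -
      (T.shift i).2)))).2 ⟨rfl, i, by linear_combination (-(a * (T.shift i).1 - (T.shift i).2)) *
      hu⟩
    refine ⟨p, hp, ?_⟩
    rw [hq]
    linear_combination hi + (a * (T.shift i).1 - (T.shift i).2) * hu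

section
variable {N k : ℕ} [NeZero N]

/-- The targets are returned, and nothing else, and no estimate is off by more than `δ`. -/
def Correct (δ : ℝ) (T : Targets N k) (s : ZMod N × ZMod N × ZMod N) (R : ZMod N → ℂ) (c : Config) :
  Prop := (∀ q, q ∈ c.shifts N ↔ q ∈ Set.range T.shift) ∧ ¬ BadEstimate δ s R c

lemma Output.correct {μ η δ B B₂ : ℝ} {s : ZMod N × ZMod N × ZMod N} {R : ZMod N → ℂ} {T : Targets N
  k} {r : Draws N} {c : Config} (hT : Tame N R B) (hL : GoodLines T s) (hG : ∀ a ∈ [s.1, s.2.1,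
  s.2.2], Gap (dechirp a R) μ η (targetFreqs T a)) (hr : ∀ a ∈ [s.1, s.2.1, s.2.2], Decoded R a
  (targetFreqs T a) η r) (hη : 0 < η) (hμ : 4 * η ≤ μ) (hδ : 2 * η ≤ δ) (hB₂ : ∀ a, ∑ x, ‖dft
  (dechirp a R) x‖ ^ 2 ≤ B₂) (hp : Precise N B B₂ η) (h : Output N k (toFixed N μ) s R (r.1 : ℕ)
  (drawSeq r.2.1) (drawSeq r.2.2) c) : Correct δ T s R c := by
  have key : ∀ a ∈ [s.1, s.2.1, s.2.2], ∀ (b : ZMod N) (l : List (Peak N)), (∃ u : ℤ, u * ((a.val :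
    ℤ) - b.val) ≡ 1 [ZMOD N] ∧ PeakOutput N k R (toFixed N μ) a.val b.val u (r.1 : ℕ) (drawSeq
    r.2.1) (drawSeq r.2.2) l) → (∀ q, (∃ p ∈ l, q - p.pt ∈ line a) ↔ ∃ i, q - T.shift i ∈ line a) ∧
    ¬ ∃ p ∈ l, δ < ‖p.est - ambiguity (chirp a) R p.pt‖ := by
    rintro a ha b l ⟨u, hu, hl⟩
    have hu' : (u : ZMod N) * (a - b) = 1 := by
      have := (ZMod.intCast_eq_intCast_iff _ _ _).2 hu
      rw [Int.cast_mul, Int.cast_sub, intCast_val, intCast_val] at this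
      simpa using this
    obtain ⟨h1, h2⟩ := hl.spec hT hu' (card_targetFreqs_le T a) (hr a ha) (hG a ha) hη hμ (hB₂ a) hp
    exact ⟨exists_peak_iff hu' h1, fun ⟨p, hp, hpd⟩ => hpd.not_ge ((h2 p hp).trans hδ)⟩
  obtain ⟨h0, e0⟩ := key s.1 (by simp) _ _ h.peaks₀
  obtain ⟨h1, e1⟩ := key s.2.1 (by simp) _ _ h.peaks₁
  obtain ⟨h2, e2⟩ := key s.2.2 (by simp) _ _ h.peaks₂
  refine ⟨fun q => (h.shifts q).trans ⟨?_, ?_⟩, by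
    rintro (h | h | h)
    exacts [e0 h, e1 h, e2 h]⟩
  · rintro ⟨x, hx, y, hy, z, hz, h3, h4, h5⟩
    exact hL.incident q ((h0 q).1 ⟨x, hx, h3⟩) ((h1 q).1 ⟨y, hy, h4⟩) ((h2 q).1 ⟨z, hz, h5⟩)
  · rintro ⟨i, rfl⟩
    have hz : ∀ a : ZMod N, ∃ j, T.shift i - T.shift j ∈ line a := fun a => ⟨i, by simp [mem_line]⟩
    obtain ⟨x, hx, h3⟩ := (h0 _).2 (hz _)
    obtain ⟨y, hy, h4⟩ := (h1 _).2 (hz _)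
    obtain ⟨z, hz, h5⟩ := (h2 _).2 (hz _)
    exact ⟨x, hx, y, hy, z, hz, h3, h4, h5⟩

/-- Bound for the probability of draws with which the decoding fails. -/
def decodeBound (N k : ℕ) (μ η B₂ : ℝ) : ℝ := k * (3200 / μ ^ 2 * (2 * B₂ * (1 / N.minFac + 1 / ell
  (size N) + (2 * pi / ell (size N)) ^ 2))) + k * ((size N + 2) * (16 * (1 / draws N))) + grid N *
  (B₂ / draws N / η ^ 2)

/-- The modulus is large in comparison with the other parameters. -/
structure Large (N k : ℕ) (A μ η B₂ : ℝ) : Prop where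
  fits : Fits N k μ
  odd : Odd N
  size_ge : 40 ≤ size N
  draws_le : (draws N * (3 * √B₂ + 9)) ^ 2 ≤ 2 ^ size N
  precise : Precise N (√B₂) B₂ η
  cross_le : k * (√A * (2 / √N)) ≤ η
  ell_ge : 40 * pi ≤ ell (size N)
  fixErr_le : fixErr N (√B₂) ≤ μ / 40

/-- Lines, coefficients and noise are fixed and good here; only the draws are random. The factor 3
is for the three spectra, which share the same draws. -/
lemma run_incorrect_le {A μ η δ β B₂ B₃ : ℝ} (hN : Large N k A μ η B₂) {s : ZMod N × ZMod N × ZMod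
  N} (hs : s ∈ slopeTriples N) {T : Targets N k} (hL : GoodLines T s) {α : EuclideanSpace ℂ (Fin
  T.num)} (hα : GoodCoeff β A α) {ν : ZMod N → ℂ} (hν : ν ∈ goodNoise N η B₃) (hη : 0 < η) (hμ : 4 *
  η ≤ μ) (hβ : μ + 5 * η ≤ β) (hδ : 2 * η ≤ δ) (hB₂ : 2 * (k * (9 * A)) + 2 * B₃ ≤ B₂) : ((algorithm
  k).run N k μ s (received T (transmitted s) α ν)).toOuterMeasure {c | ¬ Correct δ T s (received T
  (transmitted s) α ν) c} ≤ ofReal (3 * decodeBound N k μ η B₂) := by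
  set R := received T (transmitted s) α ν with hR
  have hμ0 : 0 < μ := by linarith
  have hsum : ∑ t, ‖R t‖ ^ 2 ≤ B₂ := (norm_received_sq_le hα.norm ν).trans (by linarith [hν.2])
  have hT : Tame N R (√B₂) := ⟨hN.odd, hN.size_ge, fun t => Real.le_sqrt_of_sq_le
    ((Finset.single_le_sum (f := fun x => ‖R x‖ ^ 2) (fun _ _ => by positivity) (mem_univ t)).trans
    hsum), hN.draws_le⟩
  have hdft : ∀ a, ∑ x, ‖dft (dechirp a R) x‖ ^ 2 ≤ B₂ := by
    intro a
    rw [sum_norm_sq_dft]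
    simp only [norm_dechirp, mul_pow, Real.sq_sqrt (Nat.cast_nonneg N), ← mul_sum]
    rwa [mul_div_cancel_left₀ _ (mod_cast NeZero.ne N)]
  have hG := gap_received hN.odd hs hL hα hν.1 hN.cross_le hβ
  classical
  obtain ⟨bad, hbad⟩ : ∃ bad : Draws N → Prop, ∀ r, ¬ bad r ↔ ∀ a ∈ [s.1, s.2.1, s.2.2],
    Decoded R a (targetFreqs T a) η r := ⟨_, fun _ => not_not⟩
  refine (run_le hN.fits hs R _ bad fun r c h hr => not_not.2
    (h.correct hT hL hG ((hbad r).1 hr) hη hμ hδ hdft hN.precise)).trans ?_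
  have hd : ∀ a ∈ [s.1, s.2.1, s.2.2], ((univ.filter fun r : Draws N => ¬ Decoded R a (targetFreqs T
    a) η r).card : ℝ) / Fintype.card (Draws N) ≤ decodeBound N k μ η B₂ := by
    intro a ha
    have hB0 : 0 ≤ B₂ := le_trans (sum_nonneg fun _ _ => by positivity) hsum
    have hk : ((targetFreqs T a).card : ℝ) ≤ k := mod_cast card_targetFreqs_le T a
    refine (card_not_decoded_le hT a hμ0 hη (fun x hx => ?_) hN.ell_ge hN.fixErr_le
      (hdft a)).trans ?_
    · linarith [(hG a ha).large x hx]
    · rw [decodeBound]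
      gcongr
  have h0 : (univ.filter bad).card ≤ (univ.filter fun r : Draws N => ¬ Decoded R s.1 (targetFreqs T
    s.1) η r).card + (univ.filter fun r : Draws N => ¬ Decoded R s.2.1 (targetFreqs T s.2.1) η
    r).card + (univ.filter fun r : Draws N => ¬ Decoded R s.2.2 (targetFreqs T s.2.2) η r).card :=
    by
    refine (card_le_card fun r hr => ?_).trans ((card_union_le _ _).trans
      (Nat.add_le_add_right (card_union_le _ _) _))
    have := hbad r
    simp only [List.forall_mem_cons, List.not_mem_nil, false_imp_iff, imp_true_iff, and_true,
      mem_filter, mem_univ, true_and, Finset.mem_union] at hr this ⊢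
    tauto
  have hc : (0 : ℝ) < Fintype.card (Draws N) := by
    exact_mod_cast Fintype.card_pos
  rw [← ENNReal.ofReal_natCast, ← ENNReal.ofReal_natCast, ← ENNReal.ofReal_div_of_pos hc]
  refine ofReal_le_ofReal ?_
  have h0' : ((univ.filter bad).card : ℝ) ≤ _ := Nat.cast_le.2 h0
  push_cast at h0'
  refine (div_le_div_of_nonneg_right h0' hc.le).trans ?_
  rw [add_div, add_div]
  linarith [hd s.1 (by simp), hd s.2.1 (by simp), hd s.2.2 (by simp)]

/-! ## Probability of an incorrect output -/

open Classical in
lemma sum_le_of_goodLines {T : Targets N k} {b : ℝ≥0∞} {η : ℝ} (hη : 0 ≤ η) (hp : 2 < N.minFac) (h :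
  3 * (k : ℝ) ^ 2 + k ^ 3 ≤ η * (N.minFac - 2)) : ∑ s ∈ slopeTriples N, (if GoodLines T s then b
  else 1) ≤ (b + ofReal η) * (slopeTriples N).card := by
  have h1 := card_not_goodLines_mul_le T
  have h2 : (((slopeTriples N).filter fun s => ¬ GoodLines T s).card : ℝ) ≤ η * (slopeTriples
    N).card := by
    have hp' : (0 : ℝ) < N.minFac - 2 := by rw [sub_pos]; exact_mod_cast hp
    have h3 : (((slopeTriples N).filter fun s => ¬ GoodLines T s).card : ℝ) * (N.minFac - 2) ≤ (3 *
      k ^ 2 + k ^ 3) * (slopeTriples N).card := by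
      rw [show ((N.minFac : ℝ) - 2) = ((N.minFac - 2 : ℕ) : ℝ) by rw [Nat.cast_sub hp.le]; simp]
      exact_mod_cast h1
    refine le_of_mul_le_mul_right (h3.trans ((mul_le_mul_of_nonneg_right h
      (Nat.cast_nonneg _)).trans_eq ?_)) hp'
    ring
  rw [Finset.sum_ite, sum_const, sum_const, nsmul_eq_mul, nsmul_eq_mul, mul_one, add_mul, mul_comm]
  refine add_le_add (mul_le_mul_right (mod_cast Finset.card_filter_le _ _) _) ?_
  rw [← ENNReal.ofReal_natCast, ← ENNReal.ofReal_natCast, ← ENNReal.ofReal_mul hη]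
  exact ofReal_le_ofReal h2

/-- The slopes `0, 1, 2` have differences `±1` and `±2`, which are units because `N` is odd. -/
lemma slopeTriples_nonempty (hN : Odd N) : (slopeTriples N).Nonempty := by
  have h2 : IsUnit (2 : ZMod N) := by
    simpa using (ZMod.isUnit_iff_coprime 2 N).2 hN.coprime_two_left
  refine ⟨(0, 1, 2), mem_slopeTriples.2 ⟨?_, ?_, ?_⟩⟩ <;> rw [transversal_iff]
  · simp
  · simpa using h2
  · norm_num

end

section
variable {N k : ℕ} [NeZero N]

/-- Bound for the probability of an incorrect output, given good lines. -/
def errBound (N k : ℕ) (μ η B₂ B₃ σ : ℝ) : ℝ≥0∞ := ofReal (3 * decodeBound N k μ η B₂) + ofReal (4 *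
  (N : ℝ) ^ 2 * exp (-(η ^ 2 / (32 * σ ^ 2)) * N) + 16 * σ ^ 2 / B₃)

/-- The failure probability of a run, as a function of coefficients and noise, is not shown to be
measurable. A measurable majorant `G` takes its place: a constant, plus the indicator of bad noise.
-/
lemma exists_bound_run_incorrect {A μ η δ ε B₂ B₃ σ : ℝ} (hN : Large N k A μ η B₂) {s : ZMod N ×
  ZMod N × ZMod N} (hs : s ∈ slopeTriples N) {T : Targets N k} (hL : GoodLines T s) {Q : Measure ℂ}
  (hQ : IsSubgaussianLaw Q (σ ^ 2 / N)) (hσ : 0 < σ) (hB₃ : 0 < B₃) (hA : 0 < A) (hε : ε < 1) (hη :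
  0 < η) (hμ : 4 * η ≤ μ) (hβ : μ + 5 * η ≤ ε * √(A / k)) (hδ : 2 * η ≤ δ) (hB₂ : 2 * (k * (9 * A))
  + 2 * B₃ ≤ B₂) : ∃ G : EuclideanSpace ℂ (Fin T.num) × (ZMod N → ℂ) → ℝ≥0∞, Measurable G ∧ (∀ᵐ z
  ∂((coeffLaw T.num k A ε).prod (Measure.pi fun _ : ZMod N => Q)), ((algorithm k).run N k μ s
  (received T (transmitted s) z.1 z.2)).toOuterMeasure {c | ¬ Correct δ T s (received T (transmitted
  s) z.1 z.2) c} ≤ G z) ∧ ∫⁻ z, G z ∂((coeffLaw T.num k A ε).prod (Measure.pi fun _ : ZMod N => Q))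
  ≤ errBound N k μ η B₂ B₃ σ := by
  have := hQ.1
  have := isProbabilityMeasure_coeffLaw T.one_le_num T.num_le hA hε
  have hm : MeasurableSet ((Set.univ : Set (EuclideanSpace ℂ (Fin T.num))) ×ˢ (goodNoise N η B₃)ᶜ)
    := MeasurableSet.univ.prod (measurableSet_goodNoise η B₃).compl
  refine ⟨fun z => ofReal (3 * decodeBound N k μ η B₂) + (Set.univ ×ˢ (goodNoise N η B₃)ᶜ).indicator
    1 z, ?_, ?_, ?_⟩
  · exact Measurable.const_add (measurable_one.indicator hm) _
  · filter_upwards [Measure.quasiMeasurePreserving_fst.ae (ae_goodCoeff_coeffLaw hA)] with z hz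
    by_cases hν : z.2 ∈ goodNoise N η B₃
    · exact (run_incorrect_le hN hs hL hz hν hη hμ hβ hδ hB₂).trans le_self_add
    · rw [Set.indicator_of_mem (by simpa using hν)]
      exact (((algorithm k).run N k μ s _).toOuterMeasure.mono (Set.subset_univ _)).trans
        (((PMF.toOuterMeasure_apply_eq_one_iff _ _).2 (Set.subset_univ _)).le.trans le_add_self)
  · rw [lintegral_add_left measurable_const, lintegral_const, measure_univ, mul_one,
      lintegral_indicator_one hm, Measure.prod_prod, measure_univ, one_mul]
    exact add_le_add_right (measure_goodNoise_compl_le hσ hQ hη hB₃) _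

-- The lower bound adds `G` under the integral, which needs only `G` to be measurable, and uses that
-- an event and its complement have outer measures with sum at least 1. Bad lines count as total
-- failure and contribute at most `θ`.
open Classical in
lemma prob_bounds {A μ η δ ε B₂ B₃ σ θ : ℝ} (hN : Large N k A μ η B₂) {T : Targets N k} {Q : Measure
  ℂ} (hQ : IsSubgaussianLaw Q (σ ^ 2 / N)) (hσ : 0 < σ) (hB₃ : 0 < B₃) (hA : 0 < A) (hε : ε < 1) (hη
  : 0 < η) (hμ : 4 * η ≤ μ) (hβ : μ + 5 * η ≤ ε * √(A / k)) (hδ : 2 * η ≤ δ) (hB₂ : 2 * (k * (9 *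
  A)) + 2 * B₃ ≤ B₂) (hθ : 0 ≤ θ) (hp : 2 < N.minFac) (hline : 3 * (k : ℝ) ^ 2 + k ^ 3 ≤ θ *
  (N.minFac - 2)) {E : ZMod N × ZMod N × ZMod N → (ZMod N → ℂ) → Config → Prop} : ((∀ s R c, E s R c
  → ¬ Correct δ T s R c) → prob (algorithm k) μ A ε T Q E ≤ errBound N k μ η B₂ B₃ σ + ofReal θ) ∧
  ((∀ s R c, Correct δ T s R c → E s R c) → 1 ≤ prob (algorithm k) μ A ε T Q E + (errBound N k μ η
  B₂ B₃ σ + ofReal θ)) := by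
  have := hQ.1
  have := isProbabilityMeasure_coeffLaw T.one_le_num T.num_le hA hε
  have hS0 : ((slopeTriples N).card : ℝ≥0∞) ≠ 0 := by
    exact_mod_cast (slopeTriples_nonempty hN.odd).card_pos.ne'
  have hS1 : ((slopeTriples N).card : ℝ≥0∞) ≠ ∞ := ENNReal.natCast_ne_top _
  have hsum := sum_le_of_goodLines (T := T) (b := errBound N k μ η B₂ B₃ σ) hθ hp hline
  constructor
  · intro hE
    refine ENNReal.div_le_of_le_mul ((sum_le_sum fun s hs => ?_).trans hsum)
    split_ifs with hL
    · obtain ⟨G, -, h1, h2⟩ := exists_bound_run_incorrect hN hs hL hQ hσ hB₃ hA hε hη hμ hβ hδ hB₂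
      refine (lintegral_mono_ae (h1.mono fun z hz => ?_)).trans h2
      exact (((algorithm k).run N k μ s _).toOuterMeasure.mono fun c hc => hE _ _ _ hc).trans hz
    · refine (lintegral_mono fun z => ?_).trans (lintegral_one.trans measure_univ).le
      exact (((algorithm k).run N k μ s _).toOuterMeasure.mono (Set.subset_univ _)).trans
        ((PMF.toOuterMeasure_apply_eq_one_iff _ _).2 (Set.subset_univ _)).le
  · intro hE
    rw [prob, ← ENNReal.div_self hS0 hS1]
    refine (ENNReal.div_le_div_right ?_ _).trans (ENNReal.add_div.le.trans (add_le_add_right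
      (ENNReal.div_le_of_le_mul hsum) _))
    rw [← sum_add_distrib, Finset.cast_card]
    refine sum_le_sum fun s hs => ?_
    split_ifs with hL
    · obtain ⟨G, h0, h1, h2⟩ := exists_bound_run_incorrect hN hs hL hQ hσ hB₃ hA hε hη hμ hβ hδ hB₂
      refine le_trans ?_ (add_le_add_right h2 _)
      rw [← lintegral_add_right _ h0]
      refine (lintegral_one.trans measure_univ).ge.trans (lintegral_mono_ae (h1.mono fun z hz => ?_))
      refine (run_compl s (received T (transmitted s) z.1 z.2) {c | E s _ c}).trans
        (add_le_add_right (le_trans ?_ hz) _)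
      exact ((algorithm k).run N k μ s _).toOuterMeasure.mono fun c hc h => hc (hE _ _ _ h)
    · exact le_add_self

end

/-! ## Large moduli -/

open Filter Topology

/-- The smallest prime factor tends to infinity. -/
def primeFilter : Filter ℕ := comap Nat.minFac atTop

lemma eventually_primeFilter {P : ℕ → Prop} : (∀ᶠ N in primeFilter, P N) ↔ ∃ p₀, ∀ N : ℕ, p₀ ≤
  N.minFac → P N := (atTop_basis.comap Nat.minFac).eventually_iff.trans (by simp)

lemma tendsto_minFac : Tendsto Nat.minFac primeFilter atTop := tendsto_comap

lemma eventually_two_lt_minFac : ∀ᶠ N in primeFilter, 2 < N.minFac :=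
  tendsto_minFac.eventually_gt_atTop 2

lemma tendsto_id_primeFilter : Tendsto (fun N : ℕ => N) primeFilter atTop :=
  tendsto_atTop_mono' _ (eventually_two_lt_minFac.mono fun N hN =>
    Nat.minFac_le (Nat.pos_of_ne_zero (by rintro rfl; simp at hN))) tendsto_minFac

lemma eventually_odd : ∀ᶠ N in primeFilter, Odd N := eventually_two_lt_minFac.mono fun N hN => by
    by_contra h
    rw [Nat.not_odd_iff_even, even_iff_two_dvd, ← Nat.minFac_eq_two_iff] at h
    omega

lemma tendsto_size : Tendsto size primeFilter atTop := by
  refine tendsto_atTop.2 fun b => ?_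
  filter_upwards [tendsto_id_primeFilter.eventually_ge_atTop (2 ^ b)] with N hN
  exact le_size hN

lemma tendsto_ell : Tendsto (fun N => ell (size N)) primeFilter atTop := by
  refine tendsto_atTop.2 fun b => ?_
  filter_upwards [tendsto_size.eventually_ge_atTop (b ^ 8)] with N hN
  exact le_of_pow_le_pow_left₀ (by simp) (Nat.zero_le _) (hN.trans (le_ell_pow _))

lemma tendsto_inv_ell : Tendsto (fun N => 1 / (ell (size N) : ℝ)) primeFilter (𝓝 0) :=
  tendsto_one_div_atTop_nhds_zero_nat.comp tendsto_ell

lemma tendsto_pow_size (n : ℕ) : Tendsto (fun N => (size N : ℝ) ^ n / 2 ^ size N) primeFilter (𝓝 0)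
  := (tendsto_pow_const_div_const_pow_of_one_lt n one_lt_two).comp tendsto_size

lemma tendsto_inv_pow_size : Tendsto (fun N => 1 / (2 : ℝ) ^ size N) primeFilter (𝓝 0) := by
  simpa using tendsto_pow_size 0

lemma tendsto_inv_sqrt : Tendsto (fun N : ℕ => 1 / √N) primeFilter (𝓝 0) := by
  simp only [one_div]
  exact tendsto_inv_atTop_zero.comp (Real.tendsto_sqrt_atTop.comp
    (tendsto_natCast_atTop_atTop.comp tendsto_id_primeFilter))

lemma ell_le_size {L : ℕ} (h : 3 ≤ ell L) : ell L ≤ L := by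
  rcases lt_or_ge L 2 with hL | hL
  · have h1 := le_ell_pow L
    exact absurd h (by interval_cases L <;> decide)
  have h1 := ell_pow_le hL
  have h2 : 3 ^ 7 * ell L ≤ ell L ^ 8 := by
    rw [pow_succ _ 7]
    exact Nat.mul_le_mul_right _ (Nat.pow_le_pow_left h 7)
  omega

lemma eventually_large {k : ℕ} {A μ η B₂ : ℝ} (hk : 1 ≤ k) (hμ : 0 < μ) (hη : 0 < η) : ∀ᶠ N in
  primeFilter, Large N k A μ η B₂ := by
  obtain ⟨n₀, hn₀⟩ := exists_resources hk hμ.le one_pos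
  have hfix : Tendsto (fun N => fixErr N (√B₂)) primeFilter (𝓝 0) := by
    have := tendsto_inv_pow_size.const_mul (2 * √B₂ + 8)
    simpa [fixErr, div_eq_mul_inv] using this
  have h1 : ∀ᶠ N in primeFilter, (draws N * (3 * √B₂ + 9)) ^ 2 ≤ (2 : ℝ) ^ size N := by
    have h := (tendsto_pow_size 4).const_mul ((3 * √B₂ + 9) ^ 2)
    rw [mul_zero] at h
    filter_upwards [h.eventually_le_const one_pos, tendsto_ell.eventually_ge_atTop 3] with N h h3
    have h4 : (draws N : ℝ) ≤ size N ^ 2 := by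
      rw [draws, sq]
      exact_mod_cast Nat.mul_le_mul_left _ (ell_le_size h3)
    rw [← mul_div_assoc, div_le_one (by positivity)] at h
    refine le_trans ?_ h
    rw [mul_pow, mul_comm]
    refine mul_le_mul_of_nonneg_left ?_ (by positivity)
    calc (draws N : ℝ) ^ 2 ≤ (size N ^ 2) ^ 2 := by gcongr
      _ = _ := by ring
  have h2 : ∀ᶠ N in primeFilter, 2 / (2 : ℝ) ^ (2 * size N) ≤ η := by
    filter_upwards [tendsto_inv_pow_size.eventually_le_const (half_pos hη)] with N h
    refine le_trans ?_ (show 2 * (1 / (2 : ℝ) ^ size N) ≤ η by linarith)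
    rw [mul_one_div]
    gcongr
    · norm_num
    · omega
  have h3 : ∀ᶠ N : ℕ in primeFilter, (√B₂ + η) / √N + fixErr N (√B₂) ≤ η := by
    have h := (tendsto_inv_sqrt.const_mul (√B₂ + η)).add hfix
    rw [mul_zero, add_zero] at h
    filter_upwards [h.eventually_le_const hη] with N h
    rwa [mul_one_div] at h
  have h4 : ∀ᶠ N : ℕ in primeFilter, k * (√A * (2 / √N)) ≤ η := by
    have h := tendsto_inv_sqrt.const_mul (k * (√A * 2))
    rw [mul_zero] at h
    filter_upwards [h.eventually_le_const hη] with N h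
    exact le_trans (le_of_eq (by ring)) h
  filter_upwards [h1, h2, h3, h4, tendsto_id_primeFilter.eventually_ge_atTop n₀, eventually_odd,
    tendsto_size.eventually_ge_atTop 40, hfix.eventually_le_const (show 0 < μ / 40 by positivity),
    (tendsto_natCast_atTop_atTop.comp tendsto_ell).eventually_ge_atTop (40 * Real.pi)]
    with N h1 h2 h3 h4 h5 h6 h7 h8 h9
  exact ⟨(hn₀ N h5).1, h6, h7, h1, ⟨h2, h3⟩, h4, h9, h8⟩

/-- The choice of the parameters is decided here. The leak is of order `1 / p + 1 / W`; the votes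
fail with `(L + 2) / M`, at most `3 / W`, since `M = L W`; the estimates with `W^2 / M = W / L`, at
most `256 / W` because `W^2 ≤ W^8 ≤ 256 L`. -/
lemma tendsto_decodeBound (k : ℕ) (μ η B₂ : ℝ) (hB₂ : 0 ≤ B₂) : Tendsto (fun N => decodeBound N k μ
  η B₂) primeFilter (𝓝 0) := by
  have hp : Tendsto (fun N : ℕ => 1 / (N.minFac : ℝ)) primeFilter (𝓝 0) :=
    tendsto_one_div_atTop_nhds_zero_nat.comp tendsto_minFac
  have hW := tendsto_inv_ell
  have h1 := ((((hp.add hW).add ((hW.const_mul (2 * Real.pi)).pow 2)).const_mul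
    (2 * B₂)).const_mul (3200 / μ ^ 2)).const_mul (k : ℝ)
  have h := (h1.add (hW.const_mul (k * 48 : ℝ))).add (hW.const_mul (256 * (B₂ / η ^ 2)))
  simp only [mul_zero, add_zero, ne_eq, OfNat.ofNat_ne_zero, not_false_eq_true, zero_pow] at h
  refine squeeze_zero' (Eventually.of_forall fun N => by rw [decodeBound]; positivity) ?_ h
  filter_upwards [tendsto_size.eventually_ge_atTop 2, tendsto_ell.eventually_ge_atTop 1]
    with N hL hW
  have hL' : (1 : ℝ) ≤ size N := mod_cast one_le_two.trans hL
  have hW' : (1 : ℝ) ≤ ell (size N) := mod_cast hW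
  have hWL : (ell (size N) : ℝ) ^ 8 ≤ 256 * size N := by
    exact_mod_cast ell_pow_le hL
  rw [decodeBound, draws, grid]
  push_cast
  set L : ℝ := (size N : ℝ)
  set W : ℝ := (ell (size N) : ℝ)
  refine add_le_add (add_le_add (by rw [mul_one_div]) ?_) ?_
  · rw [mul_assoc (k : ℝ)]
    refine mul_le_mul_of_nonneg_left ?_ (Nat.cast_nonneg k)
    rw [mul_one_div, mul_one_div, mul_div_assoc', div_le_div_iff₀ (by positivity) (by positivity)]
    nlinarith
  · have h2 : W * W * (B₂ / (L * W) / η ^ 2) = W / L * (B₂ / η ^ 2) := by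
      field_simp
    rw [h2, mul_one_div, mul_comm 256, mul_div_assoc, mul_comm (W / L)]
    refine mul_le_mul_of_nonneg_left ?_ (by positivity)
    rw [div_le_div_iff₀ (by positivity) (by positivity)]
    refine le_trans ?_ hWL
    rw [← sq]
    exact pow_le_pow_right₀ hW' (by simp)

lemma tendsto_sq_mul_exp {c : ℝ} (hc : 0 < c) :
    Tendsto (fun N : ℕ => 4 * (N : ℝ) ^ 2 * exp (-c * N)) primeFilter (𝓝 0) := by
  have h := ((tendsto_pow_const_mul_const_pow_of_abs_lt_one 2 (r := exp (-c))
    (by rw [abs_of_pos (Real.exp_pos _)]; exact Real.exp_lt_one_iff.2 (by linarith))).comp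
      tendsto_id_primeFilter).const_mul 4
  rw [mul_zero] at h
  refine h.congr fun N => ?_
  rw [Function.comp, ← Real.exp_nat_mul, mul_comm (N : ℝ) (-c), mul_assoc]

lemma eventually_lines (k : ℕ) {θ : ℝ} (hθ : 0 < θ) : ∀ᶠ N in primeFilter, 3 * (k : ℝ) ^ 2 + k ^ 3 ≤
  θ * (N.minFac - 2) := by
  filter_upwards [(tendsto_natCast_atTop_atTop.comp tendsto_minFac).eventually_ge_atTop
    ((3 * (k : ℝ) ^ 2 + k ^ 3) / θ + 2)] with N h
  rw [Function.comp] at h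
  exact (div_le_iff₀' hθ).1 (by linarith)

/-- For large moduli the output is correct with high probability, uniformly. -/
lemma eventually_prob_bounds {k : ℕ} {κ ε A σ δ : ℝ} (hκ₀ : 0 < κ) (hκ₁ : κ < 1) (hk : 1 ≤ k)
    (hε₀ : 0 < ε) (hε₁ : ε < 1) (hA : 0 < A) (hσ : 0 < σ) (hδ : 0 < δ) :
    ∀ᶠ N in primeFilter, ∀ [NeZero N] (T : Targets N k) (Q : Measure ℂ),
      IsSubgaussianLaw Q (σ ^ 2 / N) →
      ∀ E : ZMod N × ZMod N × ZMod N → (ZMod N → ℂ) → Config → Prop,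
      ((∀ s R c, E s R c → ¬ Correct δ T s R c) →
        prob (algorithm k) (κ * ε * √(A / k)) A ε T Q E ≤ ofReal δ) ∧
      ((∀ s R c, Correct δ T s R c → E s R c) →
        1 - ofReal δ ≤ prob (algorithm k) (κ * ε * √(A / k)) A ε T Q E) := by
  set β := ε * √(A / k) with hβ
  have hβ0 : 0 < β := mul_pos hε₀ (Real.sqrt_pos.2 (by positivity))
  rw [mul_assoc, ← hβ]
  set μ := κ * β with hμ
  have hμ0 : 0 < μ := mul_pos hκ₀ hβ0
  -- One tolerance for three purposes: accuracy of the estimates, rejection below `μ`, and the gap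
  -- `(1 - κ) β` between `μ` and the smallest coefficient.
  obtain ⟨η, hη, h1, h2, h3⟩ : ∃ η : ℝ, 0 < η ∧ 2 * η ≤ δ ∧ 4 * η ≤ μ ∧ 5 * η ≤ (1 - κ) * β :=
    ⟨min (δ / 2) (min (μ / 4) ((1 - κ) * β / 5)), by positivity,
      by linarith [min_le_left (δ / 2) (min (μ / 4) ((1 - κ) * β / 5))],
      by linarith [min_le_right (δ / 2) (min (μ / 4) ((1 - κ) * β / 5)),
        min_le_left (μ / 4) ((1 - κ) * β / 5)],
      by linarith [min_le_right (δ / 2) (min (μ / 4) ((1 - κ) * β / 5)),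
        min_le_right (μ / 4) ((1 - κ) * β / 5)]⟩
  -- Chosen so that `16 σ^2 / B₃ = δ / 4`. Decoding, small spectra of the noise, its energy and the
  -- choice of lines each receive `δ / 4`.
  set B₃ := 64 * σ ^ 2 / δ with hB₃
  have hB₃0 : 0 < B₃ := by positivity
  set B₂ := 2 * (k * (9 * A)) + 2 * B₃ with hB₂
  have hB₂0 : 0 ≤ B₂ := by positivity
  have hδ4 : 0 < δ / 4 := by positivity
  filter_upwards [eventually_large (A := A) (B₂ := B₂) hk hμ0 hη, eventually_two_lt_minFac,
    eventually_lines k hδ4, ((tendsto_decodeBound k μ η B₂ hB₂0).const_mul 3).eventually_le_const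
      (show 3 * 0 < δ / 4 by linarith),
    (tendsto_sq_mul_exp (c := η ^ 2 / (32 * σ ^ 2)) (by positivity)).eventually_le_const hδ4]
    with N hN hp hline hdec hexp
  intro _ T Q hQ E
  have hb : errBound N k μ η B₂ B₃ σ + ofReal (δ / 4) ≤ ofReal δ := by
    have h4 : 16 * σ ^ 2 / B₃ = δ / 4 := by rw [hB₃]; field_simp; norm_num
    rw [errBound, h4]
    refine (add_le_add_left (add_le_add (ofReal_le_ofReal hdec)
      (ofReal_le_ofReal (add_le_add_left hexp _))) _).trans ?_
    rw [← ENNReal.ofReal_add (by positivity) (by positivity),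
      ← ENNReal.ofReal_add (by positivity) (by positivity)]
    exact ofReal_le_ofReal (by linarith)
  obtain ⟨h5, h6⟩ := prob_bounds (E := E) hN (T := T) hQ hσ hB₃0 hA hε₁ hη h2 (by linarith) h1 le_rfl
    hδ4.le hp hline
  exact ⟨fun h => (h5 h).trans hb, fun h => tsub_le_iff_right.2 ((h6 h).trans
    (add_le_add_right hb _))⟩

end SCE

end

theorem mainTheorem1 (κ : ℝ) (hκ₀ : 0 < κ) (hκ₁ : κ < 1) :
    ∃ c₁ c₂ c₃ : ℝ, 0 < c₁ ∧ 0 < c₂ ∧ 0 < c₃ ∧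
      ∀ (k : ℕ) (ε A σ μ SNR : ℝ), 1 ≤ k → 0 < ε → ε < 1 → 0 < A → 0 < σ →
        μ = κ * ε * Real.sqrt (A / k) → SNR = A / σ ^ 2 →
        ∃ P : SCE.Algorithm,
          (∃ p₀ : ℕ, ∀ (N : ℕ) [NeZero N], p₀ ≤ N.minFac →
            SCE.Implements P N k μ ∧
            SCE.RunsWithin P N k μ
              (c₁ * k * Real.log N ^ 3 * (ε ^ 2 * SNR)⁻¹)
              (c₃ * k * Real.log N ^ 3 * (ε ^ 2 * SNR)⁻¹ + k ^ 2) ∧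
            (P.memoryBits N : ℝ) ≤ c₂ * k * Real.log N ^ 3 * (ε ^ 2 * SNR)⁻¹) ∧
          ∀ δ : ℝ, 0 < δ → ∃ p₀ : ℕ, ∀ (N : ℕ) [NeZero N], p₀ ≤ N.minFac →
            ∀ (T : SCE.Targets N k) (Q : MeasureTheory.Measure ℂ),
              SCE.IsSubgaussianLaw Q (σ ^ 2 / N) →
              (∀ j, 1 - ENNReal.ofReal δ ≤ SCE.PD P μ A ε T Q j) ∧
              (∀ j, SCE.PFA P μ A ε T Q j ≤ ENNReal.ofReal δ) ∧
              SCE.prob P μ A ε T Q (SCE.BadEstimate δ) ≤ ENNReal.ofReal δ := by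
  -- Any positive constants would do, as the resources are `o((log N)^3)` for fixed `k`, `ε`, `A`,
  -- `σ`.
  refine ⟨1, 1, 1, one_pos, one_pos, one_pos, ?_⟩
  rintro k ε A σ μ SNR hk hε₀ hε₁ hA hσ rfl rfl
  have hk0 : (0 : ℝ) < k := by exact_mod_cast hk
  refine ⟨SCE.algorithm k, ?_, fun δ hδ => ?_⟩
  -- The factor `k (ε^2 SNR)⁻¹` does not depend on `N` and is taken as the constant `C`. The
  -- smallest prime factor is at most `N`, so a lower bound on it bounds `N`.
  · obtain ⟨n₀, h⟩ := SCE.exists_resources (μ := κ * ε * Real.sqrt (A / k))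
      (C := k * (ε ^ 2 * (A / σ ^ 2))⁻¹) hk (by positivity) (by positivity)
    refine ⟨n₀, fun N _ hN => ?_⟩
    obtain ⟨hF, ht, hm⟩ := h N (hN.trans (Nat.minFac_le (NeZero.pos N)))
    rw [one_mul, mul_right_comm (k : ℝ)]
    exact ⟨SCE.implements hF, SCE.runsWithin hF ht (ht.trans (le_add_of_nonneg_right (by positivity))),
      hm⟩
  · refine (SCE.eventually_primeFilter.1
      (SCE.eventually_prob_bounds hκ₀ hκ₁ hk hε₀ hε₁ hA hσ hδ)).imp fun p₀ h N _ hN T Q hQ => ?_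
    refine ⟨fun j => (h N hN T Q hQ _).2 fun s R c hc => (hc.1 _).2 ⟨j, rfl⟩,
      fun j => (h N hN T Q hQ _).1 fun s R c hc hc' => ?_,
      (h N hN T Q hQ _).1 fun s R c hc hc' => hc'.2 hc⟩
    obtain ⟨q, hq, hq'⟩ := hc
    exact hq' ((hc'.1 q).1 (List.mem_of_getElem? hq))
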